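/- Let $m\ge 2$, $k\ge m-1$ and $0\le l<2m$ be integers. Put $n:=\lceil\frac{k-(m-2)}{m}\rceil$, $\underline k:=n+(m-2)$, and write $a\vee b=\max\{a,b\}$, $a\wedge b=\min\{a,b\}$. **Spaces.** Let $\eta(x)=-x\log x$ on $[0,e^{-1}]$ and $\eta(x)=e^{-1}$ for $x\ge e^{-1}$. For an integer $N\ge 0$ and a modulus $w$, where $w(t)=t^a$ with $0<a<1$ or $w=\eta$, the space $C^{N+a}(A)$, resp. $C^{N+\eta}(A)$, consists of the $C^N$ functions $g$ on the closed set $A\subset\mathbb C=\mathbb R^2$ for which $|D^Ng|_w:=\sup_{x\ne y\in A}\|D^Ng(x)-D^Ng(y)\|/w(|x-y|)<\infty$; its norm is $\|g\|_{C^N(A)}+|D^Ng|_w$ with $\|g\|_{C^N(A)}=\sum_{j\le N}\sup_A\|D^jg\|$. For a non-integer $r>0$, $C^r:=C^{\lfloor r\rfloor+(r-\lfloor r\rfloor)}$. Let $$\mathfrak e(\sigma,k)=\begin{cases}\frac{k-(m-2)}m&\text{if }\frac{k-(m-2)}m\notin\mathbb Z,\\[2pt] \frac{k-2(m-1)}m+\eta&\text{if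 }\frac{k-(m-2)}m\in\mathbb Z.\end{cases}$$ **Domain and local solution.** Let $\mathcal D$ be the preimage of $[-1,1]^2$ under $\omega\mapsto\omega^m$. For $0\le\alpha<\beta\le1$ let $\mathcal D(\alpha,\beta)=\{\omega\in\mathcal D\setminus\{0\}:\operatorname{Arg}\omega\in(2\pi\alpha,2\pi\beta)\}$ with $\operatorname{Arg}\in[0,2\pi)$, and let $\overline{\mathcal D}(\alpha,\beta)$ be its closure. For $0\le j<m$ let $G_j(re^{it})=e^{2\pi ij/m}r^{1/m}e^{it/m}$ for $t\in[0,2\pi)$. For $f:\mathcal D\to\mathbb C$ put $$\mathscr F_{f,j}(u,s)=\int_{-1}^u\frac{f(G_j(v+is))}{(v^2+s^2)^{\frac{m-1}m}}\,dv,\qquad F_f(\omega)=\mathscr F_{f,j}(\operatorname{Re}\omega^m,\operatorname{Im}\omega^m)\ \text{ for }\ \omega\in\mathcal D(\tfrac jm,\tfrac{j+1}m).$$ **Functionals.** For $0\le i\le j\wedge(m-2)$ with $i\not\equiv j-(m-1)\pmod m$ let $$\partial^j_i(f)=\sum_{0\le q\le\frac{j-i}m}\frac{\binom j{i+qm}\binom{\frac{(m-1)-i}m-1}q}{\binom{\frac{(j-i)-(m-1)}m}q}\,\frac{\partial^jf}{\partial\omega^{i+qm}\partial\overline\omega^{\,j-i-qm}}(0),$$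 and, with $\theta_0=e^{\pi i/m}$ (here, and in the factor $e^{i\frac\pi2(y-x)}$ below, $i$ is the imaginary unit), $$\mathscr C^j_l(f)=\sum_{\substack{0\le p\le j\wedge(m-2)\\ p\not\equiv j-(m-1)\ (\mathrm{mod}\ m)}}\theta_0^{\,l(2p-j)}\,\mathfrak B\Big(\tfrac{(m-1)-p}m,\tfrac{(m-1)-(j-p)}m\Big)\,\partial^j_p(f),$$ $$\mathfrak B(x,y)=\frac{\pi e^{i\frac\pi2(y-x)}}{2^{x+y-2}}\,\frac{\Gamma(x+y-1)}{\Gamma(x)\Gamma(y)},\qquad\text{with the convention }\Gamma(-q)=\frac1{(-1)^q\,q!}\text{ for integers }q\ge0.$$ **Theorem.** There is a constant $C>0$ (depending only on $m,k,l$) such that the following holds. Let $f\in C^{k\vee(n+1)}(\mathcal D)$ satisfy * $\partial^j_i(f)=0$ for all $0\le j<\underline k$ and $0\le i\le j\wedge(m-2)$ with $i\not\equiv j-(m-1)\pmod m$, and * $\mathscr C^j_l(f)=0$ for all $0\le j<k$. Then $F_f:\mathcal D(\frac l{2m},\frac{l+1}{2m})\to\mathbb C$ has an extension to $\overline{\mathcal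 D}(\frac l{2m},\frac{l+1}{2m})$ of class $C^{\mathfrak e(\sigma,k)}$, and its norm satisfies $$\|F_f\|_{C^{\mathfrak e(\sigma,k)}(\overline{\mathcal D}(\frac l{2m},\frac{l+1}{2m}))}\le C\,\|f\|_{C^{k\vee(n+1)}(\mathcal D)}.$$ -/

import Mathlib

open scoped ENNReal NNReal

noncomputable section

namespace SaddleSector

/-! ### Spaces of differentiable functions with a prescribed modulus of continuity -/

/-- The modulus `η(x) = -x log x` on `[0, e⁻¹]`, constant `e⁻¹` afterwards. -/
def etaMod (x : ℝ) : ℝ :=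
  if x ≤ Real.exp (-1) then -x * Real.log x else Real.exp (-1)

/-- Regularity exponents: a non-integer real number `r`, or a symbol `n + η` with `n` an integer. -/
inductive RegExp where
  | hol (r : ℝ) : RegExp
  | eta (n : ℤ) : RegExp

/-- Number of derivatives in the class `C^r` (for exponents `r > 0`, resp. `n + η` with `n ≥ 0`). -/
def RegExp.degree : RegExp → ℕ
  | .hol r => ⌊r⌋₊
  | .eta n => n.toNat

/-- Modulus of continuity of the top derivative in the class `C^r`: `x ↦ x ^ {r}`, resp. `η`. -/
def RegExp.modulus : RegExp → ℝ → ℝ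
  | .hol r => fun x => x ^ Int.fract r
  | .eta _ => etaMod

/-- The `C^N` norm on a (closed) set `A`. -/
def cNorm (N : ℕ) (A : Set ℂ) (g : ℂ → ℂ) : ℝ≥0∞ :=
  ∑ j ∈ Finset.range (N + 1), ⨆ x ∈ A, ‖iteratedFDerivWithin ℝ j g A x‖ₑ

/-- The seminorm of the `N`-th derivative of `g` on `A` with respect to a modulus `w`. -/
def modSeminorm (N : ℕ) (w : ℝ → ℝ) (A : Set ℂ) (g : ℂ → ℂ) : ℝ≥0∞ :=
  ⨆ x ∈ A, ⨆ y ∈ A, ⨆ _ : x ≠ y,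
    ‖iteratedFDerivWithin ℝ N g A x - iteratedFDerivWithin ℝ N g A y‖ₑ / ENNReal.ofReal (w (dist x y))

/-- `g` is of class `C^r` on the (closed) set `A`. -/
def IsClassC (r : RegExp) (A : Set ℂ) (g : ℂ → ℂ) : Prop :=
  ContDiffOn ℝ r.degree g A ∧ modSeminorm r.degree r.modulus A g < ∞

/-- The norm of `C^r(A)`. -/
def regNorm (r : RegExp) (A : Set ℂ) (g : ℂ → ℂ) : ℝ≥0∞ :=
  cNorm r.degree A g + modSeminorm r.degree r.modulus A g

/-! ### Orders and exponents of a saddle of multiplicity `m` -/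

/-- `𝔬(σ,k) = (k - (m - 2)) / m`. -/
def ord (m k : ℕ) : ℝ := ((k : ℝ) - ((m : ℝ) - 2)) / m

/-- `𝔬̂(σ,k) = k - (m - 2)`. -/
def ordHat (m k : ℕ) : ℤ := (k : ℤ) - ((m : ℤ) - 2)

/-- The exponent `𝔢(σ,k)`: it is `(k-(m-2))/m` when this is not an integer, and
`(k-2(m-1))/m + η` when it is (then the division below is exact). -/
def expo (m k : ℕ) : RegExp :=
  if (m : ℤ) ∣ (k : ℤ) - ((m : ℤ) - 2) then .eta (((k : ℤ) - 2 * ((m : ℤ) - 1)) / m)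
  else .hol (ord m k)

/-! ### The domain, its sectors and the local solution -/

/-- Argument with values in `[0, 2π)`. -/
def argPos (z : ℂ) : ℝ := if 0 ≤ z.arg then z.arg else z.arg + 2 * Real.pi

/-- `𝒟`: the preimage of the square `[-1,1]²` under `ω ↦ ω ^ m`. -/
def dom (m : ℕ) : Set ℂ := {ω | |(ω ^ m).re| ≤ 1 ∧ |(ω ^ m).im| ≤ 1}

/-- `𝒟(α,β)`. -/
def sector (m : ℕ) (α β : ℝ) : Set ℂ :=
  {ω | ω ∈ dom m ∧ ω ≠ 0 ∧ argPos ω ∈ Set.Ioo (2 * Real.pi * α) (2 * Real.pi * β)}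

/-- The `l`-th branch `G_l = θ^l G_0` of the `m`-th root, `θ = exp(2πi/m)`. -/
def rootBranch (m l : ℕ) (z : ℂ) : ℂ :=
  Complex.exp (2 * Real.pi * Complex.I / m) ^ l *
    (((‖z‖ ^ (1 / (m : ℝ)) : ℝ) : ℂ) * Complex.exp (Complex.I * ((argPos z / m : ℝ) : ℂ)))

/-- `𝓕_{f,l}(u,s) = ∫_{-1}^u f(G_l(v,s)) (v²+s²)^{-(m-1)/m} dv`. -/
def scriptF (m l : ℕ) (f : ℂ → ℂ) (u s : ℝ) : ℂ :=
  ∫ v in (-1 : ℝ)..u, f (rootBranch m l (⟨v, s⟩ : ℂ)) /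
    (((v ^ 2 + s ^ 2) ^ (((m : ℝ) - 1) / m) : ℝ) : ℂ)

/-- `F_f(ω) = 𝓕_{f,l}(ω^m)` for `ω ∈ 𝒟(l/m,(l+1)/m)`; the floor is the `l` of the sector of `ω`. -/
def localSol (m : ℕ) (f : ℂ → ℂ) (ω : ℂ) : ℂ :=
  scriptF m ⌊(m : ℝ) * argPos ω / (2 * Real.pi)⌋₊ f (ω ^ m).re (ω ^ m).im

/-! ### The functionals -/

/-- `∂/∂ω = (∂/∂x - i ∂/∂y) / 2`. -/
def dz (g : ℂ → ℂ) (ω : ℂ) : ℂ := (fderiv ℝ g ω 1 - Complex.I * fderiv ℝ g ω Complex.I) / 2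

/-- `∂/∂ω̄ = (∂/∂x + i ∂/∂y) / 2`. -/
def dzbar (g : ℂ → ℂ) (ω : ℂ) : ℂ := (fderiv ℝ g ω 1 + Complex.I * fderiv ℝ g ω Complex.I) / 2

/-- `∂^{a+b} f / ∂ω^a ∂ω̄^b` at the origin. -/
def mixedDeriv (a b : ℕ) (f : ℂ → ℂ) : ℂ := (dz^[a] (dzbar^[b] f)) 0

/-- The functional `∂^k_j` (used for `j ≤ k`). -/
def parDist (m k j : ℕ) (f : ℂ → ℂ) : ℂ :=
  ∑ n ∈ Finset.range ((k - j) / m + 1),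
    (((k.choose (j + n * m) : ℝ) * Ring.choose (((m : ℝ) - 1 - j) / m - 1) n /
        Ring.choose ((((k : ℝ) - j) - ((m : ℝ) - 1)) / m) n : ℝ) : ℂ) *
      mixedDeriv (j + n * m) (k - j - n * m) f

/-- The Gamma function with the convention `Γ(-n) = 1 / ((-1)^n n!)` for `n = 0, 1, 2, …`. -/
def gammaExt (x : ℝ) : ℝ :=
  if x = -(⌊-x⌋₊ : ℝ) then 1 / ((-1) ^ ⌊-x⌋₊ * (⌊-x⌋₊.factorial : ℝ)) else Real.Gamma x

open scoped Classical in
/-- The beta-like function `𝔅(x,y)`, zero if `x` or `y` is a non-positive integer. -/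
def betaLike (x y : ℝ) : ℂ :=
  if (∃ n : ℕ, x = -(n : ℝ)) ∨ (∃ n : ℕ, y = -(n : ℝ)) then 0 else
    (Real.pi : ℂ) * Complex.exp (Complex.I * ((Real.pi / 2 * (y - x) : ℝ) : ℂ)) *
      ((gammaExt (x + y - 1) / ((2 : ℝ) ^ (x + y - 2) * (gammaExt x * gammaExt y)) : ℝ) : ℂ)

/-- The relevant indices: `0 ≤ i ≤ min j (m-2)` and `i ≠ j - (m-1) mod m`. -/
def Relevant (m j i : ℕ) : Prop :=
  i ≤ j ∧ i ≤ m - 2 ∧ ¬ ((i : ℤ) ≡ (j : ℤ) - ((m : ℤ) - 1) [ZMOD (m : ℤ)])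

open scoped Classical in
/-- The functional `𝒞^k_l`, with `θ₀ = exp(πi/m)` the principal `2m`-th root of unity. -/
def secDist (m k l : ℕ) (f : ℂ → ℂ) : ℂ :=
  ∑ j ∈ (Finset.range (k + 1)).filter (fun j => Relevant m k j),
    Complex.exp (Real.pi * Complex.I / m) ^ ((l : ℤ) * (2 * (j : ℤ) - (k : ℤ))) *
      betaLike (((m : ℝ) - 1 - j) / m) (((m : ℝ) - 1 - ((k : ℝ) - j)) / m) * parDist m k j f

end SaddleSector

end

/-! The assertion concerns one closed sector, on which `chi`, that is ω ↦ (-1)^l ω^m, is a chart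
onto the half-square [-1,1] × [0,1], with inverse `psi`. In the coordinate z = u + is the local
solution is, up to sign, the integral of f(psi z) |z|^(-2(m-1)/m) along horizontal lines, started
from one of the two vertical sides (`localSol_eq`). Let N be the number of derivatives in the class
𝔢(σ,k), so that n = N + 1, and let N + a = (k-(m-2))/m with 0 < a ≤ 1. The function f is split at
the origin into its homogeneous Taylor parts P_j, j < k, and a remainder that is flat of order k.

Remainder. Transported to the half-square it is a symbol of order N + a - 1: it is O(|z|^(N+a-1)),
and each derivative costs one factor |z|. Under a horizontal integral N derivatives may be taken;
what is left has size |z|^(a-1), and its horizontal integral has modulus t^a if a < 1 and η if a = 1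
(`GoodMod.reg_horInt`). Composition with the polynomial ω^m preserves this (`GoodMod.reg_comp_pow`).

Low degrees, j < n + m - 2. If Q is a polynomial in ω and its conjugate, then ±m Q∘psi is a
horizontal primitive of the transport of conj(ω)^(m-1) ∂Q + ω^(m-1) ∂̄Q. Modulo such polynomials the
monomials ω^p conj(ω)^(j-p) with p in a fixed class mod m are multiples of a single one, or vanish,
and the coefficient of P_j on that one is ∂^j_i up to the factor j!. Hence the conditions put P_j in
the range (`taylorPart_mem_polyRange`), and its solution is a polynomial minus a smooth function of
s alone.

High degrees. The transport of P_j is homogeneous of degree γ = (j-2(m-1))/m, a combination of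
products (-iz)^α conj((-iz)^β). It should have a u-primitive which is homogeneous of degree γ + 1,
up to a logarithm, and smooth on the closed half-plane away from 0. Integrating inwards from -∞ and
from +∞ gives two candidates, once enough s-derivatives are taken to make these integrals converge;
they agree exactly when the integral over the line s = 1 vanishes. Parseval's identity for Gamma
densities evaluates this integral as a constant depending only on the degree times ∑ c / (Γ(-α)
Γ(-β)) (`lineInt_mono`, `lineInt_dsMono`), and that sum is 𝒞^j_l up to a nonzero factor
(`sum_taylor_gamma_eq_zero`). Euler's relation then removes the s-derivatives one at a time
(`IsPrim.step`, and `IsPrim.step_log` at degree 0, the source of the logarithm); see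
`exists_isPrim`. Pulled back by `chi`, the primitive has degree j - (m-2) ≥ N + 1, which suffices
for both kinds of moduli, logarithm included.

Norm estimate. The homogeneous contributions depend linearly on finitely many Taylor coefficients,
so fixing extensions for a basis of the admissible coefficient vectors makes the constants uniform
(`exists_uniform_reg`). -/

namespace SaddleSector

/-! ### Wirtinger derivatives, symbol classes and regularity classes -/

open Set Filter Topology

/-- The real-linear map `v ↦ a v + b v̄`. -/
noncomputable def wirt (a b : ℂ) : ℂ →L[ℝ] ℂ :=
  a • (1 : ℂ →L[ℝ] ℂ) + b • (Complex.conjCLE : ℂ →L[ℝ] ℂ)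

@[simp] lemma wirt_apply (a b v : ℂ) : wirt a b v = a * v + b * (starRingEnd ℂ) v := by
  simp [wirt]

lemma norm_wirt_le (a b : ℂ) : ‖wirt a b‖ ≤ ‖a‖ + ‖b‖ := by
  refine ContinuousLinearMap.opNorm_le_bound _ (by positivity) fun v => ?_
  rw [wirt_apply, add_mul]
  refine (norm_add_le _ _).trans ?_
  simp

/-- Evaluation at 1 and at I recovers the sum and the difference of the coefficients. This lets an
identity between functions on an open set be differentiated coefficientwise. -/
lemma wirt_injective {a b a' b' : ℂ} (h : wirt a b = wirt a' b') : a = a' ∧ b = b' := by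
  have h1 := congrArg (fun L => L 1) h
  have h2 := congrArg (fun L => L Complex.I) h
  simp only [wirt_apply, map_one, mul_one, Complex.conj_I] at h1 h2
  have h3 : a - b = a' - b' := by
    have : (a - b - (a' - b')) * Complex.I = 0 := by linear_combination h2
    rcases mul_eq_zero.1 this with h | h
    · exact sub_eq_zero.1 h
    · exact absurd h Complex.I_ne_zero
  constructor
  · linear_combination (h1 + h3) / 2
  · linear_combination (h1 - h3) / 2

/-- Every real-linear map of the plane is of the form `wirt a b`. -/
lemma eq_wirt (L : ℂ →L[ℝ] ℂ) :
    L = wirt ((L 1 - Complex.I * L Complex.I) / 2) ((L 1 + Complex.I * L Complex.I) / 2) := by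
  ext v
  have hv : v = v.re • (1 : ℂ) + v.im • Complex.I := by
    simp [Complex.re_add_im]
  have h1 : L v = v.re * L 1 + v.im * L Complex.I := by
    conv_lhs => rw [hv]
    rw [map_add, map_smul, map_smul]; simp
  rw [h1, wirt_apply]
  have e1 : v = v.re + v.im * Complex.I := (Complex.re_add_im v).symm
  have e2 : (starRingEnd ℂ) v = v.re - v.im * Complex.I := by
    apply Complex.ext <;> simp
  rw [e2]
  nth_rewrite 3 [e1]
  linear_combination (v.im : ℂ) * L Complex.I * Complex.I_sq

/-- `g` has Wirtinger derivatives `a = ∂g`, `b = ∂̄g` at `x` within `A`. -/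
def HasD (g : ℂ → ℂ) (a b : ℂ) (A : Set ℂ) (x : ℂ) : Prop :=
  HasFDerivWithinAt g (wirt a b) A x

namespace HasD

variable {g g₁ g₂ : ℂ → ℂ} {a b a₁ b₁ a₂ b₂ x : ℂ} {A B : Set ℂ}

lemma mono (h : HasD g a b A x) (hBA : B ⊆ A) : HasD g a b B x :=
  HasFDerivWithinAt.mono h hBA

lemma congr (h : HasD g₁ a b A x) (hg : ∀ y ∈ A, g₂ y = g₁ y) (hx : g₂ x = g₁ x) :
    HasD g₂ a b A x :=
  HasFDerivWithinAt.congr h hg hx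

lemma congr_of_eventuallyEq (h : HasD g₁ a b A x) (hg : g₂ =ᶠ[𝓝[A] x] g₁) (hx : g₂ x = g₁ x) :
    HasD g₂ a b A x :=
  HasFDerivWithinAt.congr_of_eventuallyEq h hg hx

lemma continuousWithinAt (h : HasD g a b A x) : ContinuousWithinAt g A x :=
  HasFDerivWithinAt.continuousWithinAt h

lemma cast (h : HasD g a₁ b₁ A x) (ha : a₁ = a₂) (hb : b₁ = b₂) : HasD g a₂ b₂ A x := by
  subst ha hb; exact h

lemma add (h₁ : HasD g₁ a₁ b₁ A x) (h₂ : HasD g₂ a₂ b₂ A x) :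
    HasD (fun y => g₁ y + g₂ y) (a₁ + a₂) (b₁ + b₂) A x := by
  have := HasFDerivWithinAt.add h₁ h₂
  exact this.congr_fderiv (by ext v; simp; ring)

lemma const (c : ℂ) : HasD (fun _ => c) 0 0 A x := by
  have := hasFDerivWithinAt_const (𝕜 := ℝ) c x A
  exact this.congr_fderiv (by ext v; simp)

lemma mul (h₁ : HasD g₁ a₁ b₁ A x) (h₂ : HasD g₂ a₂ b₂ A x) :
    HasD (fun y => g₁ y * g₂ y) (a₁ * g₂ x + g₁ x * a₂) (b₁ * g₂ x + g₁ x * b₂) A x := by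
  have := HasFDerivWithinAt.mul h₁ h₂
  exact this.congr_fderiv (by ext v; simp; ring)

lemma const_mul (c : ℂ) (h : HasD g a b A x) : HasD (fun y => c * g y) (c * a) (c * b) A x := by
  refine ((const (A := A) (x := x) c).mul h).cast ?_ ?_ <;> ring

lemma neg (h : HasD g a b A x) : HasD (fun y => -g y) (-a) (-b) A x := by
  have := h.const_mul (-1)
  simpa using this

lemma sub (h₁ : HasD g₁ a₁ b₁ A x) (h₂ : HasD g₂ a₂ b₂ A x) :
    HasD (fun y => g₁ y - g₂ y) (a₁ - a₂) (b₁ - b₂) A x := by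
  have := h₁.add h₂.neg
  simpa [sub_eq_add_neg] using this

lemma sum {ι : Type*} {s : Finset ι} {g : ι → ℂ → ℂ} {a b : ι → ℂ}
    (h : ∀ i ∈ s, HasD (g i) (a i) (b i) A x) :
    HasD (fun y => ∑ i ∈ s, g i y) (∑ i ∈ s, a i) (∑ i ∈ s, b i) A x := by
  classical
  induction s using Finset.induction_on with
  | empty => simpa using const (A := A) (x := x) 0
  | insert i s hi ih =>
    simp only [Finset.sum_insert hi]
    exact (h i (by simp)).add (ih fun j hj => h j (by simp [hj]))

lemma conj (h : HasD g a b A x) :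
    HasD (fun y => (starRingEnd ℂ) (g y)) ((starRingEnd ℂ) b) ((starRingEnd ℂ) a) A x := by
  have := (Complex.conjCLE : ℂ →L[ℝ] ℂ).hasFDerivAt.comp_hasFDerivWithinAt x h
  exact this.congr_fderiv (by ext v; simp; ring)

lemma of_hasDerivAt (h : HasDerivAt g a x) : HasD g a 0 A x := by
  have := (h.hasFDerivAt.restrictScalars ℝ).hasFDerivWithinAt (s := A)
  exact this.congr_fderiv (by ext v; simp [mul_comm])

/-- Chain rule. -/
lemma comp {χ : ℂ → ℂ} {c d : ℂ} (h : HasD g a b A (χ x)) (hχ : HasD χ c d B x)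
    (hBA : MapsTo χ B A) :
    HasD (fun y => g (χ y)) (a * c + b * (starRingEnd ℂ) d) (a * d + b * (starRingEnd ℂ) c) B x := by
  have := HasFDerivWithinAt.comp x h hχ hBA
  exact this.congr_fderiv (by ext v; simp; ring)

/-- Chain rule for a holomorphic inner function. -/
lemma comp_holo {χ : ℂ → ℂ} {c : ℂ} (h : HasD g a b A (χ x)) (hχ : HasD χ c 0 B x)
    (hBA : MapsTo χ B A) :
    HasD (fun y => g (χ y)) (a * c) (b * (starRingEnd ℂ) c) B x := by
  refine (h.comp hχ hBA).cast ?_ ?_ <;> simp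

/-- Derivative along a curve. -/
lemma comp_curve {γ : ℝ → ℂ} {v : ℂ} {t : ℝ} {S : Set ℝ} (h : HasD g a b A (γ t))
    (hγ : HasDerivWithinAt γ v S t) (hSA : MapsTo γ S A) :
    HasDerivWithinAt (fun τ => g (γ τ)) (a * v + b * (starRingEnd ℂ) v) S t := by
  have := HasFDerivWithinAt.comp_hasDerivWithinAt t h hγ hSA
  rw [wirt_apply] at this
  exact this

end HasD

/-- Symbols: `g` is bounded by `Ω` on `A`, and every derivative up to order `N` loses a factor
`‖x‖`. -/
def Sym : ℕ → (ℂ → ℝ) → Set ℂ → (ℂ → ℂ) → Prop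
  | 0, Ω, A, g => ∀ x ∈ A, ‖g x‖ ≤ Ω x
  | N + 1, Ω, A, g => (∀ x ∈ A, ‖g x‖ ≤ Ω x) ∧ ∃ a b : ℂ → ℂ, (∀ x ∈ A, HasD g (a x) (b x) A x) ∧
      Sym N (fun x => Ω x / ‖x‖) A a ∧ Sym N (fun x => Ω x / ‖x‖) A b

namespace Sym

variable {N : ℕ} {Ω Ω₁ Ω₂ : ℂ → ℝ} {A B : Set ℂ} {g g₁ g₂ : ℂ → ℂ}

lemma bound (h : Sym N Ω A g) : ∀ x ∈ A, ‖g x‖ ≤ Ω x := by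
  cases N with
  | zero => exact h
  | succ N => exact h.1

lemma mono_set (h : Sym N Ω A g) (hBA : B ⊆ A) : Sym N Ω B g := by
  induction N generalizing Ω g with
  | zero => exact fun x hx => h x (hBA hx)
  | succ N ih =>
    obtain ⟨h0, a, b, hd, ha, hb⟩ := h
    exact ⟨fun x hx => h0 x (hBA hx), a, b, fun x hx => (hd x (hBA hx)).mono hBA, ih ha, ih hb⟩

lemma mono_weight (h : Sym N Ω₁ A g) (hΩ : ∀ x ∈ A, Ω₁ x ≤ Ω₂ x) : Sym N Ω₂ A g := by
  induction N generalizing Ω₁ Ω₂ g with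
  | zero => exact fun x hx => (h x hx).trans (hΩ x hx)
  | succ N ih =>
    obtain ⟨h0, a, b, hd, ha, hb⟩ := h
    have : ∀ x ∈ A, Ω₁ x / ‖x‖ ≤ Ω₂ x / ‖x‖ := fun x hx => by have := hΩ x hx; gcongr
    exact ⟨fun x hx => (h0 x hx).trans (hΩ x hx), a, b, hd, ih ha this, ih hb this⟩

lemma congr (h : Sym N Ω A g₁) (hg : ∀ x ∈ A, g₂ x = g₁ x) : Sym N Ω A g₂ := by
  cases N with
  | zero => exact fun x hx => by rw [hg x hx]; exact h x hx
  | succ N =>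
    obtain ⟨h0, a, b, hd, ha, hb⟩ := h
    exact ⟨fun x hx => by rw [hg x hx]; exact h0 x hx, a, b,
      fun x hx => (hd x hx).congr hg (hg x hx), ha, hb⟩

lemma pred (h : Sym (N + 1) Ω A g) : Sym N Ω A g := by
  induction N generalizing Ω g with
  | zero => exact h.1
  | succ N ih =>
    obtain ⟨h0, a, b, hd, ha, hb⟩ := h
    exact ⟨h0, a, b, hd, ih ha, ih hb⟩

lemma of_le {N' : ℕ} (h : Sym N Ω A g) (hN : N' ≤ N) : Sym N' Ω A g := by
  induction N, hN using Nat.le_induction with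
  | base => exact h
  | succ n _ ih => exact ih h.pred

lemma add (h₁ : Sym N Ω₁ A g₁) (h₂ : Sym N Ω₂ A g₂) :
    Sym N (fun x => Ω₁ x + Ω₂ x) A (fun x => g₁ x + g₂ x) := by
  induction N generalizing Ω₁ Ω₂ g₁ g₂ with
  | zero => exact fun x hx => (norm_add_le _ _).trans (add_le_add (h₁ x hx) (h₂ x hx))
  | succ N ih =>
    obtain ⟨h0, a, b, hd, ha, hb⟩ := h₁
    obtain ⟨h0', a', b', hd', ha', hb'⟩ := h₂
    refine ⟨fun x hx => (norm_add_le _ _).trans (add_le_add (h0 x hx) (h0' x hx)), _, _,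
      fun x hx => (hd x hx).add (hd' x hx), ?_, ?_⟩
    · exact (ih ha ha').mono_weight fun x _ => (add_div _ _ _).ge
    · exact (ih hb hb').mono_weight fun x _ => (add_div _ _ _).ge

lemma const_mul (c : ℂ) (h : Sym N Ω A g) : Sym N (fun x => ‖c‖ * Ω x) A (fun x => c * g x) := by
  induction N generalizing Ω g with
  | zero => exact fun x hx => (norm_mul _ _).trans_le (mul_le_mul_of_nonneg_left (h x hx) (norm_nonneg c))
  | succ N ih =>
    obtain ⟨h0, a, b, hd, ha, hb⟩ := h
    refine ⟨fun x hx => (norm_mul _ _).trans_le (mul_le_mul_of_nonneg_left (h0 x hx) (norm_nonneg c)), _, _,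
      fun x hx => (hd x hx).const_mul c, ?_, ?_⟩
    · exact (ih ha).mono_weight fun x _ => (mul_div_assoc _ _ _).ge
    · exact (ih hb).mono_weight fun x _ => (mul_div_assoc _ _ _).ge

lemma conj (h : Sym N Ω A g) : Sym N Ω A (fun x => (starRingEnd ℂ) (g x)) := by
  induction N generalizing Ω g with
  | zero => exact fun x hx => by simpa using h x hx
  | succ N ih =>
    obtain ⟨h0, a, b, hd, ha, hb⟩ := h
    exact ⟨fun x hx => by simpa using h0 x hx, _, _, fun x hx => (hd x hx).conj, ih hb, ih ha⟩

/-- The Leibniz rule turns one product into two at each differentiation, whence the factor 2 ^ N. -/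
lemma mul (h₁ : Sym N Ω₁ A g₁) (h₂ : Sym N Ω₂ A g₂) :
    Sym N (fun x => 2 ^ N * (Ω₁ x * Ω₂ x)) A (fun x => g₁ x * g₂ x) := by
  have key : ∀ {g₁ g₂ : ℂ → ℂ} {Ω₁ Ω₂ : ℂ → ℝ}, (∀ x ∈ A, ‖g₁ x‖ ≤ Ω₁ x) →
      (∀ x ∈ A, ‖g₂ x‖ ≤ Ω₂ x) → ∀ x ∈ A, ‖g₁ x * g₂ x‖ ≤ Ω₁ x * Ω₂ x := by
    intro g₁ g₂ Ω₁ Ω₂ h h' x hx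
    rw [norm_mul]
    exact mul_le_mul (h x hx) (h' x hx) (norm_nonneg _) ((norm_nonneg _).trans (h x hx))
  induction N generalizing Ω₁ Ω₂ g₁ g₂ with
  | zero => simpa [Sym] using key h₁ h₂
  | succ N ih =>
    have h1 := h₁.pred
    have h2 := h₂.pred
    obtain ⟨h0, a, b, hd, ha, hb⟩ := h₁
    obtain ⟨h0', a', b', hd', ha', hb'⟩ := h₂
    have hpow : ∀ y : ℝ, 0 ≤ y → y ≤ 2 ^ (N + 1) * y := fun y hy =>
      le_mul_of_one_le_left hy (one_le_pow₀ (by norm_num))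
    refine ⟨fun x hx => (key h0 h0' x hx).trans (hpow _ ?_), _, _,
      fun x hx => (hd x hx).mul (hd' x hx), ?_, ?_⟩
    · exact (norm_nonneg _).trans (key h0 h0' x hx)
    · refine ((ih ha h2).add (ih h1 ha')).mono_weight fun x _ => le_of_eq ?_
      ring
    · refine ((ih hb h2).add (ih h1 hb')).mono_weight fun x _ => le_of_eq ?_
      ring

lemma sum {ι : Type*} {s : Finset ι} {Ω : ι → ℂ → ℝ} {g : ι → ℂ → ℂ}
    (h : ∀ i ∈ s, Sym N (Ω i) A (g i)) :
    Sym N (fun x => ∑ i ∈ s, Ω i x) A (fun x => ∑ i ∈ s, g i x) := by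
  classical
  induction s using Finset.induction_on with
  | empty =>
    simp only [Finset.sum_empty]
    clear h
    have : ∀ N, Sym N (fun _ => 0) A (fun _ => 0) := by
      intro N
      induction N with
      | zero => intro x _; simp
      | succ N ih =>
        refine ⟨fun x _ => by simp, fun _ => 0, fun _ => 0, fun x _ => HasD.const 0, ?_, ?_⟩ <;>
        simpa using ih
    exact this N
  | insert i s hi ih =>
    simp only [Finset.sum_insert hi]
    exact (h i (by simp)).add (ih fun j hj => h j (by simp [hj]))

lemma const {c : ℂ} {C : ℝ} (hc : ‖c‖ ≤ C) : Sym N (fun _ => C) A (fun _ => c) := by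
  cases N with
  | zero => intro x _; exact hc
  | succ N =>
    refine ⟨fun _ _ => hc, fun _ => 0, fun _ => 0, fun x _ => HasD.const c, ?_, ?_⟩ <;>
    · have hC : 0 ≤ C := (norm_nonneg _).trans hc
      have := Sym.sum (N := N) (A := A) (s := (∅ : Finset ℕ)) (Ω := fun _ _ => 0)
        (g := fun _ _ => 0) (by simp)
      simp only [Finset.sum_empty] at this
      exact this.mono_weight fun x _ => by positivity

lemma continuousOn (h : Sym (N + 1) Ω A g) : ContinuousOn g A := by
  obtain ⟨-, a, b, hd, -, -⟩ := h
  exact fun x hx => (hd x hx).continuousWithinAt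

/-- Composition with a holomorphic chart `χ` such that `χ' ~ χ(x) / x`. -/
lemma comp_chart {χ χ' : ℂ → ℂ} {C : ℝ} (hC : 1 ≤ C) (hBA : MapsTo χ B A)
    (hB : ∀ x ∈ B, x ≠ 0) (hA : ∀ x ∈ A, x ≠ 0)
    (hχ : ∀ x ∈ B, HasD χ (χ' x) 0 B x) (hχ' : Sym N (fun x => C * (‖χ x‖ / ‖x‖)) B χ')
    (h : Sym N Ω A g) :
    Sym N (fun x => (2 * C) ^ (N * N) * Ω (χ x)) B (fun x => g (χ x)) := by
  have hpow : ∀ (n : ℕ) (y : ℝ), 0 ≤ y → y ≤ (2 * C) ^ n * y := fun n y hy =>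
    le_mul_of_one_le_left hy (one_le_pow₀ (by linarith))
  induction N generalizing Ω g with
  | zero => intro x hx; simpa using h (χ x) (hBA hx)
  | succ N ih =>
    obtain ⟨h0, a, b, hd, ha, hb⟩ := h
    have hnn : ∀ x ∈ B, 0 ≤ Ω (χ x) := fun x hx => (norm_nonneg _).trans (h0 _ (hBA hx))
    have hw : ∀ x ∈ B, 2 ^ N * ((2 * C) ^ (N * N) * (Ω (χ x) / ‖χ x‖) * (C * (‖χ x‖ / ‖x‖))) ≤
        (2 * C) ^ ((N + 1) * (N + 1)) * Ω (χ x) / ‖x‖ := by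
      intro x hx
      have h1 := norm_pos_iff.2 (hA _ (hBA hx))
      have h2 := norm_pos_iff.2 (hB _ hx)
      have e1 : 2 ^ N * ((2 * C) ^ (N * N) * (Ω (χ x) / ‖χ x‖) * (C * (‖χ x‖ / ‖x‖))) =
        (2 ^ N * C * (2 * C) ^ (N * N)) * (Ω (χ x) / ‖x‖) := by
        field_simp
      rw [e1, mul_div_assoc]
      have := hnn x hx
      gcongr
      -- The exponent N * N is chosen because (N + 1)² = N + (N + 1) + N²: the first summand absorbs
      -- the Leibniz factor 2 ^ N, the second the factor C of the chart derivative, the third the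
      -- inductive constant.
      have e2 : (2 * C) ^ ((N + 1) * (N + 1)) = (2 * C) ^ N * (2 * C) ^ (N + 1) * (2 * C) ^ (N * N) := by
        ring
      rw [e2]
      gcongr
      · linarith
      · calc C ≤ (2 * C) ^ 1 := by linarith
          _ ≤ (2 * C) ^ (N + 1) := pow_le_pow_right₀ (by linarith) (by omega)
    refine ⟨fun x hx => (h0 _ (hBA hx)).trans (hpow _ _ (hnn x hx)), _, _,
      fun x hx => (hd _ (hBA hx)).comp_holo (hχ x hx) hBA, ?_, ?_⟩
    · exact ((ih hχ'.pred ha).mul hχ'.pred).mono_weight hw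
    · exact ((ih hχ'.pred hb).mul hχ'.pred.conj).mono_weight hw

end Sym

/-- Functions on `A` with `N` derivatives, bounded by `M`, the last of which have modulus of
continuity `M * w`. -/
def Reg : ℕ → (ℝ → ℝ) → Set ℂ → ℝ → (ℂ → ℂ) → Prop
  | 0, w, A, M, g => (∀ x ∈ A, ‖g x‖ ≤ M) ∧ ∀ x ∈ A, ∀ y ∈ A, ‖g x - g y‖ ≤ M * w (dist x y)
  | N + 1, w, A, M, g => (∀ x ∈ A, ‖g x‖ ≤ M) ∧ ∃ a b : ℂ → ℂ, (∀ x ∈ A, HasD g (a x) (b x) A x) ∧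
      Reg N w A M a ∧ Reg N w A M b

namespace Reg

variable {N : ℕ} {w : ℝ → ℝ} {A B : Set ℂ} {g g₁ g₂ : ℂ → ℂ} {M M₁ M₂ : ℝ}

lemma bound (h : Reg N w A M g) : ∀ x ∈ A, ‖g x‖ ≤ M := by
  cases N <;> exact h.1

lemma mono_set (h : Reg N w A M g) (hBA : B ⊆ A) : Reg N w B M g := by
  induction N generalizing g with
  | zero => exact ⟨fun x hx => h.1 x (hBA hx), fun x hx y hy => h.2 x (hBA hx) y (hBA hy)⟩
  | succ N ih =>
    obtain ⟨h0, a, b, hd, ha, hb⟩ := h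
    exact ⟨fun x hx => h0 x (hBA hx), a, b, fun x hx => (hd x (hBA hx)).mono hBA, ih ha, ih hb⟩

lemma mono_const (h : Reg N w A M₁ g) (hw : ∀ t, 0 ≤ t → 0 ≤ w t) (hM : M₁ ≤ M₂) : Reg N w A M₂ g := by
  induction N generalizing g with
  | zero =>
    refine ⟨fun x hx => (h.1 x hx).trans hM, fun x hx y hy => (h.2 x hx y hy).trans ?_⟩
    have := hw (dist x y) dist_nonneg
    gcongr
  | succ N ih =>
    obtain ⟨h0, a, b, hd, ha, hb⟩ := h
    exact ⟨fun x hx => (h0 x hx).trans hM, a, b, hd, ih ha, ih hb⟩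

lemma congr (h : Reg N w A M g₁) (hg : ∀ x ∈ A, g₂ x = g₁ x) : Reg N w A M g₂ := by
  cases N with
  | zero =>
    refine ⟨fun x hx => by rw [hg x hx]; exact h.1 x hx, fun x hx y hy => ?_⟩
    rw [hg x hx, hg y hy]; exact h.2 x hx y hy
  | succ N =>
    obtain ⟨h0, a, b, hd, ha, hb⟩ := h
    exact ⟨fun x hx => by rw [hg x hx]; exact h0 x hx, a, b,
      fun x hx => (hd x hx).congr hg (hg x hx), ha, hb⟩

lemma add (h₁ : Reg N w A M₁ g₁) (h₂ : Reg N w A M₂ g₂) :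
    Reg N w A (M₁ + M₂) (fun x => g₁ x + g₂ x) := by
  induction N generalizing g₁ g₂ with
  | zero =>
    refine ⟨fun x hx => (norm_add_le _ _).trans (add_le_add (h₁.1 x hx) (h₂.1 x hx)),
      fun x hx y hy => ?_⟩
    rw [add_mul, add_sub_add_comm]
    exact (norm_add_le _ _).trans (add_le_add (h₁.2 x hx y hy) (h₂.2 x hx y hy))
  | succ N ih =>
    obtain ⟨h0, a, b, hd, ha, hb⟩ := h₁
    obtain ⟨h0', a', b', hd', ha', hb'⟩ := h₂
    exact ⟨fun x hx => (norm_add_le _ _).trans (add_le_add (h0 x hx) (h0' x hx)), _, _,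
      fun x hx => (hd x hx).add (hd' x hx), ih ha ha', ih hb hb'⟩

lemma const_mul (c : ℂ) (h : Reg N w A M g) : Reg N w A (‖c‖ * M) (fun x => c * g x) := by
  induction N generalizing g with
  | zero =>
    refine ⟨fun x hx => by rw [norm_mul]; gcongr; exact h.1 x hx, fun x hx y hy => ?_⟩
    rw [← mul_sub, norm_mul, mul_assoc]
    gcongr
    exact h.2 x hx y hy
  | succ N ih =>
    obtain ⟨h0, a, b, hd, ha, hb⟩ := h
    exact ⟨fun x hx => (norm_mul _ _).trans_le (mul_le_mul_of_nonneg_left (h0 x hx) (norm_nonneg c)), _, _,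
      fun x hx => (hd x hx).const_mul c, ih ha, ih hb⟩

lemma sum {ι : Type*} {s : Finset ι} {M : ι → ℝ} {g : ι → ℂ → ℂ}
    (h : ∀ i ∈ s, Reg N w A (M i) (g i)) :
    Reg N w A (∑ i ∈ s, M i) (fun x => ∑ i ∈ s, g i x) := by
  classical
  induction s using Finset.induction_on with
  | empty =>
    simp only [Finset.sum_empty]
    clear h
    have : ∀ N, Reg N w A 0 (fun _ => 0) := by
      intro N
      induction N with
      | zero => exact ⟨fun x _ => by simp, fun x _ y _ => by simp⟩
      | succ N ih => exact ⟨fun x _ => by simp, fun _ => 0, fun _ => 0, fun x _ => HasD.const 0, ih, ih⟩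
    exact this N
  | insert i s hi ih =>
    simp only [Finset.sum_insert hi]
    exact (h i (by simp)).add (ih fun j hj => h j (by simp [hj]))

lemma const {c : ℂ} (hw : ∀ t, 0 ≤ t → 0 ≤ w t) (hc : ‖c‖ ≤ M) : Reg N w A M (fun _ => c) := by
  have hM : 0 ≤ M := (norm_nonneg _).trans hc
  cases N with
  | zero =>
    refine ⟨fun x _ => hc, fun x _ y _ => ?_⟩
    have := hw (dist x y) dist_nonneg
    simp; positivity
  | succ N =>
    have := (Reg.sum (N := N) (w := w) (A := A) (s := (∅ : Finset ℕ)) (M := fun _ => 0)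
        (g := fun _ _ => 0) (by simp)).mono_const hw (M₂ := M) (by simpa using hM)
    simp only [Finset.sum_empty] at this
    exact ⟨fun _ _ => hc, fun _ => 0, fun _ => 0, fun x _ => HasD.const c, this, this⟩

end Reg

end SaddleSector

/-! ### From Wirtinger coefficients to iterated Fréchet derivatives -/

namespace SaddleSector

open Set Filter Topology

/-- `a ↦ (v ↦ a v)` as a real-linear map. -/
noncomputable def wirtL : ℂ →L[ℝ] (ℂ →L[ℝ] ℂ) :=
  LinearMap.mkContinuous
    { toFun := fun a => wirt a 0
      map_add' := fun a b => by ext v; simp; ring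
      map_smul' := fun c a => by ext v; simp [mul_assoc] } 1
    fun a => by simpa using norm_wirt_le a 0

/-- `b ↦ (v ↦ b v̄)` as a real-linear map. -/
noncomputable def wirtR : ℂ →L[ℝ] (ℂ →L[ℝ] ℂ) :=
  LinearMap.mkContinuous
    { toFun := fun b => wirt 0 b
      map_add' := fun a b => by ext v; simp; ring
      map_smul' := fun c a => by ext v; simp [mul_assoc] } 1
    fun a => by simpa using norm_wirt_le 0 a

lemma norm_wirtL_le : ‖wirtL‖ ≤ 1 := LinearMap.mkContinuous_norm_le _ zero_le_one _

lemma norm_wirtR_le : ‖wirtR‖ ≤ 1 := LinearMap.mkContinuous_norm_le _ zero_le_one _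

lemma wirt_eq (a b : ℂ) : wirt a b = wirtL a + wirtR b := by
  have h1 : wirtL a = wirt a 0 := rfl
  have h2 : wirtR b = wirt 0 b := rfl
  rw [h1, h2]; ext v; simp

lemma norm_map_add_le {E F : Type*} [NormedAddCommGroup E] [NormedSpace ℝ E]
    [NormedAddCommGroup F] [NormedSpace ℝ F] (e : E ≃ₗᵢ[ℝ] F) (x y : E) :
    ‖e (x + y)‖ ≤ ‖x‖ + ‖y‖ := by
  rw [LinearIsometryEquiv.norm_map]; exact norm_add_le _ _

lemma norm_map_add_sub_le {E F : Type*} [NormedAddCommGroup E] [NormedSpace ℝ E]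
    [NormedAddCommGroup F] [NormedSpace ℝ F] (e : E ≃ₗᵢ[ℝ] F) (x y x' y' : E) :
    ‖e (x + y) - e (x' + y')‖ ≤ ‖x - x'‖ + ‖y - y'‖ := by
  rw [← map_sub, LinearIsometryEquiv.norm_map, add_sub_add_comm]; exact norm_add_le _ _

section iterated

variable {A : Set ℂ} {g a b : ℂ → ℂ} {j : ℕ}

lemma contDiffOn_wirt {n : WithTop ℕ∞} (ha : ContDiffOn ℝ n a A) (hb : ContDiffOn ℝ n b A) :
    ContDiffOn ℝ n (fun x => wirt (a x) (b x)) A := by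
  simp only [wirt_eq]
  exact (wirtL.contDiff.comp_contDiffOn ha).add (wirtR.contDiff.comp_contDiffOn hb)

lemma fderivWithin_eq_wirt (hA : UniqueDiffOn ℝ A) (hd : ∀ x ∈ A, HasD g (a x) (b x) A x) {x : ℂ}
    (hx : x ∈ A) : fderivWithin ℝ g A x = wirt (a x) (b x) :=
  HasFDerivWithinAt.fderivWithin (hd x hx) (hA x hx)

lemma contDiffOn_succ_of_hasD (hA : UniqueDiffOn ℝ A) (hd : ∀ x ∈ A, HasD g (a x) (b x) A x)
    (ha : ContDiffOn ℝ j a A) (hb : ContDiffOn ℝ j b A) : ContDiffOn ℝ (j + 1 : ℕ) g A := by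
  have : ContDiffOn ℝ ((j : ℕ) + 1) g A := by
    rw [contDiffOn_succ_iff_fderivWithin hA]
    refine ⟨fun x hx => (HasFDerivWithinAt.differentiableWithinAt (hd x hx)), by simp, ?_⟩
    exact (contDiffOn_wirt ha hb).congr fun x hx => fderivWithin_eq_wirt hA hd hx
  exact_mod_cast this

/-- The iterated derivative of order `j + 1` in terms of the Wirtinger derivatives. -/
lemma iteratedFDerivWithin_succ_eq_wirt (hA : UniqueDiffOn ℝ A)
    (hd : ∀ x ∈ A, HasD g (a x) (b x) A x)
    (ha : ContDiffOn ℝ j a A) (hb : ContDiffOn ℝ j b A) {x : ℂ} (hx : x ∈ A) :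
    iteratedFDerivWithin ℝ (j + 1) g A x = (continuousMultilinearCurryRightEquiv' ℝ j ℂ ℂ).symm
      (wirtL.compContinuousMultilinearMap (iteratedFDerivWithin ℝ j a A x) +
        wirtR.compContinuousMultilinearMap (iteratedFDerivWithin ℝ j b A x)) := by
  rw [iteratedFDerivWithin_succ_eq_comp_right hA hx, Function.comp_apply]
  congr 1
  have h1 : iteratedFDerivWithin ℝ j (fun y => fderivWithin ℝ g A y) A x =
      iteratedFDerivWithin ℝ j (wirtL ∘ a + wirtR ∘ b) A x := by
    refine iteratedFDerivWithin_congr (fun y hy => ?_) hx _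
    rw [fderivWithin_eq_wirt hA hd hy, wirt_eq]; rfl
  rw [h1, iteratedFDerivWithin_add_apply
    ((wirtL.contDiff.comp_contDiffOn ha) x hx) ((wirtR.contDiff.comp_contDiffOn hb) x hx) hA hx]
  congr 1
  · exact wirtL.iteratedFDerivWithin_comp_left (ha x hx) hA hx le_rfl
  · exact wirtR.iteratedFDerivWithin_comp_left (hb x hx) hA hx le_rfl

lemma norm_wirtL_comp_le {j : ℕ} (m : ContinuousMultilinearMap ℝ (fun _ : Fin j => ℂ) ℂ) :
    ‖wirtL.compContinuousMultilinearMap m‖ ≤ ‖m‖ :=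
  (wirtL.norm_compContinuousMultilinearMap_le m).trans
    (mul_le_of_le_one_left (norm_nonneg _) norm_wirtL_le)

lemma norm_wirtR_comp_le {j : ℕ} (m : ContinuousMultilinearMap ℝ (fun _ : Fin j => ℂ) ℂ) :
    ‖wirtR.compContinuousMultilinearMap m‖ ≤ ‖m‖ :=
  (wirtR.norm_compContinuousMultilinearMap_le m).trans
    (mul_le_of_le_one_left (norm_nonneg _) norm_wirtR_le)

lemma norm_wirtL_comp_sub_le {j : ℕ} (m m' : ContinuousMultilinearMap ℝ (fun _ : Fin j => ℂ) ℂ) :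
    ‖wirtL.compContinuousMultilinearMap m - wirtL.compContinuousMultilinearMap m'‖ ≤ ‖m - m'‖ := by
  have : wirtL.compContinuousMultilinearMap m - wirtL.compContinuousMultilinearMap m' =
      wirtL.compContinuousMultilinearMap (m - m') := by
    ext v u; simp
  rw [this]; exact norm_wirtL_comp_le _

lemma norm_wirtR_comp_sub_le {j : ℕ} (m m' : ContinuousMultilinearMap ℝ (fun _ : Fin j => ℂ) ℂ) :
    ‖wirtR.compContinuousMultilinearMap m - wirtR.compContinuousMultilinearMap m'‖ ≤ ‖m - m'‖ := by
  have : wirtR.compContinuousMultilinearMap m - wirtR.compContinuousMultilinearMap m' =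
      wirtR.compContinuousMultilinearMap (m - m') := by
    ext v u; simp
  rw [this]; exact norm_wirtR_comp_le _

lemma norm_iteratedFDerivWithin_succ_le (hA : UniqueDiffOn ℝ A)
    (hd : ∀ x ∈ A, HasD g (a x) (b x) A x)
    (ha : ContDiffOn ℝ j a A) (hb : ContDiffOn ℝ j b A) {x : ℂ} (hx : x ∈ A) :
    ‖iteratedFDerivWithin ℝ (j + 1) g A x‖ ≤
      ‖iteratedFDerivWithin ℝ j a A x‖ + ‖iteratedFDerivWithin ℝ j b A x‖ := by
  rw [iteratedFDerivWithin_succ_eq_wirt hA hd ha hb hx]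
  have h1 := norm_wirtL_comp_le (iteratedFDerivWithin ℝ j a A x)
  have h2 := norm_wirtR_comp_le (iteratedFDerivWithin ℝ j b A x)
  have h3 := norm_map_add_le (continuousMultilinearCurryRightEquiv' ℝ j ℂ ℂ).symm
    (wirtL.compContinuousMultilinearMap (iteratedFDerivWithin ℝ j a A x))
    (wirtR.compContinuousMultilinearMap (iteratedFDerivWithin ℝ j b A x))
  exact h3.trans (add_le_add h1 h2)

lemma norm_iteratedFDerivWithin_succ_sub_le (hA : UniqueDiffOn ℝ A)
    (hd : ∀ x ∈ A, HasD g (a x) (b x) A x)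
    (ha : ContDiffOn ℝ j a A) (hb : ContDiffOn ℝ j b A) {x y : ℂ} (hx : x ∈ A) (hy : y ∈ A) :
    ‖iteratedFDerivWithin ℝ (j + 1) g A x - iteratedFDerivWithin ℝ (j + 1) g A y‖ ≤
      ‖iteratedFDerivWithin ℝ j a A x - iteratedFDerivWithin ℝ j a A y‖ +
      ‖iteratedFDerivWithin ℝ j b A x - iteratedFDerivWithin ℝ j b A y‖ := by
  rw [iteratedFDerivWithin_succ_eq_wirt hA hd ha hb hx,
    iteratedFDerivWithin_succ_eq_wirt hA hd ha hb hy]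
  have h1 := norm_wirtL_comp_sub_le (iteratedFDerivWithin ℝ j a A x) (iteratedFDerivWithin ℝ j a A y)
  have h2 := norm_wirtR_comp_sub_le (iteratedFDerivWithin ℝ j b A x) (iteratedFDerivWithin ℝ j b A y)
  have h3 := norm_map_add_sub_le (continuousMultilinearCurryRightEquiv' ℝ j ℂ ℂ).symm
    (wirtL.compContinuousMultilinearMap (iteratedFDerivWithin ℝ j a A x))
    (wirtR.compContinuousMultilinearMap (iteratedFDerivWithin ℝ j b A x))
    (wirtL.compContinuousMultilinearMap (iteratedFDerivWithin ℝ j a A y))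
    (wirtR.compContinuousMultilinearMap (iteratedFDerivWithin ℝ j b A y))
  exact h3.trans (add_le_add h1 h2)

end iterated

namespace Reg

variable {N : ℕ} {w : ℝ → ℝ} {A : Set ℂ} {g : ℂ → ℂ} {M : ℝ}

/-- The derivative is `wirtL` of one coefficient plus `wirtR` of the other, and both operators have
norm at most 1, so bounds at most double with each order. The hypothesis `hc` supplies continuity of
the top derivatives, which the modulus alone must give. -/
lemma norm_iterated_sub_le (hA : UniqueDiffOn ℝ A)
    (hc : ∀ (g : ℂ → ℂ), (∀ x ∈ A, ∀ y ∈ A, ‖g x - g y‖ ≤ M * w (dist x y)) → ContinuousOn g A)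
    (h : Reg N w A M g) : ContDiffOn ℝ N g A ∧
    (∀ j ≤ N, ∀ x ∈ A, ‖iteratedFDerivWithin ℝ j g A x‖ ≤ 2 ^ j * M) ∧
    ∀ x ∈ A, ∀ y ∈ A, ‖iteratedFDerivWithin ℝ N g A x - iteratedFDerivWithin ℝ N g A y‖ ≤
      2 ^ N * (M * w (dist x y)) := by
  induction N generalizing g with
  | zero =>
    refine ⟨by simpa using hc g h.2, ?_, ?_⟩
    · intro j hj x hx
      obtain rfl : j = 0 := by omega
      simpa using h.1 x hx
    · intro x hx y hy
      rw [iteratedFDerivWithin_zero_eq_comp, Function.comp_apply, Function.comp_apply, ← map_sub,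
        LinearIsometryEquiv.norm_map]
      simpa using h.2 x hx y hy
  | succ N ih =>
    obtain ⟨h0, a, b, hd, ha, hb⟩ := h
    obtain ⟨ha1, ha2, ha3⟩ := ih ha
    obtain ⟨hb1, hb2, hb3⟩ := ih hb
    refine ⟨contDiffOn_succ_of_hasD hA hd ha1 hb1, ?_, ?_⟩
    · rintro (_ | j) hj x hx
      · simpa using h0 x hx
      · have hj' : j ≤ N := by omega
        have hjc : ((j : ℕ) : WithTop ℕ∞) ≤ (N : ℕ) := by exact_mod_cast hj'
        refine (norm_iteratedFDerivWithin_succ_le hA hd (ha1.of_le hjc) (hb1.of_le hjc) hx).trans ?_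
        have := ha2 j hj' x hx
        have := hb2 j hj' x hx
        rw [pow_succ]; linarith
    · intro x hx y hy
      refine (norm_iteratedFDerivWithin_succ_sub_le hA hd ha1 hb1 hx hy).trans ?_
      have := ha3 x hx y hy
      have := hb3 x hx y hy
      rw [pow_succ]; linarith

end Reg

lemma enorm_le_ofReal {E : Type*} [SeminormedAddCommGroup E] {x : E} {c : ℝ} (h : ‖x‖ ≤ c) :
    ‖x‖ₑ ≤ ENNReal.ofReal c := by
  rw [← ofReal_norm]; exact ENNReal.ofReal_le_ofReal h

/-- The class and the norm of `C^r(A)` are controlled by `Reg`. -/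
lemma Reg.isClassC {r : RegExp} {A : Set ℂ} {g : ℂ → ℂ} {M : ℝ} (hA : UniqueDiffOn ℝ A)
    (hw : ∀ x ∈ A, ∀ y ∈ A, x ≠ y → 0 < r.modulus (dist x y))
    (hc : ∀ (g : ℂ → ℂ), (∀ x ∈ A, ∀ y ∈ A, ‖g x - g y‖ ≤ M * r.modulus (dist x y)) →
      ContinuousOn g A) (hM : 0 ≤ M)
    (h : Reg r.degree r.modulus A M g) :
    IsClassC r A g ∧ regNorm r A g ≤
      ENNReal.ofReal (((∑ j ∈ Finset.range (r.degree + 1), (2 : ℝ) ^ j) + 2 ^ r.degree) * M) := by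
  obtain ⟨h1, h2, h3⟩ := h.norm_iterated_sub_le hA hc
  have hs : modSeminorm r.degree r.modulus A g ≤ ENNReal.ofReal (2 ^ r.degree * M) := by
    refine iSup₂_le fun x hx => iSup₂_le fun y hy => iSup_le fun hxy => ?_
    have hp := hw x hx y hy hxy
    refine ENNReal.div_le_of_le_mul ?_
    rw [← ENNReal.ofReal_mul (by positivity)]
    refine enorm_le_ofReal ((h3 x hx y hy).trans_eq ?_)
    ring
  have hn : cNorm r.degree A g ≤
      ENNReal.ofReal ((∑ j ∈ Finset.range (r.degree + 1), (2 : ℝ) ^ j) * M) := by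
    rw [Finset.sum_mul, ENNReal.ofReal_sum_of_nonneg (fun _ _ => by positivity)]
    refine Finset.sum_le_sum fun j hj => iSup₂_le fun x hx => enorm_le_ofReal ?_
    exact h2 j (by simpa [Nat.lt_succ_iff] using hj) x hx
  refine ⟨⟨h1, hs.trans_lt ENNReal.ofReal_lt_top⟩, ?_⟩
  rw [add_mul, ENNReal.ofReal_add (by positivity) (by positivity)]
  exact add_le_add hn hs

end SaddleSector

/-! ### Moduli of continuity: the powers t ^ a and η -/

namespace SaddleSector

open Set Filter Topology

/-- A modulus of continuity `w`, comparable on `[0,8]` with a concave function `Θ` whose derivative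
`ρ` dominates `t ^ (a - 1)` and the logarithm. -/
structure GoodMod (a : ℝ) (w ρ Θ : ℝ → ℝ) (K : ℝ) : Prop where
  a_pos : 0 < a
  a_le : a ≤ 1
  one_le : 1 ≤ K
  w_pos : ∀ t, 0 < t → 0 < w t
  w_zero : w 0 = 0
  w_cont : ContinuousAt w 0
  w_mono : ∀ s t, 0 ≤ s → s ≤ t → w s ≤ w t
  w_scale : ∀ c t, 1 ≤ c → 0 ≤ t → w (c * t) ≤ c * w t
  le_w : ∀ t, 0 < t → t ≤ 8 → t ≤ K * w t
  rho_anti : ∀ s t, 0 < s → s ≤ t → ρ t ≤ ρ s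
  le_rho : ∀ t, 0 < t → t ≤ 8 → t ^ (a - 1) ≤ ρ t
  log_le_rho : ∀ t, 0 < t → t ≤ 8 → 1 + |Real.log t| ≤ K * ρ t
  mul_rho_le : ∀ t, 0 < t → t ≤ 8 → t * ρ t ≤ K * w t
  theta_deriv : ∀ t, 0 < t → HasDerivAt Θ (ρ t) t
  theta_cont : Continuous Θ
  theta_zero : Θ 0 = 0
  theta_sub : ∀ s t, 0 < s → 0 < t → Θ (s + t) ≤ Θ s + Θ t
  theta_le : ∀ t, 0 < t → t ≤ 8 → Θ t ≤ K * w t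
  rpow_le_w : ∀ t, 0 < t → t ≤ 8 → t ^ a ≤ K * w t
  base : ∀ t, 0 < t → t ≤ 1 → t * ∫ v in t..1, v ^ (a - 2) ≤ K * w t

namespace GoodMod

variable {a K : ℝ} {w ρ Θ : ℝ → ℝ}

lemma w_nonneg (h : GoodMod a w ρ Θ K) {t : ℝ} (ht : 0 ≤ t) : 0 ≤ w t := by
  rcases ht.eq_or_lt with rfl | ht
  · exact h.w_zero.ge
  · exact (h.w_pos t ht).le

lemma rho_pos (h : GoodMod a w ρ Θ K) {t : ℝ} (ht : 0 < t) (ht8 : t ≤ 8) : 0 < ρ t :=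
  (Real.rpow_pos_of_pos ht _).trans_le (h.le_rho t ht ht8)

end GoodMod

lemma integral_rpow_sub_two {t a : ℝ} (ht : 0 < t) (ht1 : t ≤ 1) (ha : a ≠ 1) :
    ∫ v in t..1, v ^ (a - 2) = (1 - t ^ (a - 1)) / (a - 1) := by
  rw [integral_rpow]
  · have : a - 2 + 1 = a - 1 := by ring
    rw [this, Real.one_rpow]
  · refine Or.inr ⟨fun h => ha (by linarith), ?_⟩
    rw [uIcc_of_le ht1]; exact fun h => absurd h.1 (not_le.2 ht)

/-- The Hölder moduli. -/
lemma goodMod_hol {a : ℝ} (ha : 0 < a) (ha1 : a < 1) :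
    ∃ K, GoodMod a (fun t => t ^ a) (fun t => t ^ (a - 1)) (fun t => t ^ a / a) K := by
  have h1a : 0 < 1 - a := by linarith
  have hinv : 1 ≤ 1 / a := by rw [le_div_iff₀ ha]; linarith
  have hinv' : 1 ≤ 1 / (1 - a) := by rw [le_div_iff₀ h1a]; linarith
  have e1 : ∀ t : ℝ, 0 < t → t * t ^ (a - 1) = t ^ a := fun t ht => by
    rw [Real.rpow_sub_one ht.ne']; field_simp
  have e8 : ∀ t : ℝ, 0 < t → t ≤ 8 → 1 ≤ 8 * t ^ (a - 1) := by
    intro t ht ht8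
    have h8 : (8 : ℝ) ^ (a - 1) ≤ t ^ (a - 1) :=
      Real.rpow_le_rpow_of_nonpos ht ht8 (by linarith)
    have : (8 : ℝ) ^ (-1 : ℝ) ≤ 8 ^ (a - 1) :=
      Real.rpow_le_rpow_of_exponent_le (by norm_num) (by linarith)
    rw [Real.rpow_neg_one] at this
    linarith
  -- The summand 1 / a serves Θ; 1 / (1 - a) serves the logarithm near 0 and the integral in `base`;
  -- 8 + 24 = 4 * 8 serves 1 + |log t| ≤ 4 on [1, 8], where 1 ≤ 8 t ^ (a - 1).
  refine ⟨8 + 24 + 1 / a + 1 / (1 - a), ha, ha1.le, by linarith, fun t ht => Real.rpow_pos_of_pos ht _,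
    Real.zero_rpow ha.ne', Real.continuousAt_rpow_const _ _ (Or.inr ha.le),
    fun s t hs hst => Real.rpow_le_rpow hs hst ha.le, ?_, ?_, ?_, fun _ _ _ => le_rfl, ?_, ?_, ?_, ?_,
    ?_, ?_, ?_, ?_, ?_⟩
  · intro c t hc ht
    rw [Real.mul_rpow (by linarith) ht]
    have : c ^ a ≤ c ^ (1 : ℝ) := Real.rpow_le_rpow_of_exponent_le hc ha1.le
    rw [Real.rpow_one] at this
    gcongr
  · intro t ht ht8
    have := e8 t ht ht8
    have h2 : t * 1 ≤ t * (8 * t ^ (a - 1)) := by gcongr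
    have h3 : t ≤ 8 * t ^ a := by rw [← e1 t ht]; linarith
    have := Real.rpow_pos_of_pos ht a
    nlinarith
  · exact fun s t hs hst => Real.rpow_le_rpow_of_nonpos hs hst (by linarith)
  · intro t ht ht8
    have h1 := e8 t ht ht8
    have hp := Real.rpow_pos_of_pos ht (a - 1)
    rcases le_total t 1 with h | h
    · have h2 := Real.abs_log_mul_self_rpow_lt t (1 - a) ht h h1a
      have h3 : |Real.log t| = |Real.log t * t ^ (1 - a)| * t ^ (a - 1) := by
        rw [abs_mul, abs_of_pos (Real.rpow_pos_of_pos ht _), mul_assoc, ← Real.rpow_add ht]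
        simp
      have h4 : |Real.log t| ≤ 1 / (1 - a) * t ^ (a - 1) := by
        rw [h3]; gcongr
      nlinarith
    · have h2 : |Real.log t| ≤ 3 := by
        rw [abs_of_nonneg (Real.log_nonneg h)]
        have h3 : Real.log t ≤ Real.log 8 := Real.log_le_log ht ht8
        have h4 : Real.log 8 = 3 * Real.log 2 := by
          rw [show (8 : ℝ) = 2 ^ 3 by norm_num, Real.log_pow]; norm_num
        have := Real.log_two_lt_d9
        linarith
      nlinarith
  · intro t ht _
    have := Real.rpow_pos_of_pos ht a
    rw [e1 t ht]
    nlinarith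
  · intro t ht
    have := (Real.hasDerivAt_rpow_const (x := t) (p := a) (Or.inl ht.ne')).div_const a
    exact this.congr_deriv (by field_simp)
  · exact (Real.continuous_rpow_const ha.le).div_const a
  · simp [Real.zero_rpow ha.ne']
  · intro s t hs ht
    rw [← add_div]
    gcongr
    exact Real.rpow_add_le_add_rpow hs.le ht.le ha.le ha1.le
  · intro t ht _
    have := Real.rpow_pos_of_pos ht a
    have h2 : t ^ a / a = 1 / a * t ^ a := by ring
    simp only [h2]
    gcongr
    linarith
  · intro t ht _
    have := Real.rpow_pos_of_pos ht a
    nlinarith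
  · intro t ht ht1
    have := Real.rpow_pos_of_pos ht a
    rw [integral_rpow_sub_two ht ht1 ha1.ne]
    have h2 : t * ((1 - t ^ (a - 1)) / (a - 1)) = 1 / (1 - a) * (t ^ a - t) := by
      rw [← e1 t ht]
      have : a - 1 ≠ 0 := by linarith
      field_simp
      ring
    rw [h2]
    have h3 : 1 / (1 - a) * (t ^ a - t) ≤ 1 / (1 - a) * t ^ a := by gcongr; linarith
    nlinarith

lemma etaMod_of_le {t : ℝ} (h : t ≤ Real.exp (-1)) : etaMod t = -t * Real.log t := if_pos h

lemma etaMod_of_ge {t : ℝ} (h : Real.exp (-1) ≤ t) : etaMod t = Real.exp (-1) := by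
  rcases h.eq_or_lt with rfl | h
  · rw [etaMod_of_le le_rfl, Real.log_exp]; ring
  · exact if_neg (not_le.2 h)

lemma log_le_neg_one {t : ℝ} (ht : 0 < t) (h : t ≤ Real.exp (-1)) : Real.log t ≤ -1 := by
  have := Real.log_le_log ht h
  rwa [Real.log_exp] at this

lemma exp_neg_one_ge : (1 : ℝ) / 3 ≤ Real.exp (-1) := by
  rw [Real.exp_neg, one_div]
  have := Real.exp_one_lt_d9
  gcongr
  linarith

/-- The modulus `η`. -/
lemma goodMod_eta :
    ∃ K, GoodMod 1 etaMod (fun t => 7 - Real.log t) (fun t => t * (8 - Real.log t)) K := by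
  -- The shift 7 keeps ρ = 7 - log t at least 4 on (0, 8], since log 8 ≤ 3, and t (8 - log t) is its
  -- primitive vanishing at 0.
  have e3 := exp_neg_one_ge
  have e4 : Real.exp (-1) < 1 := by rw [Real.exp_lt_one_iff]; norm_num
  have l8 : ∀ t : ℝ, 0 < t → t ≤ 8 → Real.log t ≤ 3 := by
    intro t ht ht8
    have h3 : Real.log t ≤ Real.log 8 := Real.log_le_log ht ht8
    have h4 : Real.log 8 = 3 * Real.log 2 := by
      rw [show (8 : ℝ) = 2 ^ 3 by norm_num, Real.log_pow]; norm_num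
    have := Real.log_two_lt_d9
    linarith
  have le_eta : ∀ t, 0 < t → t ≤ 8 → t ≤ 24 * etaMod t := by
    intro t ht ht8
    rcases le_total t (Real.exp (-1)) with h | h
    · rw [etaMod_of_le h]
      nlinarith [log_le_neg_one ht h]
    · rw [etaMod_of_ge h]; linarith
  have log_eta : ∀ t, 0 < t → t ≤ 8 → -t * Real.log t ≤ etaMod t := by
    intro t ht ht8
    rcases le_total t (Real.exp (-1)) with h | h
    · rw [etaMod_of_le h]
    · rw [etaMod_of_ge h]
      -- The inequality x + 1 ≤ e ^ x at x = -1 - log t reads -t log t ≤ 1 / e.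
      have h1 := Real.add_one_le_exp (-1 - Real.log t)
      have h2 : Real.exp (-1 - Real.log t) = Real.exp (-1) / t := by
        rw [Real.exp_sub, Real.exp_log ht]
      rw [h2, le_div_iff₀ ht] at h1
      nlinarith
  have eta_pos : ∀ t, 0 < t → 0 < etaMod t := by
    intro t ht
    rcases le_total t (Real.exp (-1)) with h | h
    · rw [etaMod_of_le h]
      nlinarith [log_le_neg_one ht h]
    · rw [etaMod_of_ge h]; exact Real.exp_pos _
  have eta_le : ∀ t, 0 ≤ t → etaMod t ≤ Real.exp (-1) := by
    intro t ht
    rcases le_total t (Real.exp (-1)) with h | h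
    · rcases ht.eq_or_lt with rfl | ht
      · rw [etaMod_of_le h]; simpa using (Real.exp_pos _).le
      rw [etaMod_of_le h]
      have h1 := Real.add_one_le_exp (-1 - Real.log t)
      have h2 : Real.exp (-1 - Real.log t) = Real.exp (-1) / t := by
        rw [Real.exp_sub, Real.exp_log ht]
      rw [h2, le_div_iff₀ ht] at h1
      nlinarith
    · rw [etaMod_of_ge h]
  have hcont : Continuous fun t : ℝ => t * Real.log t := Real.continuous_mul_log
  refine ⟨300, one_pos, le_rfl, by norm_num, eta_pos, ?_, ?_, ?_, ?_, ?_, ?_, ?_, ?_, ?_, ?_, ?_, ?_, ?_,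
    ?_, ?_, ?_⟩
  · rw [etaMod_of_le (Real.exp_pos _).le]; simp
  · have h1 : ContinuousAt (fun t : ℝ => -(t * Real.log t)) 0 := hcont.neg.continuousAt
    refine h1.congr ?_
    filter_upwards [Iio_mem_nhds (Real.exp_pos (-1))] with t ht
    rw [etaMod_of_le (le_of_lt ht)]; ring
  · intro s t hs hst
    rcases le_total t (Real.exp (-1)) with h | h
    · rcases hs.eq_or_lt with rfl | hs
      · rcases hst.eq_or_lt with rfl | ht
        · exact le_rfl
        · rw [etaMod_of_le (Real.exp_pos _).le]; simpa using (eta_pos t ht).le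
      have ht := hs.trans_le hst
      rw [etaMod_of_le h, etaMod_of_le (hst.trans h)]
      -- This gives s (log t - log s) ≤ t - s, and log t ≤ -1 bounds t - s by -(t - s) log t; adding
      -- -s log t yields monotonicity.
      have h1 := Real.add_one_le_exp (Real.log t - Real.log s)
      rw [Real.exp_sub, Real.exp_log ht, Real.exp_log hs, le_div_iff₀ hs] at h1
      have := log_le_neg_one ht h
      nlinarith
    · rw [etaMod_of_ge h]; exact eta_le s hs
  · intro c t hc ht
    rcases ht.eq_or_lt with rfl | ht
    · rw [mul_zero, etaMod_of_le (Real.exp_pos _).le]; simp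
    have hct : t ≤ c * t := le_mul_of_one_le_left ht.le hc
    rcases le_total (c * t) (Real.exp (-1)) with h | h
    · rw [etaMod_of_le h, etaMod_of_le (hct.trans h)]
      have := Real.log_le_log ht hct
      have h0 : 0 < c * t := by positivity
      nlinarith
    · rw [etaMod_of_ge h]
      rcases le_total t (Real.exp (-1)) with h' | h'
      · rw [etaMod_of_le h']
        have := log_le_neg_one ht h'
        nlinarith
      · rw [etaMod_of_ge h']; nlinarith
  · intro t ht ht8
    have := le_eta t ht ht8
    have := eta_pos t ht
    linarith
  · intro s t hs hst
    have := Real.log_le_log hs hst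
    linarith
  · intro t ht ht8
    have := l8 t ht ht8
    simp only [sub_self, Real.rpow_zero]
    linarith
  · intro t ht ht8
    have := l8 t ht ht8
    rcases abs_cases (Real.log t) with h | h <;> linarith
  · intro t ht ht8
    have := le_eta t ht ht8
    have := log_eta t ht ht8
    nlinarith
  · intro t ht
    have h1 := (hasDerivAt_id t).mul ((Real.hasDerivAt_log ht.ne').const_sub 8)
    refine h1.congr_deriv ?_
    simp only [id]
    field_simp
    ring
  · have : (fun t : ℝ => t * (8 - Real.log t)) = fun t => t * 8 - t * Real.log t := by
      ext t; ring
    rw [this]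
    exact (continuous_id.mul continuous_const).sub hcont
  · simp
  · intro s t hs ht
    have h1 := Real.log_le_log hs (by linarith : s ≤ s + t)
    have h2 := Real.log_le_log ht (by linarith : t ≤ s + t)
    nlinarith
  · intro t ht ht8
    have := le_eta t ht ht8
    have := log_eta t ht ht8
    nlinarith
  · intro t ht ht8
    have := le_eta t ht ht8
    have := eta_pos t ht
    rw [Real.rpow_one]
    linarith
  · intro t ht ht1
    have h1 : ∫ v in t..1, v ^ ((1 : ℝ) - 2) = -Real.log t := by
      have : (1 : ℝ) - 2 = -1 := by norm_num
      simp only [this, Real.rpow_neg_one]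
      rw [integral_inv]
      · simp
      · rw [uIcc_of_le ht1]; exact fun h => absurd h.1 (not_le.2 ht)
    rw [h1]
    have := log_eta t ht (by linarith)
    have := eta_pos t ht
    linarith

variable {a K : ℝ} {w ρ Θ : ℝ → ℝ}

/-- Modulus of continuity on an interval not containing the singular point in its interior. -/
lemma GoodMod.one_sided (h : GoodMod a w ρ Θ K) {M L t₀ : ℝ} (hL : 0 ≤ L) (hL8 : L ≤ 8)
    (ht₀ : t₀ ≤ 0) {ψ ψ' : ℝ → ℂ} (hψ : ContinuousOn ψ (Icc 0 L)) (hM : 0 ≤ M)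
    (hd : ∀ t ∈ Ioo 0 L, HasDerivAt ψ (ψ' t) t) (hb : ∀ t ∈ Ioo 0 L, ‖ψ' t‖ ≤ M * ρ (t - t₀)) :
    ‖ψ L - ψ 0‖ ≤ M * Θ L := by
  rcases hL.eq_or_lt with rfl | hL
  · simp [h.theta_zero]
  have hmain : ‖ψ L - ψ 0‖ ≤ M * Θ (L - t₀) - M * Θ (0 - t₀) := by
    -- The derivative bound may blow up at 0 (when t₀ = 0), so the comparison is made on [ε, L] and
    -- ε tends to 0.
    have hlim : ∀ ε ∈ Ioo 0 L, ‖ψ L - ψ ε‖ ≤ M * Θ (L - t₀) - M * Θ (ε - t₀) := by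
      intro ε hε
      have hsub : Icc ε L ⊆ Icc 0 L := Icc_subset_Icc_left hε.1.le
      have h1 := image_norm_le_of_norm_deriv_right_le_deriv_boundary' (f := fun t => ψ t - ψ ε)
        (f' := ψ') (a := ε) (b := L) (B := fun t => M * Θ (t - t₀) - M * Θ (ε - t₀))
        (B' := fun t => M * ρ (t - t₀)) ((hψ.mono hsub).sub continuousOn_const) ?_ (by simp) ?_ ?_ ?_
        (right_mem_Icc.2 hε.2.le)
      · exact h1
      · intro t ht
        have hd' : HasDerivAt (fun t => ψ t - ψ ε) (ψ' t) t :=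
          (hd t ⟨hε.1.trans_le ht.1, ht.2⟩).sub_const _
        exact hd'.hasDerivWithinAt
      · exact ((continuous_const.mul (h.theta_cont.comp (continuous_id.sub continuous_const))).sub
          continuous_const).continuousOn
      · intro t ht
        have hp : 0 < t - t₀ := by have := hε.1.trans_le ht.1; linarith
        have h2 : HasDerivAt (fun t => Θ (t - t₀)) (ρ (t - t₀)) t := by
          simpa using (h.theta_deriv _ hp).comp_sub_const t t₀
        exact ((h2.const_mul M).sub_const _).hasDerivWithinAt
      · exact fun t ht => hb t ⟨hε.1.trans_le ht.1, ht.2⟩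
    have hT1 : Tendsto (fun ε => ‖ψ L - ψ ε‖) (𝓝[Ioo 0 L] 0) (𝓝 ‖ψ L - ψ 0‖) :=
      (tendsto_const_nhds.sub ((hψ 0 (left_mem_Icc.2 hL.le)).mono Ioo_subset_Icc_self)).norm
    have hT2 : Tendsto (fun ε => M * Θ (L - t₀) - M * Θ (ε - t₀)) (𝓝[Ioo 0 L] 0)
        (𝓝 (M * Θ (L - t₀) - M * Θ (0 - t₀))) :=
      ((continuous_const.sub (continuous_const.mul (h.theta_cont.comp
        (continuous_id.sub continuous_const)))).tendsto (0 : ℝ)).mono_left nhdsWithin_le_nhds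
    have : (𝓝[Ioo 0 L] (0 : ℝ)).NeBot := by
      rw [nhdsWithin_Ioo_eq_nhdsGT hL]; infer_instance
    exact le_of_tendsto_of_tendsto hT1 hT2 (eventually_mem_nhdsWithin.mono hlim)
  refine hmain.trans ?_
  rcases ht₀.eq_or_lt with rfl | ht
  · simp [h.theta_zero]
  -- Subadditivity of Θ makes the estimate independent of the position of the singular point.
  · have := h.theta_sub (0 - t₀) L (by linarith) hL
    rw [show 0 - t₀ + L = L - t₀ by ring] at this
    nlinarith

/-- Modulus of continuity of a function of one variable whose derivative is controlled by `ρ`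
of the distance to a singular point. -/
lemma GoodMod.one_dim (h : GoodMod a w ρ Θ K) {M L t₀ : ℝ} (hL : 0 ≤ L) (hL8 : L ≤ 8)
    {ψ ψ' : ℝ → ℂ} (hψ : ContinuousOn ψ (Icc 0 L)) (hM : 0 ≤ M)
    (hd : ∀ t ∈ Ioo 0 L, t ≠ t₀ → HasDerivAt ψ (ψ' t) t)
    (hb : ∀ t ∈ Ioo 0 L, t ≠ t₀ → ‖ψ' t‖ ≤ M * ρ |t - t₀|) :
    ‖ψ L - ψ 0‖ ≤ 2 * K * M * w L := by
  rcases hL.eq_or_lt with rfl | hL'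
  · simp [h.w_zero]
  have hKw : ∀ c, 0 ≤ c → c ≤ L → M * Θ c ≤ K * M * w L := by
    intro c hc hcL
    rcases hc.eq_or_lt with rfl | hc
    · rw [h.theta_zero, mul_zero]
      have := h.w_nonneg hL
      have := h.one_le
      positivity
    have h1 := h.theta_le c hc (hcL.trans hL8)
    have h2 := h.w_mono c L hc.le hcL
    have h3 := h.one_le
    calc M * Θ c ≤ M * (K * w c) := by gcongr
      _ ≤ M * (K * w L) := by gcongr
      _ = _ := by ring
  have hw0 : 0 ≤ K * M * w L := by
    have := h.w_nonneg hL
    have := h.one_le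
    positivity
  rcases le_or_gt t₀ 0 with h0 | h0
  · have := h.one_sided hL hL8 h0 hψ hM (fun t ht => hd t ht (by have := ht.1; linarith))
      (fun t ht => by
        have h1 := hb t ht (by have := ht.1; linarith)
        rwa [abs_of_pos (by have := ht.1; linarith)] at h1)
    have := hKw L hL le_rfl
    linarith
  -- The reflection t ↦ c - t moves a singular point on the right of [0, c] to the left.
  have hrev : ∀ c, 0 ≤ c → c ≤ L → c ≤ t₀ → ‖ψ c - ψ 0‖ ≤ M * Θ c := by
    intro c hc hcL hct
    have hmaps : MapsTo (fun t => c - t) (Icc 0 c) (Icc 0 L) := fun t ht =>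
      ⟨by have := ht.2; simp only; linarith, by have := ht.1; simp only; linarith⟩
    have := h.one_sided (ψ := fun t => ψ (c - t)) (ψ' := fun t => -ψ' (c - t)) (t₀ := c - t₀) hc
      (hcL.trans hL8) (by linarith) (hψ.comp (by fun_prop) hmaps) hM (fun t ht => ?_) (fun t ht => ?_)
    · simp only [sub_self, sub_zero] at this
      rwa [norm_sub_rev]
    · have h1 := hd (c - t) ⟨by linarith [ht.2], by linarith [ht.1]⟩ (by linarith [ht.1])
      have h2 := HasDerivAt.scomp t h1 ((hasDerivAt_id t).const_sub c)
      rw [neg_one_smul] at h2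
      exact h2
    · have h1 := hb (c - t) ⟨by linarith [ht.2], by linarith [ht.1]⟩ (by linarith [ht.1])
      rw [norm_neg]
      rwa [abs_of_neg (by linarith [ht.1]), show -(c - t - t₀) = t - (c - t₀) by ring] at h1
  rcases le_or_gt L t₀ with hLt | hLt
  · have := hrev L hL le_rfl hLt
    have := hKw L hL le_rfl
    linarith
  -- A singular point inside the interval splits it into two one-sided pieces; this is the origin of
  -- the factor 2.
  · have h1 := hrev t₀ h0.le hLt.le le_rfl
    have hmaps : MapsTo (fun t => t₀ + t) (Icc 0 (L - t₀)) (Icc 0 L) := fun t ht =>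
      ⟨by have := ht.1; simp only; linarith, by have := ht.2; simp only; linarith⟩
    have h2 := h.one_sided (ψ := fun t => ψ (t₀ + t)) (ψ' := fun t => ψ' (t₀ + t)) (t₀ := 0)
      (L := L - t₀) (by linarith) (by linarith) le_rfl (hψ.comp (by fun_prop) hmaps) hM
      (fun t ht => ?_) (fun t ht => ?_)
    · simp only [add_sub_cancel, add_zero] at h2
      have h3 := hKw t₀ h0.le hLt.le
      have h4 := hKw (L - t₀) (by linarith) (by linarith)
      calc ‖ψ L - ψ 0‖ = ‖(ψ L - ψ t₀) + (ψ t₀ - ψ 0)‖ := by congr 1; ring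
        _ ≤ _ := norm_add_le _ _
        _ ≤ _ := by linarith
    · have h3 := hd (t₀ + t) ⟨by linarith [ht.1], by linarith [ht.2]⟩ (by linarith [ht.1])
      simpa using HasDerivAt.comp_const_add t₀ t h3
    · have h3 := hb (t₀ + t) ⟨by linarith [ht.1], by linarith [ht.2]⟩ (by linarith [ht.1])
      simpa [abs_of_pos ht.1] using h3

end SaddleSector

/-! ### Regularity from symbol bounds, and composition with the power map -/

namespace SaddleSector

open Set Filter Topology

lemma HasD.of_diff_singleton {g : ℂ → ℂ} {a b x z : ℂ} {A : Set ℂ} (h : HasD g a b (A \ {z}) x)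
    (hx : x ≠ z) : HasD g a b A x := by
  refine HasFDerivWithinAt.mono_of_mem_nhdsWithin h ?_
  rw [sdiff_eq]
  exact inter_mem self_mem_nhdsWithin (mem_nhdsWithin_of_mem_nhds (isOpen_compl_singleton.mem_nhds hx))

/-- The bound says g(x) = o(|x|). It identifies the derivative at the origin as 0, where symbol
estimates say nothing. -/
lemma HasD.zero_of_le {g : ℂ → ℂ} {A : Set ℂ} {v : ℝ → ℝ} (hv : ContinuousAt v 0) (hv0 : v 0 = 0)
    (h0 : g 0 = 0) (hg : ∀ x ∈ A, ‖g x‖ ≤ ‖x‖ * v ‖x‖) : HasD g 0 0 A 0 := by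
  have h1 : HasFDerivWithinAt g (wirt 0 0) A 0 := by
    rw [hasFDerivWithinAt_iff_isLittleO, Asymptotics.isLittleO_iff]
    intro c hc
    have h2 : Tendsto (fun x : ℂ => v ‖x‖) (𝓝 0) (𝓝 0) := by
      have : Tendsto v (𝓝 ‖(0 : ℂ)‖) (𝓝 0) := by
        rw [norm_zero]; nth_rewrite 2 [← hv0]; exact hv
      exact this.comp continuous_norm.continuousAt
    filter_upwards [self_mem_nhdsWithin, mem_nhdsWithin_of_mem_nhds (h2.eventually (gt_mem_nhds hc))]
      with x hx hxc
    simp only [h0, sub_zero, wirt_apply, zero_mul, add_zero]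
    rw [mul_comm]
    exact (hg x hx).trans (by gcongr)
  exact h1

namespace GoodMod

variable {a K : ℝ} {w ρ Θ : ℝ → ℝ}

lemma continuousOn_of_le (h : GoodMod a w ρ Θ K) {A : Set ℂ} {M : ℝ} {g : ℂ → ℂ}
    (hg : ∀ x ∈ A, ∀ y ∈ A, ‖g x - g y‖ ≤ M * w (dist x y)) : ContinuousOn g A := by
  intro x hx
  rw [ContinuousWithinAt, tendsto_iff_norm_sub_tendsto_zero]
  have h2 : Tendsto (fun y : ℂ => M * w (dist y x)) (𝓝[A] x) (𝓝 0) := by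
    have h3 : Tendsto w (𝓝 (dist x x)) (𝓝 0) := by
      rw [dist_self]; nth_rewrite 2 [← h.w_zero]; exact h.w_cont
    have h4 : Tendsto (fun y : ℂ => dist y x) (𝓝[A] x) (𝓝 (dist x x)) :=
      ((continuous_id.dist continuous_const).tendsto x).mono_left nhdsWithin_le_nhds
    simpa using (h3.comp h4).const_mul M
  refine squeeze_zero' (Eventually.of_forall fun _ => norm_nonneg _) ?_ h2
  filter_upwards [self_mem_nhdsWithin] with y hy using hg y hy x hx

/-- Regularity of a function which, together with its derivatives, is small at the origin. -/
lemma reg_of_sym (h : GoodMod a w ρ Θ K) {A : Set ℂ} (hA : Convex ℝ A)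
    (hA4 : A ⊆ Metric.closedBall 0 4) (N : ℕ) {M : ℝ} (hM : 0 ≤ M) {g : ℂ → ℂ} (hg0 : g 0 = 0)
    (hg : Sym (N + 1) (fun x => M * (‖x‖ ^ (N + 1) * ρ ‖x‖)) (A \ {0}) g) :
    Reg N w A (M * (4 ^ N * K * (w 4 + 4))) g := by
  have hK := h.one_le
  have hw4 := h.w_nonneg (show (0 : ℝ) ≤ 4 by norm_num)
  have hx4 : ∀ x ∈ A, ‖x‖ ≤ 4 := fun x hx => by simpa using hA4 hx
  have bound : ∀ (N : ℕ) (g : ℂ → ℂ), g 0 = 0 → (∀ x ∈ A \ {0}, ‖g x‖ ≤ M * (‖x‖ ^ (N + 1) * ρ ‖x‖)) →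
      ∀ x ∈ A, ‖g x‖ ≤ ‖x‖ ^ N * (M * K * w ‖x‖) := by
    intro N g hg0 hg x hx
    by_cases hx0 : x = 0
    · subst hx0
      rw [hg0, norm_zero]
      have := h.w_nonneg (le_refl 0)
      positivity
    · refine (hg x ⟨hx, hx0⟩).trans ?_
      have h1 := h.mul_rho_le ‖x‖ (norm_pos_iff.2 hx0) ((hx4 x hx).trans (by norm_num))
      calc M * (‖x‖ ^ (N + 1) * ρ ‖x‖) = ‖x‖ ^ N * (M * (‖x‖ * ρ ‖x‖)) := by ring
        _ ≤ ‖x‖ ^ N * (M * (K * w ‖x‖)) := by gcongr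
        _ = _ := by ring
  have bound' : ∀ (N : ℕ) (g : ℂ → ℂ), g 0 = 0 → (∀ x ∈ A \ {0}, ‖g x‖ ≤ M * (‖x‖ ^ (N + 1) * ρ ‖x‖)) →
      ∀ x ∈ A, ‖g x‖ ≤ M * (4 ^ N * K * (w 4 + 4)) := by
    intro N g hg0 hg x hx
    refine (bound N g hg0 hg x hx).trans ?_
    have h1 := h.w_mono ‖x‖ 4 (norm_nonneg _) (hx4 x hx)
    have h2 := h.w_nonneg (norm_nonneg x)
    calc ‖x‖ ^ N * (M * K * w ‖x‖) ≤ 4 ^ N * (M * K * (w 4 + 4)) := by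
          gcongr
          · exact hx4 x hx
          · linarith
      _ = _ := by ring
  induction N generalizing g with
  | zero =>
    refine ⟨bound' 0 g hg0 hg.bound, ?_⟩
    have hcont : ContinuousOn g A := by
      intro x hx
      by_cases hx0 : x = 0
      · subst hx0
        have h1 := bound 0 g hg0 hg.bound
        rw [ContinuousWithinAt, hg0]
        refine squeeze_zero_norm' (a := fun x => ‖x‖ ^ 0 * (M * K * w ‖x‖)) ?_ ?_
        · filter_upwards [self_mem_nhdsWithin] with x hx using h1 x hx
        · have h3 : Tendsto w (𝓝 ‖(0 : ℂ)‖) (𝓝 0) := by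
            rw [norm_zero]; nth_rewrite 2 [← h.w_zero]; exact h.w_cont
          have h4 : Tendsto (fun x : ℂ => w ‖x‖) (𝓝[A] 0) (𝓝 0) :=
            (h3.comp continuous_norm.continuousAt).mono_left nhdsWithin_le_nhds
          simpa using h4.const_mul (M * K)
      · obtain ⟨-, a', b', hd, -, -⟩ := hg
        exact ((hd x ⟨hx, hx0⟩).of_diff_singleton hx0).continuousWithinAt
    obtain ⟨-, a', b', hd, ha, hb⟩ := hg
    -- The segment from x to y may run through the origin, where g is continuous but without
    -- derivative bound; `one_dim` tolerates one such parameter.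
    intro x hx y hy
    rcases eq_or_ne x y with rfl | hxy
    · simp [h.w_zero]
    set L := dist x y with hLdef
    have hL : 0 < L := dist_pos.2 hxy
    have hL8 : L ≤ 8 := by
      have := dist_triangle x 0 y
      have h1 := hx4 x hx
      have h2 := hx4 y hy
      rw [dist_zero_right, dist_zero_left] at this
      linarith
    set e : ℂ := (y - x) / L with he
    have hLC : (L : ℂ) ≠ 0 := by exact_mod_cast hL.ne'
    have hen : ‖e‖ = 1 := by
      rw [he, norm_div, Complex.norm_real, Real.norm_of_nonneg hL.le, ← dist_eq_norm, dist_comm]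
      exact div_self hL.ne'
    set γ : ℝ → ℂ := fun t => x + t * e with hγ
    have hγA : MapsTo γ (Icc 0 L) A := by
      intro t ht
      have : γ t = x + (t / L) • (y - x) := by
        simp only [hγ, he]; rw [Complex.real_smul]; push_cast; field_simp
      rw [this]
      exact hA.add_smul_sub_mem hx hy ⟨div_nonneg ht.1 hL.le, (div_le_one hL).2 ht.2⟩
    have hγd : ∀ t, HasDerivAt γ e t := by
      intro t
      have h1 : HasDerivAt (fun t : ℝ => (t : ℂ)) 1 t := Complex.ofRealCLM.hasDerivAt
      exact ((h1.mul_const e).const_add x).congr_deriv (by simp)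
    -- The parameter of the foot of the perpendicular from the origin to the line through x and y.
    -- Hence |t - t₀| ≤ ‖γ t‖, and since ρ is antitone the bound in ρ ‖γ t‖ becomes one in ρ |t -
    -- t₀|.
    set t₀ : ℝ := -(x * (starRingEnd ℂ) e).re with ht₀
    have hγt : ∀ t : ℝ, |t - t₀| ≤ ‖γ t‖ := by
      intro t
      have h1 : ‖γ t‖ = ‖γ t * (starRingEnd ℂ) e‖ := by rw [norm_mul, Complex.norm_conj, hen, mul_one]
      have h2 : (γ t * (starRingEnd ℂ) e).re = t - t₀ := by
        have h3 : e * (starRingEnd ℂ) e = 1 := by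
          rw [Complex.mul_conj, Complex.normSq_eq_norm_sq, hen]; simp
        simp only [hγ, add_mul, mul_assoc, h3, ht₀]
        simp; ring
      rw [h1, ← h2]
      exact Complex.abs_re_le_norm _
    have hmain := h.one_dim (ψ := fun t => g (γ t))
      (ψ' := fun t => a' (γ t) * e + b' (γ t) * (starRingEnd ℂ) e) (M := 2 * M) (t₀ := t₀) hL.le hL8
      (hcont.comp (by fun_prop) hγA) (by positivity) (fun t ht htt => ?_) (fun t ht htt => ?_)
    · have e0 : γ 0 = x := by simp [hγ]
      have e1 : γ L = y := by simp only [hγ, he]; field_simp; ring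
      rw [e0, e1, norm_sub_rev] at hmain
      refine hmain.trans (le_of_eq_of_le (by ring) (mul_le_mul_of_nonneg_right
        (show 4 * K * M ≤ M * (4 ^ 0 * K * (w 4 + 4)) from ?_) (h.w_nonneg hL.le)))
      have : 0 ≤ M * K * w 4 := by positivity
      nlinarith
    · have hne : γ t ≠ 0 := by
        rw [← norm_pos_iff]
        exact (abs_pos.2 (sub_ne_zero.2 htt)).trans_le (hγt t)
      have h1 := (hd (γ t) ⟨hγA (Ioo_subset_Icc_self ht), hne⟩).of_diff_singleton hne
      exact (h1.comp_curve (hγd t).hasDerivWithinAt hγA).hasDerivAt (Icc_mem_nhds ht.1 ht.2)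
    · have hpos : 0 < |t - t₀| := abs_pos.2 (sub_ne_zero.2 htt)
      have hne : γ t ≠ 0 := by
        rw [← norm_pos_iff]
        exact hpos.trans_le (hγt t)
      have hn : ‖γ t‖ ≠ 0 := norm_ne_zero_iff.2 hne
      have hmem : γ t ∈ A \ {0} := ⟨hγA (Ioo_subset_Icc_self ht), hne⟩
      have ha2 := ha.bound _ hmem
      have hb2 := hb.bound _ hmem
      have e2 : M * (‖γ t‖ ^ (0 + 1) * ρ ‖γ t‖) / ‖γ t‖ = M * ρ ‖γ t‖ := by
        field_simp
        ring
      simp only [e2] at ha2 hb2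
      have hr := h.rho_anti _ _ hpos (hγt t)
      calc ‖a' (γ t) * e + b' (γ t) * (starRingEnd ℂ) e‖ ≤ ‖a' (γ t)‖ + ‖b' (γ t)‖ := by
            refine (norm_add_le _ _).trans ?_
            simp [hen]
        _ ≤ 2 * M * ρ ‖γ t‖ := by linarith
        _ ≤ _ := by gcongr
  | succ N ih =>
    have hbd := bound' (N + 1) g hg0 hg.bound
    have hbd2 := bound (N + 1) g hg0 hg.bound
    obtain ⟨-, a', b', hd, ha, hb⟩ := hg
    -- The Wirtinger coefficients are prescribed only off the origin; giving them the value 0 there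
    -- makes them eligible for the induction hypothesis.
    have hcomp : ∀ a' : ℂ → ℂ, Sym (N + 1) (fun x => M * (‖x‖ ^ (N + 1 + 1) * ρ ‖x‖) / ‖x‖) (A \ {0}) a' →
        Reg N w A (M * (4 ^ (N + 1) * K * (w 4 + 4))) (Function.update a' 0 0) := by
      intro a' ha
      have h1 := ih (g := Function.update a' 0 0) (by simp)
        ((ha.congr fun x hx => Function.update_of_ne hx.2 _ _).mono_weight fun x hx => ?_)
      · refine h1.mono_const (fun t => h.w_nonneg) ?_
        gcongr <;> norm_num
      · have : ‖x‖ ≠ 0 := norm_ne_zero_iff.2 hx.2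
        apply le_of_eq
        field_simp
        ring
    refine ⟨hbd, Function.update a' 0 0, Function.update b' 0 0, ?_, hcomp a' ha, hcomp b' hb⟩
    intro x hx
    by_cases hx0 : x = 0
    · subst hx0
      simp only [Function.update_self]
      refine HasD.zero_of_le (v := fun t => 4 ^ N * (M * K * w t)) ?_ (by simp [h.w_zero]) hg0 ?_
      · exact continuousAt_const.mul (continuousAt_const.mul h.w_cont)
      · intro x hx
        refine (hbd2 x hx).trans ?_
        have h2 := h.w_nonneg (norm_nonneg x)
        rw [pow_succ, mul_comm (‖x‖ ^ N), mul_assoc]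
        gcongr
        exact hx4 x hx
    · rw [Function.update_of_ne hx0, Function.update_of_ne hx0]
      exact (hd x ⟨hx, hx0⟩).of_diff_singleton hx0

/-- On a convex set one derivative may be dropped. -/
lemma reg_pred (h : GoodMod a w ρ Θ K) {A : Set ℂ} (hA : Convex ℝ A)
    (hA4 : A ⊆ Metric.closedBall 0 4) {N : ℕ} {M : ℝ} (hM : 0 ≤ M) {g : ℂ → ℂ}
    (hg : Reg (N + 1) w A M g) : Reg N w A (2 * K * M) g := by
  have hK := h.one_le
  have hMM : M ≤ 2 * K * M := by nlinarith
  induction N generalizing g with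
  | zero =>
    obtain ⟨h0, a, b, hd, ha, hb⟩ := hg
    refine ⟨fun x hx => (h0 x hx).trans hMM, fun x hx y hy => ?_⟩
    rcases eq_or_ne x y with rfl | hxy
    · simp [h.w_zero]
    have h1 := hA.norm_image_sub_le_of_norm_hasFDerivWithin_le (f := g)
      (f' := fun x => wirt (a x) (b x)) (C := 2 * M) (fun x hx => hd x hx)
      (fun x hx => (norm_wirt_le _ _).trans (by linarith [ha.bound x hx, hb.bound x hx])) hy hx
    refine h1.trans ?_
    rw [← dist_eq_norm]
    have hd8 : dist x y ≤ 8 := by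
      have := dist_triangle x 0 y
      have h1 : ‖x‖ ≤ 4 := by simpa using hA4 hx
      have h2 : ‖y‖ ≤ 4 := by simpa using hA4 hy
      rw [dist_zero_right, dist_zero_left] at this
      linarith
    have := h.le_w _ (dist_pos.2 hxy) hd8
    calc 2 * M * dist x y ≤ 2 * M * (K * w (dist x y)) := by gcongr
      _ = _ := by ring
  | succ N ih =>
    obtain ⟨h0, a, b, hd, ha, hb⟩ := hg
    exact ⟨fun x hx => (h0 x hx).trans hMM, a, b, hd, ih ha, ih hb⟩

end GoodMod

lemma monomial_lipschitz (p q : ℕ) (R : ℝ) : ∃ C, 0 ≤ C ∧ ∀ x ∈ Metric.closedBall (0 : ℂ) R,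
    ∀ y ∈ Metric.closedBall (0 : ℂ) R,
    ‖x ^ p * (starRingEnd ℂ) x ^ q - y ^ p * (starRingEnd ℂ) y ^ q‖ ≤ C * ‖x - y‖ := by
  have hc : ContDiff ℝ 1 (fun x : ℂ => x ^ p * (starRingEnd ℂ) x ^ q) :=
    (contDiff_id.pow p).mul ((Complex.conjCLE : ℂ →L[ℝ] ℂ).contDiff.pow q)
  obtain ⟨C, hC⟩ := (isCompact_closedBall (0 : ℂ) R).exists_bound_of_continuousOn
    (hc.continuous_fderiv (by norm_num)).continuousOn
  refine ⟨max C 0, le_max_right _ _, fun x hx y hy => ?_⟩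
  exact (convex_closedBall (0 : ℂ) R).norm_image_sub_le_of_norm_hasFDerivWithin_le
    (f' := fun x => fderiv ℝ (fun x : ℂ => x ^ p * (starRingEnd ℂ) x ^ q) x)
    (fun x _ => (hc.differentiable (by norm_num) x).hasFDerivAt.hasFDerivWithinAt)
    (fun x hx => (hC x hx).trans (le_max_left _ _)) hy hx

lemma HasD.pow (p : ℕ) {A : Set ℂ} {x : ℂ} : HasD (fun y => y ^ p) (p * x ^ (p - 1)) 0 A x :=
  HasD.of_hasDerivAt (hasDerivAt_pow p x)

lemma HasD.monomial (p q : ℕ) {A : Set ℂ} {x : ℂ} :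
    HasD (fun y => y ^ p * (starRingEnd ℂ) y ^ q) (p * (x ^ (p - 1) * (starRingEnd ℂ) x ^ q))
      (q * (x ^ p * (starRingEnd ℂ) x ^ (q - 1))) A x := by
  have h := (HasD.pow p (A := A) (x := x)).mul (HasD.pow q (A := A) (x := x)).conj
  simp only [map_pow, map_mul, map_natCast, map_zero] at h
  exact h.cast (by ring) (by ring)

/-- Composition with the power map, times a monomial. -/
lemma GoodMod.reg_comp_pow {a K : ℝ} {w ρ Θ : ℝ → ℝ} (h : GoodMod a w ρ Θ K) {A H : Set ℂ}
    (hH : Convex ℝ H) (hH4 : H ⊆ Metric.closedBall 0 4) (hA2 : A ⊆ Metric.closedBall 0 2)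
    {c : ℂ} (hc : ‖c‖ = 1) (m : ℕ) (hmaps : MapsTo (fun x => c * x ^ m) A H) (N p q : ℕ) :
    ∃ C, 0 ≤ C ∧ ∀ (M : ℝ) (g : ℂ → ℂ), 0 ≤ M → Reg N w H M g →
      Reg N w A (C * M) (fun x => g (c * x ^ m) * (x ^ p * (starRingEnd ℂ) x ^ q)) := by
  have hK := h.one_le
  have hx2 : ∀ x ∈ A, ‖x‖ ≤ 2 := fun x hx => by simpa using hA2 hx
  have hbd : ∀ (p q : ℕ) (M : ℝ) (g : ℂ → ℂ), 0 ≤ M → (∀ x ∈ H, ‖g x‖ ≤ M) → ∀ x ∈ A,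
      ‖g (c * x ^ m) * (x ^ p * (starRingEnd ℂ) x ^ q)‖ ≤ 2 ^ p * 2 ^ q * M := by
    intro p q M g hM hg x hx
    have h1 := hg _ (hmaps hx)
    have h2 := hx2 x hx
    rw [norm_mul, norm_mul, norm_pow, norm_pow, Complex.norm_conj]
    calc _ ≤ M * (2 ^ p * 2 ^ q) := by gcongr
      _ = _ := by ring
  -- The exponents vary because the derivative of x ^ m brings out a factor x ^ (m - 1) or its
  -- conjugate, which is merged into the monomial.
  induction N generalizing p q with
  | zero =>
    obtain ⟨C₁, hC₁, hl₁⟩ := monomial_lipschitz p q 2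
    obtain ⟨C₂, hC₂, hl₂⟩ := monomial_lipschitz m 0 2
    refine ⟨2 ^ p * 2 ^ q * (C₂ + 1) + C₁ * K, by positivity, fun M g hM hg => ⟨fun x hx => ?_, ?_⟩⟩
    · refine (hbd p q M g hM hg.bound x hx).trans ?_
      have h1 : 0 ≤ 2 ^ p * 2 ^ q * C₂ * M := by positivity
      have h2 : 0 ≤ C₁ * K * M := by positivity
      nlinarith
    · intro x hx y hy
      rcases eq_or_ne x y with rfl | hxy
      · simp [h.w_zero]
      have hxy0 := dist_pos.2 hxy
      have hd8 : dist x y ≤ 8 := by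
        have := dist_triangle x 0 y
        rw [dist_zero_right, dist_zero_left] at this
        linarith [hx2 x hx, hx2 y hy]
      have e1 : g (c * x ^ m) * (x ^ p * (starRingEnd ℂ) x ^ q) -
          g (c * y ^ m) * (y ^ p * (starRingEnd ℂ) y ^ q) =
          (g (c * x ^ m) - g (c * y ^ m)) * (x ^ p * (starRingEnd ℂ) x ^ q) +
          g (c * y ^ m) * (x ^ p * (starRingEnd ℂ) x ^ q - y ^ p * (starRingEnd ℂ) y ^ q) := by ring
      have h1 : ‖g (c * x ^ m) - g (c * y ^ m)‖ ≤ M * ((C₂ + 1) * w (dist x y)) := by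
        refine (hg.2 _ (hmaps hx) _ (hmaps hy)).trans ?_
        refine mul_le_mul_of_nonneg_left ((h.w_mono _ ((C₂ + 1) * dist x y) dist_nonneg ?_).trans
          (h.w_scale _ _ (by linarith) dist_nonneg)) hM
        have h3 := hl₂ x (hA2 hx) y (hA2 hy)
        simp only [pow_zero, mul_one] at h3
        rw [dist_eq_norm, ← mul_sub, norm_mul, hc, one_mul, dist_eq_norm]
        nlinarith [norm_nonneg (x - y)]
      have h2 : ‖x ^ p * (starRingEnd ℂ) x ^ q‖ ≤ 2 ^ p * 2 ^ q := by
        rw [norm_mul, norm_pow, norm_pow, Complex.norm_conj]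
        have := hx2 x hx
        gcongr
      have h3 := hl₁ x (hA2 hx) y (hA2 hy)
      rw [← dist_eq_norm x y] at h3
      have h4 := h.le_w _ hxy0 hd8
      replace h3 := h3.trans (mul_le_mul_of_nonneg_left h4 hC₁)
      have h5 := hg.bound _ (hmaps hy)
      have h6 := h.w_nonneg hxy0.le
      rw [e1]
      refine (norm_add_le _ _).trans ?_
      rw [norm_mul (g _ - g _), norm_mul (g _)]
      calc _ ≤ M * ((C₂ + 1) * w (dist x y)) * (2 ^ p * 2 ^ q) + M * (C₁ * (K * w (dist x y))) :=
            add_le_add (mul_le_mul h1 h2 (norm_nonneg _) (by positivity))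
              (mul_le_mul h5 h3 (norm_nonneg _) hM)
        _ = _ := by ring
  | succ N ih =>
    -- The first two instances are used for the derivatives of g, the last two for g itself with one
    -- derivative dropped (`reg_pred`). The truncation in p - 1 and q - 1 is harmless, as these
    -- terms carry the factors p and q.
    obtain ⟨C₁, hC₁, h₁⟩ := ih (m - 1 + p) q
    obtain ⟨C₂, hC₂, h₂⟩ := ih p (m - 1 + q)
    obtain ⟨C₃, hC₃, h₃⟩ := ih (p - 1) q
    obtain ⟨C₄, hC₄, h₄⟩ := ih p (q - 1)
    refine ⟨2 ^ p * 2 ^ q + m * C₁ + m * C₂ + p * (C₃ * (2 * K)) + q * (C₄ * (2 * K)), by positivity,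
      fun M g hM hg => ?_⟩
    have hgp := h.reg_pred hH hH4 hM hg
    have n1 : 0 ≤ 2 ^ p * 2 ^ q * M := by positivity
    have n2 : 0 ≤ m * C₁ * M := by positivity
    have n3 : 0 ≤ m * C₂ * M := by positivity
    have n4 : 0 ≤ p * (C₃ * (2 * K)) * M := by positivity
    have n5 : 0 ≤ q * (C₄ * (2 * K)) * M := by positivity
    obtain ⟨h0, a', b', hd, ha, hb⟩ := hg
    refine ⟨fun x hx => (hbd p q M g hM h0 x hx).trans (by nlinarith),
      fun x => (c * m) * (a' (c * x ^ m) * (x ^ (m - 1 + p) * (starRingEnd ℂ) x ^ q)) +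
        p * (g (c * x ^ m) * (x ^ (p - 1) * (starRingEnd ℂ) x ^ q)),
      fun x => ((starRingEnd ℂ) c * m) *
        (b' (c * x ^ m) * (x ^ p * (starRingEnd ℂ) x ^ (m - 1 + q))) +
        q * (g (c * x ^ m) * (x ^ p * (starRingEnd ℂ) x ^ (q - 1))), fun x hx => ?_, ?_, ?_⟩
    · have hχ : HasD (fun x => c * x ^ m) (c * (m * x ^ (m - 1))) 0 A x :=
        ((HasD.pow m).const_mul c).cast rfl (mul_zero _)
      refine ((HasD.comp_holo (g := g) (χ := fun x => c * x ^ m) (hd _ (hmaps hx)) hχ hmaps).mul (HasD.monomial p q)).cast ?_ ?_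
      · simp only [pow_add]; ring
      · simp only [map_mul, map_pow, map_natCast, pow_add]
        ring
    · refine (((h₁ M a' hM ha).const_mul (c * m)).add ((h₃ _ g (by positivity) hgp).const_mul p)).mono_const
        (fun t => h.w_nonneg) ?_
      rw [norm_mul, hc, Complex.norm_natCast, Complex.norm_natCast]
      nlinarith
    · refine (((h₂ M b' hM hb).const_mul ((starRingEnd ℂ) c * m)).add
        ((h₄ _ g (by positivity) hgp).const_mul q)).mono_const (fun t => h.w_nonneg) ?_
      rw [norm_mul, Complex.norm_conj, hc, Complex.norm_natCast, Complex.norm_natCast]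
      nlinarith

end SaddleSector

/-! ### The half-square, integrable singularities and differentiability from increments -/

namespace SaddleSector

open Set Filter Topology MeasureTheory

/-- The closed upper half `[-1,1] × [0,1]` of the square. -/
def halfSq : Set ℂ := Icc (-1 : ℝ) 1 ×ℂ Icc (0 : ℝ) 1

lemma mem_halfSq {z : ℂ} : z ∈ halfSq ↔ z.re ∈ Icc (-1 : ℝ) 1 ∧ z.im ∈ Icc (0 : ℝ) 1 := Iff.rfl

lemma convex_halfSq : Convex ℝ halfSq :=
  ((convex_Icc (-1 : ℝ) 1).linear_preimage Complex.reLm).inter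
    ((convex_Icc (0 : ℝ) 1).linear_preimage Complex.imLm)

lemma norm_le_two_of_mem_halfSq {z : ℂ} (hz : z ∈ halfSq) : ‖z‖ ≤ 2 := by
  obtain ⟨⟨h1, h2⟩, h3, h4⟩ := mem_halfSq.1 hz
  have := Complex.norm_le_abs_re_add_abs_im z
  have h5 : |z.re| ≤ 1 := abs_le.2 ⟨h1, h2⟩
  have h6 : |z.im| ≤ 1 := abs_le.2 ⟨by linarith, h4⟩
  linarith

lemma halfSq_subset : halfSq ⊆ Metric.closedBall 0 4 := fun z hz => by
  have := norm_le_two_of_mem_halfSq hz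
  simp; linarith

/-- The integral of `φ` along the horizontal segment from `Re = b` to `z`. -/
noncomputable def horInt (b : ℝ) (φ : ℂ → ℂ) (z : ℂ) : ℂ := ∫ v in b..z.re, φ (⟨v, z.im⟩ : ℂ)

lemma hasDerivAt_vert (v t : ℝ) : HasDerivAt (fun t : ℝ => (⟨v, t⟩ : ℂ)) Complex.I t := by
  have h1 : HasDerivAt (fun t : ℝ => (t : ℂ)) 1 t := Complex.ofRealCLM.hasDerivAt
  have h2 := ((h1.mul_const Complex.I).const_add (v : ℂ)).congr_deriv (one_mul _)
  refine h2.congr_of_eventuallyEq (Eventually.of_forall fun t => ?_)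
  exact Complex.mk_eq_add_mul_I v t

lemma hasDerivAt_horiz (s t : ℝ) : HasDerivAt (fun t : ℝ => (⟨t, s⟩ : ℂ)) 1 t := by
  have h1 : HasDerivAt (fun t : ℝ => (t : ℂ)) 1 t := Complex.ofRealCLM.hasDerivAt
  refine (h1.add_const ((s : ℂ) * Complex.I)).congr_of_eventuallyEq (Eventually.of_forall fun t => ?_)
  exact Complex.mk_eq_add_mul_I t s

lemma continuous_vert (v : ℝ) : Continuous (fun t : ℝ => (⟨v, t⟩ : ℂ)) :=
  continuous_iff_continuousAt.2 fun t => (hasDerivAt_vert v t).continuousAt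

lemma continuous_horiz (s : ℝ) : Continuous (fun t : ℝ => (⟨t, s⟩ : ℂ)) :=
  continuous_iff_continuousAt.2 fun t => (hasDerivAt_horiz s t).continuousAt

lemma mk_ne_zero_of_left {v s : ℝ} (hv : v ≠ 0) : (⟨v, s⟩ : ℂ) ≠ 0 := fun h =>
  hv (by simpa using congrArg Complex.re h)

section abs_rpow

variable {a : ℝ}

lemma intervalIntegrable_abs_rpow (ha : 0 < a) (x y : ℝ) :
    IntervalIntegrable (fun v : ℝ => |v| ^ (a - 1)) volume x y := by
  have h0 : ∀ z : ℝ, 0 ≤ z → IntervalIntegrable (fun v : ℝ => |v| ^ (a - 1)) volume 0 z := by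
    intro z hz
    have h1 : IntervalIntegrable (fun v : ℝ => v ^ (a - 1)) volume 0 z :=
      intervalIntegral.intervalIntegrable_rpow' (by linarith)
    refine h1.congr fun v hv => ?_
    rw [uIoc_of_le hz] at hv
    simp only [abs_of_pos hv.1]
  have h1 : ∀ z : ℝ, IntervalIntegrable (fun v : ℝ => |v| ^ (a - 1)) volume 0 z := by
    intro z
    rcases le_total 0 z with hz | hz
    · exact h0 z hz
    · have := (IntervalIntegrable.iff_comp_neg (f := fun v : ℝ => |v| ^ (a - 1)) (a := 0) (b := -z)).1 (h0 (-z) (by linarith))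
      simpa using this
  exact (h1 x).symm.trans (h1 y)

/-- On one side of 0 this is the subadditivity of t ^ a; an interval containing 0 is cut there,
which gives 2 in place of 1. -/
lemma integral_abs_rpow_le (ha : 0 < a) (ha1 : a ≤ 1) {x y : ℝ} (hxy : x ≤ y) :
    ∫ v in x..y, |v| ^ (a - 1) ≤ 2 / a * (y - x) ^ a := by
  have hpos : ∀ x y : ℝ, 0 ≤ x → x ≤ y → ∫ v in x..y, |v| ^ (a - 1) ≤ 1 / a * (y - x) ^ a := by
    intro x y hx hxy
    have h1 : ∫ v in x..y, |v| ^ (a - 1) = ∫ v in x..y, v ^ (a - 1) := by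
      refine intervalIntegral.integral_congr fun v hv => ?_
      rw [uIcc_of_le hxy] at hv
      simp only [abs_of_nonneg (hx.trans hv.1)]
    rw [h1, integral_rpow (Or.inl (by linarith)), sub_add_cancel, div_eq_inv_mul, one_div]
    have := Real.rpow_add_le_add_rpow hx (sub_nonneg.2 hxy) ha.le ha1
    rw [add_sub_cancel] at this
    gcongr
    linarith
  have hneg : ∀ x y : ℝ, y ≤ 0 → x ≤ y → ∫ v in x..y, |v| ^ (a - 1) ≤ 1 / a * (y - x) ^ a := by
    intro x y hy hxy
    have h1 := hpos (-y) (-x) (by linarith) (by linarith)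
    rw [← intervalIntegral.integral_comp_neg] at h1
    simp only [abs_neg] at h1
    rwa [neg_sub_neg] at h1
  have h0 : 0 ≤ 1 / a * (y - x) ^ a := by
    have := Real.rpow_nonneg (sub_nonneg.2 hxy) a
    positivity
  have e2 : 2 / a * (y - x) ^ a = 1 / a * (y - x) ^ a + 1 / a * (y - x) ^ a := by ring
  rw [e2]
  rcases le_total 0 x with hx | hx
  · linarith [hpos x y hx hxy]
  rcases le_total y 0 with hy | hy
  · linarith [hneg x y hy hxy]
  rw [← intervalIntegral.integral_add_adjacent_intervals (intervalIntegrable_abs_rpow ha x 0)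
    (intervalIntegrable_abs_rpow ha 0 y)]
  have h3 : (0 - x) ^ a ≤ (y - x) ^ a := Real.rpow_le_rpow (by linarith) (by linarith) ha.le
  have h4 : (y - 0) ^ a ≤ (y - x) ^ a := Real.rpow_le_rpow (by linarith) (by linarith) ha.le
  have h5 := hneg x 0 le_rfl hx
  have h6 := hpos 0 y le_rfl hy
  have ha' : 0 ≤ 1 / a := by positivity
  exact add_le_add (h5.trans (mul_le_mul_of_nonneg_left h3 ha'))
    (h6.trans (mul_le_mul_of_nonneg_left h4 ha'))

lemma intervalIntegrable_of_le_abs_rpow (ha : 0 < a) {k : ℝ → ℂ} {C : ℝ}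
    (hk : ContinuousOn k (Icc (-1) 1 \ {0})) (hC : ∀ v ∈ Icc (-1 : ℝ) 1, v ≠ 0 → ‖k v‖ ≤ C * |v| ^ (a - 1))
    {x y : ℝ} (hx : x ∈ Icc (-1 : ℝ) 1) (hy : y ∈ Icc (-1 : ℝ) 1) : IntervalIntegrable k volume x y := by
  have hsub : uIoc x y ⊆ Icc (-1) 1 := uIoc_subset_uIcc.trans (uIcc_subset_Icc hx hy)
  have hae : ∀ᵐ v : ℝ, v ≠ 0 := by simp [ae_iff]
  refine ((intervalIntegrable_abs_rpow ha x y).const_mul C).mono_fun ?_ ?_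
  · have h1 : AEStronglyMeasurable k (volume.restrict (Icc (-1) 1 \ {0})) :=
      hk.aestronglyMeasurable (measurableSet_Icc.diff (measurableSet_singleton 0))
    have h2 : volume.restrict (Icc (-1 : ℝ) 1 \ {0}) = volume.restrict (Icc (-1) 1) :=
      Measure.restrict_congr_set (sdiff_null_ae_eq_self (by simp))
    rw [h2] at h1
    exact h1.mono_set hsub
  · filter_upwards [ae_restrict_mem measurableSet_uIoc, ae_restrict_of_ae hae] with v hv hv0
    exact (hC v (hsub hv) hv0).trans (le_abs_self _)

end abs_rpow

/-- A function whose increments are integrals of continuous functions along horizontal and vertical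
segments is differentiable. -/
lemma hasD_of_integral {g p q : ℂ → ℂ} (hp : ContinuousOn p halfSq) (hq : ContinuousOn q halfSq)
    {z₀ : ℂ} (hz₀ : z₀ ∈ halfSq)
    (hg : ∀ z ∈ halfSq, g z - g z₀ = (∫ v in z₀.re..z.re, p ⟨v, z.im⟩) +
      ∫ σ in z₀.im..z.im, q ⟨z₀.re, σ⟩) :
    HasD g ((p z₀ - Complex.I * q z₀) / 2) ((p z₀ + Complex.I * q z₀) / 2) halfSq z₀ := by
  have h1 : HasFDerivWithinAt g (wirt ((p z₀ - Complex.I * q z₀) / 2)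
      ((p z₀ + Complex.I * q z₀) / 2)) halfSq z₀ := by
    rw [hasFDerivWithinAt_iff_isLittleO, Asymptotics.isLittleO_iff]
    intro c hc
    obtain ⟨δ₁, hδ₁, h₁⟩ := Metric.continuousOn_iff.1 hp z₀ hz₀ (c / 2) (by linarith)
    obtain ⟨δ₂, hδ₂, h₂⟩ := Metric.continuousOn_iff.1 hq z₀ hz₀ (c / 2) (by linarith)
    filter_upwards [self_mem_nhdsWithin,
      mem_nhdsWithin_of_mem_nhds (Metric.ball_mem_nhds z₀ (lt_min hδ₁ hδ₂))] with z hz hzδ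
    rw [Metric.mem_ball, dist_eq_norm] at hzδ
    obtain ⟨hz1, hz2⟩ := mem_halfSq.1 hz
    obtain ⟨hz₀1, hz₀2⟩ := mem_halfSq.1 hz₀
    -- Both legs of the path from z₀ to z, vertical then horizontal, stay at distance at most ‖z -
    -- z₀‖ from z₀, so continuity of p and q at z₀ controls the integrands.
    have hin1 : ∀ v ∈ uIoc z₀.re z.re, (⟨v, z.im⟩ : ℂ) ∈ halfSq ∧ ‖(⟨v, z.im⟩ : ℂ) - z₀‖ ≤ ‖z - z₀‖ := by
      intro v hv
      have hv' : v ∈ uIcc z₀.re z.re := uIoc_subset_uIcc hv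
      refine ⟨mem_halfSq.2 ⟨uIcc_subset_Icc hz₀1 hz1 hv', hz2⟩, ?_⟩
      have h3 := abs_sub_left_of_mem_uIcc hv'
      rw [Complex.norm_eq_sqrt_sq_add_sq, Complex.norm_eq_sqrt_sq_add_sq]
      apply Real.sqrt_le_sqrt
      simp only [Complex.sub_re, Complex.sub_im]
      have := sq_le_sq.2 h3
      linarith
    have hin2 : ∀ σ ∈ uIoc z₀.im z.im,
        (⟨z₀.re, σ⟩ : ℂ) ∈ halfSq ∧ ‖(⟨z₀.re, σ⟩ : ℂ) - z₀‖ ≤ ‖z - z₀‖ := by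
      intro v hv
      have hv' : v ∈ uIcc z₀.im z.im := uIoc_subset_uIcc hv
      refine ⟨mem_halfSq.2 ⟨hz₀1, uIcc_subset_Icc hz₀2 hz2 hv'⟩, ?_⟩
      have h3 := abs_sub_left_of_mem_uIcc hv'
      rw [Complex.norm_eq_sqrt_sq_add_sq, Complex.norm_eq_sqrt_sq_add_sq]
      apply Real.sqrt_le_sqrt
      simp only [Complex.sub_re, Complex.sub_im, sub_self]
      have := sq_le_sq.2 h3
      have := sq_nonneg (z.re - z₀.re)
      linarith
    have hi1 : IntervalIntegrable (fun v => p ⟨v, z.im⟩) volume z₀.re z.re := by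
      refine ContinuousOn.intervalIntegrable (hp.comp (continuous_horiz _).continuousOn ?_)
      exact fun v hv => mem_halfSq.2 ⟨uIcc_subset_Icc hz₀1 hz1 hv, hz2⟩
    have hi2 : IntervalIntegrable (fun σ => q ⟨z₀.re, σ⟩) volume z₀.im z.im := by
      refine ContinuousOn.intervalIntegrable (hq.comp (continuous_vert _).continuousOn ?_)
      exact fun v hv => mem_halfSq.2 ⟨hz₀1, uIcc_subset_Icc hz₀2 hz2 hv⟩
    have e1 : g z - g z₀ - wirt ((p z₀ - Complex.I * q z₀) / 2) ((p z₀ + Complex.I * q z₀) / 2) (z - z₀) =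
        (∫ v in z₀.re..z.re, (p ⟨v, z.im⟩ - p z₀)) + ∫ σ in z₀.im..z.im, (q ⟨z₀.re, σ⟩ - q z₀) := by
      rw [intervalIntegral.integral_sub hi1 intervalIntegrable_const,
        intervalIntegral.integral_sub hi2 intervalIntegrable_const,
        intervalIntegral.integral_const, intervalIntegral.integral_const, hg z hz, wirt_apply]
      have e2 : z - z₀ = ((z.re - z₀.re : ℝ) : ℂ) + ((z.im - z₀.im : ℝ) : ℂ) * Complex.I := by
        apply Complex.ext <;> simp
      have e3 : (starRingEnd ℂ) (z - z₀) =
          ((z.re - z₀.re : ℝ) : ℂ) - ((z.im - z₀.im : ℝ) : ℂ) * Complex.I := by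
        apply Complex.ext
        · simp
        · simp; ring
      rw [e3, e2, Complex.real_smul, Complex.real_smul]
      linear_combination (q z₀ * ((z.im - z₀.im : ℝ) : ℂ)) * Complex.I_sq
    rw [e1]
    have b1 := intervalIntegral.norm_integral_le_of_norm_le_const (a := z₀.re) (b := z.re)
      (f := fun v => p ⟨v, z.im⟩ - p z₀) (C := c / 2) fun v hv => by
        have := h₁ _ (hin1 v hv).1 (by
          rw [dist_eq_norm]; exact ((hin1 v hv).2.trans_lt hzδ).trans_le (min_le_left _ _))
        rw [dist_eq_norm] at this
        exact this.le
    have b2 := intervalIntegral.norm_integral_le_of_norm_le_const (a := z₀.im) (b := z.im)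
      (f := fun σ => q ⟨z₀.re, σ⟩ - q z₀) (C := c / 2) fun v hv => by
        have := h₂ _ (hin2 v hv).1 (by
          rw [dist_eq_norm]; exact ((hin2 v hv).2.trans_lt hzδ).trans_le (min_le_right _ _))
        rw [dist_eq_norm] at this
        exact this.le
    have b3 := Complex.abs_re_le_norm (z - z₀)
    have b4 := Complex.abs_im_le_norm (z - z₀)
    rw [Complex.sub_re] at b3
    rw [Complex.sub_im] at b4
    refine (norm_add_le _ _).trans ?_
    nlinarith
  exact h1

end SaddleSector

/-! ### Regularity of horizontal integrals of singular symbols -/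

namespace SaddleSector

open Set Filter Topology MeasureTheory

section horInt

variable {a b C : ℝ} {φ : ℂ → ℂ}

lemma continuousOn_horiz_slice (hc : ContinuousOn φ (halfSq \ {0})) {s : ℝ} (hs : s ∈ Icc (0 : ℝ) 1) :
    ContinuousOn (fun v : ℝ => φ ⟨v, s⟩) (Icc (-1) 1 \ {0}) :=
  hc.comp (continuous_horiz s).continuousOn fun _ hv =>
    ⟨mem_halfSq.2 ⟨hv.1, hs⟩, mk_ne_zero_of_left hv.2⟩

lemma intervalIntegrable_horiz_slice (ha : 0 < a) (hc : ContinuousOn φ (halfSq \ {0}))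
    (hb : ∀ z ∈ halfSq, z.re ≠ 0 → ‖φ z‖ ≤ C * |z.re| ^ (a - 1)) {s : ℝ} (hs : s ∈ Icc (0 : ℝ) 1)
    {x y : ℝ} (hx : x ∈ Icc (-1 : ℝ) 1) (hy : y ∈ Icc (-1 : ℝ) 1) :
    IntervalIntegrable (fun v : ℝ => φ ⟨v, s⟩) volume x y :=
  intervalIntegrable_of_le_abs_rpow ha (continuousOn_horiz_slice hc hs)
    (fun v hv hv0 => hb ⟨v, s⟩ (mem_halfSq.2 ⟨hv, hs⟩) hv0) hx hy

lemma norm_integral_horiz_slice_le (ha : 0 < a) (ha1 : a ≤ 1) (hC : 0 ≤ C)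
    (hb : ∀ z ∈ halfSq, z.re ≠ 0 → ‖φ z‖ ≤ C * |z.re| ^ (a - 1)) {s : ℝ} (hs : s ∈ Icc (0 : ℝ) 1)
    {x y : ℝ} (hx : x ∈ Icc (-1 : ℝ) 1) (hy : y ∈ Icc (-1 : ℝ) 1) :
    ‖∫ v in x..y, φ ⟨v, s⟩‖ ≤ C * (2 / a * |y - x| ^ a) := by
  have main : ∀ x y : ℝ, x ∈ Icc (-1 : ℝ) 1 → y ∈ Icc (-1 : ℝ) 1 → x ≤ y →
      ‖∫ v in x..y, φ ⟨v, s⟩‖ ≤ C * (2 / a * |y - x| ^ a) := by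
    intro x y hx hy hxy
    have hae : ∀ᵐ v : ℝ, v ≠ 0 := by simp [ae_iff]
    have h1 := intervalIntegral.norm_integral_le_of_norm_le (f := fun v : ℝ => φ ⟨v, s⟩) hxy
      (g := fun v => C * |v| ^ (a - 1)) (by
        filter_upwards [hae] with v hv0 hv
        exact hb ⟨v, s⟩ (mem_halfSq.2 ⟨⟨hx.1.trans hv.1.le, hv.2.trans hy.2⟩, hs⟩) hv0)
      ((intervalIntegrable_abs_rpow ha x y).const_mul C)
    rw [intervalIntegral.integral_const_mul] at h1
    rw [abs_of_nonneg (sub_nonneg.2 hxy)]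
    exact h1.trans (mul_le_mul_of_nonneg_left (integral_abs_rpow_le ha ha1 hxy) hC)
  rcases le_total x y with h | h
  · exact main x y hx hy h
  · rw [intervalIntegral.integral_symm, norm_neg, abs_sub_comm]
    exact main y x hy hx h

lemma horInt_sub_re (ha : 0 < a) (hc : ContinuousOn φ (halfSq \ {0}))
    (hb : ∀ z ∈ halfSq, z.re ≠ 0 → ‖φ z‖ ≤ C * |z.re| ^ (a - 1)) (hbb : b ∈ Icc (-1 : ℝ) 1)
    {s : ℝ} (hs : s ∈ Icc (0 : ℝ) 1)
    {x y : ℝ} (hx : x ∈ Icc (-1 : ℝ) 1) (hy : y ∈ Icc (-1 : ℝ) 1) :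
    horInt b φ ⟨y, s⟩ - horInt b φ ⟨x, s⟩ = ∫ v in x..y, φ ⟨v, s⟩ := by
  unfold horInt
  exact intervalIntegral.integral_interval_sub_left
    (intervalIntegrable_horiz_slice ha hc hb hs hbb hy)
    (intervalIntegrable_horiz_slice ha hc hb hs hbb hx)

lemma norm_horInt_le (ha : 0 < a) (ha1 : a ≤ 1) (hC : 0 ≤ C)
    (hb : ∀ z ∈ halfSq, z.re ≠ 0 → ‖φ z‖ ≤ C * |z.re| ^ (a - 1)) (hbb : b ∈ Icc (-1 : ℝ) 1)
    {z : ℂ} (hz : z ∈ halfSq) : ‖horInt b φ z‖ ≤ C * (4 / a) := by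
  obtain ⟨h1, h2⟩ := mem_halfSq.1 hz
  refine (norm_integral_horiz_slice_le ha ha1 hC hb h2 hbb h1).trans ?_
  have h3 : |z.re - b| ≤ 2 := abs_le.2 ⟨by linarith [h1.1, hbb.2], by linarith [h1.2, hbb.1]⟩
  have h4 : |z.re - b| ^ a ≤ 2 := by
    calc |z.re - b| ^ a ≤ 2 ^ a := Real.rpow_le_rpow (abs_nonneg _) h3 ha.le
      _ ≤ 2 ^ (1 : ℝ) := Real.rpow_le_rpow_of_exponent_le (by norm_num) ha1
      _ = 2 := Real.rpow_one 2
  have e : (4 : ℝ) / a = 2 / a * 2 := by ring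
  rw [e]
  gcongr

/-- Modulus of continuity of a horizontal integral of a function with a singularity at `0`. -/
lemma GoodMod.horInt_sub_im_le {K : ℝ} {w ρ Θ : ℝ → ℝ} (h : GoodMod a w ρ Θ K) (hC : 0 ≤ C)
    (hc : ContinuousOn φ (halfSq \ {0}))
    (hb : ∀ z ∈ halfSq, z.re ≠ 0 → ‖φ z‖ ≤ C * |z.re| ^ (a - 1))
    (hv : ∀ v ∈ Icc (-1 : ℝ) 1, v ≠ 0 → ∀ s ∈ Icc (0 : ℝ) 1, ∀ s' ∈ Icc (0 : ℝ) 1,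
      ‖φ ⟨v, s⟩ - φ ⟨v, s'⟩‖ ≤ C * |v| ^ (a - 2) * |s - s'|) (hbb : b ∈ Icc (-1 : ℝ) 1)
    {u s s' : ℝ} (hu : u ∈ Icc (-1 : ℝ) 1) (hs : s ∈ Icc (0 : ℝ) 1) (hs' : s' ∈ Icc (0 : ℝ) 1) :
    ‖horInt b φ ⟨u, s⟩ - horInt b φ ⟨u, s'⟩‖ ≤ C * (10 / a * K * w |s - s'|) := by
  have ha := h.a_pos
  have hK := h.one_le
  rcases eq_or_ne s s' with rfl | hne
  · simp [h.w_zero]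
  set δ := |s - s'| with hδ
  have hδ0 : 0 < δ := abs_pos.2 (sub_ne_zero.2 hne)
  have hδ1 : δ ≤ 1 := abs_le.2 ⟨by linarith [hs.1, hs'.2], by linarith [hs.2, hs'.1]⟩
  set Δ : ℝ → ℂ := fun v => φ ⟨v, s⟩ - φ ⟨v, s'⟩ with hΔ
  have hcont : ContinuousOn Δ (Icc (-1) 1 \ {0}) :=
    (continuousOn_horiz_slice hc hs).sub (continuousOn_horiz_slice hc hs')
  have hΔb : ∀ v ∈ Icc (-1 : ℝ) 1, v ≠ 0 → ‖Δ v‖ ≤ (2 * C) * |v| ^ (a - 1) := by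
    intro v hv hv0
    have h1 := hb ⟨v, s⟩ (mem_halfSq.2 ⟨hv, hs⟩) hv0
    have h2 := hb ⟨v, s'⟩ (mem_halfSq.2 ⟨hv, hs'⟩) hv0
    refine (norm_sub_le _ _).trans ?_
    simp only at h1 h2
    linarith
  have hint : ∀ x ∈ Icc (-1 : ℝ) 1, ∀ y ∈ Icc (-1 : ℝ) 1, IntervalIntegrable Δ volume x y :=
    fun x hx y hy => intervalIntegrable_of_le_abs_rpow ha hcont hΔb hx hy
  have m1 : (-1 : ℝ) ∈ Icc (-1 : ℝ) 1 := ⟨le_rfl, by norm_num⟩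
  have m2 : (1 : ℝ) ∈ Icc (-1 : ℝ) 1 := ⟨by norm_num, le_rfl⟩
  have m3 : δ ∈ Icc (-1 : ℝ) 1 := ⟨by linarith, hδ1⟩
  have m4 : -δ ∈ Icc (-1 : ℝ) 1 := ⟨by linarith, by linarith⟩
  have e1 : horInt b φ ⟨u, s⟩ - horInt b φ ⟨u, s'⟩ = ∫ v in b..u, Δ v := by
    unfold horInt
    exact (intervalIntegral.integral_sub (intervalIntegrable_horiz_slice ha hc hb hs hbb hu)
      (intervalIntegrable_horiz_slice ha hc hb hs' hbb hu)).symm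
  have e2 : ‖∫ v in b..u, Δ v‖ ≤ ∫ v in (-1 : ℝ)..1, ‖Δ v‖ := by
    refine intervalIntegral.norm_integral_le_integral_norm_uIoc.trans ?_
    rw [intervalIntegral.integral_of_le (by norm_num : (-1 : ℝ) ≤ 1)]
    refine setIntegral_mono_set (hint _ m1 _ m2).norm.1 (Eventually.of_forall fun _ => norm_nonneg _) ?_
    refine LE.le.eventuallyLE ?_
    rw [uIoc]
    exact Ioc_subset_Ioc (le_min hbb.1 hu.1) (max_le hbb.2 hu.2)
  -- The cut is at |v| = δ, the vertical increment. Inside, the size |v| ^ (a - 1) of each term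
  -- integrates to order δ ^ a; outside, the vertical derivative gives δ |v| ^ (a - 2), whose
  -- integral is what the field `base` bounds.
  have e3 : ∫ v in (-1 : ℝ)..1, ‖Δ v‖ = (∫ v in (-1 : ℝ)..(-δ), ‖Δ v‖) + (∫ v in (-δ)..δ, ‖Δ v‖) +
      ∫ v in δ..1, ‖Δ v‖ := by
    rw [intervalIntegral.integral_add_adjacent_intervals (hint _ m1 _ m4).norm (hint _ m4 _ m3).norm,
      intervalIntegral.integral_add_adjacent_intervals (hint _ m1 _ m3).norm (hint _ m3 _ m2).norm]
  have hae : ∀ᵐ v : ℝ, v ≠ 0 := by simp [ae_iff]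
  have b2 : ∫ v in (-δ)..δ, ‖Δ v‖ ≤ 2 * C * (2 / a * (2 * (K * w δ))) := by
    have h1 : ∫ v in (-δ)..δ, ‖Δ v‖ ≤ ∫ v in (-δ)..δ, (2 * C) * |v| ^ (a - 1) := by
      refine intervalIntegral.integral_mono_ae_restrict (by linarith) (hint _ m4 _ m3).norm
        ((intervalIntegrable_abs_rpow ha _ _).const_mul _) ?_
      filter_upwards [ae_restrict_mem measurableSet_Icc, ae_restrict_of_ae hae] with v hv hv0
      exact hΔb v ⟨by linarith [hv.1, m4.1], by linarith [hv.2]⟩ hv0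
    rw [intervalIntegral.integral_const_mul] at h1
    refine h1.trans (mul_le_mul_of_nonneg_left
      ((integral_abs_rpow_le ha h.a_le (by linarith)).trans ?_) (by linarith))
    have h2 : (δ - -δ) ^ a ≤ 2 * (K * w δ) := by
      rw [show δ - -δ = 2 * δ by ring, Real.mul_rpow (by norm_num) hδ0.le]
      have h3 : (2 : ℝ) ^ a ≤ 2 ^ (1 : ℝ) := Real.rpow_le_rpow_of_exponent_le (by norm_num) h.a_le
      rw [Real.rpow_one] at h3
      have h4 := h.rpow_le_w δ hδ0 (by linarith)
      exact mul_le_mul h3 h4 (Real.rpow_nonneg hδ0.le _) (by norm_num)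
    gcongr
  have hpw : IntervalIntegrable (fun v : ℝ => v ^ (a - 2)) volume δ 1 := by
    refine (ContinuousOn.rpow_const continuousOn_id fun v hv => Or.inl ?_).intervalIntegrable
    rw [uIcc_of_le hδ1] at hv
    exact (hδ0.trans_le hv.1).ne'
  have b3 : ∫ v in δ..1, ‖Δ v‖ ≤ C * (K * w δ) := by
    have h1 : ∫ v in δ..1, ‖Δ v‖ ≤ ∫ v in δ..1, (C * δ) * v ^ (a - 2) := by
      refine intervalIntegral.integral_mono_on hδ1 (hint _ m3 _ m2).norm (hpw.const_mul _) ?_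
      intro v hv'
      have hv0 := hδ0.trans_le hv'.1
      have h2 := hv v ⟨by linarith, hv'.2⟩ hv0.ne' s hs s' hs'
      rw [abs_of_pos hv0] at h2
      calc ‖Δ v‖ ≤ _ := h2
        _ = _ := by ring
    rw [intervalIntegral.integral_const_mul, mul_assoc] at h1
    exact h1.trans (mul_le_mul_of_nonneg_left (h.base δ hδ0 hδ1) hC)
  have b1 : ∫ v in (-1 : ℝ)..(-δ), ‖Δ v‖ ≤ C * (K * w δ) := by
    have h0 : ∫ v in (-1 : ℝ)..(-δ), ‖Δ v‖ = ∫ v in δ..1, ‖Δ (-v)‖ := by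
      rw [intervalIntegral.integral_comp_neg (fun v => ‖Δ v‖)]
    have hi : IntervalIntegrable (fun v => ‖Δ (-v)‖) volume δ 1 := by
      have := (IntervalIntegrable.iff_comp_neg).1 (hint _ m4 _ m1).norm
      simpa using this
    have h1 : ∫ v in δ..1, ‖Δ (-v)‖ ≤ ∫ v in δ..1, (C * δ) * v ^ (a - 2) := by
      refine intervalIntegral.integral_mono_on hδ1 hi (hpw.const_mul _) ?_
      intro v hv'
      have hv0 := hδ0.trans_le hv'.1
      have h2 := hv (-v) ⟨by linarith [hv'.2], by linarith⟩ (by linarith) s hs s' hs'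
      rw [abs_neg, abs_of_pos hv0] at h2
      calc ‖Δ (-v)‖ ≤ _ := h2
        _ = _ := by ring
    rw [h0]
    rw [intervalIntegral.integral_const_mul, mul_assoc] at h1
    exact h1.trans (mul_le_mul_of_nonneg_left (h.base δ hδ0 hδ1) hC)
  rw [e1]
  refine e2.trans ?_
  rw [e3]
  have hw := h.w_nonneg hδ0.le
  have hCKw : 0 ≤ C * (K * w δ) := by positivity
  have hinv : 1 ≤ 1 / a := by rw [le_div_iff₀ ha]; linarith [h.a_le]
  -- The 10 is 8 from the middle piece and 1 from each outer one, using 1 ≤ 1 / a.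
  have e4 : C * (10 / a * K * w δ) = 10 * (1 / a) * (C * (K * w δ)) := by ring
  have e5 : 2 * C * (2 / a * (2 * (K * w δ))) = 8 * (1 / a) * (C * (K * w δ)) := by ring
  rw [e4]
  rw [e5] at b2
  nlinarith

lemma norm_pow_mul_rpow_le (ha1 : a ≤ 1) (N : ℕ) {z : ℂ} (hz : z ∈ halfSq) (hz0 : z.re ≠ 0) :
    ‖z‖ ^ N * ‖z‖ ^ (a - 1) ≤ 2 ^ N * |z.re| ^ (a - 1) := by
  have h1 := norm_le_two_of_mem_halfSq hz
  have h2 : ‖z‖ ^ (a - 1) ≤ |z.re| ^ (a - 1) :=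
    Real.rpow_le_rpow_of_nonpos (abs_pos.2 hz0) (Complex.abs_re_le_norm z) (by linarith)
  gcongr

lemma hasDerivWithinAt_vert_slice {a' b' : ℂ → ℂ}
    (hd : ∀ x ∈ halfSq \ {0}, HasD φ (a' x) (b' x) (halfSq \ {0}) x) {v t : ℝ}
    (hv : v ∈ Icc (-1 : ℝ) 1) (hv0 : v ≠ 0) (ht : t ∈ Icc (0 : ℝ) 1) :
    HasDerivWithinAt (fun t : ℝ => φ ⟨v, t⟩) (Complex.I * (a' ⟨v, t⟩ - b' ⟨v, t⟩)) (Icc 0 1) t := by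
  have hm : MapsTo (fun t : ℝ => (⟨v, t⟩ : ℂ)) (Icc 0 1) (halfSq \ {0}) := fun t ht =>
    ⟨mem_halfSq.2 ⟨hv, ht⟩, mk_ne_zero_of_left hv0⟩
  have := HasD.comp_curve (γ := fun t : ℝ => (⟨v, t⟩ : ℂ)) (hd _ (hm ht))
    (hasDerivAt_vert v t).hasDerivWithinAt hm
  exact this.congr_deriv (by rw [Complex.conj_I]; ring)

lemma GoodMod.continuousOn_of_reg {K : ℝ} {w ρ Θ : ℝ → ℝ} (h : GoodMod a w ρ Θ K) {N : ℕ} {A : Set ℂ}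
    {M : ℝ} {g : ℂ → ℂ} (hg : Reg N w A M g) : ContinuousOn g A := by
  cases N with
  | zero => exact h.continuousOn_of_le hg.2
  | succ N =>
    obtain ⟨-, a, b, hd, -, -⟩ := hg
    exact fun x hx => (hd x hx).continuousWithinAt

/-- Vertical increments of horizontal integrals. -/
lemma horInt_sub_im (ha : 0 < a) {ψ : ℂ → ℂ}
    (hc : ContinuousOn φ halfSq) (hψc : ContinuousOn ψ (halfSq \ {0}))
    (hψ : ∀ z ∈ halfSq, z.re ≠ 0 → ‖ψ z‖ ≤ C * |z.re| ^ (a - 1))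
    (hd : ∀ v ∈ Icc (-1 : ℝ) 1, v ≠ 0 → ∀ t ∈ Icc (0 : ℝ) 1,
      HasDerivWithinAt (fun t : ℝ => φ ⟨v, t⟩) (ψ ⟨v, t⟩) (Icc 0 1) t)
    (hqc : ContinuousOn (horInt b ψ) halfSq) (hbb : b ∈ Icc (-1 : ℝ) 1)
    {u s s' : ℝ} (hu : u ∈ Icc (-1 : ℝ) 1) (hs : s ∈ Icc (0 : ℝ) 1) (hs' : s' ∈ Icc (0 : ℝ) 1) :
    horInt b φ ⟨u, s'⟩ - horInt b φ ⟨u, s⟩ = ∫ σ in s..s', horInt b ψ ⟨u, σ⟩ := by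
  have hsub : uIoc b u ⊆ Icc (-1) 1 := uIoc_subset_uIcc.trans (uIcc_subset_Icc hbb hu)
  have hae : ∀ᵐ v : ℝ, v ≠ 0 := by simp [ae_iff]
  have hslice : ∀ σ ∈ Icc (0 : ℝ) 1, ContinuousOn (fun v : ℝ => φ ⟨v, σ⟩) (uIcc b u) := fun σ hσ =>
    hc.comp (continuous_horiz σ).continuousOn fun v hv =>
      mem_halfSq.2 ⟨uIcc_subset_Icc hbb hu hv, hσ⟩
  obtain ⟨B, hB⟩ := ((isCompact_Icc (a := (-1 : ℝ)) (b := 1)).reProdIm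
    (isCompact_Icc (a := (0 : ℝ)) (b := 1))).exists_bound_of_continuousOn hc
  -- Differentiation under the integral is made only for 0 < σ < 1; continuity up to both ends then
  -- lets the fundamental theorem reach the closed interval. The point v = 0 is negligible.
  have hcD : ContinuousOn (fun σ : ℝ => horInt b φ ⟨u, σ⟩) (Icc 0 1) := by
    intro σ₀ hσ₀
    unfold horInt
    refine intervalIntegral.continuousWithinAt_of_dominated_interval (bound := fun _ => B) ?_ ?_
      intervalIntegrable_const ?_
    · filter_upwards [self_mem_nhdsWithin] with σ hσ
      exact (hslice σ hσ).intervalIntegrable.def'.aestronglyMeasurable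
    · filter_upwards [self_mem_nhdsWithin] with σ hσ
      refine Eventually.of_forall fun v hv => hB _ (mem_halfSq.2 ⟨hsub hv, hσ⟩)
    · refine Eventually.of_forall fun v hv => ?_
      have hm : MapsTo (fun σ : ℝ => (⟨v, σ⟩ : ℂ)) (Icc 0 1) halfSq :=
        fun σ hσ => mem_halfSq.2 ⟨hsub hv, hσ⟩
      exact (hc.comp (continuous_vert v).continuousOn hm) σ₀ hσ₀
  have hdD : ∀ σ ∈ Ioo (0 : ℝ) 1, HasDerivAt (fun σ : ℝ => horInt b φ ⟨u, σ⟩) (horInt b ψ ⟨u, σ⟩) σ := by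
    intro σ₀ hσ₀
    unfold horInt
    refine (intervalIntegral.hasDerivAt_integral_of_dominated_loc_of_deriv_le
      (F := fun σ v => φ ⟨v, σ⟩) (F' := fun σ v => ψ ⟨v, σ⟩)
      (bound := fun v => C * |v| ^ (a - 1)) (Ioo_mem_nhds hσ₀.1 hσ₀.2) ?_ ?_ ?_ ?_ ?_ ?_).2
    · filter_upwards [Ioo_mem_nhds hσ₀.1 hσ₀.2] with σ hσ
      exact (hslice σ (Ioo_subset_Icc_self hσ)).intervalIntegrable.def'.aestronglyMeasurable
    · exact (hslice σ₀ (Ioo_subset_Icc_self hσ₀)).intervalIntegrable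
    · exact (intervalIntegrable_horiz_slice ha hψc hψ (Ioo_subset_Icc_self hσ₀) hbb
        hu).def'.aestronglyMeasurable
    · filter_upwards [hae] with v hv0 hv σ hσ
      exact hψ ⟨v, σ⟩ (mem_halfSq.2 ⟨hsub hv, Ioo_subset_Icc_self hσ⟩) hv0
    · exact (intervalIntegrable_abs_rpow ha _ _).const_mul _
    · filter_upwards [hae] with v hv0 hv σ hσ
      exact (hd v (hsub hv) hv0 σ (Ioo_subset_Icc_self hσ)).hasDerivAt (Icc_mem_nhds hσ.1 hσ.2)
  have hqi : ∀ x ∈ Icc (0 : ℝ) 1, ∀ y ∈ Icc (0 : ℝ) 1,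
      IntervalIntegrable (fun σ : ℝ => horInt b ψ ⟨u, σ⟩) volume x y := fun x hx y hy =>
    (hqc.comp (continuous_vert u).continuousOn fun σ hσ =>
      mem_halfSq.2 ⟨hu, uIcc_subset_Icc hx hy hσ⟩).intervalIntegrable
  have z0 : (0 : ℝ) ∈ Icc (0 : ℝ) 1 := ⟨le_rfl, zero_le_one⟩
  have key : ∀ y ∈ Icc (0 : ℝ) 1,
      ∫ σ in (0 : ℝ)..y, horInt b ψ ⟨u, σ⟩ = horInt b φ ⟨u, y⟩ - horInt b φ ⟨u, 0⟩ := fun y hy =>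
    intervalIntegral.integral_eq_sub_of_hasDerivAt_of_le hy.1 (hcD.mono (Icc_subset_Icc_right hy.2))
      (fun σ hσ => hdD σ ⟨hσ.1, hσ.2.trans_le hy.2⟩) (hqi _ z0 _ hy)
  rw [← intervalIntegral.integral_interval_sub_left (hqi _ z0 _ hs') (hqi _ z0 _ hs), key _ hs, key _ hs']
  ring

/-- Regularity of horizontal integrals of symbols. -/
lemma GoodMod.reg_horInt {K : ℝ} {w ρ Θ : ℝ → ℝ} (h : GoodMod a w ρ Θ K) (hbb : b ∈ Icc (-1 : ℝ) 1)
    (N : ℕ) : ∃ D, 0 ≤ D ∧ ∀ (M : ℝ) (φ : ℂ → ℂ), 0 ≤ M → φ 0 = 0 →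
      Sym (N + 1) (fun z => M * (‖z‖ ^ N * ‖z‖ ^ (a - 1))) (halfSq \ {0}) φ →
      Reg N w halfSq (D * M) (horInt b φ) := by
  have ha := h.a_pos
  have ha1 := h.a_le
  have hK := h.one_le
  have hb : ∀ (N : ℕ) (M : ℝ) (φ : ℂ → ℂ), 0 ≤ M →
      (∀ z ∈ halfSq \ {0}, ‖φ z‖ ≤ M * (‖z‖ ^ N * ‖z‖ ^ (a - 1))) →
      ∀ z ∈ halfSq, z.re ≠ 0 → ‖φ z‖ ≤ (M * 2 ^ N) * |z.re| ^ (a - 1) := by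
    intro N M φ hM hφ z hz hz0
    have hz1 : z ≠ 0 := fun h => hz0 (by simp [h])
    refine (hφ z ⟨hz, hz1⟩).trans ?_
    rw [mul_assoc]
    exact mul_le_mul_of_nonneg_left (norm_pow_mul_rpow_le ha1 N hz hz0) hM
  induction N with
  | zero =>
    refine ⟨22 / a * K, by positivity, fun M φ hM hφ0 hφ => ⟨fun z hz => ?_, fun z hz z' hz' => ?_⟩⟩
    · have h1 := norm_horInt_le ha ha1 (by positivity) (hb 0 M φ hM hφ.bound) hbb hz
      refine h1.trans ?_
      have h2 : 0 ≤ M * (1 / a) := by positivity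
      have e1 : M * 2 ^ 0 * (4 / a) = 4 * (M * (1 / a)) := by ring
      have e2 : 22 / a * K * M = 22 * K * (M * (1 / a)) := by ring
      rw [e1, e2]
      gcongr
      linarith
    · have hb' := hb 0 M φ hM hφ.bound
      have hc := hφ.continuousOn
      obtain ⟨-, a', b', hd, ha', hb''⟩ := hφ
      -- Mean value inequality on a vertical segment with abscissa v ≠ 0: there |z| ≥ |v|, so the
      -- first derivatives of the symbol are O(|v| ^ (a - 2)).
      have hv : ∀ v ∈ Icc (-1 : ℝ) 1, v ≠ 0 → ∀ s ∈ Icc (0 : ℝ) 1, ∀ s' ∈ Icc (0 : ℝ) 1,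
          ‖φ ⟨v, s⟩ - φ ⟨v, s'⟩‖ ≤ (2 * M) * |v| ^ (a - 2) * |s - s'| := by
        intro v hv hv0 s hs s' hs'
        refine (convex_Icc (0 : ℝ) 1).norm_image_sub_le_of_norm_hasDerivWithin_le
          (f := fun t : ℝ => φ ⟨v, t⟩) (fun t ht => hasDerivWithinAt_vert_slice hd hv hv0 ht)
          (fun t ht => ?_) hs' hs
        have hmem : (⟨v, t⟩ : ℂ) ∈ halfSq \ {0} := ⟨mem_halfSq.2 ⟨hv, ht⟩, mk_ne_zero_of_left hv0⟩
        have hn : 0 < ‖(⟨v, t⟩ : ℂ)‖ := norm_pos_iff.2 hmem.2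
        have h1 : M * (‖(⟨v, t⟩ : ℂ)‖ ^ 0 * ‖(⟨v, t⟩ : ℂ)‖ ^ (a - 1)) / ‖(⟨v, t⟩ : ℂ)‖ ≤
            M * |v| ^ (a - 2) := by
          have h2 : ‖(⟨v, t⟩ : ℂ)‖ ^ (a - 1) / ‖(⟨v, t⟩ : ℂ)‖ = ‖(⟨v, t⟩ : ℂ)‖ ^ (a - 2) := by
            rw [show a - 2 = a - 1 - 1 by ring, Real.rpow_sub_one hn.ne' (a - 1)]
          rw [pow_zero, one_mul, mul_div_assoc, h2]
          exact mul_le_mul_of_nonneg_left (Real.rpow_le_rpow_of_nonpos (abs_pos.2 hv0)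
            (Complex.abs_re_le_norm ⟨v, t⟩) (by linarith)) hM
        have h3 := (ha'.bound _ hmem).trans h1
        have h4 := (hb''.bound _ hmem).trans h1
        rw [norm_mul, Complex.norm_I, one_mul]
        refine (norm_sub_le _ _).trans ?_
        linarith
      have hb2 : ∀ z ∈ halfSq, z.re ≠ 0 → ‖φ z‖ ≤ (2 * M) * |z.re| ^ (a - 1) := by
        intro z hz hz0
        refine (hb' z hz hz0).trans ?_
        have := Real.rpow_nonneg (abs_nonneg z.re) (a - 1)
        rw [pow_zero, mul_one]
        nlinarith
      obtain ⟨hz1, hz2⟩ := mem_halfSq.1 hz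
      obtain ⟨hz1', hz2'⟩ := mem_halfSq.1 hz'
      have h1 := h.horInt_sub_im_le (by positivity) hc hb2 hv hbb hz1' hz2 hz2'
      have h2 : ‖horInt b φ ⟨z.re, z.im⟩ - horInt b φ ⟨z'.re, z.im⟩‖ ≤
          M * (2 / a * (K * w |z.re - z'.re|)) := by
        rw [horInt_sub_re ha hc hb' hbb hz2 hz1' hz1]
        refine (norm_integral_horiz_slice_le ha ha1 (by positivity) hb' hz2 hz1' hz1).trans ?_
        rcases eq_or_ne z.re z'.re with he | he
        · rw [he]; simp [h.w_zero, Real.zero_rpow ha.ne']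
        have h3 := h.rpow_le_w |z.re - z'.re| (abs_pos.2 (sub_ne_zero.2 he))
          (abs_le.2 ⟨by linarith [hz1.1, hz1'.2], by linarith [hz1.2, hz1'.1]⟩)
        rw [pow_zero, mul_one]
        gcongr
      have w1 : w |z.re - z'.re| ≤ w (dist z z') := h.w_mono _ _ (abs_nonneg _) (by
        rw [dist_eq_norm, ← Complex.sub_re]; exact Complex.abs_re_le_norm _)
      have w2 : w |z.im - z'.im| ≤ w (dist z z') := h.w_mono _ _ (abs_nonneg _) (by
        rw [dist_eq_norm, ← Complex.sub_im]; exact Complex.abs_im_le_norm _)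
      have e : horInt b φ z - horInt b φ z' = (horInt b φ ⟨z.re, z.im⟩ - horInt b φ ⟨z'.re, z.im⟩) +
          (horInt b φ ⟨z'.re, z.im⟩ - horInt b φ ⟨z'.re, z'.im⟩) := by
        simp
      rw [e]
      refine (norm_add_le _ _).trans ((add_le_add h2 h1).trans ?_)
      have hMa : 0 ≤ M * (1 / a) * K := by positivity
      calc _ = M * (1 / a) * K * (2 * w |z.re - z'.re| + 20 * w |z.im - z'.im|) := by ring
        _ ≤ M * (1 / a) * K * (2 * w (dist z z') + 20 * w (dist z z')) := by gcongr
        _ = _ := by ring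
  | succ N ih =>
    obtain ⟨D, hD, ih⟩ := ih
    have hw4 := h.w_nonneg (show (0 : ℝ) ≤ 4 by norm_num)
    refine ⟨2 ^ (N + 1) * (4 / a) + 4 ^ N * K * (w 4 + 4) + D * 2, by positivity, fun M φ hM hφ0 hφ => ?_⟩
    have n1 : 0 ≤ 2 ^ (N + 1) * (4 / a) * M := by positivity
    have n2 : 0 ≤ 4 ^ N * K * (w 4 + 4) * M := by positivity
    have n3 : 0 ≤ D * 2 * M := by positivity
    have hb' := hb (N + 1) M φ hM hφ.bound
    have hcS := hφ.continuousOn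
    -- The u-derivative of the horizontal integral is φ itself, which is small at the origin to
    -- order N + a; its regularity is that of a symbol, no integration being needed.
    have hφr : Reg N w halfSq (M * (4 ^ N * K * (w 4 + 4))) φ := by
      refine h.reg_of_sym convex_halfSq halfSq_subset N hM hφ0 (hφ.pred.mono_weight fun z hz => ?_)
      have h1 := h.le_rho ‖z‖ (norm_pos_iff.2 hz.2) ((norm_le_two_of_mem_halfSq hz.1).trans (by norm_num))
      gcongr
    have hφc := h.continuousOn_of_reg hφr
    obtain ⟨-, a', b', hd, ha', hb''⟩ := hφ
    -- This is ∂φ/∂s, set to 0 at the origin. It is a symbol of one order less, and its horizontal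
    -- integral is the s-derivative of that of φ, so the induction hypothesis applies to it.
    set ψ : ℂ → ℂ := Function.update (fun z => Complex.I * (a' z + -1 * b' z)) 0 0 with hψ
    have hψS : Sym (N + 1) (fun z => (2 * M) * (‖z‖ ^ N * ‖z‖ ^ (a - 1))) (halfSq \ {0}) ψ := by
      refine ((((ha'.add (hb''.const_mul (-1))).const_mul Complex.I)).congr
        fun x hx => Function.update_of_ne hx.2 _ _).mono_weight fun z hz => ?_
      have hn : ‖z‖ ≠ 0 := norm_ne_zero_iff.2 hz.2
      apply le_of_eq
      simp only [Complex.norm_I, norm_neg, norm_one, one_mul]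
      field_simp
      ring
    have hqr := ih (2 * M) ψ (by positivity) (by simp [hψ]) hψS
    have hqc := h.continuousOn_of_reg hqr
    refine ⟨fun z hz => ?_, fun z => (φ z - Complex.I * horInt b ψ z) / 2,
      fun z => (φ z + Complex.I * horInt b ψ z) / 2, fun z hz => ?_, ?_, ?_⟩
    · refine (norm_horInt_le ha ha1 (by positivity) hb' hbb hz).trans ?_
      nlinarith
    · refine hasD_of_integral hφc hqc hz fun z' hz' => ?_
      obtain ⟨hz1, hz2⟩ := mem_halfSq.1 hz
      obtain ⟨hz1', hz2'⟩ := mem_halfSq.1 hz'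
      rw [← horInt_sub_re ha hcS hb' hbb hz2' hz1 hz1',
        ← horInt_sub_im ha hφc hψS.continuousOn (hb N (2 * M) ψ (by positivity) hψS.bound) ?_ hqc hbb
          hz1 hz2 hz2']
      · simp
      · intro v hv hv0 t ht
        refine (hasDerivWithinAt_vert_slice hd hv hv0 ht).congr_deriv ?_
        rw [hψ, Function.update_of_ne (mk_ne_zero_of_left hv0)]
        ring
    · refine ((hφr.add (hqr.const_mul (-Complex.I))).const_mul (1 / 2)).congr
        (fun z _ => by ring) |>.mono_const (fun t => h.w_nonneg) ?_
      simp only [norm_neg, Complex.norm_I]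
      norm_num
      nlinarith
    · refine ((hφr.add (hqr.const_mul Complex.I)).const_mul (1 / 2)).congr
        (fun z _ => by ring) |>.mono_const (fun t => h.w_nonneg) ?_
      simp only [Complex.norm_I]
      norm_num
      nlinarith

end horInt

end SaddleSector

/-! ### Homogeneous functions on the slit plane -/

namespace SaddleSector

open Set Filter Topology MeasureTheory

/-- The closed upper half plane without the origin. -/
def upperHP : Set ℂ := {z | 0 ≤ z.im ∧ z ≠ 0}

/-- The plane without the closed negative imaginary half-axis. -/
def slitHP : Set ℂ := {z | 0 < z.im ∨ z.re ≠ 0}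

lemma upperHP_subset : upperHP ⊆ slitHP := by
  rintro z ⟨h1, h2⟩
  by_contra h
  simp only [slitHP, mem_ofPred_eq, not_or, not_lt, not_not] at h
  exact h2 (Complex.ext h.2 (le_antisymm h.1 h1))

lemma ne_zero_of_mem_slitHP {z : ℂ} (hz : z ∈ slitHP) : z ≠ 0 := by
  rintro rfl
  simp [slitHP] at hz

lemma neg_I_mul_mem_slitPlane {z : ℂ} (hz : z ∈ slitHP) : -Complex.I * z ∈ Complex.slitPlane := by
  rw [Complex.mem_slitPlane_iff]
  simpa [slitHP] using hz

lemma smul_mem_upperHP {z : ℂ} (hz : z ∈ upperHP) {t : ℝ} (ht : 0 < t) : (t : ℂ) * z ∈ upperHP := by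
  refine ⟨?_, mul_ne_zero (by exact_mod_cast ht.ne') hz.2⟩
  simpa using mul_nonneg ht.le hz.1

lemma smul_mem_slitHP {z : ℂ} (hz : z ∈ slitHP) {t : ℝ} (ht : 0 < t) : (t : ℂ) * z ∈ slitHP := by
  rcases hz with hz | hz
  · left; simpa using mul_pos ht hz
  · right; simpa using And.intro ht.ne' hz

lemma isOpen_slitHP : IsOpen slitHP :=
  (isOpen_lt continuous_const Complex.continuous_im).union
    (isOpen_ne_fun Complex.continuous_re continuous_const)

/-- The branch of `(-i z) ^ α` on the plane cut along the negative imaginary half-axis. -/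
noncomputable def pw (α : ℝ) (z : ℂ) : ℂ := (-Complex.I * z) ^ (α : ℂ)

/-- The homogeneous function `(-i z) ^ α * conj ((-i z) ^ β)`. -/
noncomputable def mono (α β : ℝ) (z : ℂ) : ℂ := pw α z * (starRingEnd ℂ) (pw β z)

lemma norm_pw (α : ℝ) {z : ℂ} (hz : z ≠ 0) : ‖pw α z‖ = ‖z‖ ^ α := by
  have h : -Complex.I * z ≠ 0 := mul_ne_zero (neg_ne_zero.2 Complex.I_ne_zero) hz
  rw [pw, Complex.norm_cpow_of_ne_zero h]
  simp

lemma norm_mono (α β : ℝ) {z : ℂ} (hz : z ≠ 0) : ‖mono α β z‖ = ‖z‖ ^ (α + β) := by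
  rw [mono, norm_mul, Complex.norm_conj, norm_pw _ hz, norm_pw _ hz,
    Real.rpow_add (norm_pos_iff.2 hz)]

lemma pw_mul (α : ℝ) {t : ℝ} (ht : 0 < t) (z : ℂ) : pw α (t * z) = (t ^ α : ℝ) * pw α z := by
  rcases eq_or_ne z 0 with rfl | hz
  · rcases eq_or_ne α 0 with rfl | hα
    · simp [pw]
    · simp [pw, hα]
  have hw : -Complex.I * z ≠ 0 := mul_ne_zero (neg_ne_zero.2 Complex.I_ne_zero) hz
  have htc : (t : ℂ) ≠ 0 := by exact_mod_cast ht.ne'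
  rw [pw, pw, Complex.ofReal_cpow ht.le,
    show -Complex.I * (t * z) = (t : ℂ) * (-Complex.I * z) by ring,
    Complex.cpow_def_of_ne_zero (mul_ne_zero htc hw), Complex.cpow_def_of_ne_zero hw,
    Complex.cpow_def_of_ne_zero htc, Complex.log_ofReal_mul ht hw, Complex.ofReal_log ht.le,
    ← Complex.exp_add, add_mul]

lemma mono_mul (α β : ℝ) {t : ℝ} (ht : 0 < t) (z : ℂ) :
    mono α β (t * z) = (t ^ (α + β) : ℝ) * mono α β z := by
  rw [mono, mono, pw_mul α ht, pw_mul β ht, Real.rpow_add ht]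
  simp only [map_mul, Complex.conj_ofReal, Complex.ofReal_mul]
  ring

lemma hasDerivAt_pw (α : ℝ) {z : ℂ} (hz : z ∈ slitHP) :
    HasDerivAt (pw α) (-Complex.I * α * pw (α - 1) z) z := by
  have h1 : HasDerivAt (fun z : ℂ => -Complex.I * z) (-Complex.I) z := by
    simpa using (hasDerivAt_id z).const_mul (-Complex.I)
  have h2 := h1.cpow_const (c := (α : ℂ)) (neg_I_mul_mem_slitPlane hz)
  refine h2.congr_deriv ?_
  rw [pw]
  push_cast
  ring

lemma hasD_mono (α β : ℝ) {z : ℂ} (hz : z ∈ slitHP) (A : Set ℂ) :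
    HasD (mono α β) (-Complex.I * α * mono (α - 1) β z) (Complex.I * β * mono α (β - 1) z) A z := by
  have h1 : HasD (pw α) (-Complex.I * α * pw (α - 1) z) 0 A z := HasD.of_hasDerivAt (hasDerivAt_pw α hz)
  have h2 : HasD (pw β) (-Complex.I * β * pw (β - 1) z) 0 A z := HasD.of_hasDerivAt (hasDerivAt_pw β hz)
  refine (h1.mul h2.conj).cast ?_ ?_
  · simp only [mono, map_zero]; ring
  · simp only [mono, map_mul, map_neg, Complex.conj_I, Complex.conj_ofReal]; ring

/-- The space of homogeneous functions of degree `γ` spanned by the `mono α β`. -/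
noncomputable def homSpace (γ : ℝ) : Submodule ℂ (ℂ → ℂ) :=
  Submodule.span ℂ {f | ∃ α β : ℝ, α + β = γ ∧ f = mono α β}

lemma mono_mem {α β γ : ℝ} (h : α + β = γ) : mono α β ∈ homSpace γ :=
  Submodule.subset_span ⟨α, β, h, rfl⟩

namespace homSpace

variable {γ : ℝ} {h : ℂ → ℂ}

lemma exists_hasD (hh : h ∈ homSpace γ) : ∃ a ∈ homSpace (γ - 1), ∃ b ∈ homSpace (γ - 1),
    ∀ z ∈ slitHP, ∀ A : Set ℂ, HasD h (a z) (b z) A z := by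
  induction hh using Submodule.span_induction with
  | mem f hf =>
    obtain ⟨α, β, rfl, rfl⟩ := hf
    refine ⟨(-Complex.I * α) • mono (α - 1) β, Submodule.smul_mem _ _ (mono_mem (by ring)),
      (Complex.I * β) • mono α (β - 1), Submodule.smul_mem _ _ (mono_mem (by ring)), fun z hz A => ?_⟩
    exact hasD_mono α β hz A
  | zero => exact ⟨0, Submodule.zero_mem _, 0, Submodule.zero_mem _, fun z _ A => HasD.const 0⟩
  | add f g _ _ ihf ihg =>
    obtain ⟨a, ha, b, hb, hd⟩ := ihf
    obtain ⟨a', ha', b', hb', hd'⟩ := ihg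
    exact ⟨a + a', Submodule.add_mem _ ha ha', b + b', Submodule.add_mem _ hb hb',
      fun z hz A => (hd z hz A).add (hd' z hz A)⟩
  | smul c f _ ih =>
    obtain ⟨a, ha, b, hb, hd⟩ := ih
    exact ⟨c • a, Submodule.smul_mem _ c ha, c • b, Submodule.smul_mem _ c hb,
      fun z hz A => (hd z hz A).const_mul c⟩

lemma exists_bound (hh : h ∈ homSpace γ) : ∃ C, 0 ≤ C ∧ ∀ z, z ≠ 0 → ‖h z‖ ≤ C * ‖z‖ ^ γ := by
  induction hh using Submodule.span_induction with
  | mem f hf =>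
    obtain ⟨α, β, rfl, rfl⟩ := hf
    exact ⟨1, zero_le_one, fun z hz => by rw [norm_mono α β hz, one_mul]⟩
  | zero => exact ⟨0, le_rfl, fun z hz => by simp⟩
  | add f g _ _ ihf ihg =>
    obtain ⟨C, hC, h1⟩ := ihf
    obtain ⟨C', hC', h2⟩ := ihg
    refine ⟨C + C', add_nonneg hC hC', fun z hz => ?_⟩
    rw [add_mul]
    exact (norm_add_le _ _).trans (add_le_add (h1 z hz) (h2 z hz))
  | smul c f _ ih =>
    obtain ⟨C, hC, h1⟩ := ih
    refine ⟨‖c‖ * C, by positivity, fun z hz => ?_⟩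
    rw [Pi.smul_apply, norm_smul, mul_assoc]
    exact mul_le_mul_of_nonneg_left (h1 z hz) (norm_nonneg c)

lemma apply_mul (hh : h ∈ homSpace γ) {t : ℝ} (ht : 0 < t) (z : ℂ) :
    h (t * z) = (t ^ γ : ℝ) * h z := by
  induction hh using Submodule.span_induction with
  | mem f hf =>
    obtain ⟨α, β, rfl, rfl⟩ := hf
    exact mono_mul α β ht z
  | zero => simp
  | add f g _ _ ihf ihg => rw [Pi.add_apply, Pi.add_apply, ihf, ihg, mul_add]
  | smul c f _ ih => simp only [Pi.smul_apply, smul_eq_mul, ih]; ring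

lemma continuousOn (hh : h ∈ homSpace γ) : ContinuousOn h slitHP := by
  obtain ⟨a, -, b, -, hd⟩ := exists_hasD hh
  exact fun z hz => (hd z hz slitHP).continuousWithinAt

/-- A derivative of a homogeneous function is homogeneous of degree one less, so each derivative
loses exactly one factor ‖z‖. -/
lemma sym (hh : h ∈ homSpace γ) (N : ℕ) :
    ∃ C, 0 ≤ C ∧ Sym N (fun z => C * ‖z‖ ^ γ) upperHP h := by
  induction N generalizing γ h with
  | zero =>
    obtain ⟨C, hC, hb⟩ := exists_bound hh
    exact ⟨C, hC, fun z hz => hb z hz.2⟩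
  | succ N ih =>
    obtain ⟨C, hC, hb⟩ := exists_bound hh
    obtain ⟨a, ha, b, hb', hd⟩ := exists_hasD hh
    obtain ⟨C₁, hC₁, h₁⟩ := ih ha
    obtain ⟨C₂, hC₂, h₂⟩ := ih hb'
    have key : ∀ z ∈ upperHP, ∀ c : ℝ, 0 ≤ c → c ≤ C + C₁ + C₂ →
        c * ‖z‖ ^ (γ - 1) ≤ (C + C₁ + C₂) * ‖z‖ ^ γ / ‖z‖ := by
      intro z hz c hc hcC
      rw [Real.rpow_sub_one (norm_ne_zero_iff.2 hz.2), mul_div_assoc]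
      exact mul_le_mul_of_nonneg_right hcC (div_nonneg (Real.rpow_nonneg (norm_nonneg z) γ) (norm_nonneg z))
    refine ⟨C + C₁ + C₂, by positivity, fun z hz => (hb z hz.2).trans ?_, a, b,
      fun z hz => hd z (upperHP_subset hz) _, ?_, ?_⟩
    · have := Real.rpow_nonneg (norm_nonneg z) γ
      exact mul_le_mul_of_nonneg_right (by linarith) this
    · exact h₁.mono_weight fun z hz => key z hz _ hC₁ (by linarith)
    · exact h₂.mono_weight fun z hz => key z hz _ hC₂ (by linarith)

end homSpace

/-- Iterated derivatives `∂_s ^ N` of `mono α β` in the direction of the imaginary axis. -/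
noncomputable def dsMono : ℕ → ℝ → ℝ → ℂ → ℂ
  | 0, α, β => mono α β
  | N + 1, α, β => (α : ℂ) • dsMono N (α - 1) β + (β : ℂ) • dsMono N α (β - 1)

lemma dsMono_mem (N : ℕ) (α β : ℝ) : dsMono N α β ∈ homSpace (α + β - N) := by
  induction N generalizing α β with
  | zero => exact mono_mem (by simp)
  | succ N ih =>
    refine Submodule.add_mem _ (Submodule.smul_mem _ _ ?_) (Submodule.smul_mem _ _ ?_)
    · convert ih (α - 1) β using 2; push_cast; ring
    · convert ih α (β - 1) using 2; push_cast; ring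

/-- Since -i z has s-derivative 1, as has its conjugate, ∂_s = i(∂ - ∂̄) lowers α or β by one with
factor α or β. The two Wirtinger coefficients here are the separate halves of `dsMono (N + 1)`. -/
lemma hasD_dsMono (N : ℕ) (α β : ℝ) {z : ℂ} (hz : z ∈ slitHP) (A : Set ℂ) :
    HasD (dsMono N α β) (-Complex.I * α * dsMono N (α - 1) β z)
      (Complex.I * β * dsMono N α (β - 1) z) A z := by
  induction N generalizing α β with
  | zero => exact hasD_mono α β hz A
  | succ N ih =>
    refine (((ih (α - 1) β).const_mul α).add ((ih α (β - 1)).const_mul β)).cast ?_ ?_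
    · simp only [dsMono, Pi.add_apply, Pi.smul_apply, smul_eq_mul]; push_cast; ring
    · simp only [dsMono, Pi.add_apply, Pi.smul_apply, smul_eq_mul]; push_cast; ring

/-- Euler's relation for a homogeneous function. -/
lemma euler_of_homogeneous {g : ℂ → ℂ} {κ : ℝ}
    (hg : ∀ t : ℝ, 0 < t → ∀ z ∈ slitHP, g (t * z) = (t ^ κ : ℝ) * g z) {a b z : ℂ} (hz : z ∈ slitHP)
    (hd : HasD g a b slitHP z) : z * a + (starRingEnd ℂ) z * b = κ * g z := by
  have h1 : HasDerivAt (fun t : ℝ => (t : ℂ) * z) z 1 := by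
    have := (Complex.ofRealCLM.hasDerivAt (x := (1 : ℝ))).mul_const z
    exact this.congr_deriv (by simp)
  have hm : MapsTo (fun t : ℝ => (t : ℂ) * z) (Ioi 0) slitHP := fun t ht => smul_mem_slitHP hz ht
  have h2 := HasD.comp_curve (γ := fun t : ℝ => (t : ℂ) * z) (t := 1) (S := Ioi 0) (g := g)
    (A := slitHP) (a := a) (b := b) (by simpa using hd) h1.hasDerivWithinAt hm
  have h3 : HasDerivWithinAt (fun t : ℝ => g ((t : ℂ) * z)) (κ * g z) (Ioi 0) 1 := by
    have h4 : HasDerivAt (fun t : ℝ => ((t ^ κ : ℝ) : ℂ) * g z) (κ * g z) 1 := by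
      have := ((Real.hasDerivAt_rpow_const (x := 1) (p := κ) (Or.inl one_ne_zero)).ofReal_comp).mul_const
        (g z)
      exact this.congr_deriv (by simp)
    exact h4.hasDerivWithinAt.congr (fun t ht => hg t ht z hz) (hg 1 one_pos z hz)
  have := (isOpen_Ioi.uniqueDiffWithinAt (mem_Ioi.2 one_pos)).eq_deriv _ h2 h3
  rw [← this]; ring

/-- A continuous homogeneous function on the punctured closed half-plane is bounded by a power. -/
lemma exists_bound_of_homogeneous {g : ℂ → ℂ} {κ : ℝ}
    (hg : ∀ t : ℝ, 0 < t → ∀ z ∈ upperHP, g (t * z) = (t ^ κ : ℝ) * g z)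
    (hc : ContinuousOn g upperHP) : ∃ C, 0 ≤ C ∧ ∀ z ∈ upperHP, ‖g z‖ ≤ C * ‖z‖ ^ κ := by
  have hK : IsCompact (Metric.sphere (0 : ℂ) 1 ∩ {z | 0 ≤ z.im}) :=
    (isCompact_sphere 0 1).inter_right (isClosed_le continuous_const Complex.continuous_im)
  have hsub : Metric.sphere (0 : ℂ) 1 ∩ {z | 0 ≤ z.im} ⊆ upperHP := fun z hz =>
    ⟨hz.2, fun h => by have := hz.1; simp [h] at this⟩
  obtain ⟨C, hC⟩ := hK.exists_bound_of_continuousOn (hc.mono hsub)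
  refine ⟨max C 0, le_max_right _ _, fun z hz => ?_⟩
  have hn : 0 < ‖z‖ := norm_pos_iff.2 hz.2
  have hnC : (‖z‖ : ℂ) ≠ 0 := by exact_mod_cast hn.ne'
  have h1 : z = (‖z‖ : ℂ) * (((‖z‖⁻¹ : ℝ) : ℂ) * z) := by push_cast; field_simp
  have h2 := smul_mem_upperHP hz (inv_pos.2 hn)
  have h3 := hg ‖z‖ hn _ h2
  rw [← h1] at h3
  rw [h3, norm_mul, Complex.norm_real, Real.norm_of_nonneg (Real.rpow_nonneg hn.le _), mul_comm]
  refine mul_le_mul_of_nonneg_right ((hC _ ⟨?_, h2.1⟩).trans (le_max_left _ _))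
    (Real.rpow_nonneg hn.le _)
  simp [hn.ne']

end SaddleSector

/-! ### Ray integrals and the decaying primitive -/

namespace SaddleSector

open Set Filter Topology MeasureTheory

/-- The points from which the horizontal ray in the direction `-ε` avoids the lower imaginary
half-axis. -/
def rayDom (ε : ℝ) : Set ℂ := {z | ε * z.re < 0 ∨ 0 < z.im}

lemma isOpen_rayDom (ε : ℝ) : IsOpen (rayDom ε) :=
  (isOpen_lt (continuous_const.mul Complex.continuous_re) continuous_const).union
    (isOpen_lt continuous_const Complex.continuous_im)

lemma rayDom_subset (ε : ℝ) : rayDom ε ⊆ slitHP := by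
  rintro z (h | h)
  · right; rintro h0; simp [h0] at h
  · exact Or.inl h

lemma smul_mem_rayDom {ε : ℝ} {z : ℂ} (hz : z ∈ rayDom ε) {t : ℝ} (ht : 0 < t) :
    (t : ℂ) * z ∈ rayDom ε := by
  rcases hz with h | h
  · left
    have := mul_neg_of_pos_of_neg ht h
    simp only [Complex.re_ofReal_mul]; linarith
  · right; simpa using mul_pos ht h

lemma ray_mem {ε : ℝ} (hε : ε = 1 ∨ ε = -1) {z : ℂ} (hz : z ∈ rayDom ε) {v : ℝ} (hv : 0 ≤ v) :
    z - ((ε * v : ℝ) : ℂ) ∈ rayDom ε := by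
  rcases hz with h | h
  · left
    rcases hε with rfl | rfl <;> simp at h ⊢ <;> linarith
  · right; simpa using h

/-- Growth in v, uniform for starting points near z, is what dominates ray integrals of degree below
-1. Either the abscissa already points in the direction of the ray, or the ordinate stays away from
0 while the abscissa escapes. -/
lemma ray_lower {ε : ℝ} (hε : ε = 1 ∨ ε = -1) {z : ℂ} (hz : z ∈ rayDom ε) :
    ∃ r > 0, ∃ c > 0, Metric.ball z r ⊆ rayDom ε ∧ ∀ x ∈ Metric.ball z r, ∀ v : ℝ, 0 ≤ v →
      c * (1 + v) ≤ ‖x - ((ε * v : ℝ) : ℂ)‖ := by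
  rcases hz with h | h
  · set d := -(ε * z.re) with hd
    have hdp : 0 < d := by rw [hd]; linarith
    have key : ∀ x ∈ Metric.ball z (d / 2), d / 2 ≤ -(ε * x.re) := by
      intro x hx
      rw [Metric.mem_ball, dist_eq_norm] at hx
      have h1 := (abs_le.1 ((Complex.abs_re_le_norm (x - z)).trans hx.le))
      rw [Complex.sub_re] at h1
      rcases hε with rfl | rfl <;> linarith [h1.1, h1.2]
    refine ⟨d / 2, by positivity, min 1 (d / 2), by positivity, fun x hx => Or.inl ?_,
      fun x hx v hv => ?_⟩
    · linarith [key x hx]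
    · have h1 := key x hx
      have h2 : v - ε * x.re ≤ ‖x - ((ε * v : ℝ) : ℂ)‖ := by
        refine le_trans ?_ (Complex.abs_re_le_norm _)
        rw [Complex.sub_re, Complex.ofReal_re]
        rcases hε with rfl | rfl
        · refine le_trans (le_of_eq ?_) (neg_le_abs _); ring
        · refine le_trans (le_of_eq ?_) (le_abs_self _); ring
      have h3 : min 1 (d / 2) * (1 + v) ≤ d / 2 + v := by
        rw [mul_add, mul_one]
        exact add_le_add (min_le_right _ _) (mul_le_of_le_one_left hv (min_le_left _ _))
      linarith
  · set d := z.im with hd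
    have key : ∀ x ∈ Metric.ball z (d / 2), d / 2 ≤ x.im ∧ ‖x‖ ≤ ‖z‖ + d / 2 := by
      intro x hx
      rw [Metric.mem_ball, dist_eq_norm] at hx
      have h1 := (abs_le.1 ((Complex.abs_im_le_norm (x - z)).trans hx.le))
      rw [Complex.sub_im] at h1
      refine ⟨by linarith [h1.1], ?_⟩
      have := norm_add_le (x - z) z
      rw [sub_add_cancel] at this
      linarith
    set B := ‖z‖ + d / 2 with hB
    have hBp : 0 ≤ B := by positivity
    refine ⟨d / 2, by positivity, (1 + (1 + B) / (d / 2))⁻¹, by positivity, fun x hx => Or.inr ?_,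
      fun x hx v hv => ?_⟩
    · linarith [(key x hx).1]
    · obtain ⟨h1, h2⟩ := key x hx
      set w := x - ((ε * v : ℝ) : ℂ) with hw
      have h3 : d / 2 ≤ ‖w‖ := by
        refine h1.trans (le_trans (le_of_eq ?_) ((le_abs_self _).trans (Complex.abs_im_le_norm _)))
        rw [hw, Complex.sub_im, Complex.ofReal_im, sub_zero]
      have h4 : v ≤ ‖w‖ + B := by
        have h5 : ‖((ε * v : ℝ) : ℂ)‖ = v := by
          rw [Complex.norm_real, Real.norm_eq_abs, abs_mul, abs_of_nonneg hv]
          rcases hε with rfl | rfl <;> simp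
        have h6 : ((ε * v : ℝ) : ℂ) = x - w := by rw [hw]; ring
        rw [h6] at h5
        linarith [norm_sub_le x w]
      rw [inv_mul_le_iff₀ (by positivity), add_mul, one_mul]
      have h7 : 1 + B ≤ (1 + B) / (d / 2) * ‖w‖ := by
        rw [div_mul_eq_mul_div, le_div_iff₀ (by positivity)]
        exact mul_le_mul_of_nonneg_left h3 (by positivity)
      linarith

/-- The integral of `h` along the horizontal ray from `z` in the direction `-ε`. -/
noncomputable def rayInt (ε : ℝ) (h : ℂ → ℂ) (z : ℂ) : ℂ :=
  ∫ v in Ioi (0 : ℝ), h (z - ((ε * v : ℝ) : ℂ))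

lemma integrableOn_one_add_rpow {γ : ℝ} (hγ : γ < -1) (c : ℝ) :
    Integrable (fun v : ℝ => c * (1 + |v|) ^ γ) := by
  have := integrable_one_add_norm (E := ℝ) (μ := volume) (r := -γ) (by simp; linarith)
  simp only [neg_neg, Real.norm_eq_abs] at this
  exact this.const_mul c

section

variable {ε γ : ℝ} {h : ℂ → ℂ}

lemma continuousOn_ray (hε : ε = 1 ∨ ε = -1) (hh : ContinuousOn h slitHP) {z : ℂ} (hz : z ∈ rayDom ε) :
    ContinuousOn (fun v : ℝ => h (z - ((ε * v : ℝ) : ℂ))) (Ici 0) :=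
  hh.comp (by fun_prop) fun v hv => rayDom_subset ε (ray_mem hε hz hv)

lemma ray_bound (hε : ε = 1 ∨ ε = -1) (hγ : γ < -1) (hh : h ∈ homSpace γ) {z : ℂ} (hz : z ∈ rayDom ε) :
    ∃ r > 0, Metric.ball z r ⊆ rayDom ε ∧ ∃ c, ∀ x ∈ Metric.ball z r, ∀ v : ℝ, 0 ≤ v →
      ‖h (x - ((ε * v : ℝ) : ℂ))‖ ≤ c * (1 + |v|) ^ γ := by
  obtain ⟨r, hr, c, hc, hb, hl⟩ := ray_lower hε hz
  obtain ⟨C, hC, hbd⟩ := homSpace.exists_bound hh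
  refine ⟨r, hr, hb, C * c ^ γ, fun x hx v hv => ?_⟩
  refine (hbd _ (ne_zero_of_mem_slitHP (rayDom_subset ε (ray_mem hε (hb hx) hv)))).trans ?_
  rw [mul_assoc, abs_of_nonneg hv, ← Real.mul_rpow hc.le (by linarith)]
  exact mul_le_mul_of_nonneg_left
    (Real.rpow_le_rpow_of_nonpos (by positivity) (hl x hx v hv) (by linarith)) hC

lemma integrableOn_ray (hε : ε = 1 ∨ ε = -1) (hγ : γ < -1) (hh : h ∈ homSpace γ) {z : ℂ}
    (hz : z ∈ rayDom ε) : IntegrableOn (fun v : ℝ => h (z - ((ε * v : ℝ) : ℂ))) (Ioi 0) := by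
  obtain ⟨r, hr, hb, c, hc⟩ := ray_bound hε hγ hh hz
  refine Integrable.mono' (integrableOn_one_add_rpow hγ c).integrableOn
    (((continuousOn_ray hε (homSpace.continuousOn hh) hz).mono Ioi_subset_Ici_self).aestronglyMeasurable
      measurableSet_Ioi) ?_
  filter_upwards [ae_restrict_mem measurableSet_Ioi] with v hv
  exact hc z (Metric.mem_ball_self hr) v (le_of_lt hv)

lemma hasD_rayInt (hε : ε = 1 ∨ ε = -1) (hγ : γ < -1) (hh : h ∈ homSpace γ) {a b : ℂ → ℂ}
    (ha : a ∈ homSpace (γ - 1)) (hb : b ∈ homSpace (γ - 1))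
    (hd : ∀ z ∈ slitHP, ∀ A : Set ℂ, HasD h (a z) (b z) A z) {z : ℂ} (hz : z ∈ rayDom ε) (A : Set ℂ) :
    HasD (rayInt ε h) (rayInt ε a z) (rayInt ε b z) A z := by
  have hγ' : γ - 1 < -1 := by linarith
  obtain ⟨r₁, hr₁, hs₁, c₁, hc₁⟩ := ray_bound hε hγ' ha hz
  obtain ⟨r₂, hr₂, hs₂, c₂, hc₂⟩ := ray_bound hε hγ' hb hz
  have hia := integrableOn_ray hε hγ' ha hz
  have hib := integrableOn_ray hε hγ' hb hz
  have key := hasFDerivAt_integral_of_dominated_of_fderiv_le (𝕜 := ℝ)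
    (μ := volume.restrict (Ioi (0 : ℝ))) (x₀ := z)
    (s := Metric.ball z (min r₁ r₂)) (F := fun x v => h (x - ((ε * v : ℝ) : ℂ)))
    (F' := fun x v => wirt (a (x - ((ε * v : ℝ) : ℂ))) (b (x - ((ε * v : ℝ) : ℂ))))
    (bound := fun v => (c₁ + c₂) * (1 + |v|) ^ (γ - 1))
    (Metric.ball_mem_nhds z (lt_min hr₁ hr₂)) ?_ (integrableOn_ray hε hγ hh hz) ?_ ?_
    (integrableOn_one_add_rpow hγ' _).integrableOn ?_
  · have e : ∫ v in Ioi (0 : ℝ), wirt (a (z - ((ε * v : ℝ) : ℂ))) (b (z - ((ε * v : ℝ) : ℂ))) =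
        wirt (rayInt ε a z) (rayInt ε b z) := by
      simp only [wirt_eq]
      rw [integral_add (wirtL.integrable_comp hia) (wirtR.integrable_comp hib),
        wirtL.integral_comp_comm hia, wirtR.integral_comp_comm hib]
      rfl
    rw [e] at key
    exact key.hasFDerivWithinAt
  · filter_upwards [(isOpen_rayDom ε).mem_nhds hz] with x hx
    exact (integrableOn_ray hε hγ hh hx).aestronglyMeasurable
  · simp only [wirt_eq]
    exact ((wirtL.integrable_comp hia).add (wirtR.integrable_comp hib)).aestronglyMeasurable
  · filter_upwards [ae_restrict_mem measurableSet_Ioi] with v hv x hx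
    rw [add_mul]
    exact (norm_wirt_le _ _).trans (add_le_add
      (hc₁ x (Metric.ball_subset_ball (min_le_left _ _) hx) v (le_of_lt hv))
      (hc₂ x (Metric.ball_subset_ball (min_le_right _ _) hx) v (le_of_lt hv)))
  · filter_upwards [ae_restrict_mem measurableSet_Ioi] with v hv x hx
    have hx' := rayDom_subset ε (ray_mem hε (hs₁ (Metric.ball_subset_ball (min_le_left _ _) hx))
      (le_of_lt hv))
    have h1 : HasFDerivAt h (wirt (a (x - ((ε * v : ℝ) : ℂ))) (b (x - ((ε * v : ℝ) : ℂ))))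
        (x - ((ε * v : ℝ) : ℂ)) := hasFDerivWithinAt_univ.1 (hd _ hx' univ)
    have h2 : HasFDerivAt (fun x : ℂ => x - ((ε * v : ℝ) : ℂ)) (ContinuousLinearMap.id ℝ ℂ) x :=
      (hasFDerivAt_id x).sub_const _
    exact h1.comp x h2

/-- The sum a + b is ∂h/∂u, and h tends to 0 along the ray because its degree is negative; the
fundamental theorem leaves the value at z. -/
lemma rayInt_add (hε : ε = 1 ∨ ε = -1) (hγ : γ < -1) (hh : h ∈ homSpace γ) {a b : ℂ → ℂ}
    (ha : a ∈ homSpace (γ - 1)) (hb : b ∈ homSpace (γ - 1))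
    (hd : ∀ z ∈ slitHP, ∀ A : Set ℂ, HasD h (a z) (b z) A z) {z : ℂ} (hz : z ∈ rayDom ε) :
    rayInt ε a z + rayInt ε b z = ε * h z := by
  have hγ' : γ - 1 < -1 := by linarith
  have hia := integrableOn_ray hε hγ' ha hz
  have hib := integrableOn_ray hε hγ' hb hz
  have hεε : (ε : ℂ) * ε = 1 := by rcases hε with rfl | rfl <;> simp
  have hder : ∀ v ∈ Ici (0 : ℝ), HasDerivAt (fun v : ℝ => h (z - ((ε * v : ℝ) : ℂ)))
      (-(ε : ℂ) * (a (z - ((ε * v : ℝ) : ℂ)) + b (z - ((ε * v : ℝ) : ℂ)))) v := by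
    intro v hv
    have h1 : HasDerivAt (fun v : ℝ => z - ((ε * v : ℝ) : ℂ)) (-(ε : ℂ)) v := by
      have := (((hasDerivAt_id v).const_mul ε).ofReal_comp).const_sub z
      exact this.congr_deriv (by simp)
    have h2 := HasD.comp_curve (γ := fun v : ℝ => z - ((ε * v : ℝ) : ℂ)) (S := univ) (A := univ)
      (hd _ (rayDom_subset ε (ray_mem hε hz hv)) univ) h1.hasDerivWithinAt (mapsTo_univ _ _)
    refine (hasDerivWithinAt_univ.1 h2).congr_deriv ?_
    simp only [map_neg, Complex.conj_ofReal]; ring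
  have hlim : Tendsto (fun v : ℝ => h (z - ((ε * v : ℝ) : ℂ))) atTop (𝓝 0) := by
    obtain ⟨r, hr, hs, c, hc⟩ := ray_bound hε hγ hh hz
    refine squeeze_zero_norm' (a := fun v : ℝ => c * (1 + |v|) ^ γ) ?_ ?_
    · filter_upwards [eventually_ge_atTop 0] with v hv
      exact hc z (Metric.mem_ball_self hr) v hv
    · have h1 : Tendsto (fun v : ℝ => 1 + |v|) atTop atTop :=
        tendsto_atTop_add_const_left _ _ tendsto_abs_atTop_atTop
      have h2 := (tendsto_rpow_neg_atTop (y := -γ) (by linarith)).comp h1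
      simpa using h2.const_mul c
  have h3 := integral_Ioi_of_hasDerivAt_of_tendsto' hder ((hia.add hib).const_mul _) hlim
  simp only [mul_zero, Complex.ofReal_zero, sub_zero, zero_sub] at h3
  have h4 : ∫ v in Ioi (0 : ℝ), (-(ε : ℂ) * (a (z - ((ε * v : ℝ) : ℂ)) + b (z - ((ε * v : ℝ) : ℂ)))) =
      -(ε : ℂ) * (rayInt ε a z + rayInt ε b z) := by
    rw [integral_const_mul, integral_add hia hib]
    rfl
  rw [h4] at h3
  linear_combination (-(ε : ℂ)) * h3 - (rayInt ε a z + rayInt ε b z) * hεε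

/-- Substitution of t v for v: the line element contributes the extra degree. -/
lemma rayInt_mul (hh : h ∈ homSpace γ) {t : ℝ} (ht : 0 < t) (z : ℂ) :
    rayInt ε h (t * z) = (t ^ (γ + 1) : ℝ) * rayInt ε h z := by
  have h1 := integral_comp_mul_left_Ioi (fun v : ℝ => h (t * z - ((ε * v : ℝ) : ℂ))) 0 ht
  have h2 : ∀ v : ℝ, h (t * z - ((ε * (t * v) : ℝ) : ℂ)) = (t ^ γ : ℝ) * h (z - ((ε * v : ℝ) : ℂ)) := by
    intro v
    rw [← homSpace.apply_mul hh ht]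
    congr 1; push_cast; ring
  simp only [h2, mul_zero] at h1
  rw [integral_const_mul] at h1
  have htc : (t : ℂ) ≠ 0 := by exact_mod_cast ht.ne'
  rw [Real.rpow_add_one ht.ne', Complex.ofReal_mul]
  rw [Complex.real_smul, Complex.ofReal_inv] at h1
  have h3 : rayInt ε h (t * z) = ∫ v in Ioi (0 : ℝ), h (t * z - ((ε * v : ℝ) : ℂ)) := rfl
  rw [h3, mul_assoc, mul_left_comm]
  change _ = (t : ℂ) * (_ * ∫ v in Ioi (0 : ℝ), h (z - ((ε * v : ℝ) : ℂ)))
  rw [mul_comm (t : ℂ), mul_comm (t : ℂ)] at *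
  rw [h1]
  field_simp

end

/-- The integral over the line `im = 1`. -/
noncomputable def lineInt (h : ℂ → ℂ) : ℂ := ∫ v : ℝ, h (v + Complex.I)

/-- The integrals along the two rays from any point of the upper half-plane cancel. -/
def Balanced (h : ℂ → ℂ) : Prop := ∀ z : ℂ, 0 < z.im → rayInt 1 h z + rayInt (-1) h z = 0

lemma integrable_line {γ : ℝ} {h : ℂ → ℂ} (hγ : γ < -1) (hh : h ∈ homSpace γ) {z : ℂ} (hz : 0 < z.im) :
    Integrable fun v : ℝ => h (z + v) := by
  have h1 := integrableOn_ray (Or.inl rfl) hγ hh (z := z) (Or.inr hz)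
  have h2 := integrableOn_ray (Or.inr rfl) hγ hh (z := z) (Or.inr hz)
  simp only [neg_mul, one_mul, Complex.ofReal_neg, sub_neg_eq_add] at h1 h2
  rw [← integrableOn_univ, ← Iic_union_Ioi (a := (0 : ℝ))]
  refine IntegrableOn.union ?_ h2
  have := ((Measure.measurePreserving_neg (volume : Measure ℝ)).integrableOn_comp_preimage
    (Homeomorph.neg ℝ).measurableEmbedding (f := fun v : ℝ => h (z - v)) (s := Ioi 0)).2 h1
  refine (this.congr_set_ae ?_).congr_fun (fun v _ => by simp) measurableSet_Iic
  simpa using Iio_ae_eq_Iic.symm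

/-- By translation and homogeneity the integral over any horizontal line of the upper half-plane is
a multiple of the one over im = 1, so one number decides. -/
lemma balanced_of_lineInt {γ : ℝ} {h : ℂ → ℂ} (hγ : γ < -1) (hh : h ∈ homSpace γ) (h0 : lineInt h = 0) :
    Balanced h := by
  intro z hz
  have hi := integrable_line hγ hh hz
  have h1 : rayInt 1 h z = ∫ v in Iic (0 : ℝ), h (z + v) := by
    have := integral_comp_neg_Ioi (0 : ℝ) (fun v : ℝ => h (z + v))
    rw [neg_zero] at this
    rw [← this]
    simp [rayInt, sub_eq_add_neg]
  have h2 : rayInt (-1) h z = ∫ v in Ioi (0 : ℝ), h (z + v) := by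
    simp [rayInt]
  rw [h1, h2, intervalIntegral.integral_Iic_add_Ioi hi.integrableOn hi.integrableOn]
  have h3 : ∀ v : ℝ, h (z + v) = (z.im ^ γ : ℝ) * h (((v + z.re) / z.im : ℝ) + Complex.I) := by
    intro v
    rw [← homSpace.apply_mul hh hz]
    congr 1
    have : (z.im : ℂ) ≠ 0 := by exact_mod_cast hz.ne'
    apply Complex.ext
    · simp; field_simp; ring
    · simp
  simp only [h3]
  rw [integral_const_mul,
    integral_add_right_eq_self (fun v : ℝ => h ((v / z.im : ℝ) + Complex.I)) z.re,
    Measure.integral_comp_div (fun v : ℝ => h ((v : ℂ) + Complex.I)) z.im]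
  change _ * (_ • lineInt h) = 0
  rw [h0]; simp

/-- Balance is an identity on an open set, so it may be differentiated under the ray integrals. -/
lemma Balanced.hasD {γ : ℝ} {h : ℂ → ℂ} (hγ : γ < -1) (hh : h ∈ homSpace γ) (hb : Balanced h) {a b : ℂ → ℂ}
    (ha : a ∈ homSpace (γ - 1)) (hb' : b ∈ homSpace (γ - 1))
    (hd : ∀ z ∈ slitHP, ∀ A : Set ℂ, HasD h (a z) (b z) A z) : Balanced a ∧ Balanced b := by
  have key : ∀ z : ℂ, 0 < z.im → rayInt 1 a z + rayInt (-1) a z = 0 ∧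
      rayInt 1 b z + rayInt (-1) b z = 0 := by
    intro z hz
    have h1 := (hasD_rayInt (Or.inl rfl) hγ hh ha hb' hd (z := z) (Or.inr hz) univ).add
      (hasD_rayInt (Or.inr rfl) hγ hh ha hb' hd (z := z) (Or.inr hz) univ)
    have h2 : HasD (fun y => rayInt 1 h y + rayInt (-1) h y) 0 0 univ z := by
      refine (HasD.const 0).congr_of_eventuallyEq ?_ (hb z hz)
      rw [nhdsWithin_univ]
      filter_upwards [(isOpen_lt continuous_const Complex.continuous_im).mem_nhds hz] with y hy
      exact hb y hy
    exact wirt_injective ((hasFDerivWithinAt_univ.1 h1).unique (hasFDerivWithinAt_univ.1 h2))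
  exact ⟨fun z hz => (key z hz).1, fun z hz => (key z hz).2⟩

open scoped Classical in
/-- The decaying primitive of a balanced homogeneous function along horizontal lines. -/
noncomputable def rayPrim (h : ℂ → ℂ) (z : ℂ) : ℂ :=
  if z ∈ rayDom 1 then rayInt 1 h z else -rayInt (-1) h z

section

variable {γ : ℝ} {h : ℂ → ℂ}

lemma mem_rayDom_neg {z : ℂ} (hz : z ∈ slitHP) (hz1 : z ∉ rayDom 1) : 0 < z.re := by
  simp only [rayDom, mem_ofPred_eq, not_or, not_lt, one_mul] at hz1
  rcases hz with h | h
  · exact absurd h (not_lt.2 hz1.2)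
  · exact lt_of_le_of_ne hz1.1 (Ne.symm h)

/-- Where both ray integrals make sense, balance makes the two branches of the definition agree.
This gluing yields smoothness up to both halves of the real axis. -/
lemma rayPrim_of_re_pos (hb : Balanced h) {z : ℂ} (hz : 0 < z.re) : rayPrim h z = -rayInt (-1) h z := by
  rw [rayPrim]
  split_ifs with h1
  · rcases h1 with h1 | h1
    · linarith
    · linear_combination hb z h1
  · rfl

lemma hasD_rayPrim (hγ : γ < -1) (hh : h ∈ homSpace γ) (hbal : Balanced h) {a b : ℂ → ℂ}
    (ha : a ∈ homSpace (γ - 1)) (hb : b ∈ homSpace (γ - 1))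
    (hd : ∀ z ∈ slitHP, ∀ A : Set ℂ, HasD h (a z) (b z) A z) {z : ℂ} (hz : z ∈ slitHP) (A : Set ℂ) :
    HasD (rayPrim h) (rayPrim a z) (rayPrim b z) A z := by
  refine HasD.mono ?_ (subset_univ A)
  by_cases h1 : z ∈ rayDom 1
  · simp only [rayPrim, if_pos h1]
    refine (hasD_rayInt (Or.inl rfl) hγ hh ha hb hd h1 univ).congr_of_eventuallyEq ?_ (if_pos h1)
    rw [nhdsWithin_univ]
    filter_upwards [(isOpen_rayDom 1).mem_nhds h1] with y hy
    exact if_pos hy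
  · have hre := mem_rayDom_neg hz h1
    obtain ⟨hA, hB⟩ := hbal.hasD hγ hh ha hb hd
    rw [rayPrim_of_re_pos hA hre, rayPrim_of_re_pos hB hre]
    have hm : z ∈ rayDom (-1) := Or.inl (by linarith)
    refine (hasD_rayInt (Or.inr rfl) hγ hh ha hb hd hm univ).neg.congr_of_eventuallyEq ?_
      (rayPrim_of_re_pos hbal hre)
    rw [nhdsWithin_univ]
    filter_upwards [(isOpen_lt continuous_const Complex.continuous_re).mem_nhds hre] with y hy
    exact rayPrim_of_re_pos hbal hy

lemma rayPrim_add (hγ : γ < -1) (hh : h ∈ homSpace γ) {a b : ℂ → ℂ}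
    (ha : a ∈ homSpace (γ - 1)) (hb : b ∈ homSpace (γ - 1))
    (hd : ∀ z ∈ slitHP, ∀ A : Set ℂ, HasD h (a z) (b z) A z) {z : ℂ} (hz : z ∈ slitHP) :
    rayPrim a z + rayPrim b z = h z := by
  simp only [rayPrim]
  split_ifs with h1
  · rw [rayInt_add (Or.inl rfl) hγ hh ha hb hd h1]; simp
  · have hre := mem_rayDom_neg hz h1
    have := rayInt_add (Or.inr rfl) hγ hh ha hb hd (z := z) (Or.inl (by linarith))
    push_cast at this
    linear_combination -this

lemma rayPrim_mul (hh : h ∈ homSpace γ) {t : ℝ} (ht : 0 < t) {z : ℂ} :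
    rayPrim h (t * z) = (t ^ (γ + 1) : ℝ) * rayPrim h z := by
  have : (t : ℂ) * z ∈ rayDom 1 ↔ z ∈ rayDom 1 := by
    refine ⟨fun h1 => ?_, fun h1 => smul_mem_rayDom h1 ht⟩
    have := smul_mem_rayDom h1 (inv_pos.2 ht)
    rwa [Complex.ofReal_inv, inv_mul_cancel_left₀ (by exact_mod_cast ht.ne')] at this
  by_cases h1 : z ∈ rayDom 1
  · rw [rayPrim, rayPrim, if_pos h1, if_pos (this.2 h1), rayInt_mul hh ht]
  · rw [rayPrim, rayPrim, if_neg h1, if_neg (fun h2 => h1 (this.1 h2)), rayInt_mul hh ht, mul_neg]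

/-- Boundedness on the compact half-circle and homogeneity give the size; the derivatives are the
same construction applied to the derivatives of h, which are again balanced. -/
lemma sym_rayPrim (hγ : γ < -1) (hh : h ∈ homSpace γ) (hbal : Balanced h) (N : ℕ) :
    ∃ C, 0 ≤ C ∧ Sym N (fun z => C * ‖z‖ ^ (γ + 1)) upperHP (rayPrim h) := by
  have hbd : ∀ {γ : ℝ} {h : ℂ → ℂ}, γ < -1 → h ∈ homSpace γ → Balanced h →
      ∃ C, 0 ≤ C ∧ ∀ z ∈ upperHP, ‖rayPrim h z‖ ≤ C * ‖z‖ ^ (γ + 1) := by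
    intro γ h hγ hh hbal
    obtain ⟨a, ha, b, hb, hd⟩ := homSpace.exists_hasD hh
    exact exists_bound_of_homogeneous (fun t ht z _ => rayPrim_mul hh ht) fun z hz =>
      (hasD_rayPrim hγ hh hbal ha hb hd (upperHP_subset hz) upperHP).continuousWithinAt
  induction N generalizing γ h with
  | zero => exact hbd hγ hh hbal
  | succ N ih =>
    obtain ⟨C, hC, h0⟩ := hbd hγ hh hbal
    obtain ⟨a, ha, b, hb, hd⟩ := homSpace.exists_hasD hh
    obtain ⟨hA, hB⟩ := hbal.hasD hγ hh ha hb hd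
    obtain ⟨C₁, hC₁, h₁⟩ := ih (by linarith) ha hA
    obtain ⟨C₂, hC₂, h₂⟩ := ih (by linarith) hb hB
    have key : ∀ z ∈ upperHP, ∀ c : ℝ, 0 ≤ c → c ≤ C + C₁ + C₂ →
        c * ‖z‖ ^ (γ - 1 + 1) ≤ (C + C₁ + C₂) * ‖z‖ ^ (γ + 1) / ‖z‖ := by
      intro z hz c hc hcC
      rw [show γ - 1 + 1 = (γ + 1) - 1 by ring, Real.rpow_sub_one (norm_ne_zero_iff.2 hz.2), mul_div_assoc]
      exact mul_le_mul_of_nonneg_right hcC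
        (div_nonneg (Real.rpow_nonneg (norm_nonneg z) _) (norm_nonneg z))
    refine ⟨C + C₁ + C₂, by positivity, fun z hz => (h0 z hz).trans ?_, rayPrim a, rayPrim b,
      fun z hz => hasD_rayPrim hγ hh hbal ha hb hd (upperHP_subset hz) _, ?_, ?_⟩
    · exact mul_le_mul_of_nonneg_right (by linarith) (Real.rpow_nonneg (norm_nonneg z) _)
    · exact h₁.mono_weight fun z hz => key z hz _ hC₁ (by linarith)
    · exact h₂.mono_weight fun z hz => key z hz _ hC₂ (by linarith)

end

end SaddleSector

/-! ### Primitives up to a logarithm, and Euler's relation -/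

namespace SaddleSector

open Set Filter Topology MeasureTheory

/-- `g` has partial derivatives `p = ∂g/∂u` and `q = ∂g/∂s` at `z = u + i s` within `A`. -/
def HasUS (g : ℂ → ℂ) (p q : ℂ) (A : Set ℂ) (z : ℂ) : Prop :=
  HasD g ((p - Complex.I * q) / 2) ((p + Complex.I * q) / 2) A z

namespace HasUS

variable {g g₁ g₂ : ℂ → ℂ} {p q p₁ q₁ p₂ q₂ z : ℂ} {A : Set ℂ}

lemma of_hasD {a b : ℂ} (h : HasD g a b A z) : HasUS g (a + b) (Complex.I * (a - b)) A z := by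
  refine HasD.cast h ?_ ?_
  · linear_combination (1 / 2 : ℂ) * (a - b) * Complex.I_sq
  · linear_combination (-1 / 2 : ℂ) * (a - b) * Complex.I_sq

lemma cast (h : HasUS g p₁ q₁ A z) (hp : p₁ = p) (hq : q₁ = q) : HasUS g p q A z := hp ▸ hq ▸ h

lemma of_hasFDerivAt {L : ℂ →L[ℝ] ℂ} (h : HasFDerivAt g L z) (hp : L 1 = p) (hq : L Complex.I = q) :
    HasUS g p q A z := by
  have := h.hasFDerivWithinAt (s := A)
  rw [eq_wirt L, hp, hq] at this
  exact this

lemma add (h₁ : HasUS g₁ p₁ q₁ A z) (h₂ : HasUS g₂ p₂ q₂ A z) :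
    HasUS (fun x => g₁ x + g₂ x) (p₁ + p₂) (q₁ + q₂) A z :=
  (HasD.add h₁ h₂).cast (by ring) (by ring)

lemma sub (h₁ : HasUS g₁ p₁ q₁ A z) (h₂ : HasUS g₂ p₂ q₂ A z) :
    HasUS (fun x => g₁ x - g₂ x) (p₁ - p₂) (q₁ - q₂) A z :=
  (HasD.sub h₁ h₂).cast (by ring) (by ring)

lemma const_mul (c : ℂ) (h : HasUS g p q A z) : HasUS (fun x => c * g x) (c * p) (c * q) A z :=
  (HasD.const_mul c h).cast (by ring) (by ring)

lemma mul (h₁ : HasUS g₁ p₁ q₁ A z) (h₂ : HasUS g₂ p₂ q₂ A z) :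
    HasUS (fun x => g₁ x * g₂ x) (p₁ * g₂ z + g₁ z * p₂) (q₁ * g₂ z + g₁ z * q₂) A z :=
  (HasD.mul h₁ h₂).cast (by ring) (by ring)

lemma re : HasUS (fun x => (x.re : ℂ)) 1 0 A z :=
  of_hasFDerivAt (Complex.ofRealCLM.hasFDerivAt.comp z Complex.reCLM.hasFDerivAt) (by simp) (by simp)

lemma im : HasUS (fun x => (x.im : ℂ)) 0 1 A z :=
  of_hasFDerivAt (Complex.ofRealCLM.hasFDerivAt.comp z Complex.imCLM.hasFDerivAt) (by simp) (by simp)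

lemma im_pow (i : ℕ) : HasUS (fun x => (x.im : ℂ) ^ (i + 1)) 0 ((i + 1) * (z.im : ℂ) ^ i) A z := by
  induction i with
  | zero => simpa using im (z := z) (A := A)
  | succ i ih =>
    have := ih.mul im
    simp only [← pow_succ] at this
    refine this.cast (by ring) ?_
    push_cast; ring

end HasUS

/-- The weight `C r ^ κ`, with a logarithm for nonnegative degree. -/
noncomputable def logWeight (κ C r : ℝ) : ℝ := C * (r ^ κ * (1 + if 0 ≤ κ then |Real.log r| else 0))

lemma logWeight_factor_ge (κ r : ℝ) : 1 ≤ 1 + if 0 ≤ κ then |Real.log r| else 0 := by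
  split_ifs <;> simp

lemma logWeight_mono {κ C C' r : ℝ} (hr : 0 ≤ r) (h : C ≤ C') : logWeight κ C r ≤ logWeight κ C' r :=
  mul_le_mul_of_nonneg_right h (mul_nonneg (Real.rpow_nonneg hr κ)
    (zero_le_one.trans (logWeight_factor_ge κ r)))

lemma logWeight_nonneg {κ C r : ℝ} (hr : 0 ≤ r) (hC : 0 ≤ C) : 0 ≤ logWeight κ C r :=
  mul_nonneg hC (mul_nonneg (Real.rpow_nonneg hr κ) (zero_le_one.trans (logWeight_factor_ge κ r)))

lemma rpow_le_logWeight {κ C r : ℝ} (hr : 0 ≤ r) (hC : 0 ≤ C) : C * r ^ κ ≤ logWeight κ C r :=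
  mul_le_mul_of_nonneg_left (le_mul_of_one_le_right (Real.rpow_nonneg hr κ) (logWeight_factor_ge κ r)) hC

/-- Dividing by r lowers the degree by one; a logarithm allowed in degree κ is also allowed in
degree κ + 1, so nothing is lost. -/
lemma logWeight_le_div {κ C r : ℝ} (hr : 0 < r) (hC : 0 ≤ C) :
    logWeight κ C r ≤ logWeight (κ + 1) C r / r := by
  have h1 : r ^ (κ + 1) = r ^ κ * r := Real.rpow_add_one hr.ne' κ
  have h2 : (1 + if 0 ≤ κ then |Real.log r| else 0) ≤ 1 + if 0 ≤ κ + 1 then |Real.log r| else 0 := by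
    split_ifs with h3 h4
    · exact le_rfl
    · linarith
    · simp
    · exact le_rfl
  rw [le_div_iff₀ hr, logWeight, logWeight, h1]
  have := mul_le_mul_of_nonneg_left h2 (mul_nonneg hC (mul_nonneg (Real.rpow_nonneg hr.le κ) hr.le))
  linarith

/-- `Y` is a primitive of `h` in the direction of the real axis, homogeneous of degree `κ` up to a
logarithm. -/
structure IsPrim (κ : ℝ) (h Y : ℂ → ℂ) : Prop where
  exists_deriv : ∃ (c : ℂ) (i : ℕ) (Ys : ℂ → ℂ), (c = 0 ∨ κ = i) ∧ ∀ z ∈ slitHP,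
    HasUS Y (h z) (Ys z) univ z ∧ z.re * h z + z.im * Ys z = κ * Y z + c * (z.im : ℂ) ^ i
  homogeneous : κ < 0 → ∀ t : ℝ, 0 < t → ∀ z ∈ slitHP, Y (t * z) = (t ^ κ : ℝ) * Y z
  sym : ∀ N, ∃ C, 0 ≤ C ∧ Sym N (fun z => logWeight κ C ‖z‖) upperHP Y

/-- The start of the descent: in degree γ + 1 < 0 the primitive is exactly homogeneous, so Euler's
relation holds without defect. -/
lemma isPrim_rayPrim {γ : ℝ} {h : ℂ → ℂ} (hγ : γ < -1) (hh : h ∈ homSpace γ) (hbal : Balanced h) :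
    IsPrim (γ + 1) h (rayPrim h) := by
  obtain ⟨a, ha, b, hb, hd⟩ := homSpace.exists_hasD hh
  refine ⟨⟨0, 0, fun z => Complex.I * (rayPrim a z - rayPrim b z), Or.inl rfl, fun z hz => ⟨?_, ?_⟩⟩,
    fun _ t ht z hz => rayPrim_mul hh ht, fun N => ?_⟩
  · exact (HasUS.of_hasD (hasD_rayPrim hγ hh hbal ha hb hd hz univ)).cast
      (rayPrim_add hγ hh ha hb hd hz) rfl
  · have h1 := euler_of_homogeneous (fun t ht z _ => rayPrim_mul hh ht) hz
      (hasD_rayPrim hγ hh hbal ha hb hd hz slitHP)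
    rw [← rayPrim_add hγ hh ha hb hd hz, zero_mul, add_zero, ← h1]
    have h2 : (starRingEnd ℂ) z = z.re - z.im * Complex.I := by
      apply Complex.ext <;> simp
    have h3 := Complex.re_add_im z
    rw [h2]
    linear_combination rayPrim a z * h3
  · obtain ⟨C, hC, hs⟩ := sym_rayPrim hγ hh hbal N
    exact ⟨C, hC, hs.mono_weight fun z _ => rpow_le_logWeight (norm_nonneg z) hC⟩

/-- Symbol estimates for a function from those of its partial derivatives. -/
lemma sym_of_hasUS {κ : ℝ} {h Y X : ℂ → ℂ} (hh : h ∈ homSpace κ)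
    (hY : ∀ N, ∃ C, 0 ≤ C ∧ Sym N (fun z => logWeight κ C ‖z‖) upperHP Y)
    (hX : ∀ z ∈ slitHP, HasUS X (h z) (Y z) univ z) {C₀ : ℝ} (hC₀ : 0 ≤ C₀)
    (hb : ∀ z ∈ upperHP, ‖X z‖ ≤ logWeight (κ + 1) C₀ ‖z‖) (N : ℕ) :
    ∃ C, 0 ≤ C ∧ Sym N (fun z => logWeight (κ + 1) C ‖z‖) upperHP X := by
  cases N with
  | zero => exact ⟨C₀, hC₀, hb⟩
  | succ N =>
    obtain ⟨C₁, hC₁, h₁⟩ := homSpace.sym hh N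
    obtain ⟨C₂, hC₂, h₂⟩ := hY N
    have h₁' : Sym N (fun z => logWeight κ C₁ ‖z‖) upperHP h :=
      h₁.mono_weight fun z _ => rpow_le_logWeight (norm_nonneg z) hC₁
    have hw : ∀ z ∈ upperHP, ‖(1 / 2 : ℂ)‖ * logWeight κ C₁ ‖z‖ + ‖Complex.I / 2‖ * logWeight κ C₂ ‖z‖ ≤
        logWeight (κ + 1) (C₀ + C₁ + C₂) ‖z‖ / ‖z‖ := by
      intro z hz
      have hn : 0 < ‖z‖ := norm_pos_iff.2 hz.2
      refine le_trans ?_ (logWeight_le_div hn (by positivity))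
      have e1 := logWeight_mono (κ := κ) hn.le (show C₁ ≤ C₀ + C₁ + C₂ by linarith)
      have e2 := logWeight_mono (κ := κ) hn.le (show C₂ ≤ C₀ + C₁ + C₂ by linarith)
      simp only [norm_div, norm_one, RCLike.norm_ofNat, Complex.norm_I]
      linarith
    refine ⟨C₀ + C₁ + C₂, by positivity, fun z hz => (hb z hz).trans
      (logWeight_mono (norm_nonneg z) (by linarith)), fun z => (h z - Complex.I * Y z) / 2,
      fun z => (h z + Complex.I * Y z) / 2, fun z hz => (hX z (upperHP_subset hz)).mono (subset_univ _),
      ?_, ?_⟩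
    · refine (((h₁'.const_mul (1 / 2)).add (h₂.const_mul (-(Complex.I / 2)))).mono_weight ?_).congr
        fun z _ => by ring
      intro z hz
      simpa using hw z hz
    · exact (((h₁'.const_mul (1 / 2)).add (h₂.const_mul (Complex.I / 2))).mono_weight hw).congr
        fun z _ => by ring

section step

variable {γ : ℝ} {h hs Y : ℂ → ℂ}

/-- Euler's relation u h_u + s h_s = γ h shows that (u h + s Y) / (γ + 1) has u-derivative h, when Y
is a primitive of h_s. If Y satisfies Euler's relation only up to c s ^ i, its s-derivative differs
from Y by c s ^ i / (γ + 1), which the subtracted power of s corrects; the defect passes on as c s ^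
(i + 1) / (i + 1). -/
lemma IsPrim.step (hh : h ∈ homSpace γ) (hd : ∀ z ∈ slitHP, ∃ hu, HasUS h hu (hs z) univ z)
    (hY : IsPrim γ hs Y) (hγ : γ + 1 ≠ 0) : ∃ X, IsPrim (γ + 1) h X := by
  obtain ⟨c, i, Ys, hci, hYd⟩ := hY.exists_deriv
  have hγc : (γ : ℂ) + 1 ≠ 0 := by exact_mod_cast hγ
  have hic : (i : ℂ) + 1 ≠ 0 := by exact_mod_cast i.succ_ne_zero
  -- A defect occurs only when the degree is a natural number, so there is none in negative degree
  -- and exact homogeneity persists.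
  have hcγ : γ < 0 → c = 0 := fun h0 => hci.resolve_right fun h1 => by
    rw [h1] at h0; exact absurd h0 (not_lt.2 (Nat.cast_nonneg i))
  have hXd : ∀ z ∈ slitHP, HasUS (fun z => (γ + 1 : ℂ)⁻¹ * (z.re * h z + z.im * Y z) -
      c / ((γ + 1) * (i + 1)) * (z.im : ℂ) ^ (i + 1)) (h z) (Y z) univ z := by
    intro z hz
    obtain ⟨hu, hdz⟩ := hd z hz
    obtain ⟨hYz, hYe⟩ := hYd z hz
    have he : (z.re : ℂ) * hu + z.im * hs z = γ * h z := by
      have h1 := euler_of_homogeneous (fun t ht z _ => homSpace.apply_mul hh ht z) hz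
        (HasD.mono hdz (subset_univ slitHP))
      rw [← h1]
      have h2 : (starRingEnd ℂ) z = z.re - z.im * Complex.I := by
        apply Complex.ext <;> simp
      have h3 := Complex.re_add_im z
      rw [h2]
      linear_combination (1 / 2) * (hu - Complex.I * hs z) * h3 + z.im * hs z * Complex.I_sq
    refine ((((HasUS.re.mul hdz).add (HasUS.im.mul hYz)).const_mul _).sub
      ((HasUS.im_pow i).const_mul _)).cast ?_ ?_
    · field_simp
      linear_combination (i + 1 : ℂ) * he
    · field_simp
      linear_combination hYe
  refine ⟨_, ⟨c / (i + 1), i + 1, Y, ?_, fun z hz => ⟨hXd z hz, ?_⟩⟩, ?_, ?_⟩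
  · rcases hci with h1 | h1
    · left; simp [h1]
    · right; push_cast; rw [h1]
  · push_cast
    field_simp
    ring
  · intro hneg t ht z hz
    have hc0 := hcγ (by linarith)
    have hYt := hY.homogeneous (by linarith) t ht z hz
    rw [hYt, homSpace.apply_mul hh ht, hc0, Real.rpow_add_one ht.ne']
    simp only [Complex.re_ofReal_mul, Complex.im_ofReal_mul]
    push_cast
    ring
  · obtain ⟨C₁, hC₁, hb₁⟩ := homSpace.exists_bound hh
    obtain ⟨C₂, hC₂, hb₂⟩ := hY.sym 0
    refine sym_of_hasUS hh hY.sym hXd (C₀ := ‖(γ + 1 : ℂ)⁻¹‖ * (C₁ + C₂) + ‖c / ((γ + 1) * (i + 1))‖)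
      (by positivity) fun z hz => ?_
    have hn : 0 < ‖z‖ := norm_pos_iff.2 hz.2
    have e1 : ‖(z.re : ℂ) * h z‖ ≤ logWeight (γ + 1) C₁ ‖z‖ := by
      rw [norm_mul, Complex.norm_real]
      refine le_trans ?_ (rpow_le_logWeight hn.le hC₁)
      rw [Real.rpow_add_one hn.ne', ← mul_assoc, mul_comm]
      exact mul_le_mul (hb₁ z hz.2) (Complex.abs_re_le_norm z) (norm_nonneg _) (by positivity)
    have e2 : ‖(z.im : ℂ) * Y z‖ ≤ logWeight (γ + 1) C₂ ‖z‖ := by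
      rw [norm_mul, Complex.norm_real]
      have h1 := hb₂ z hz
      have h2 := logWeight_le_div (κ := γ) hn hC₂
      rw [le_div_iff₀ hn] at h2
      refine le_trans ?_ h2
      rw [mul_comm]
      exact mul_le_mul h1 (Complex.abs_im_le_norm z) (norm_nonneg _) (logWeight_nonneg hn.le hC₂)
    have e3 : ‖c / ((γ + 1) * (i + 1)) * (z.im : ℂ) ^ (i + 1)‖ ≤
        logWeight (γ + 1) ‖c / ((γ + 1) * (i + 1))‖ ‖z‖ := by
      rcases hci with h1 | h1
      · simp [h1, logWeight]
      · refine le_trans ?_ (rpow_le_logWeight hn.le (norm_nonneg _))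
        rw [norm_mul, norm_pow, Complex.norm_real, h1]
        have : ‖z‖ ^ ((i : ℝ) + 1) = ‖z‖ ^ (i + 1) := by
          rw [← Real.rpow_natCast]; push_cast; rfl
        rw [this]
        refine mul_le_mul_of_nonneg_left ?_ (norm_nonneg _)
        exact pow_le_pow_left₀ (norm_nonneg _) (Complex.abs_im_le_norm z) _
    refine (norm_sub_le _ _).trans ?_
    rw [norm_mul]
    have e4 := mul_le_mul_of_nonneg_left ((norm_add_le _ _).trans (add_le_add e1 e2))
      (norm_nonneg (γ + 1 : ℂ)⁻¹)
    refine (add_le_add e4 e3).trans (le_of_eq ?_)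
    simp only [logWeight]
    ring

lemma neg_I_mul_eq {z : ℂ} : z = (‖z‖ : ℂ) * (Complex.I * Complex.exp ((-Complex.I * z).arg * Complex.I)) := by
  have h1 := Complex.norm_mul_exp_arg_mul_I (-Complex.I * z)
  have h2 : ‖-Complex.I * z‖ = ‖z‖ := by simp
  rw [h2] at h1
  linear_combination (-Complex.I) * h1 + z * Complex.I_sq

lemma I_mul_exp_mem {θ : ℝ} (hθ : θ ∈ Ioo (-Real.pi) Real.pi) :
    Complex.I * Complex.exp (θ * Complex.I) ∈ slitHP := by
  by_cases hs : Real.sin θ = 0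
  · left
    have : θ = 0 := by
      rcases lt_trichotomy θ 0 with h1 | h1 | h1
      · exact absurd hs (Real.sin_neg_of_neg_of_neg_pi_lt h1 hθ.1).ne
      · exact h1
      · exact absurd hs (Real.sin_pos_of_pos_of_lt_pi h1 hθ.2).ne'
    simp [this]
  · right
    simpa [Complex.exp_ofReal_mul_I_re, Complex.exp_ofReal_mul_I_im] using hs

/-- In degree 0 the division by γ + 1 fails. Instead u h + s Y is a constant k, so in polar
coordinates h du + Y ds = k dr/r + q(θ) dθ, and k log r + ∫ q dθ is the primitive. The constant k
becomes the defect c s ^ 0. -/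
lemma IsPrim.step_log (hh : h ∈ homSpace (-1)) (hd : ∀ z ∈ slitHP, ∃ hu, HasUS h hu (hs z) univ z)
    (hY : IsPrim (-1) hs Y) : ∃ X, IsPrim 0 h X := by
  obtain ⟨c, i, Ys, hci, hYd⟩ := hY.exists_deriv
  have hc0 : c = 0 := hci.resolve_right fun h1 => by
    have := Nat.cast_nonneg (α := ℝ) i; linarith
  subst hc0
  simp only [zero_mul, add_zero] at hYd
  have he : ∀ z ∈ slitHP, ∀ hu, HasUS h hu (hs z) univ z → (z.re : ℂ) * hu + z.im * hs z = -h z := by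
    intro z hz hu hdz
    have h1 := euler_of_homogeneous (fun t ht z _ => homSpace.apply_mul hh ht z) hz
      (HasD.mono hdz (subset_univ slitHP))
    push_cast at h1
    have h2 : (starRingEnd ℂ) z = z.re - z.im * Complex.I := by
      apply Complex.ext <;> simp
    have h3 := Complex.re_add_im z
    rw [h2] at h1
    linear_combination h1 + (1 / 2) * (hu - Complex.I * hs z) * h3 + z.im * hs z * Complex.I_sq
  have hconst : ∃ k : ℂ, ∀ z ∈ slitHP, (z.re : ℂ) * h z + z.im * Y z = k := by
    have hderiv : ∀ z ∈ slitHP, HasFDerivAt (fun z : ℂ => (z.re : ℂ) * h z + z.im * Y z)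
        (0 : ℂ →L[ℝ] ℂ) z := by
      intro z hz
      obtain ⟨hu, hdz⟩ := hd z hz
      obtain ⟨hYz, hYe⟩ := hYd z hz
      have h1 := he z hz hu hdz
      have h2 : HasUS (fun z : ℂ => (z.re : ℂ) * h z + z.im * Y z) 0 0 univ z := by
        refine ((HasUS.re.mul hdz).add (HasUS.im.mul hYz)).cast ?_ ?_
        · linear_combination h1
        · push_cast at hYe
          linear_combination hYe
      have h3 := hasFDerivWithinAt_univ.1 h2
      have h4 : wirt ((0 - Complex.I * 0) / 2) ((0 + Complex.I * 0) / 2) = 0 := by ext v; simp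
      rwa [h4] at h3
    -- Multiplication by I carries the standard slit plane, which is star-shaped about 1, onto
    -- `slitHP`.
    have hpre : IsPreconnected slitHP := by
      have : slitHP = (fun z => Complex.I * z) '' Complex.slitPlane := by
        ext z
        refine ⟨fun hz => ⟨-Complex.I * z, neg_I_mul_mem_slitPlane hz, ?_⟩, ?_⟩
        · linear_combination (-z) * Complex.I_sq
        · rintro ⟨w, hw, rfl⟩
          rw [Complex.mem_slitPlane_iff] at hw
          simpa [slitHP] using hw
      rw [this]
      refine IsPreconnected.image ?_ _ (by fun_prop)
      exact (Complex.starConvex_one_slitPlane.isPathConnected (Or.inl (by simp))).isConnected.isPreconnected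
    obtain ⟨k, hk⟩ := isOpen_slitHP.exists_is_const_of_fderiv_eq_zero hpre
      (fun z hz => (hderiv z hz).differentiableAt.differentiableWithinAt)
      (fun z hz => (hderiv z hz).fderiv)
    exact ⟨k, hk⟩
  obtain ⟨k, hk⟩ := hconst
  -- The angular component u Y - s h on the unit circle, with the angle measured from the positive
  -- imaginary axis. In degree -1 this component is constant along rays.
  set q : ℝ → ℂ := fun θ => (Complex.I * Complex.exp (θ * Complex.I)).re *
    Y (Complex.I * Complex.exp (θ * Complex.I)) - (Complex.I * Complex.exp (θ * Complex.I)).im *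
    h (Complex.I * Complex.exp (θ * Complex.I)) with hq
  have hYc : ContinuousOn Y slitHP := fun z hz =>
    HasD.continuousWithinAt (HasD.mono (hYd z hz).1 (subset_univ slitHP))
  have hqc : ContinuousOn q (Ioo (-Real.pi) Real.pi) := by
    have h1 : ContinuousOn (fun θ : ℝ => Complex.I * Complex.exp (θ * Complex.I))
        (Ioo (-Real.pi) Real.pi) := by fun_prop
    have hm : MapsTo (fun θ : ℝ => Complex.I * Complex.exp (θ * Complex.I)) (Ioo (-Real.pi) Real.pi)
        slitHP := fun θ hθ => I_mul_exp_mem hθ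
    exact ((Complex.continuous_ofReal.comp Complex.continuous_re).comp_continuousOn h1 |>.mul
      (hYc.comp h1 hm)).sub
      ((Complex.continuous_ofReal.comp Complex.continuous_im).comp_continuousOn h1 |>.mul
      ((homSpace.continuousOn hh).comp h1 hm))
  have hqz : ∀ z ∈ slitHP, q (-Complex.I * z).arg = z.re * Y z - z.im * h z := by
    intro z hz
    have hn : 0 < ‖z‖ := norm_pos_iff.2 (ne_zero_of_mem_slitHP hz)
    have harg := (Complex.mem_slitPlane_iff_arg.1 (neg_I_mul_mem_slitPlane hz)).1
    have hw := I_mul_exp_mem ⟨Complex.neg_pi_lt_arg _, lt_of_le_of_ne (Complex.arg_le_pi _) harg⟩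
    set w := Complex.I * Complex.exp ((-Complex.I * z).arg * Complex.I) with hwdef
    have hzw : z = (‖z‖ : ℂ) * w := neg_I_mul_eq
    have h1 := hY.homogeneous (by norm_num) ‖z‖ hn w hw
    have h2 := homSpace.apply_mul hh hn w
    rw [← hzw] at h1 h2
    have hre : z.re = ‖z‖ * w.re := by
      conv_lhs => rw [hzw]
      simp
    have him : z.im = ‖z‖ * w.im := by
      conv_lhs => rw [hzw]
      simp
    have hnc : (‖z‖ : ℂ) ≠ 0 := by exact_mod_cast hn.ne'
    rw [h1, h2, hre, him, Real.rpow_neg_one]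
    change (w.re : ℂ) * Y w - w.im * h w = _
    push_cast
    field_simp
  set Q : ℝ → ℂ := fun θ => ∫ τ in (0 : ℝ)..θ, q τ with hQ
  have hQd : ∀ θ ∈ Ioo (-Real.pi) Real.pi, HasDerivAt Q (q θ) θ := by
    intro θ hθ
    have hsub : uIcc 0 θ ⊆ Ioo (-Real.pi) Real.pi :=
      OrdConnected.uIcc_subset ordConnected_Ioo ⟨neg_lt_zero.2 Real.pi_pos, Real.pi_pos⟩ hθ
    refine intervalIntegral.integral_hasDerivAt_right ((hqc.mono hsub).intervalIntegrable)
      (hqc.stronglyMeasurableAtFilter isOpen_Ioo _ hθ) (hqc.continuousAt (isOpen_Ioo.mem_nhds hθ))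
  have hXd : ∀ z ∈ slitHP, HasUS (fun z => k * (Real.log ‖z‖ : ℂ) + Q (-Complex.I * z).arg)
      (h z) (Y z) univ z := by
    intro z hz
    have hz0 := ne_zero_of_mem_slitHP hz
    have hslit := neg_I_mul_mem_slitPlane hz
    have harg := (Complex.mem_slitPlane_iff_arg.1 hslit).1
    have hL : HasDerivAt (fun z : ℂ => Complex.log (-Complex.I * z)) (1 / z) z := by
      have h1 : HasDerivAt (fun z : ℂ => -Complex.I * z) (-Complex.I) z := by
        simpa using (hasDerivAt_id z).const_mul (-Complex.I)
      refine (h1.clog hslit).congr_deriv ?_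
      field_simp [Complex.I_ne_zero]
    have hL' : HasFDerivAt (fun z : ℂ => Complex.log (-Complex.I * z)) (wirt (1 / z) 0) z :=
      hasFDerivWithinAt_univ.1 (HasD.of_hasDerivAt (A := univ) hL)
    have hre := Complex.ofRealCLM.hasFDerivAt.comp z (Complex.reCLM.hasFDerivAt.comp z hL')
    have him := (hQd _ ⟨Complex.neg_pi_lt_arg _,
      lt_of_le_of_ne (Complex.arg_le_pi _) harg⟩).hasFDerivAt.comp z
      (show HasFDerivAt (fun z : ℂ => (-Complex.I * z).arg) (Complex.imCLM.comp (wirt (1 / z) 0)) z by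
        have := Complex.imCLM.hasFDerivAt.comp z hL'
        refine this.congr_of_eventuallyEq (Eventually.of_forall fun y => ?_)
        simp [Complex.log_im])
    have hre' : HasFDerivAt (fun z : ℂ => (Real.log ‖z‖ : ℂ))
        (Complex.ofRealCLM.comp (Complex.reCLM.comp (wirt (1 / z) 0))) z := by
      refine hre.congr_of_eventuallyEq (Eventually.of_forall fun y => ?_)
      simp [Complex.log_re]
    have h1 : HasUS (fun z : ℂ => (Real.log ‖z‖ : ℂ)) ((1 / z).re : ℂ) ((1 / z * Complex.I).re : ℂ) univ z :=
      HasUS.of_hasFDerivAt hre' (by simp) (by simp)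
    have h2 : HasUS (fun z : ℂ => Q (-Complex.I * z).arg) (((1 / z).im : ℂ) * q (-Complex.I * z).arg)
        (((1 / z * Complex.I).im : ℂ) * q (-Complex.I * z).arg) univ z :=
      HasUS.of_hasFDerivAt him (by simp) (by simp)
    have hns : (Complex.normSq z : ℂ) ≠ 0 := by
      exact_mod_cast (Complex.normSq_pos.2 hz0).ne'
    have hns' : (Complex.normSq z : ℂ) = z.re * z.re + z.im * z.im := by
      rw [Complex.normSq_apply]; push_cast; ring
    refine ((h1.const_mul k).add h2).cast ?_ ?_
    · rw [hqz z hz, ← hk z hz]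
      simp only [one_div, Complex.inv_re, Complex.inv_im]
      push_cast
      field_simp
      rw [hns']; ring
    · rw [hqz z hz, ← hk z hz]
      simp only [one_div, Complex.mul_I_re, Complex.mul_I_im, Complex.inv_re, Complex.inv_im]
      push_cast
      field_simp
      rw [hns']; ring
  refine ⟨_, ⟨k, 0, Y, Or.inr (by simp), fun z hz => ⟨hXd z hz, ?_⟩⟩, fun h0 => absurd h0 (lt_irrefl _), ?_⟩
  · rw [hk z hz]; simp
  -- On the closed upper half-plane the argument of -i z stays in the compact interval [-π/2, π/2],
  -- so the angular part is bounded there.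
  · have hIcc : Icc (-(Real.pi / 2)) (Real.pi / 2) ⊆ Ioo (-Real.pi) Real.pi := fun θ hθ =>
      ⟨by linarith [hθ.1, Real.pi_pos], by linarith [hθ.2, Real.pi_pos]⟩
    obtain ⟨C, hC⟩ := isCompact_Icc.exists_bound_of_continuousOn
      (fun θ hθ => (hQd θ (hIcc hθ)).continuousAt.continuousWithinAt :
        ContinuousOn Q (Icc (-(Real.pi / 2)) (Real.pi / 2)))
    have := sym_of_hasUS (κ := -1) hh hY.sym hXd (C₀ := ‖k‖ + |C|) (by positivity) ?_
    · simpa using this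
    · intro z hz
      have harg : (-Complex.I * z).arg ∈ Icc (-(Real.pi / 2)) (Real.pi / 2) := by
        rw [mem_Icc, ← abs_le, Complex.abs_arg_le_pi_div_two_iff]
        simpa using hz.1
      refine (norm_add_le _ _).trans ?_
      have e1 := (hC _ harg).trans (le_abs_self C)
      rw [norm_mul, Complex.norm_real, Real.norm_eq_abs]
      simp only [logWeight, neg_add_cancel, Real.rpow_zero, le_refl, if_true, one_mul]
      have := mul_nonneg (abs_nonneg C) (abs_nonneg (Real.log ‖z‖))
      nlinarith [norm_nonneg k]

end step

end SaddleSector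

/-! ### The obstruction as a sum of reciprocal Gamma values -/

namespace SaddleSector

open Set Filter Topology MeasureTheory
open scoped FourierTransform

/-- The Laplace transform of a power. -/
lemma laplace_rpow {b : ℝ} (hb : 0 < b) {w : ℂ} (hw : 0 < w.re) :
    ∫ t in Ioi (0 : ℝ), ((t ^ (b - 1) : ℝ) : ℂ) * Complex.exp (-(w * t)) = Complex.Gamma b * w ^ (-b : ℂ) := by
  -- With this measure the Laplace transform becomes a complex moment generating function, hence
  -- analytic for Re w > 0; the formula on the positive reals then extends by the identity theorem.
  set μ : Measure ℝ := (volume.restrict (Ioi 0)).withDensity (fun t => ENNReal.ofReal (t ^ (b - 1)))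
    with hμ
  have hmeas : Measurable fun t : ℝ => ENNReal.ofReal (t ^ (b - 1)) := by fun_prop
  have hlt : ∀ᵐ t ∂(volume.restrict (Ioi (0 : ℝ))), ENNReal.ofReal (t ^ (b - 1)) < ∞ :=
    Eventually.of_forall fun t => ENNReal.ofReal_lt_top
  have hmgf : ∀ z : ℂ, ProbabilityTheory.complexMGF (fun t : ℝ => -t) μ z =
      ∫ t in Ioi (0 : ℝ), ((t ^ (b - 1) : ℝ) : ℂ) * Complex.exp (-(z * t)) := by
    intro z
    rw [ProbabilityTheory.complexMGF, hμ, integral_withDensity_eq_integral_toReal_smul hmeas hlt]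
    refine setIntegral_congr_fun measurableSet_Ioi fun t ht => ?_
    rw [ENNReal.toReal_ofReal (Real.rpow_nonneg (le_of_lt ht) _), Complex.real_smul]
    push_cast
    rw [mul_neg]
  have hset : Ioi (0 : ℝ) ⊆ interior (ProbabilityTheory.integrableExpSet (fun t : ℝ => -t) μ) := by
    refine interior_maximal (fun x hx => ?_) isOpen_Ioi
    have h1 : IntegrableOn (fun t : ℝ => t ^ (b - 1) * Real.exp (-x * t ^ (1 : ℝ))) (Ioi 0) :=
      integrableOn_rpow_mul_exp_neg_mul_rpow (by linarith) one_pos hx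
    rw [ProbabilityTheory.integrableExpSet, mem_ofPred_eq, hμ,
      integrable_withDensity_iff_integrable_smul' hmeas hlt]
    refine IntegrableOn.congr_fun h1 (fun t ht => ?_) measurableSet_Ioi
    rw [ENNReal.toReal_ofReal (Real.rpow_nonneg (le_of_lt ht) _), smul_eq_mul, Real.rpow_one]
    ring_nf
  set U : Set ℂ := {z | 0 < z.re} with hU
  have hUo : IsOpen U := isOpen_lt continuous_const Complex.continuous_re
  have hUc : IsPreconnected U := (convex_halfSpace_re_gt 0).isPreconnected
  have hf : AnalyticOnNhd ℂ (ProbabilityTheory.complexMGF (fun t : ℝ => -t) μ) U := by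
    refine DifferentiableOn.analyticOnNhd ?_ hUo
    exact (ProbabilityTheory.differentiableOn_complexMGF).mono fun z hz => hset hz
  have hg : AnalyticOnNhd ℂ (fun z : ℂ => Complex.Gamma b * z ^ (-b : ℂ)) U := by
    refine DifferentiableOn.analyticOnNhd (fun z hz => ?_) hUo
    exact ((differentiableAt_id.cpow_const (Or.inl hz)).const_mul _).differentiableWithinAt
  have hreal : ∀ x : ℝ, 0 < x → ProbabilityTheory.complexMGF (fun t : ℝ => -t) μ x =
      Complex.Gamma b * (x : ℂ) ^ (-b : ℂ) := by
    intro x hx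
    rw [hmgf]
    have h1 := Complex.integral_cpow_mul_exp_neg_mul_Ioi (a := b) (r := x) (by simpa using hb) hx
    rw [one_div, Complex.inv_cpow _ _ (by rw [Complex.arg_ofReal_of_nonneg hx.le]; exact Real.pi_pos.ne),
      ← Complex.cpow_neg, mul_comm] at h1
    rw [← h1]
    refine setIntegral_congr_fun measurableSet_Ioi fun t ht => ?_
    rw [Complex.ofReal_cpow (le_of_lt ht)]
    push_cast
    rfl
  -- Agreement at the reals x > 1 accumulating at 1 is enough for the identity theorem.
  have hfreq : ∃ᶠ z in 𝓝[≠] (1 : ℂ), ProbabilityTheory.complexMGF (fun t : ℝ => -t) μ z =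
      Complex.Gamma b * z ^ (-b : ℂ) := by
    have ht : Tendsto (fun x : ℝ => (x : ℂ)) (𝓝[>] 1) (𝓝[≠] (1 : ℂ)) := by
      refine tendsto_nhdsWithin_iff.2 ⟨?_, ?_⟩
      · exact (Complex.continuous_ofReal.tendsto' 1 1 (by simp)).mono_left nhdsWithin_le_nhds
      · filter_upwards [self_mem_nhdsWithin] with x hx
        have : x ≠ 1 := (ne_of_gt hx)
        simpa using this
    refine ht.frequently (Eventually.frequently ?_)
    filter_upwards [self_mem_nhdsWithin] with x hx
    exact hreal x (one_pos.trans hx)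
  rw [← hmgf]
  exact hf.eqOn_of_preconnected_of_frequently_eq hg hUc (z₀ := 1) (by simp [hU]) hfreq hw

/-- The density `t ^ (a - 1) e ^ (-2πt)` on the positive half-line. -/
noncomputable def gammaFun (a t : ℝ) : ℂ := (((max t 0) ^ (a - 1) * Real.exp (-(2 * Real.pi * t)) : ℝ) : ℂ)

/-- The condition 1 < a makes the density vanish continuously at 0, as needed for pointwise Fourier
inversion. -/
lemma continuous_gammaFun {a : ℝ} (ha : 1 < a) : Continuous (gammaFun a) := by
  refine Complex.continuous_ofReal.comp (Continuous.mul ?_ (by fun_prop))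
  exact (continuous_id.max continuous_const).rpow_const fun t => Or.inr (by linarith)

lemma gammaFun_of_nonpos {a : ℝ} (ha : 1 < a) {t : ℝ} (ht : t ≤ 0) : gammaFun a t = 0 := by
  rw [gammaFun, max_eq_right ht, Real.zero_rpow (by linarith)]; simp

lemma gammaFun_of_pos {a t : ℝ} (ht : 0 < t) :
    gammaFun a t = ((t ^ (a - 1) : ℝ) : ℂ) * Complex.exp (-(2 * Real.pi * t)) := by
  rw [gammaFun, max_eq_left ht.le]; push_cast; rfl

lemma integrable_gammaFun {a : ℝ} (ha : 1 < a) : Integrable (gammaFun a) := by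
  rw [← integrableOn_univ, ← Iic_union_Ioi (a := (0 : ℝ))]
  refine IntegrableOn.union ?_ ?_
  · exact integrableOn_zero.congr_fun (fun t ht => (gammaFun_of_nonpos ha ht).symm) measurableSet_Iic
  · have h1 : IntegrableOn (fun t : ℝ => t ^ (a - 1) * Real.exp (-(2 * Real.pi) * t ^ (1 : ℝ))) (Ioi 0) :=
      integrableOn_rpow_mul_exp_neg_mul_rpow (by linarith) one_pos (by positivity)
    refine (Integrable.ofReal (𝕜 := ℂ) h1).congr ?_
    filter_upwards [ae_restrict_mem measurableSet_Ioi] with t ht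
    rw [gammaFun, max_eq_left (le_of_lt ht), Real.rpow_one, neg_mul]; rfl

lemma pw_line (a v : ℝ) : pw (-a) (((2 * Real.pi : ℝ) : ℂ) * (v + Complex.I)) =
    (((2 * Real.pi) ^ (-a) : ℝ) : ℂ) * pw (-a) (v + Complex.I) := pw_mul _ (by positivity) _

/-- The inverse Fourier transform at v is the Laplace transform of t ^ (a - 1) at w = 2π(1 - i v),
and w = -i · 2π(v + i). -/
lemma fourierInv_gammaFun {a : ℝ} (ha : 1 < a) (v : ℝ) :
    𝓕⁻ (gammaFun a) v = Complex.Gamma a * pw (-a) (((2 * Real.pi : ℝ) : ℂ) * (v + Complex.I)) := by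
  rw [Real.fourierInv_eq' (gammaFun a) v, ← setIntegral_eq_integral_of_forall_compl_eq_zero (s := Ioi 0)]
  · have hw : 0 < ((2 * Real.pi : ℝ) * (1 - v * Complex.I) : ℂ).re := by
      simp [Real.pi_pos]
    have h1 := laplace_rpow (b := a) (by linarith) hw
    rw [pw]
    have e : -Complex.I * (((2 * Real.pi : ℝ) : ℂ) * (v + Complex.I)) =
        (2 * Real.pi : ℝ) * (1 - v * Complex.I) := by
      linear_combination (-((2 * Real.pi : ℝ) : ℂ)) * Complex.I_sq
    rw [e, Complex.ofReal_neg, ← h1]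
    refine setIntegral_congr_fun measurableSet_Ioi fun t ht => ?_
    rw [gammaFun_of_pos ht, smul_eq_mul, mul_left_comm, ← Complex.exp_add]
    congr 2
    simp
    ring
  · intro t ht
    rw [gammaFun_of_nonpos ha (not_lt.1 ht), smul_zero]

lemma fourier_gammaFun {a : ℝ} (ha : 1 < a) (v : ℝ) :
    𝓕 (gammaFun a) v = Complex.Gamma a *
      (starRingEnd ℂ) (pw (-a) (((2 * Real.pi : ℝ) : ℂ) * (v + Complex.I))) := by
  have h1 : (starRingEnd ℂ) (𝓕⁻ (gammaFun a) v) = 𝓕 (gammaFun a) v := by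
    rw [Real.fourierInv_eq' (gammaFun a) v, Real.fourier_eq' (gammaFun a) v, ← integral_conj]
    congr 1
    ext t
    rw [smul_eq_mul, smul_eq_mul, map_mul, ← Complex.exp_conj]
    congr 2
    · simp [Complex.conj_ofNat]
    · exact Complex.conj_ofReal _
  rw [← h1, fourierInv_gammaFun ha, map_mul, Complex.Gamma_ofReal, Complex.conj_ofReal]

lemma integrable_pw_line {a : ℝ} (ha : 1 < a) : Integrable fun v : ℝ => pw (-a) (v + Complex.I) := by
  have h1 := integrable_line (γ := -a) (h := mono (-a) 0) (by linarith) (mono_mem (by ring))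
    (z := Complex.I) (by simp)
  refine h1.congr (Eventually.of_forall fun v => ?_)
  have h2 : (v : ℂ) + Complex.I ≠ 0 := fun h => by simpa using congrArg Complex.im h
  simp [mono, pw, add_comm]

/-- The constant in the evaluation of `lineInt (mono α β)`, depending on the degree only. -/
noncomputable def lineConst (γ : ℝ) : ℂ :=
  (((2 * Real.pi) ^ (-γ) : ℝ) : ℂ) *
    ∫ t : ℝ, (((max t 0) ^ (-γ - 2) * Real.exp (-(4 * Real.pi * t)) : ℝ) : ℂ)

/-- On the line im = 1 the two factors of `mono (-a) (-b)` are, up to constants and the factors 1/Γ,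
the inverse Fourier and the Fourier transform of Gamma densities. Parseval turns the line integral
into the integral of the product of the densities, which sees only a + b. -/
lemma lineInt_mono {α β : ℝ} (hα : α < -1) (hβ : β < -1) :
    lineInt (mono α β) = lineConst (α + β) * (((Real.Gamma (-α))⁻¹ * (Real.Gamma (-β))⁻¹ : ℝ) : ℂ) := by
  obtain ⟨a, rfl⟩ : ∃ a, α = -a := ⟨-α, by ring⟩
  obtain ⟨b, rfl⟩ : ∃ b, β = -b := ⟨-β, by ring⟩
  have ha : 1 < a := by linarith
  have hb : 1 < b := by linarith
  have hFi : ∀ {a : ℝ}, 1 < a → Integrable (𝓕⁻ (gammaFun a)) := by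
    intro a ha
    refine ((integrable_pw_line ha).const_mul (Complex.Gamma a * (((2 * Real.pi) ^ (-a) : ℝ) : ℂ))).congr
      (Eventually.of_forall fun v => ?_)
    simp only
    rw [fourierInv_gammaFun ha, pw_line, mul_assoc]
  have hFF : 𝓕 (𝓕⁻ (gammaFun a)) = gammaFun a := by
    refine (continuous_gammaFun ha).fourier_fourierInv_eq (integrable_gammaFun ha) ?_
    refine (Complex.conjCLE.toContinuousLinearMap.integrable_comp ((integrable_pw_line ha).const_mul
      (Complex.Gamma a * (((2 * Real.pi) ^ (-a) : ℝ) : ℂ)))).congr (Eventually.of_forall fun v => ?_)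
    rw [fourier_gammaFun ha, pw_line]
    simp [Complex.Gamma_ofReal, mul_assoc]
  -- The Fourier transform is moved from one factor to the other, where inversion cancels it.
  have key : ∫ v : ℝ, 𝓕 (gammaFun b) v • 𝓕⁻ (gammaFun a) v = ∫ t : ℝ, gammaFun b t • gammaFun a t := by
    have := VectorFourier.integral_fourierIntegral_smul_eq_flip (μ := (volume : Measure ℝ))
      (ν := (volume : Measure ℝ)) (L := innerₗ ℝ) Real.continuous_fourierChar continuous_inner
      (integrable_gammaFun hb) (hFi ha)
    rw [flip_innerₗ] at this
    have h2 : VectorFourier.fourierIntegral Real.fourierChar volume (innerₗ ℝ) (𝓕⁻ (gammaFun a)) =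
        gammaFun a := hFF
    rw [h2] at this
    exact this
  have h3 : ∀ v : ℝ, 𝓕 (gammaFun b) v • 𝓕⁻ (gammaFun a) v =
      (Complex.Gamma a * Complex.Gamma b * (((2 * Real.pi) ^ (-a + -b) : ℝ) : ℂ)) *
        mono (-a) (-b) (v + Complex.I) := by
    intro v
    rw [fourier_gammaFun hb, fourierInv_gammaFun ha, pw_line, pw_line, mono, smul_eq_mul,
      Real.rpow_add (by positivity), map_mul, Complex.conj_ofReal]
    push_cast
    ring
  have h4 : ∀ t : ℝ, gammaFun b t • gammaFun a t =
      (((max t 0) ^ (-(-a + -b) - 2) * Real.exp (-(4 * Real.pi * t)) : ℝ) : ℂ) := by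
    intro t
    rcases le_or_gt t 0 with ht | ht
    · rw [gammaFun_of_nonpos ha ht, max_eq_right ht, Real.zero_rpow (by linarith)]; simp
    · rw [gammaFun, gammaFun, smul_eq_mul, ← Complex.ofReal_mul, max_eq_left ht.le,
        show -(-a + -b) - 2 = (b - 1) + (a - 1) by ring, Real.rpow_add ht,
        show -(4 * Real.pi * t) = -(2 * Real.pi * t) + -(2 * Real.pi * t) by ring, Real.exp_add]
      push_cast; ring
  simp only [h3, h4] at key
  rw [integral_const_mul] at key
  have hGa : (Real.Gamma a : ℂ) ≠ 0 := by exact_mod_cast (Real.Gamma_pos_of_pos (by linarith)).ne'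
  have hGb : (Real.Gamma b : ℂ) ≠ 0 := by exact_mod_cast (Real.Gamma_pos_of_pos (by linarith)).ne'
  have hp : (((2 * Real.pi) ^ (-a + -b) : ℝ) : ℂ) ≠ 0 := by
    exact_mod_cast (Real.rpow_pos_of_pos (by positivity) _).ne'
  rw [lineConst, ← key, lineInt, Complex.Gamma_ofReal, Complex.Gamma_ofReal,
    Real.rpow_neg (by positivity) (-a + -b)]
  push_cast at hp ⊢
  simp only [neg_neg]
  field_simp

lemma rayInt_add_rayInt {γ : ℝ} {h : ℂ → ℂ} (hγ : γ < -1) (hh : h ∈ homSpace γ) :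
    rayInt 1 h Complex.I + rayInt (-1) h Complex.I = lineInt h := by
  have hi := integrable_line hγ hh (z := Complex.I) (by simp)
  have h1 : rayInt 1 h Complex.I = ∫ v in Iic (0 : ℝ), h (Complex.I + v) := by
    have := integral_comp_neg_Ioi (0 : ℝ) (fun v : ℝ => h (Complex.I + v))
    rw [neg_zero] at this
    rw [← this]
    simp [rayInt, sub_eq_add_neg]
  have h2 : rayInt (-1) h Complex.I = ∫ v in Ioi (0 : ℝ), h (Complex.I + v) := by
    simp [rayInt]
  rw [h1, h2, intervalIntegral.integral_Iic_add_Ioi hi.integrableOn hi.integrableOn]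
  simp only [lineInt, add_comm]

lemma lineInt_add {γ : ℝ} {g h : ℂ → ℂ} (hγ : γ < -1) (hg : g ∈ homSpace γ) (hh : h ∈ homSpace γ)
    (c d : ℂ) : lineInt (c • g + d • h) = c * lineInt g + d * lineInt h := by
  have h1 := integrable_line hγ hg (z := Complex.I) (by simp)
  have h2 := integrable_line hγ hh (z := Complex.I) (by simp)
  simp only [add_comm Complex.I] at h1 h2
  simp only [lineInt, Pi.add_apply, Pi.smul_apply, smul_eq_mul]
  rw [integral_add (h1.const_mul c) (h2.const_mul d), integral_const_mul, integral_const_mul]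

/-- The u-derivative ∂ + ∂̄ of a decaying function integrates to 0 over the line. So the two terms
of the s-derivative i(∂ - ∂̄) have equal integrals, and either one doubled gives the whole. -/
lemma lineInt_dsMono_succ {N : ℕ} {α β : ℝ} (h : α + β - N < -1) :
    lineInt (dsMono (N + 1) α β) = 2 * α * lineInt (dsMono N (α - 1) β) ∧
      lineInt (dsMono (N + 1) α β) = 2 * β * lineInt (dsMono N α (β - 1)) := by
  have ha : dsMono N (α - 1) β ∈ homSpace (α + β - N - 1) := by
    convert dsMono_mem N (α - 1) β using 2; ring
  have hb : dsMono N α (β - 1) ∈ homSpace (α + β - N - 1) := by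
    convert dsMono_mem N α (β - 1) using 2; ring
  have h' : α + β - N - 1 < -1 := by linarith
  have e1 : lineInt (dsMono (N + 1) α β) =
      α * lineInt (dsMono N (α - 1) β) + β * lineInt (dsMono N α (β - 1)) := lineInt_add h' ha hb _ _
  have ha' : (-Complex.I * α) • dsMono N (α - 1) β ∈ homSpace (α + β - N - 1) := Submodule.smul_mem _ _ ha
  have hb' : (Complex.I * β) • dsMono N α (β - 1) ∈ homSpace (α + β - N - 1) := Submodule.smul_mem _ _ hb
  have e2 : lineInt ((-Complex.I * α) • dsMono N (α - 1) β + (Complex.I * β) • dsMono N α (β - 1)) = 0 := by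
    have hI : Complex.I ∈ rayDom 1 := Or.inr (by simp)
    have hI' : Complex.I ∈ rayDom (-1) := Or.inr (by simp)
    have hd := fun (z : ℂ) (hz : z ∈ slitHP) (A : Set ℂ) => hasD_dsMono N α β hz A
    have h1 := rayInt_add (Or.inl rfl) h (dsMono_mem N α β) ha' hb' hd hI
    have h2 := rayInt_add (Or.inr rfl) h (dsMono_mem N α β) ha' hb' hd hI'
    have h3 := rayInt_add_rayInt h' ha'
    have h4 := rayInt_add_rayInt h' hb'
    have h5 := lineInt_add h' ha' hb' 1 1
    simp only [one_smul, one_mul] at h5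
    rw [h5, ← h3, ← h4]
    push_cast at h1 h2
    linear_combination h1 + h2
  rw [lineInt_add h' ha hb] at e2
  have e3 : (α : ℂ) * lineInt (dsMono N (α - 1) β) = β * lineInt (dsMono N α (β - 1)) := by
    linear_combination Complex.I * e2 + ((α : ℂ) * lineInt (dsMono N (α - 1) β) -
      β * lineInt (dsMono N α (β - 1))) * Complex.I_sq
  exact ⟨by rw [e1]; linear_combination -e3, by rw [e1]; linear_combination e3⟩

/-- Valid for every real s: the value 0 of Γ at its poles, with 0⁻¹ = 0, makes the inverse agree
with the entire function 1/Γ. -/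
lemma inv_Gamma_eq (s : ℝ) : (Real.Gamma s)⁻¹ = s * (Real.Gamma (s + 1))⁻¹ := by
  rcases eq_or_ne s 0 with rfl | hs
  · simp
  · rw [Real.Gamma_add_one hs, mul_inv, mul_inv_cancel_left₀ hs]

/-- A of the derivatives are charged to α and B to β, until both exponents are below -1. Each costs
a factor 2α = -2(-α), and -α merges with 1/Γ(-α + 1) into 1/Γ(-α), so the closed formula keeps its
form; likewise for β. -/
lemma lineInt_dsMono (A B : ℕ) (α β : ℝ) (hα : α - A < -1) (hβ : β - B < -1) :
    lineInt (dsMono (A + B) α β) = (-2) ^ (A + B) * lineConst (α + β - (A + B : ℕ)) *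
      (((Real.Gamma (-α))⁻¹ * (Real.Gamma (-β))⁻¹ : ℝ) : ℂ) := by
  induction A generalizing α with
  | zero =>
    induction B generalizing β with
    | zero =>
      simp only [CharP.cast_eq_zero, sub_zero] at hα hβ
      simpa [dsMono] using lineInt_mono hα hβ
    | succ B ih =>
      have h1 := ih (β - 1) (by push_cast at hβ; linarith)
      simp only [zero_add] at h1 ⊢
      rw [(lineInt_dsMono_succ (by push_cast at hα hβ ⊢; linarith)).2, h1, inv_Gamma_eq (-β),
        show -(β - 1) = -β + 1 by ring, show α + (β - 1) - (B : ℝ) = α + β - (B + 1 : ℕ) by push_cast; ring]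
      push_cast
      ring
  | succ A ih =>
    have h1 := ih (α - 1) (by push_cast at hα; linarith)
    rw [show A + 1 + B = (A + B) + 1 by ring,
      (lineInt_dsMono_succ (by push_cast at hα hβ ⊢; linarith)).1, h1, inv_Gamma_eq (-α),
      show -(α - 1) = -α + 1 by ring,
      show α - 1 + β - ((A + B : ℕ) : ℝ) = α + β - ((A + B + 1 : ℕ) : ℝ) by push_cast; ring]
    push_cast
    ring

/-- Primitives of homogeneous functions along horizontal lines: the obstruction to symbol estimates
is the sum of the coefficients weighted by reciprocals of Gamma values. -/
theorem exists_isPrim {ι : Type*} (s : Finset ι) (c : ι → ℂ) (α β : ι → ℝ) {γ : ℝ}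
    (hγ : ∀ i ∈ s, α i + β i = γ)
    (h0 : ∑ i ∈ s, c i * (((Real.Gamma (-α i))⁻¹ * (Real.Gamma (-β i))⁻¹ : ℝ) : ℂ) = 0) :
    ∃ E, IsPrim (γ + 1) (fun z => ∑ i ∈ s, c i * mono (α i) (β i) z) E := by
  set H : ℕ → ℂ → ℂ := fun N z => ∑ i ∈ s, c i * dsMono N (α i) (β i) z with hH
  have hHeq : ∀ N, H N = ∑ i ∈ s, c i • dsMono N (α i) (β i) := by
    intro N; ext z; simp [hH]
  have hmem : ∀ N : ℕ, ∀ i ∈ s, dsMono N (α i) (β i) ∈ homSpace (γ - N) := fun N i hi => by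
    rw [← hγ i hi]; exact dsMono_mem N _ _
  have hHmem : ∀ N : ℕ, H N ∈ homSpace (γ - N) := fun N => by
    rw [hHeq]
    exact Submodule.sum_mem _ fun i hi => Submodule.smul_mem _ _ (hmem N i hi)
  have hHd : ∀ N, ∀ z ∈ slitHP, ∃ hu, HasUS (H N) hu (H (N + 1) z) univ z := by
    intro N z hz
    have h1 := HasUS.of_hasD (HasD.sum (s := s) fun i _ =>
      (hasD_dsMono N (α i) (β i) hz univ).const_mul (c i))
    refine ⟨_, h1.cast rfl ?_⟩
    rw [← Finset.sum_sub_distrib, Finset.mul_sum]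
    refine Finset.sum_congr rfl fun i _ => ?_
    simp only [dsMono, Pi.add_apply, Pi.smul_apply, smul_eq_mul]
    linear_combination (-(c i) * (α i * dsMono N (α i - 1) (β i) z + β i * dsMono N (α i) (β i - 1) z)) *
      Complex.I_sq
  -- A brings every individual exponent below -1, B the common degree.
  obtain ⟨A, hA⟩ : ∃ A : ℕ, ∀ i ∈ s, α i - A < -1 ∧ β i - A < -1 := by
    obtain ⟨A, hA⟩ := exists_nat_gt (∑ i ∈ s, (|α i| + |β i|) + 1)
    refine ⟨A, fun i hi => ?_⟩
    have h1 := Finset.single_le_sum (f := fun i => |α i| + |β i|) (fun j _ => by positivity) hi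
    constructor
    · linarith [le_abs_self (α i), abs_nonneg (β i)]
    · linarith [le_abs_self (β i), abs_nonneg (α i)]
  obtain ⟨B, hB⟩ : ∃ B : ℕ, γ - B < -1 := by
    obtain ⟨B, hB⟩ := exists_nat_gt (γ + 1)
    exact ⟨B, by linarith⟩
  have hA' : ∀ i ∈ s, α i - (A + B : ℕ) < -1 ∧ β i - (A + B : ℕ) < -1 := fun i hi => by
    have h1 := hA i hi
    have h2 := Nat.cast_nonneg (α := ℝ) B
    push_cast
    exact ⟨by linarith [h1.1], by linarith [h1.2]⟩
  -- One half of the derivatives is spent on each exponent in `lineInt_dsMono`. The same M serves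
  -- all terms, so they share the constant (-2) ^ M * lineConst (γ - M).
  set M := (A + B) + (A + B) with hM
  have hMγ : γ - M < -1 := by
    rw [hM]; push_cast
    have h2 := Nat.cast_nonneg (α := ℝ) B
    have h3 := Nat.cast_nonneg (α := ℝ) A
    linarith
  have hline : lineInt (H M) = 0 := by
    have h1 : lineInt (H M) = ∑ i ∈ s, c i * lineInt (dsMono M (α i) (β i)) := by
      simp only [lineInt, hH]
      rw [integral_finsetSum]
      · simp only [integral_const_mul]
      · intro i hi
        have := integrable_line hMγ (hmem M i hi) (z := Complex.I) (by simp)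
        simp only [add_comm Complex.I] at this
        exact this.const_mul _
    rw [h1]
    have h2 : ∀ i ∈ s, c i * lineInt (dsMono M (α i) (β i)) = (-2) ^ M * lineConst (γ - M) *
        (c i * (((Real.Gamma (-α i))⁻¹ * (Real.Gamma (-β i))⁻¹ : ℝ) : ℂ)) := fun i hi => by
      rw [hM, lineInt_dsMono _ _ _ _ (hA' i hi).1 (hA' i hi).2, hγ i hi]; ring
    rw [Finset.sum_congr rfl h2, ← Finset.mul_sum, h0, mul_zero]
  -- Descent from M derivatives, where the ray primitive exists by balance, down to none; the
  -- logarithmic step occurs when the degree of the primitive is 0.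
  have hdesc : ∀ N ≤ M, ∃ E, IsPrim (γ - N + 1) (H N) E := by
    intro N hN
    induction hN using Nat.decreasingInduction with
    | self => exact ⟨_, isPrim_rayPrim hMγ (hHmem M) (balanced_of_lineInt hMγ (hHmem M) hline)⟩
    | of_succ N hN ih =>
      obtain ⟨Y, hY⟩ := ih
      have e : γ - ((N + 1 : ℕ) : ℝ) + 1 = γ - N := by push_cast; ring
      rw [e] at hY
      by_cases h1 : γ - N + 1 = 0
      · have h2 : γ - N = -1 := by linarith
        have h3 := hHmem N
        rw [h2] at h3 hY
        rw [h1]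
        exact IsPrim.step_log h3 (hHd N) hY
      · exact IsPrim.step (hHmem N) (hHd N) hY h1
  obtain ⟨E, hE⟩ := hdesc 0 (Nat.zero_le _)
  refine ⟨E, ?_⟩
  simpa [hH, dsMono] using hE

end SaddleSector

/-! ### The functionals: Gamma factors, sector phases and the polynomial range -/

namespace SaddleSector

open Set Filter Topology MeasureTheory

section gamma

lemma ringChoose_succ (r : ℝ) (n : ℕ) : ((n : ℝ) + 1) * Ring.choose r (n + 1) = Ring.choose r n * (r - n) := by
  have h := Ring.choose_add_smul_choose (r - n) 1 n
  rw [sub_add_cancel, Ring.choose_one_right, add_comm 1 n, Nat.choose_succ_self_right, nsmul_eq_mul] at h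
  exact_mod_cast h

/-- The ratio of binomial coefficients in `parDist`. -/
noncomputable def binomRatio (x y : ℝ) (n : ℕ) : ℝ := Ring.choose (x - 1) n / Ring.choose (-y) n

lemma binomRatio_zero (x y : ℝ) : binomRatio x y 0 = 1 := by simp [binomRatio]

lemma binomRatio_succ (x y : ℝ) (n : ℕ) :
    binomRatio x y (n + 1) = binomRatio x y n * ((x - 1 - n) / (-y - n)) := by
  have h1 := ringChoose_succ (x - 1) n
  have h2 := ringChoose_succ (-y) n
  have hn : (n : ℝ) + 1 ≠ 0 := by positivity
  rw [binomRatio, binomRatio, ← mul_div_mul_left _ _ hn, h1, h2, mul_div_mul_comm]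

/-- The successive quotients of both sides agree by the functional equation of Γ. In this form the
binomial weights of `parDist` complete the Beta factor of `secDist` to the Gamma products of the
other members of a residue class. -/
lemma binomRatio_eq {x y : ℝ} (hx : Real.Gamma x ≠ 0) (hy : Real.Gamma y ≠ 0)
    (hyn : ∀ n : ℕ, y ≠ -(n : ℝ)) (n : ℕ) : binomRatio x y n =
      (-1) ^ n * (Real.Gamma x * Real.Gamma y * ((Real.Gamma (x - n))⁻¹ * (Real.Gamma (y + n))⁻¹)) := by
  induction n with
  | zero =>
    rw [binomRatio_zero]
    simp only [CharP.cast_eq_zero, sub_zero, add_zero, pow_zero, one_mul]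
    field_simp
  | succ n ih =>
    have h1 : (Real.Gamma (x - (n + 1 : ℕ)))⁻¹ = (x - 1 - n) * (Real.Gamma (x - n))⁻¹ := by
      rw [inv_Gamma_eq, show x - (n + 1 : ℕ) + 1 = x - n by push_cast; ring]
      push_cast; ring
    have h2 : (Real.Gamma (y + n))⁻¹ = (y + n) * (Real.Gamma (y + (n + 1 : ℕ)))⁻¹ := by
      rw [inv_Gamma_eq, show y + n + 1 = y + (n + 1 : ℕ) by push_cast; ring]
    have h3 : y + n ≠ 0 := fun h => hyn n (by linarith)
    have h4 : -y - n ≠ 0 := fun h => h3 (by linarith)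
    rw [binomRatio_succ, ih, h1, h2, pow_succ]
    field_simp
    ring

lemma gammaExt_eq {x : ℝ} (hx : ∀ n : ℕ, x ≠ -(n : ℝ)) : gammaExt x = Real.Gamma x :=
  if_neg (hx _)

/-- The convention at the poles keeps this factor nonzero; in `secDist` it depends on the degree
alone and can therefore be cancelled. -/
lemma gammaExt_ne_zero (x : ℝ) : gammaExt x ≠ 0 := by
  rw [gammaExt]
  split_ifs with h
  · exact one_div_ne_zero (mul_ne_zero (pow_ne_zero _ (by norm_num)) (by positivity))
  · refine Real.Gamma_ne_zero fun n hn => h ?_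
    rw [hn, neg_neg, Nat.floor_natCast]

end gamma

section classes

variable {m j : ℕ}

/-- The exponents `(m - 1 - p) / m` entering the Gamma factors. -/
noncomputable def gexp (m p : ℕ) : ℝ := ((m : ℝ) - 1 - p) / m

/-- In this residue class the exponent is a pole of Γ, so the term is invisible to the obstruction.
-/
lemma inv_Gamma_gexp (hm : 0 < m) {p : ℕ} (hp : p % m = m - 1) : (Real.Gamma (gexp m p))⁻¹ = 0 := by
  have h1 : gexp m p = -((p / m : ℕ) : ℝ) := by
    have h2 : (p : ℝ) = m * (p / m : ℕ) + (m - 1 : ℕ) := by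
      rw [← hp]; exact_mod_cast (Nat.div_add_mod p m).symm
    have h3 : (m : ℝ) ≠ 0 := by exact_mod_cast hm.ne'
    rw [gexp, h2, Nat.cast_sub hm]
    field_simp
    push_cast; ring
  rw [h1, Real.Gamma_neg_nat_eq_zero, inv_zero]

lemma relevant_mod (hm : 2 ≤ m) {p : ℕ} (hp : p ≤ j) (h1 : p % m ≠ m - 1) (h2 : (j - p) % m ≠ m - 1) :
    Relevant m j (p % m) := by
  have hlt := Nat.mod_lt p (show 0 < m by omega)
  refine ⟨(Nat.mod_le p m).trans hp, by omega, fun h => h2 ?_⟩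
  obtain ⟨c, hc⟩ := h.dvd
  have h3 : (p : ℤ) = m * (p / m : ℕ) + (p % m : ℕ) := by exact_mod_cast (Nat.div_add_mod p m).symm
  have h4 : ((j - p : ℕ) : ℤ) = ((m : ℤ) - 1) + m * (c - (p / m : ℕ)) := by
    rw [Nat.cast_sub hp]
    linear_combination hc - h3
  have h5 : (((j - p) % m : ℕ) : ℤ) = (m : ℤ) - 1 := by
    rw [Int.natCast_mod, h4, Int.add_mul_emod_self_left]
    exact Int.emod_eq_of_lt (by omega) (by omega)
  omega

lemma Relevant.lt (hm : 2 ≤ m) {i : ℕ} (h : Relevant m j i) : i < m := by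
  have := h.2.1; omega

lemma Relevant.gexp_pos (hm : 2 ≤ m) {i : ℕ} (h : Relevant m j i) : 0 < gexp m i := by
  have h1 := h.lt hm
  have h2 := h.2.1
  have h3 : (i : ℝ) + 2 ≤ m := by exact_mod_cast (by omega : i + 2 ≤ m)
  exact div_pos (by linarith) (by positivity)

/-- The excluded congruence is precisely the one for which the second exponent would be a pole of Γ.
-/
lemma Relevant.gexp_ne (hm : 2 ≤ m) {i : ℕ} (h : Relevant m j i) (n : ℕ) : gexp m (j - i) ≠ -(n : ℝ) := by
  intro h1
  have h3 : (m : ℝ) ≠ 0 := by positivity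
  rw [gexp, div_eq_iff h3, Nat.cast_sub h.1] at h1
  apply h.2.2
  refine Int.modEq_iff_dvd.2 ⟨n, ?_⟩
  have : ((j : ℤ) - ((m : ℤ) - 1) - i : ℤ) = m * n := by
    have h4 : (j : ℝ) - ((m : ℝ) - 1) - i = m * n := by linarith
    exact_mod_cast h4
  exact this

open scoped Classical in
/-- Summation over residue classes modulo `m`. -/
lemma sum_classes {E : Type*} [AddCommMonoid E] (hm : 2 ≤ m) (T : ℕ → E) :
    ∑ p ∈ (Finset.range (j + 1)).filter (fun p => Relevant m j (p % m)), T p =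
      ∑ i ∈ (Finset.range (j + 1)).filter (fun i => Relevant m j i),
        ∑ n ∈ Finset.range ((j - i) / m + 1), T (i + n * m) := by
  have hm0 : 0 < m := by omega
  rw [Finset.sum_sigma']
  refine Finset.sum_bij' (fun p _ => ⟨p % m, p / m⟩) (fun x _ => x.1 + x.2 * m) ?_ ?_ ?_ ?_ ?_
  · intro p hp
    simp only [Finset.mem_filter, Finset.mem_range, Finset.mem_sigma] at hp ⊢
    refine ⟨⟨(Nat.mod_le p m).trans_lt hp.1, hp.2⟩, ?_⟩
    rw [Nat.lt_succ_iff, Nat.le_div_iff_mul_le hm0]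
    have h1 := Nat.div_add_mod p m
    rw [mul_comm] at h1
    omega
  · intro x hx
    simp only [Finset.mem_filter, Finset.mem_range, Finset.mem_sigma] at hx ⊢
    obtain ⟨⟨h1, h2⟩, h3⟩ := hx
    rw [Nat.lt_succ_iff, Nat.le_div_iff_mul_le hm0] at h3
    refine ⟨by omega, ?_⟩
    rwa [Nat.add_mul_mod_self_right, Nat.mod_eq_of_lt (h2.lt hm)]
  · intro p _
    simp only
    rw [mul_comm]; exact Nat.mod_add_div p m
  · rintro ⟨i, n⟩ hx
    simp only [Finset.mem_filter, Finset.mem_range, Finset.mem_sigma] at hx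
    have h2 := hx.1.2.lt hm
    simp only [Nat.add_mul_mod_self_right, Nat.mod_eq_of_lt h2, Nat.add_mul_div_right _ _ hm0,
      Nat.div_eq_of_lt h2, zero_add]
  · intro p _
    simp only
    rw [mul_comm, Nat.mod_add_div]

end classes

section sector

variable {m j : ℕ}

/-- The phase of the monomial `ω ^ p * conj ω ^ (j - p)` on the sector of index `l`. -/
noncomputable def phase (m l j p : ℕ) : ℂ :=
  Complex.exp (Real.pi * Complex.I / m) ^ ((l : ℤ) * (2 * (p : ℤ) - (j : ℤ))) *
    Complex.exp (Complex.I * ((Real.pi / 2 * (gexp m (j - p) - gexp m p) : ℝ) : ℂ))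

lemma gexp_add (hm : 0 < m) (i n : ℕ) : gexp m (i + n * m) = gexp m i - n := by
  have : (m : ℝ) ≠ 0 := by positivity
  rw [gexp, gexp]; push_cast; field_simp; ring

lemma gexp_sub (hm : 0 < m) {i n : ℕ} (h : i + n * m ≤ j) :
    gexp m (j - (i + n * m)) = gexp m (j - i) + n := by
  have : (m : ℝ) ≠ 0 := by positivity
  rw [gexp, gexp, Nat.cast_sub h, Nat.cast_sub ((Nat.le_add_right _ _).trans h)]
  push_cast; field_simp; ring

/-- Raising p by n m changes the power of θ₀ by θ₀ ^ (2 m l n) = 1 and the angle π/2 (y - x) by n π.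
The resulting sign cancels the one in `binomRatio_eq`. -/
lemma phase_add (hm : 0 < m) (l : ℕ) {i n : ℕ} (h : i + n * m ≤ j) :
    phase m l j (i + n * m) = (-1) ^ n * phase m l j i := by
  have hmc : (m : ℂ) ≠ 0 := by exact_mod_cast hm.ne'
  have h1 : Complex.exp (Real.pi * Complex.I / m) ^ ((l : ℤ) * (2 * ((i + n * m : ℕ) : ℤ) - (j : ℤ))) =
      Complex.exp (Real.pi * Complex.I / m) ^ ((l : ℤ) * (2 * (i : ℤ) - (j : ℤ))) := by
    rw [show (l : ℤ) * (2 * ((i + n * m : ℕ) : ℤ) - (j : ℤ)) =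
      (l : ℤ) * (2 * (i : ℤ) - (j : ℤ)) + ((2 * m * (l * n) : ℕ) : ℤ) by push_cast; ring,
      zpow_add₀ (Complex.exp_ne_zero _), zpow_natCast, pow_mul, ← Complex.exp_nat_mul]
    have : ((2 * m : ℕ) : ℂ) * (Real.pi * Complex.I / m) = 2 * Real.pi * Complex.I := by
      push_cast; field_simp
    rw [this, Complex.exp_two_pi_mul_I, one_pow, mul_one]
  have h2 : Complex.exp (Complex.I * ((Real.pi / 2 * (gexp m (j - (i + n * m)) - gexp m (i + n * m)) : ℝ) : ℂ))
      = (-1) ^ n * Complex.exp (Complex.I * ((Real.pi / 2 * (gexp m (j - i) - gexp m i) : ℝ) : ℂ)) := by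
    rw [gexp_add hm, gexp_sub hm h, ← Complex.exp_pi_mul_I, ← Complex.exp_nat_mul, ← Complex.exp_add]
    congr 1; push_cast; ring
  rw [phase, phase, h1, h2]; ring

/-- The Taylor coefficient of `ω ^ p * conj ω ^ (j - p)`. -/
noncomputable def taylorCoeff (f : ℂ → ℂ) (j p : ℕ) : ℂ :=
  mixedDeriv p (j - p) f / ((p.factorial * (j - p).factorial : ℕ) : ℂ)

lemma parDist_eq (hm : 0 < m) (f : ℂ → ℂ) {i : ℕ} (hi : i ≤ j) :
    parDist m j i f = j.factorial * ∑ n ∈ Finset.range ((j - i) / m + 1),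
      (binomRatio (gexp m i) (gexp m (j - i)) n : ℂ) * taylorCoeff f j (i + n * m) := by
  rw [parDist, Finset.mul_sum]
  refine Finset.sum_congr rfl fun n hn => ?_
  rw [Finset.mem_range, Nat.lt_succ_iff, Nat.le_div_iff_mul_le hm] at hn
  have hle : i + n * m ≤ j := by omega
  have h1 : ((j.choose (i + n * m) : ℕ) : ℂ) * (((i + n * m).factorial * (j - (i + n * m)).factorial : ℕ) : ℂ) =
      j.factorial := by
    have := Nat.choose_mul_factorial_mul_factorial hle
    rw [mul_assoc] at this
    exact_mod_cast this
  have h2 : (((i + n * m).factorial * (j - (i + n * m)).factorial : ℕ) : ℂ) ≠ 0 := by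
    exact_mod_cast (mul_pos (Nat.factorial_pos _) (Nat.factorial_pos _)).ne'
  have h3 : Ring.choose ((((j : ℝ) - i) - ((m : ℝ) - 1)) / m) n = Ring.choose (-gexp m (j - i)) n := by
    congr 1
    rw [gexp, Nat.cast_sub hi]; ring
  rw [Nat.sub_sub, taylorCoeff, ← h1, h3, binomRatio]
  have h4 : ((m : ℝ) - 1 - i) / m = gexp m i := rfl
  rw [h4]
  push_cast at h2 ⊢
  obtain ⟨h5, h6⟩ := mul_ne_zero_iff.1 h2
  field_simp

-- The sum is reorganised by residue classes of p mod m. Within a relevant class the signs of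
-- `phase_add` and `binomRatio_eq` cancel and the Γ values at the representative drop out, leaving
-- one constant times the class sum; the other classes contribute poles. Thus `secDist` is a nonzero
-- multiple of this sum.
open scoped Classical in
lemma sum_taylor_gamma_eq_zero (hm : 2 ≤ m) (l : ℕ) (f : ℂ → ℂ) (h0 : secDist m j l f = 0) :
    ∑ p ∈ Finset.range (j + 1), taylorCoeff f j p * phase m l j p *
      (((Real.Gamma (gexp m p))⁻¹ * (Real.Gamma (gexp m (j - p)))⁻¹ : ℝ) : ℂ) = 0 := by
  have hm0 : 0 < m := by omega
  have hmR : (m : ℝ) ≠ 0 := by positivity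
  set D : ℕ → ℂ := fun p => taylorCoeff f j p * phase m l j p *
      (((Real.Gamma (gexp m p))⁻¹ * (Real.Gamma (gexp m (j - p)))⁻¹ : ℝ) : ℂ) with hD
  set σ : ℝ := (2 * ((m : ℝ) - 1) - j) / m with hσ
  -- The two arguments of 𝔅 add up to σ, which depends on j alone; hence K is common to all classes.
  set K : ℂ := (Real.pi : ℂ) * ((gammaExt (σ - 1) / (2 : ℝ) ^ (σ - 2) : ℝ) : ℂ) * j.factorial with hK
  have hK0 : K ≠ 0 := by
    refine mul_ne_zero (mul_ne_zero (by exact_mod_cast Real.pi_pos.ne') ?_)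
      (by exact_mod_cast (Nat.factorial_pos j).ne')
    exact_mod_cast div_ne_zero (gammaExt_ne_zero _) (Real.rpow_pos_of_pos two_pos _).ne'
  -- If the residue of p is not relevant, p or j - p is m - 1 mod m and one of the two reciprocal
  -- Gamma values is 0.
  have hsum : ∑ p ∈ Finset.range (j + 1), D p =
      ∑ p ∈ (Finset.range (j + 1)).filter (fun p => Relevant m j (p % m)), D p := by
    refine (Finset.sum_subset (Finset.filter_subset _ _) fun p hp hpn => ?_).symm
    rw [Finset.mem_range, Nat.lt_succ_iff] at hp
    have hnr : ¬ Relevant m j (p % m) := fun h =>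
      hpn (Finset.mem_filter.2 ⟨Finset.mem_range.2 (by omega), h⟩)
    by_cases h1 : p % m = m - 1
    · simp [hD, inv_eq_zero.1 (inv_Gamma_gexp hm0 h1)]
    · by_cases h2 : (j - p) % m = m - 1
      · simp [hD, inv_eq_zero.1 (inv_Gamma_gexp hm0 h2)]
      · exact absurd (relevant_mod hm hp h1 h2) hnr
  have hterm : ∀ i ∈ (Finset.range (j + 1)).filter (fun i => Relevant m j i),
      Complex.exp (Real.pi * Complex.I / m) ^ ((l : ℤ) * (2 * (i : ℤ) - (j : ℤ))) *
      betaLike (((m : ℝ) - 1 - i) / m) (((m : ℝ) - 1 - ((j : ℝ) - i)) / m) * parDist m j i f =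
      K * ∑ n ∈ Finset.range ((j - i) / m + 1), D (i + n * m) := by
    intro i hi
    have hr := (Finset.mem_filter.1 hi).2
    have hy : ((m : ℝ) - 1 - ((j : ℝ) - i)) / m = gexp m (j - i) := by
      rw [gexp, Nat.cast_sub hr.1]
    have hx : ((m : ℝ) - 1 - i) / m = gexp m i := rfl
    have hxpos := hr.gexp_pos hm
    have hxn : ∀ n : ℕ, gexp m i ≠ -(n : ℝ) := fun n h => by
      have := Nat.cast_nonneg (α := ℝ) n; linarith
    have hyn := hr.gexp_ne hm
    have hGx : Real.Gamma (gexp m i) ≠ 0 := Real.Gamma_ne_zero hxn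
    have hGy : Real.Gamma (gexp m (j - i)) ≠ 0 := Real.Gamma_ne_zero hyn
    have hxy : gexp m i + gexp m (j - i) = σ := by
      rw [gexp, gexp, hσ, Nat.cast_sub hr.1]; ring
    rw [hx, hy, betaLike, if_neg (by rintro (⟨n, hn⟩ | ⟨n, hn⟩); exacts [hxn n hn, hyn n hn]),
      gammaExt_eq hxn, gammaExt_eq hyn, hxy, parDist_eq hm0 f hr.1, Finset.mul_sum, Finset.mul_sum,
      Finset.mul_sum]
    refine Finset.sum_congr rfl fun n hn => ?_
    rw [Finset.mem_range, Nat.lt_succ_iff, Nat.le_div_iff_mul_le hm0] at hn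
    have hle : i + n * m ≤ j := by have := hr.1; omega
    have hGxc : (Real.Gamma (gexp m i) : ℂ) ≠ 0 := by exact_mod_cast hGx
    have hGyc : (Real.Gamma (gexp m (j - i)) : ℂ) ≠ 0 := by exact_mod_cast hGy
    simp only [hD]
    rw [phase_add hm0 l hle, binomRatio_eq hGx hGy hyn, gexp_add hm0, gexp_sub hm0 hle, hK, phase]
    push_cast
    field_simp
  rw [hsum, sum_classes hm]
  rw [secDist, Finset.sum_congr rfl hterm, ← Finset.mul_sum] at h0
  exact (mul_eq_zero.1 h0).resolve_left hK0

end sector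

section polynomial

variable {m J j : ℕ}

/-- The monomial `ω ^ p * conj ω ^ q`. -/
noncomputable def bimon (p q : ℕ) (ω : ℂ) : ℂ := ω ^ p * (starRingEnd ℂ) ω ^ q

/-- Polynomials of the form `conj ω ^ (m - 1) * ∂Q + ω ^ (m - 1) * ∂̄Q` with `Q` homogeneous of
degree `J`. -/
noncomputable def polyRange (m J : ℕ) : Submodule ℂ (ℂ → ℂ) where
  carrier := {P | ∃ Q ∈ Submodule.span ℂ {g : ℂ → ℂ | ∃ a b, a + b = J ∧ g = bimon a b},
    ∃ Qa Qb : ℂ → ℂ, (∀ ω, HasD Q (Qa ω) (Qb ω) univ ω) ∧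
      ∀ ω, (starRingEnd ℂ) ω ^ (m - 1) * Qa ω + ω ^ (m - 1) * Qb ω = P ω}
  add_mem' := by
    rintro P₁ P₂ ⟨Q₁, h₁, a₁, b₁, d₁, e₁⟩ ⟨Q₂, h₂, a₂, b₂, d₂, e₂⟩
    refine ⟨Q₁ + Q₂, Submodule.add_mem _ h₁ h₂, a₁ + a₂, b₁ + b₂, fun ω => (d₁ ω).add (d₂ ω), fun ω => ?_⟩
    simp only [Pi.add_apply, ← e₁ ω, ← e₂ ω]; ring
  zero_mem' := ⟨0, Submodule.zero_mem _, 0, 0, fun ω => HasD.const 0, fun ω => by simp⟩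
  smul_mem' := by
    rintro c P ⟨Q, h, a, b, d, e⟩
    refine ⟨c • Q, Submodule.smul_mem _ c h, c • a, c • b, fun ω => (d ω).const_mul c, fun ω => ?_⟩
    simp only [Pi.smul_apply, smul_eq_mul, ← e ω]; ring

lemma gen_mem_polyRange {a b : ℕ} (h : a + b = J) :
    (a : ℂ) • bimon (a - 1) (b + (m - 1)) + (b : ℂ) • bimon (a + (m - 1)) (b - 1) ∈ polyRange m J := by
  refine ⟨bimon a b, Submodule.subset_span ⟨a, b, h, rfl⟩, _, _, fun ω => HasD.monomial a b, fun ω => ?_⟩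
  simp only [Pi.add_apply, Pi.smul_apply, smul_eq_mul, bimon, pow_add]; ring

/-- The image of a single monomial Q has two terms, whose powers of ω differ by m. These relations
link consecutive members of a residue class. -/
lemma bimon_rel (hm : 2 ≤ m) (hJ : J = j + 2 - m) {p : ℕ} (hp : p + m ≤ j) :
    ((p : ℂ) + 1) • bimon p (j - p) + ((j : ℂ) - p - m + 1) • bimon (p + m) (j - (p + m)) ∈
      polyRange m J := by
  have h := gen_mem_polyRange (m := m) (J := J) (a := p + 1) (b := j - (p + m) + 1) (by omega)
  rw [show p + 1 - 1 = p by omega, show j - (p + m) + 1 + (m - 1) = j - p by omega,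
    show p + 1 + (m - 1) = p + m by omega, show j - (p + m) + 1 - 1 = j - (p + m) by omega] at h
  convert h using 2
  · push_cast; rfl
  · rw [Nat.cast_add, Nat.cast_sub hp]; push_cast; congr 1; ring

lemma coeff_ne_zero {p : ℕ} (hp : p + m ≤ j) : (j : ℂ) - p - m + 1 ≠ 0 := by
  have : ((j - (p + m) + 1 : ℕ) : ℂ) = (j : ℂ) - p - m + 1 := by
    rw [Nat.cast_add, Nat.cast_sub hp]; push_cast; ring
  rw [← this]
  exact Nat.cast_ne_zero.2 (Nat.succ_ne_zero (j - (p + m)))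

/-- The class of m - 1 starts with a one-term relation, the image of a pure power of conj ω; the
two-term relations then propagate membership upwards. -/
lemma bimon_mem_of_mod (hm : 2 ≤ m) (hJ : J = j + 2 - m) {p : ℕ} (hp : p ≤ j) (h : p % m = m - 1) :
    bimon p (j - p) ∈ polyRange m J := by
  obtain ⟨n, rfl⟩ : ∃ n, p = m - 1 + n * m :=
    ⟨p / m, by rw [← h, mul_comm]; exact (Nat.mod_add_div p m).symm⟩
  clear h
  induction n with
  | zero =>
    have h := gen_mem_polyRange (m := m) (J := J) (a := 0) (b := J) (by omega)
    simp only [CharP.cast_eq_zero, zero_smul, zero_add] at h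
    rw [Nat.zero_mul, Nat.add_zero] at hp ⊢
    rw [show j - (m - 1) = J - 1 by omega]
    exact (Submodule.smul_mem_iff _ (by exact_mod_cast (by omega : J ≠ 0))).1 h
  | succ n ih =>
    have e : m - 1 + (n + 1) * m = m - 1 + n * m + m := by ring
    rw [e] at hp ⊢
    have h1 := ih (by omega)
    have h2 := bimon_rel hm hJ hp
    have h3 := (Submodule.add_mem_iff_right _ (Submodule.smul_mem _ _ h1)).1 h2
    exact (Submodule.smul_mem_iff _ (coeff_ne_zero hp)).1 h3

/-- The mirror image: a pure power of ω gives a one-term relation at the upper end of the class, and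
membership propagates downwards. -/
lemma bimon_mem_of_mod_sub (hm : 2 ≤ m) (hJ : J = j + 2 - m) {p : ℕ} (hp : p ≤ j)
    (h : (j - p) % m = m - 1) : bimon p (j - p) ∈ polyRange m J := by
  obtain ⟨n, hn⟩ : ∃ n, j - p = m - 1 + n * m :=
    ⟨(j - p) / m, by rw [← h, mul_comm]; exact (Nat.mod_add_div _ m).symm⟩
  clear h
  induction n generalizing p with
  | zero =>
    have h := gen_mem_polyRange (m := m) (J := J) (a := J) (b := 0) (by omega)
    simp only [CharP.cast_eq_zero, zero_smul, add_zero, zero_add] at h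
    rw [hn, Nat.zero_mul, Nat.add_zero, show p = J - 1 by omega]
    exact (Submodule.smul_mem_iff _ (by exact_mod_cast (by omega : J ≠ 0))).1 h
  | succ n ih =>
    have e : m - 1 + (n + 1) * m = m - 1 + n * m + m := by ring
    rw [e] at hn
    have hp' : p + m ≤ j := by omega
    have h1 := ih hp' (by omega)
    have h2 := bimon_rel hm hJ hp'
    have h3 := (Submodule.add_mem_iff_left _ (Submodule.smul_mem _ _ h1)).1 h2
    exact (Submodule.smul_mem_iff _ (by exact_mod_cast Nat.succ_ne_zero p)).1 h3

/-- The ratio of the coefficients in `bimon_rel` is the recurrence of `binomRatio_succ`. So modulo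
the range every member of a class is a known multiple of its first one. -/
lemma bimon_sub_mem (hm : 2 ≤ m) (hJ : J = j + 2 - m) {i n : ℕ} (h : i + n * m ≤ j) :
    bimon (i + n * m) (j - (i + n * m)) - (binomRatio (gexp m i) (gexp m (j - i)) n : ℂ) •
      bimon i (j - i) ∈ polyRange m J := by
  have hmC : (m : ℂ) ≠ 0 := by exact_mod_cast (by omega : m ≠ 0)
  induction n with
  | zero => simp [binomRatio_zero]
  | succ n ih =>
    have e : i + (n + 1) * m = i + n * m + m := by ring
    rw [e] at h ⊢
    have h1 := ih (by omega)
    have h2 := bimon_rel hm hJ h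
    set R := binomRatio (gexp m i) (gexp m (j - i)) n with hR
    have hi : i ≤ j := by omega
    have hne := coeff_ne_zero h
    have hne' : (j : ℂ) - i - n * m - m + 1 ≠ 0 := by
      push_cast at hne
      intro h0; apply hne; linear_combination h0
    have hratio : (((gexp m i - 1 - n) / (-gexp m (j - i) - n) : ℝ) : ℂ) =
        -((i : ℂ) + n * m + 1) / ((j : ℂ) - i - n * m - m + 1) := by
      have h4 : (gexp m i - 1 - n) / (-gexp m (j - i) - n) =
          -((i : ℝ) + n * m + 1) / ((j : ℝ) - i - n * m - m + 1) := by
        have hmR : (m : ℝ) ≠ 0 := by positivity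
        rw [gexp, gexp, Nat.cast_sub hi, ← mul_div_mul_right _ _ hmR]
        congr 1
        · field_simp; ring
        · field_simp; ring
      rw [h4]; push_cast; rfl
    rw [binomRatio_succ, ← hR, Complex.ofReal_mul, hratio]
    refine (Submodule.smul_mem_iff _ hne').1 ?_
    have h5 := Submodule.sub_mem _ h2 (Submodule.smul_mem _ ((i : ℂ) + n * m + 1) h1)
    convert h5 using 1
    ext ω
    simp only [Pi.add_apply, Pi.sub_apply, Pi.smul_apply, smul_eq_mul]
    push_cast
    field_simp
    ring

/-- The homogeneous part of degree `j` of the Taylor polynomial. -/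
noncomputable def taylorPart (f : ℂ → ℂ) (j : ℕ) : ℂ → ℂ :=
  ∑ p ∈ Finset.range (j + 1), taylorCoeff f j p • bimon p (j - p)

-- After reduction to the first member of each relevant class, the coefficient that remains is
-- `parDist` divided by j!; the other classes lie in the range. For j ≤ m - 2 the truncated J is 0,
-- but then each relevant class has one element, every index is relevant, and the hypotheses make
-- the Taylor part vanish.
open scoped Classical in
lemma taylorPart_mem_polyRange (hm : 2 ≤ m) (hJ : J = j + 2 - m) (f : ℂ → ℂ)
    (h0 : ∀ i, Relevant m j i → parDist m j i f = 0) : taylorPart f j ∈ polyRange m J := by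
  have hm0 : 0 < m := by omega
  rw [taylorPart, ← Finset.sum_filter_add_sum_filter_not _ (fun p => Relevant m j (p % m))]
  refine Submodule.add_mem _ ?_ (Submodule.sum_mem _ fun p hp => Submodule.smul_mem _ _ ?_)
  · rw [sum_classes hm]
    refine Submodule.sum_mem _ fun i hi => ?_
    have hr := (Finset.mem_filter.1 hi).2
    have h1 : ∑ n ∈ Finset.range ((j - i) / m + 1), taylorCoeff f j (i + n * m) •
        (binomRatio (gexp m i) (gexp m (j - i)) n : ℂ) • bimon i (j - i) = 0 := by
      have h2 := h0 i hr
      rw [parDist_eq hm0 f hr.1] at h2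
      have h3 := (mul_eq_zero.1 h2).resolve_left (by exact_mod_cast (Nat.factorial_pos j).ne')
      simp only [smul_smul]
      rw [← Finset.sum_smul]
      simp only [mul_comm (taylorCoeff f j _)]
      rw [h3, zero_smul]
    rw [← sub_zero (∑ n ∈ Finset.range ((j - i) / m + 1), _), ← h1, ← Finset.sum_sub_distrib]
    refine Submodule.sum_mem _ fun n hn => ?_
    rw [Finset.mem_range, Nat.lt_succ_iff, Nat.le_div_iff_mul_le hm0] at hn
    rw [← smul_sub]
    exact Submodule.smul_mem _ _ (bimon_sub_mem hm hJ (by have := hr.1; omega))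
  · rw [Finset.mem_filter, Finset.mem_range, Nat.lt_succ_iff] at hp
    by_cases h1 : p % m = m - 1
    · exact bimon_mem_of_mod hm hJ hp.1 h1
    · by_cases h2 : (j - p) % m = m - 1
      · exact bimon_mem_of_mod_sub hm hJ hp.1 h2
      · exact absurd (relevant_mod hm hp.1 h1 h2) hp.2

end polynomial

end SaddleSector

/-! ### The cone of a sector and the chart given by the m-th power -/

namespace SaddleSector

open Set Filter Topology MeasureTheory

section cone

variable {m : ℕ}

/-- The convex cone of aperture `π / m` around the positive real axis. -/
def cone (m : ℕ) : Set ℂ := {w | |w.im| ≤ Real.tan (Real.pi / (2 * m)) * w.re}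

lemma half_aperture_mem (hm : 2 ≤ m) : Real.pi / (2 * m) ∈ Ioo 0 (Real.pi / 2) := by
  have hm' : (2 : ℝ) ≤ m := by exact_mod_cast hm
  refine ⟨by positivity, ?_⟩
  rw [div_lt_div_iff_of_pos_left Real.pi_pos (by positivity) two_pos]
  linarith

lemma tan_pos (hm : 2 ≤ m) : 0 < Real.tan (Real.pi / (2 * m)) :=
  Real.tan_pos_of_pos_of_lt_pi_div_two (half_aperture_mem hm).1 (half_aperture_mem hm).2

lemma cone_re_pos (hm : 2 ≤ m) {w : ℂ} (hw : w ∈ cone m) (h0 : w ≠ 0) : 0 < w.re := by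
  have hT := tan_pos hm
  have h1 : 0 ≤ w.re := nonneg_of_mul_nonneg_right ((abs_nonneg _).trans hw) hT
  refine lt_of_le_of_ne h1 fun h2 => h0 ?_
  rw [cone, mem_ofPred_eq, ← h2, mul_zero] at hw
  exact Complex.ext h2.symm (abs_nonpos_iff.1 hw)

lemma abs_arg_le_of_mem_cone (hm : 2 ≤ m) {w : ℂ} (hw : w ∈ cone m) (h0 : w ≠ 0) :
    |w.arg| ≤ Real.pi / (2 * m) := by
  have hre := cone_re_pos hm hw h0
  have hlt := abs_lt.1 (Complex.abs_arg_lt_pi_div_two_iff.2 (Or.inl hre))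
  have htan : Real.tan w.arg = w.im / w.re := Complex.tan_arg w
  have hap := half_aperture_mem hm
  have him := abs_le.1 (show |w.im| ≤ _ from hw)
  have hmem : w.arg ∈ Ioo (-(Real.pi / 2)) (Real.pi / 2) := hlt
  have hmem1 : Real.pi / (2 * m) ∈ Ioo (-(Real.pi / 2)) (Real.pi / 2) := ⟨by linarith [hap.1, hap.2], hap.2⟩
  have hmem2 : -(Real.pi / (2 * m)) ∈ Ioo (-(Real.pi / 2)) (Real.pi / 2) :=
    ⟨by linarith [hap.2], by linarith [hap.1, hap.2]⟩
  rw [abs_le]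
  constructor
  · rw [← Real.strictMonoOn_tan.le_iff_le hmem2 hmem, htan, Real.tan_neg, le_div_iff₀ hre]
    linarith [him.1]
  · rw [← Real.strictMonoOn_tan.le_iff_le hmem hmem1, htan, div_le_iff₀ hre]
    exact him.2

lemma polar_mem_cone (hm : 2 ≤ m) {r φ : ℝ} (hr : 0 ≤ r) (hφ : |φ| ≤ Real.pi / (2 * m)) :
    (r : ℂ) * Complex.exp (φ * Complex.I) ∈ cone m := by
  have hap := half_aperture_mem hm
  have hφ' := abs_le.1 hφ
  have hmem : φ ∈ Ioo (-(Real.pi / 2)) (Real.pi / 2) :=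
    ⟨by linarith [hap.2], by linarith [hap.2]⟩
  have hmem1 : Real.pi / (2 * m) ∈ Ioo (-(Real.pi / 2)) (Real.pi / 2) := ⟨by linarith [hap.1, hap.2], hap.2⟩
  have hmem2 : -(Real.pi / (2 * m)) ∈ Ioo (-(Real.pi / 2)) (Real.pi / 2) :=
    ⟨by linarith [hap.2], by linarith [hap.1, hap.2]⟩
  have hcos := Real.cos_pos_of_mem_Ioo hmem
  have h1 := (Real.strictMonoOn_tan.le_iff_le hmem hmem1).2 hφ'.2
  have h2 := (Real.strictMonoOn_tan.le_iff_le hmem2 hmem).2 hφ'.1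
  rw [Real.tan_neg] at h2
  have h3 : |Real.sin φ| ≤ Real.tan (Real.pi / (2 * m)) * Real.cos φ := by
    rw [← Real.tan_mul_cos hcos.ne', abs_mul, abs_of_pos hcos]
    exact mul_le_mul_of_nonneg_right (abs_le.2 ⟨h2, h1⟩) hcos.le
  rw [cone, mem_ofPred_eq, Complex.re_ofReal_mul, Complex.im_ofReal_mul, Complex.exp_ofReal_mul_I_re,
    Complex.exp_ofReal_mul_I_im, abs_mul, abs_of_nonneg hr]
  calc r * |Real.sin φ| ≤ r * (Real.tan (Real.pi / (2 * m)) * Real.cos φ) :=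
        mul_le_mul_of_nonneg_left h3 hr
    _ = _ := by ring

lemma convex_cone (m : ℕ) : Convex ℝ (cone m) := by
  have h : cone m = {w | w.im + -Real.tan (Real.pi / (2 * m)) * w.re ≤ 0} ∩
      {w | -w.im + -Real.tan (Real.pi / (2 * m)) * w.re ≤ 0} := by
    ext w
    simp only [cone, mem_ofPred_eq, mem_inter_iff, abs_le]
    constructor
    · rintro ⟨h1, h2⟩; constructor <;> linarith
    · rintro ⟨h1, h2⟩; constructor <;> linarith
  rw [h]
  refine (convex_halfSpace_le ?_ 0).inter (convex_halfSpace_le ?_ 0)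
  · exact ((Complex.imCLM + (-Real.tan (Real.pi / (2 * m))) • Complex.reCLM : ℂ →L[ℝ] ℝ)).toLinearMap.isLinear
  · exact ((-Complex.imCLM + (-Real.tan (Real.pi / (2 * m))) • Complex.reCLM : ℂ →L[ℝ] ℝ)).toLinearMap.isLinear

end cone

section chart

variable {m l : ℕ}

/-- The direction of the bisector of the sector of index `l`. -/
noncomputable def rot (m l : ℕ) : ℂ :=
  Complex.exp (((Real.pi * l / m + Real.pi / (2 * m) : ℝ) : ℂ) * Complex.I)

/-- The sign `(-1) ^ l`. -/
def eps (l : ℕ) : ℝ := (-1) ^ l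

lemma eps_cases (l : ℕ) : eps l = 1 ∨ eps l = -1 := neg_one_pow_eq_or ℝ l

lemma eps_mul_eps (l : ℕ) : (eps l : ℂ) * eps l = 1 := by
  rcases eps_cases l with h | h <;> simp [h]

lemma norm_eps (l : ℕ) : ‖(eps l : ℂ)‖ = 1 := by
  rcases eps_cases l with h | h <;> simp [h]

lemma norm_rot (m l : ℕ) : ‖rot m l‖ = 1 := Complex.norm_exp_ofReal_mul_I _

lemma rot_ne_zero (m l : ℕ) : rot m l ≠ 0 := Complex.exp_ne_zero _

lemma conj_rot_mul_rot (m l : ℕ) : (starRingEnd ℂ) (rot m l) * rot m l = 1 := by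
  rw [mul_comm, Complex.mul_conj, Complex.normSq_eq_norm_sq, norm_rot]; simp

lemma rot_pow (hm : 0 < m) (l : ℕ) : rot m l ^ m = eps l * Complex.I := by
  have hmc : (m : ℂ) ≠ 0 := by exact_mod_cast hm.ne'
  rw [rot, ← Complex.exp_nat_mul]
  have : (m : ℂ) * (((Real.pi * l / m + Real.pi / (2 * m) : ℝ) : ℂ) * Complex.I) =
      l * (Real.pi * Complex.I) + Real.pi / 2 * Complex.I := by
    push_cast; field_simp
  rw [this, Complex.exp_add, Complex.exp_nat_mul, Complex.exp_pi_mul_I, Complex.exp_pi_div_two_mul_I, eps]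
  push_cast; rfl

/-- The inverse chart: a branch of the `m`-th root on the closed upper half-plane. -/
noncomputable def psi (m l : ℕ) (z : ℂ) : ℂ := rot m l * pw (1 / m) z

/-- The chart `ω ↦ (-1) ^ l ω ^ m` of the sector of index `l`. -/
noncomputable def chi (m l : ℕ) (ω : ℂ) : ℂ := eps l * ω ^ m

lemma pw_pow (hm : 0 < m) (z : ℂ) : pw (1 / m) z ^ m = -Complex.I * z := by
  have : ((1 / (m : ℝ) : ℝ) : ℂ) = (m : ℂ)⁻¹ := by push_cast; rw [one_div]
  rw [pw, this, Complex.cpow_nat_inv_pow _ hm.ne']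

lemma psi_pow (hm : 0 < m) (z : ℂ) : psi m l z ^ m = eps l * z := by
  rw [psi, mul_pow, rot_pow hm, pw_pow hm]
  linear_combination (-(eps l : ℂ) * z) * Complex.I_sq

lemma chi_psi (hm : 0 < m) (z : ℂ) : chi m l (psi m l z) = z := by
  rw [chi, psi_pow hm, ← mul_assoc, eps_mul_eps, one_mul]

lemma norm_chi (m l : ℕ) (ω : ℂ) : ‖chi m l ω‖ = ‖ω‖ ^ m := by
  rw [chi, norm_mul, norm_eps, one_mul, norm_pow]

lemma norm_psi_pow (hm : 0 < m) (z : ℂ) : ‖psi m l z‖ ^ m = ‖z‖ := by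
  rw [← norm_chi m l, chi_psi hm]

lemma pw_polar (α : ℝ) {r φ : ℝ} (hr : 0 < r) (hφ : φ ∈ Ioc (-Real.pi) Real.pi) :
    pw α (r * (Complex.I * Complex.exp (φ * Complex.I))) = (r ^ α : ℝ) * Complex.exp ((α * φ : ℝ) * Complex.I) := by
  rw [pw_mul α hr, pw]
  congr 1
  rw [show -Complex.I * (Complex.I * Complex.exp (φ * Complex.I)) = Complex.exp (φ * Complex.I) by
    linear_combination (-Complex.exp (φ * Complex.I)) * Complex.I_sq,
    Complex.cpow_def_of_ne_zero (Complex.exp_ne_zero _), Complex.log_exp (by simpa using hφ.1) (by simpa using hφ.2)]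
  congr 1; push_cast; ring

/-- The convex cone carrying the sector of index `l`. -/
def secCone (m l : ℕ) : Set ℂ := {ω | (starRingEnd ℂ) (rot m l) * ω ∈ cone m}

lemma convex_secCone (m l : ℕ) : Convex ℝ (secCone m l) :=
  (convex_cone m).linear_preimage
    ((ContinuousLinearMap.mul ℝ ℂ ((starRingEnd ℂ) (rot m l))) : ℂ →L[ℝ] ℂ).toLinearMap

lemma secCone_polar (hm : 2 ≤ m) {ω : ℂ} (hω : ω ∈ secCone m l) (h0 : ω ≠ 0) :
    ∃ r : ℝ, 0 < r ∧ ∃ φ : ℝ, |φ| ≤ Real.pi / (2 * m) ∧ ω = rot m l * (r * Complex.exp (φ * Complex.I)) := by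
  have hw : (starRingEnd ℂ) (rot m l) * ω ≠ 0 :=
    mul_ne_zero ((map_ne_zero _).2 (rot_ne_zero m l)) h0
  refine ⟨_, norm_pos_iff.2 hw, _, abs_arg_le_of_mem_cone hm hω hw, ?_⟩
  rw [Complex.norm_mul_exp_arg_mul_I, ← mul_assoc, mul_comm (rot m l), conj_rot_mul_rot, one_mul]

lemma mem_secCone_of_polar (hm : 2 ≤ m) {r φ : ℝ} (hr : 0 ≤ r) (hφ : |φ| ≤ Real.pi / (2 * m)) :
    rot m l * (r * Complex.exp (φ * Complex.I)) ∈ secCone m l := by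
  rw [secCone, mem_ofPred_eq, ← mul_assoc, conj_rot_mul_rot, one_mul]
  exact polar_mem_cone hm hr hφ

lemma chi_polar (hm : 0 < m) (r φ : ℝ) : chi m l (rot m l * (r * Complex.exp (φ * Complex.I))) =
    ((r ^ m : ℝ) : ℂ) * (Complex.I * Complex.exp ((m * φ : ℝ) * Complex.I)) := by
  rw [chi, mul_pow, rot_pow hm, mul_pow, ← Complex.exp_nat_mul]
  push_cast
  rw [show (m : ℂ) * (φ * Complex.I) = m * φ * Complex.I by ring]
  linear_combination (Complex.I * (r ^ m * Complex.exp (m * φ * Complex.I))) * eps_mul_eps l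

lemma abs_mul_le (hm : 0 < m) {φ : ℝ} (hφ : |φ| ≤ Real.pi / (2 * m)) : |(m : ℝ) * φ| ≤ Real.pi / 2 := by
  rw [abs_mul, Nat.abs_cast]
  calc (m : ℝ) * |φ| ≤ m * (Real.pi / (2 * m)) := mul_le_mul_of_nonneg_left hφ (Nat.cast_nonneg m)
    _ = Real.pi / 2 := by
      have : (m : ℝ) ≠ 0 := by positivity
      field_simp

lemma chi_mem_upperHP (hm : 2 ≤ m) {ω : ℂ} (hω : ω ∈ secCone m l) (h0 : ω ≠ 0) : chi m l ω ∈ upperHP := by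
  refine ⟨?_, fun h => h0 ?_⟩
  · obtain ⟨r, hr, φ, hφ, rfl⟩ := secCone_polar hm hω h0
    rw [chi_polar (by omega), Complex.im_ofReal_mul, Complex.I_mul_im, Complex.exp_ofReal_mul_I_re]
    have h1 := abs_le.1 (abs_mul_le (by omega) hφ)
    exact mul_nonneg (by positivity) (Real.cos_nonneg_of_mem_Icc ⟨h1.1, h1.2⟩)
  · have h1 := norm_chi m l ω
    rw [h, norm_zero] at h1
    exact norm_eq_zero.1 (pow_eq_zero_iff (by omega) |>.1 h1.symm)

/-- Angles from the bisector are at most π/(2m) in absolute value; multiplied by m they stay within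
π/2, away from the cut of `pw`, so the root taken is the right one. -/
lemma psi_chi (hm : 2 ≤ m) {ω : ℂ} (hω : ω ∈ secCone m l) : psi m l (chi m l ω) = ω := by
  have hm0 : 0 < m := by omega
  rcases eq_or_ne ω 0 with rfl | h0
  · have := norm_psi_pow (l := l) hm0 (chi m l 0)
    rw [norm_chi, norm_zero, zero_pow hm0.ne', pow_eq_zero_iff hm0.ne'] at this
    exact norm_eq_zero.1 this
  · obtain ⟨r, hr, φ, hφ, rfl⟩ := secCone_polar hm hω h0
    have h1 := abs_le.1 (abs_mul_le hm0 hφ)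
    have hmR : (m : ℝ) ≠ 0 := by positivity
    rw [chi_polar hm0, psi, pw_polar _ (by positivity) ⟨by linarith [Real.pi_pos], by linarith [Real.pi_pos]⟩,
      ← Real.rpow_natCast, ← Real.rpow_mul hr.le, mul_one_div, div_self hmR, Real.rpow_one, ← mul_assoc (1 / (m : ℝ)),
      one_div, inv_mul_cancel₀ hmR, one_mul]

lemma psi_zero (hm : 0 < m) : psi m l 0 = 0 := by
  have := norm_psi_pow (l := l) hm 0
  rw [norm_zero, pow_eq_zero_iff hm.ne'] at this
  exact norm_eq_zero.1 this

lemma psi_polar (hm : 2 ≤ m) {z : ℂ} (hz : z ∈ upperHP) : ∃ r : ℝ, 0 < r ∧ ∃ φ : ℝ, |φ| ≤ Real.pi / (2 * m) ∧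
    (0 < z.im → |φ| < Real.pi / (2 * m)) ∧ psi m l z = rot m l * (r * Complex.exp (φ * Complex.I)) := by
  have hn : 0 < ‖z‖ := norm_pos_iff.2 hz.2
  have hm0 : (0 : ℝ) < m := by positivity
  have habs : |1 / (m : ℝ) * (-Complex.I * z).arg| = |(-Complex.I * z).arg| / m := by
    rw [abs_mul, abs_of_pos (by positivity)]; ring
  have hpi : Real.pi / (2 * m) = Real.pi / 2 / m := by rw [div_div]
  refine ⟨‖z‖ ^ (1 / m : ℝ), Real.rpow_pos_of_pos hn _, 1 / (m : ℝ) * (-Complex.I * z).arg, ?_, ?_, ?_⟩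
  · rw [habs, hpi, div_le_div_iff_of_pos_right hm0, Complex.abs_arg_le_pi_div_two_iff]
    simpa using hz.1
  · intro him
    rw [habs, hpi, div_lt_div_iff_of_pos_right hm0, Complex.abs_arg_lt_pi_div_two_iff]
    left; simpa using him
  · conv_lhs => rw [neg_I_mul_eq (z := z)]
    rw [psi, pw_polar _ hn ⟨Complex.neg_pi_lt_arg _, Complex.arg_le_pi _⟩]

lemma psi_mem_secCone (hm : 2 ≤ m) {z : ℂ} (hz : 0 ≤ z.im) : psi m l z ∈ secCone m l := by
  rcases eq_or_ne z 0 with rfl | h0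
  · rw [psi_zero (by omega), secCone, mem_ofPred_eq, mul_zero]; simp [cone]
  · obtain ⟨r, hr, φ, hφ, -, h⟩ := psi_polar (l := l) hm ⟨hz, h0⟩
    rw [h]; exact mem_secCone_of_polar hm hr.le hφ

/-- The closed curvilinear sector. -/
def clSec (m l : ℕ) : Set ℂ := psi m l '' halfSq

lemma mem_clSec_iff (hm : 2 ≤ m) {ω : ℂ} : ω ∈ clSec m l ↔ ω ∈ secCone m l ∧ chi m l ω ∈ halfSq := by
  constructor
  · rintro ⟨z, hz, rfl⟩
    rw [chi_psi (by omega)]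
    exact ⟨psi_mem_secCone hm (mem_halfSq.1 hz).2.1, hz⟩
  · rintro ⟨h1, h2⟩
    exact ⟨_, h2, psi_chi hm h1⟩

end chart

end SaddleSector

/-! ### The curvilinear sector and the local solution in the chart -/

namespace SaddleSector

open Set Filter Topology MeasureTheory

variable {m l : ℕ}

lemma argPos_polar {r t : ℝ} (hr : 0 < r) (ht : t ∈ Ico 0 (2 * Real.pi)) :
    argPos (r * Complex.exp (t * Complex.I)) = t := by
  rw [argPos, Complex.exp_mul_I]
  rcases le_or_gt t Real.pi with h | h
  · have h1 := Complex.arg_mul_cos_add_sin_mul_I hr (θ := t) ⟨by linarith [ht.1, Real.pi_pos], h⟩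
    rw [h1, if_pos ht.1]
  · have h1 := Complex.arg_mul_cos_add_sin_mul_I hr (θ := t - 2 * Real.pi)
      ⟨by linarith, by linarith [ht.2, Real.pi_pos]⟩
    push_cast at h1
    rw [Complex.cos_sub_two_pi, Complex.sin_sub_two_pi] at h1
    rw [h1, if_neg (by linarith [ht.2]), sub_add_cancel]

lemma norm_mul_exp_argPos (ω : ℂ) : (‖ω‖ : ℂ) * Complex.exp (argPos ω * Complex.I) = ω := by
  rw [argPos]
  split_ifs with h
  · exact Complex.norm_mul_exp_arg_mul_I ω
  · push_cast
    rw [add_mul, Complex.exp_add, Complex.exp_two_pi_mul_I, mul_one]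
    exact Complex.norm_mul_exp_arg_mul_I ω

lemma argPos_of_im {z : ℂ} (hz : z.im ≠ 0) :
    (0 < z.im → argPos z ∈ Ioo 0 Real.pi) ∧ (z.im < 0 → argPos z ∈ Ioo Real.pi (2 * Real.pi)) := by
  constructor
  · intro h
    have h1 : 0 ≤ z.arg := Complex.arg_nonneg_iff.2 h.le
    have h2 : z.arg ≠ 0 := fun h0 => hz ((Complex.arg_eq_zero_iff.1 h0).2)
    have h3 : z.arg ≠ Real.pi := fun h0 => hz ((Complex.arg_eq_pi_iff.1 h0).2)
    rw [argPos, if_pos h1]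
    exact ⟨lt_of_le_of_ne h1 h2.symm, lt_of_le_of_ne (Complex.arg_le_pi z) h3⟩
  · intro h
    have h1 : z.arg < 0 := Complex.arg_neg_iff.2 h
    rw [argPos, if_neg (not_le.2 h1)]
    exact ⟨by linarith [Complex.neg_pi_lt_arg z], by linarith⟩

/-- The upper half of the square, open along the real axis. -/
def openHalfSq : Set ℂ := Icc (-1 : ℝ) 1 ×ℂ Ioc (0 : ℝ) 1

lemma openHalfSq_subset : openHalfSq ⊆ halfSq := fun _ hz => ⟨hz.1, le_of_lt hz.2.1, hz.2.2⟩

lemma closure_openHalfSq : closure openHalfSq = halfSq := by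
  rw [openHalfSq, Complex.closure_reProdIm, closure_Icc, closure_Ioc zero_ne_one, halfSq]

/-- The open sector of index `l`. -/
def opSec (m l : ℕ) : Set ℂ := sector m ((l : ℝ) / (2 * m)) (((l : ℝ) + 1) / (2 * m))

lemma argPos_mem_of_mem_opSec (hm : 0 < m) {ω : ℂ} (hω : ω ∈ opSec m l) :
    argPos ω ∈ Ioo (Real.pi * l / m) (Real.pi * (l + 1) / m) := by
  have h := hω.2.2
  have e1 : 2 * Real.pi * ((l : ℝ) / (2 * m)) = Real.pi * l / m := by field_simp
  have e2 : 2 * Real.pi * (((l : ℝ) + 1) / (2 * m)) = Real.pi * (l + 1) / m := by field_simp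
  rwa [e1, e2] at h

lemma opSec_eq (hm : 2 ≤ m) (hl : l < 2 * m) : opSec m l = psi m l '' openHalfSq := by
  have hm0 : 0 < m := by omega
  have hmR : (0 : ℝ) < m := by exact_mod_cast hm0
  ext ω
  constructor
  · intro h
    have ht := argPos_mem_of_mem_opSec hm0 h
    set φ := argPos ω - (Real.pi * l / m + Real.pi / (2 * m)) with hφ
    have e : Real.pi * (l + 1) / m = Real.pi * l / m + Real.pi / (2 * m) + Real.pi / (2 * m) := by
      field_simp; ring
    rw [e] at ht
    have habs : |φ| < Real.pi / (2 * m) := by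
      rw [abs_lt]; constructor
      · linarith [ht.1]
      · linarith [ht.2]
    have hω : ω = rot m l * (‖ω‖ * Complex.exp (φ * Complex.I)) := by
      conv_lhs => rw [← norm_mul_exp_argPos ω]
      rw [rot, mul_left_comm, ← Complex.exp_add, hφ]
      congr 2; push_cast; ring
    have hcone : ω ∈ secCone m l := by
      rw [hω]; exact mem_secCone_of_polar hm (norm_nonneg _) habs.le
    refine ⟨chi m l ω, ?_, psi_chi hm hcone⟩
    have him : 0 < (chi m l ω).im := by
      rw [hω, chi_polar hm0, Complex.im_ofReal_mul, Complex.I_mul_im, Complex.exp_ofReal_mul_I_re]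
      have h2 : |(m : ℝ) * φ| < Real.pi / 2 := by
        rw [abs_mul, Nat.abs_cast]
        calc (m : ℝ) * |φ| < m * (Real.pi / (2 * m)) := mul_lt_mul_of_pos_left habs hmR
          _ = Real.pi / 2 := by field_simp
      have h3 := abs_lt.1 h2
      have := norm_pos_iff.2 h.2.1
      exact mul_pos (by positivity) (Real.cos_pos_of_mem_Ioo ⟨h3.1, h3.2⟩)
    have hd := h.1
    have hre' : |(chi m l ω).re| ≤ 1 ∧ |(chi m l ω).im| ≤ 1 := by
      rw [chi, Complex.re_ofReal_mul, Complex.im_ofReal_mul, abs_mul, abs_mul]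
      have : |eps l| = 1 := by rcases eps_cases l with h | h <;> simp [h]
      rw [this, one_mul, one_mul]
      exact hd
    exact ⟨abs_le.1 hre'.1, him, (abs_le.1 hre'.2).2⟩
  · rintro ⟨z, hz, rfl⟩
    have him : 0 < z.im := hz.2.1
    have hz0 : z ≠ 0 := by rintro rfl; simp at him
    obtain ⟨r, hr, φ, -, hφ, h⟩ := psi_polar (l := l) hm ⟨him.le, hz0⟩
    have hφ' := abs_lt.1 (hφ him)
    have hpow := psi_pow (l := l) hm0 z
    refine ⟨?_, ?_, ?_⟩
    · rw [dom, mem_ofPred_eq, hpow, Complex.re_ofReal_mul, Complex.im_ofReal_mul, abs_mul, abs_mul]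
      have : |eps l| = 1 := by rcases eps_cases l with h | h <;> simp [h]
      rw [this, one_mul, one_mul]
      exact ⟨abs_le.2 hz.1, abs_le.2 ⟨by linarith, hz.2.2⟩⟩
    · rw [h]
      exact mul_ne_zero (rot_ne_zero m l) (mul_ne_zero (by exact_mod_cast hr.ne') (Complex.exp_ne_zero _))
    · have e3 : psi m l z = r * Complex.exp (((Real.pi * l / m + Real.pi / (2 * m) + φ : ℝ) : ℂ) * Complex.I) := by
        rw [h, rot, mul_left_comm, ← Complex.exp_add]
        congr 2; push_cast; ring
      have e : Real.pi * (l + 1) / m = Real.pi * l / m + Real.pi / (2 * m) + Real.pi / (2 * m) := by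
        field_simp; ring
      have e1 : 2 * Real.pi * ((l : ℝ) / (2 * m)) = Real.pi * l / m := by field_simp
      have e2 : 2 * Real.pi * (((l : ℝ) + 1) / (2 * m)) = Real.pi * (l + 1) / m := by field_simp
      have h0 : 0 ≤ Real.pi * l / m := by positivity
      have h1 : Real.pi * (l + 1) / m ≤ 2 * Real.pi := by
        rw [div_le_iff₀ hmR]
        have : (l : ℝ) + 1 ≤ 2 * m := by exact_mod_cast hl
        nlinarith [Real.pi_pos]
      rw [e1, e2, e3, argPos_polar hr ⟨by linarith, by linarith⟩, e]
      exact ⟨by linarith, by linarith⟩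

lemma norm_psi (hm : 0 < m) (z : ℂ) : ‖psi m l z‖ = ‖z‖ ^ (1 / m : ℝ) := by
  rw [← norm_psi_pow (l := l) hm z, ← Real.rpow_natCast, ← Real.rpow_mul (norm_nonneg _), mul_one_div,
    div_self (by positivity), Real.rpow_one]

lemma continuousOn_psi (hm : 0 < m) : ContinuousOn (psi m l) {z | 0 ≤ z.im} := by
  intro z hz
  rcases eq_or_ne z 0 with rfl | h0
  · refine ContinuousAt.continuousWithinAt ?_
    rw [ContinuousAt, psi_zero hm]
    refine squeeze_zero_norm (fun z => (norm_psi hm z).le) ?_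
    have h1 : Tendsto (fun z : ℂ => ‖z‖) (𝓝 0) (𝓝 0) := by simpa using (continuous_norm (E := ℂ)).tendsto 0
    have h2 := h1.rpow_const (p := (1 / m : ℝ)) (Or.inr (by positivity))
    rwa [Real.zero_rpow (by positivity)] at h2
  · exact ((hasDerivAt_pw _ (upperHP_subset ⟨hz, h0⟩)).continuousAt.const_mul _).continuousWithinAt

lemma isClosed_clSec (hm : 0 < m) : IsClosed (clSec m l) := by
  have hK : IsCompact halfSq := isCompact_Icc.reProdIm isCompact_Icc
  exact (hK.image_of_continuousOn ((continuousOn_psi hm).mono fun z hz => hz.2.1)).isClosed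

lemma closure_opSec (hm : 2 ≤ m) (hl : l < 2 * m) : closure (opSec m l) = clSec m l := by
  have hm0 : 0 < m := by omega
  rw [opSec_eq hm hl]
  refine Subset.antisymm ?_ ?_
  · exact closure_minimal (image_mono openHalfSq_subset) (isClosed_clSec hm0)
  · rw [clSec, ← closure_openHalfSq]
    refine ContinuousOn.image_closure ?_
    rw [closure_openHalfSq]
    exact (continuousOn_psi hm0).mono fun z hz => hz.2.1

lemma opSec_subset (hm : 2 ≤ m) (hl : l < 2 * m) : opSec m l ⊆ clSec m l := by
  rw [opSec_eq hm hl]; exact image_mono openHalfSq_subset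

lemma clSec_subset_ball (hm : 2 ≤ m) : clSec m l ⊆ Metric.closedBall 0 2 := by
  intro ω hω
  have h1 := norm_le_two_of_mem_halfSq ((mem_clSec_iff hm).1 hω).2
  rw [norm_chi] at h1
  rw [mem_closedBall_zero_iff]
  by_contra h2
  rw [not_le] at h2
  have h3 : ‖ω‖ ^ 1 ≤ ‖ω‖ ^ m := pow_le_pow_right₀ (by linarith) (by omega)
  rw [pow_one] at h3
  linarith

lemma mapsTo_chi (hm : 2 ≤ m) : MapsTo (chi m l) (clSec m l) halfSq := fun _ h => ((mem_clSec_iff hm).1 h).2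

lemma halfSq_nonempty_interior : (interior halfSq).Nonempty := by
  rw [halfSq, Complex.interior_reProdIm, interior_Icc, interior_Icc]
  exact ⟨⟨0, 1 / 2⟩, by constructor <;> constructor <;> norm_num⟩

/-- Away from the corner the sector is the image of a convex set with interior under a map with
invertible derivative; at the corner it contains a piece of a convex cone with interior. -/
lemma uniqueDiffOn_clSec (hm : 2 ≤ m) : UniqueDiffOn ℝ (clSec m l) := by
  have hm0 : 0 < m := by omega
  rintro _ ⟨z, hz, rfl⟩
  rcases eq_or_ne z 0 with rfl | h0
  · rw [psi_zero hm0]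
    -- Inside the unit disc the constraints of the square hold automatically, so only those of the
    -- cone remain.
    have hsub : secCone m l ∩ Metric.closedBall 0 1 ⊆ clSec m l := by
      rintro ω ⟨h1, h2⟩
      rw [mem_clSec_iff hm]
      refine ⟨h1, ?_⟩
      rw [mem_closedBall_zero_iff] at h2
      have h3 : ‖chi m l ω‖ ≤ 1 := by rw [norm_chi]; exact pow_le_one₀ (norm_nonneg _) h2
      have h4 : 0 ≤ (chi m l ω).im := by
        rcases eq_or_ne ω 0 with rfl | h0
        · simp [chi, hm0.ne']
        · exact (chi_mem_upperHP hm h1 h0).1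
      exact ⟨abs_le.1 ((Complex.abs_re_le_norm _).trans h3), h4,
        (le_abs_self _).trans ((Complex.abs_im_le_norm _).trans h3)⟩
    refine UniqueDiffWithinAt.mono (uniqueDiffWithinAt_convex
      ((convex_secCone m l).inter (convex_closedBall 0 1)) ?_ (subset_closure ?_)) hsub
    · refine ⟨rot m l * ((1 / 2 : ℝ) : ℂ), ?_⟩
      rw [interior_inter]
      refine ⟨?_, ?_⟩
      · refine interior_maximal (t := {ω | |((starRingEnd ℂ) (rot m l) * ω).im| <
          Real.tan (Real.pi / (2 * m)) * ((starRingEnd ℂ) (rot m l) * ω).re}) (fun ω hω => ?_) ?_ ?_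
        · exact le_of_lt (mem_ofPred_eq ▸ hω)
        · exact isOpen_lt (by fun_prop) (by fun_prop)
        · rw [mem_ofPred_eq, ← mul_assoc, conj_rot_mul_rot, one_mul, Complex.ofReal_im, Complex.ofReal_re]
          simpa using tan_pos hm
      · refine interior_mono Metric.ball_subset_closedBall ?_
        rw [Metric.isOpen_ball.interior_eq, mem_ball_zero_iff, norm_mul, norm_rot, Complex.norm_real]
        norm_num
    · refine ⟨?_, by simp⟩
      rw [secCone, mem_ofPred_eq, mul_zero]; simp [cone]
  · have hd : HasDerivAt (psi m l) (rot m l * (-Complex.I * (1 / m : ℝ) * pw ((1 / m : ℝ) - 1) z)) z :=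
      (hasDerivAt_pw _ (upperHP_subset ⟨hz.2.1, h0⟩)).const_mul _
    set c := rot m l * (-Complex.I * (1 / m : ℝ) * pw ((1 / m : ℝ) - 1) z) with hc
    have hc0 : c ≠ 0 := by
      refine mul_ne_zero (rot_ne_zero m l) (mul_ne_zero (mul_ne_zero (neg_ne_zero.2 Complex.I_ne_zero) ?_) ?_)
      · exact_mod_cast (by positivity : (1 / m : ℝ) ≠ 0)
      · rw [← norm_pos_iff, norm_pw _ h0]
        exact Real.rpow_pos_of_pos (norm_pos_iff.2 h0) _
    have h1 : HasFDerivWithinAt (psi m l) (wirt c 0) halfSq z := HasD.of_hasDerivAt hd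
    refine h1.uniqueDiffWithinAt (uniqueDiffOn_convex convex_halfSq halfSq_nonempty_interior z hz) ?_
    refine Function.Surjective.denseRange fun v => ⟨v / c, ?_⟩
    rw [wirt_apply]; field_simp; ring

lemma mono_self (α : ℝ) {z : ℂ} (hz : z ≠ 0) : mono α α z = ((‖z‖ ^ 2) ^ α : ℝ) := by
  rw [mono, Complex.mul_conj, Complex.normSq_eq_norm_sq, norm_pw _ hz, ← Real.rpow_natCast,
    ← Real.rpow_natCast, ← Real.rpow_mul (norm_nonneg _), ← Real.rpow_mul (norm_nonneg _), mul_comm α]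

/-- The transported integrand on the half square. -/
noncomputable def integrand (m l : ℕ) (f : ℂ → ℂ) (z : ℂ) : ℂ :=
  f (psi m l z) * mono (-(((m : ℝ) - 1) / m)) (-(((m : ℝ) - 1) / m)) z

/-- The sectors l = 2j and l = 2j + 1 are the halves of the j-th sector of the m-th root; for odd l
they come from the lower half-plane, which the sign `eps l` turns into the upper one. -/
lemma rootBranch_eq (hm : 0 < m) {z : ℂ} (hz : 0 < eps l * z.im) :
    rootBranch m (l / 2) z = psi m l (eps l * z) := by
  have hmC : (m : ℂ) ≠ 0 := by exact_mod_cast hm.ne'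
  have hz0 : z ≠ 0 := by rintro rfl; simp at hz
  have him : z.im ≠ 0 := by rintro h; simp [h] at hz
  -- The parity of l, recording whether a half turn separates the argument in [0, 2π) from the one
  -- used by `psi`.
  set c : ℝ := ((l % 2 : ℕ) : ℝ) with hc
  have hl : (l : ℝ) = 2 * (l / 2 : ℕ) + c := by
    rw [hc]; exact_mod_cast (Nat.div_add_mod l 2).symm
  have heps : (eps l : ℂ) = Complex.exp (-(c * (Real.pi * Complex.I))) := by
    rw [eps, neg_one_pow_eq_pow_mod_two, hc]
    rcases Nat.mod_two_eq_zero_or_one l with h | h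
    · simp [h]
    · rw [h]; simp [Complex.exp_neg]
  have hφ : argPos z - Real.pi * c - Real.pi / 2 ∈ Ioo (-(Real.pi / 2)) (Real.pi / 2) := by
    rw [eps, neg_one_pow_eq_pow_mod_two] at hz
    rcases Nat.mod_two_eq_zero_or_one l with h | h
    · rw [h] at hz hc
      have := (argPos_of_im him).1 (by simpa using hz)
      simp only [hc, CharP.cast_eq_zero, mul_zero, sub_zero]
      exact ⟨by linarith [this.1], by linarith [this.2]⟩
    · rw [h] at hz hc
      have := (argPos_of_im him).2 (by simpa using hz)
      simp only [hc, Nat.cast_one, mul_one]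
      exact ⟨by linarith [this.1], by linarith [this.2]⟩
  have e1 : (eps l : ℂ) * z = (‖z‖ : ℂ) * (Complex.I *
      Complex.exp (((argPos z - Real.pi * c - Real.pi / 2 : ℝ) : ℂ) * Complex.I)) := by
    conv_lhs => rw [← norm_mul_exp_argPos z]
    have hI : ∀ x : ℂ, Complex.I * Complex.exp x = Complex.exp (Real.pi / 2 * Complex.I + x) := fun x => by
      rw [Complex.exp_add, Complex.exp_pi_div_two_mul_I]
    rw [heps, hI, mul_left_comm, ← Complex.exp_add]
    congr 2; push_cast; ring
  rw [e1, psi, pw_polar _ (norm_pos_iff.2 hz0) ⟨by linarith [hφ.1, Real.pi_pos], by linarith [hφ.2, Real.pi_pos]⟩,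
    rootBranch, rot, ← Complex.exp_nat_mul, mul_left_comm, mul_left_comm (Complex.exp _),
    ← Complex.exp_add, ← Complex.exp_add]
  congr 2
  rw [hl]
  push_cast
  field_simp
  ring

lemma localSol_eq (hm : 2 ≤ m) (f : ℂ → ℂ) {ω : ℂ} (hω : ω ∈ opSec m l) (him : 0 < (chi m l ω).im) :
    localSol m f ω = eps l * horInt (-eps l) (integrand m l f) (chi m l ω) := by
  have hm0 : 0 < m := by omega
  have hmR : (0 : ℝ) < m := by exact_mod_cast hm0
  -- The scaled argument lies strictly between l/2 and (l+1)/2, so its integer part is l / 2 rounded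
  -- down.
  have hfloor : ⌊(m : ℝ) * argPos ω / (2 * Real.pi)⌋₊ = l / 2 := by
    have ht := argPos_mem_of_mem_opSec hm0 hω
    have hpi := Real.pi_pos
    rw [mem_Ioo, div_lt_iff₀ hmR, lt_div_iff₀ hmR] at ht
    have h1 := Nat.div_add_mod l 2
    have h2 := Nat.mod_lt l two_pos
    have h3 : 2 * ((l / 2 : ℕ) : ℝ) ≤ l := by exact_mod_cast (by omega : 2 * (l / 2) ≤ l)
    have h4 : (l : ℝ) + 1 ≤ 2 * ((l / 2 : ℕ) : ℝ) + 2 := by exact_mod_cast (by omega : l + 1 ≤ 2 * (l / 2) + 2)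
    rw [Nat.floor_eq_iff (by
      have := (norm_mul_exp_argPos ω)
      have h5 : 0 ≤ argPos ω := by
        rw [argPos]; split_ifs with h; exacts [h, by linarith [Complex.neg_pi_lt_arg ω]]
      positivity)]
    rw [le_div_iff₀ (by positivity), div_lt_iff₀ (by positivity)]
    constructor <;> nlinarith
  have hint : ∀ v : ℝ, f (rootBranch m (l / 2) (⟨v, (ω ^ m).im⟩ : ℂ)) /
      (((v ^ 2 + (ω ^ m).im ^ 2) ^ (((m : ℝ) - 1) / m) : ℝ) : ℂ) =
      integrand m l f ⟨eps l * v, (chi m l ω).im⟩ := by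
    intro v
    have e1 : (eps l : ℂ) * (⟨v, (ω ^ m).im⟩ : ℂ) = ⟨eps l * v, (chi m l ω).im⟩ := by
      apply Complex.ext
      · rw [Complex.re_ofReal_mul]
      · rw [chi, Complex.im_ofReal_mul, Complex.im_ofReal_mul]
    have h0 : (⟨eps l * v, (chi m l ω).im⟩ : ℂ) ≠ 0 := fun h => him.ne' (congrArg Complex.im h)
    rw [rootBranch_eq hm0 (by rw [chi, Complex.im_ofReal_mul] at him; exact him), e1, integrand, mono_self _ h0,
      Real.rpow_neg (by positivity), ← e1, norm_mul, norm_eps, one_mul, Complex.ofReal_inv, div_eq_mul_inv,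
      ← Complex.normSq_eq_norm_sq, Complex.normSq_apply, pow_two, pow_two]
  rw [localSol, hfloor, scriptF]
  simp only [hint]
  rw [horInt]
  have hre : (chi m l ω).re = eps l * (ω ^ m).re := by rw [chi, Complex.re_ofReal_mul]
  rw [hre]
  -- For odd l the substitution v ↦ -v turns the starting side -1 into 1 and produces the outer
  -- sign.
  rcases eps_cases l with h | h
  · simp only [h, one_mul, Complex.ofReal_one]
  · simp only [h, neg_mul, one_mul, neg_neg, Complex.ofReal_neg, Complex.ofReal_one]
    rw [intervalIntegral.integral_comp_neg (fun v : ℝ => integrand m l f ⟨v, (chi m l ω).im⟩), neg_neg,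
      intervalIntegral.integral_symm]

end SaddleSector

/-! ### Homogeneous Taylor parts of high degree -/

namespace SaddleSector

open Set Filter Topology MeasureTheory

variable {m l : ℕ} {a K : ℝ} {w ρ Θ : ℝ → ℝ}

/-- The vertical segment of unit length above the real point `b`. -/
def vertSeg (b : ℝ) : Set ℂ := {x | x.re = b ∧ x.im ∈ Icc (0 : ℝ) 1}

lemma one_le_norm_of_mem_vertSeg {b : ℝ} (hb : |b| = 1) {x : ℂ} (hx : x ∈ vertSeg b) : 1 ≤ ‖x‖ := by
  have := Complex.abs_re_le_norm x
  rwa [hx.1, hb] at this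

/-- This handles the value of a primitive at the starting side, a function of s alone. On the
vertical side ‖x‖ ≥ 1, so symbol estimates become plain bounds on all derivatives. -/
lemma GoodMod.reg_vert (h : GoodMod a w ρ Θ K) {b M : ℝ} (hb : |b| = 1) (hM : 0 ≤ M) (N : ℕ) {E : ℂ → ℂ}
    (hE : Sym (N + 1) (fun _ => M) (vertSeg b) E) :
    Reg N w halfSq (2 * K * M) (fun z => E (b + z.im * Complex.I)) := by
  have hK := h.one_le
  have hMK : M ≤ 2 * K * M := by nlinarith
  have hmaps : MapsTo (fun z : ℂ => (b : ℂ) + z.im * Complex.I) halfSq (vertSeg b) := fun z hz =>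
    ⟨by simp, by simpa using hz.2⟩
  have hχ : ∀ z : ℂ, HasD (fun z : ℂ => (b : ℂ) + z.im * Complex.I) (1 / 2) (-1 / 2) halfSq z := by
    intro z
    have h1 : HasUS (fun z : ℂ => (b : ℂ) + z.im * Complex.I) 0 Complex.I halfSq z := by
      have h0 : HasUS (fun _ : ℂ => (b : ℂ)) 0 0 halfSq z := (HasD.const (b : ℂ)).cast (by simp) (by simp)
      have h2 : HasUS (fun z : ℂ => (b : ℂ) + Complex.I * z.im) 0 Complex.I halfSq z :=
        (h0.add ((HasUS.im (z := z) (A := halfSq)).const_mul Complex.I)).cast (by simp) (by simp)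
      exact HasD.congr h2 (fun y _ => by ring) (by ring)
    exact HasD.cast h1 (by rw [Complex.I_mul_I]; norm_num) (by rw [Complex.I_mul_I]; norm_num)
  have key : ∀ {n : ℕ} {E : ℂ → ℂ}, Sym (n + 1) (fun _ => M) (vertSeg b) E →
      ∃ Ea Eb : ℂ → ℂ, (∀ z ∈ halfSq, HasD (fun z : ℂ => E (b + z.im * Complex.I))
        (1 / 2 * (Ea (b + z.im * Complex.I) - Eb (b + z.im * Complex.I)))
        (-(1 / 2) * (Ea (b + z.im * Complex.I) - Eb (b + z.im * Complex.I))) halfSq z) ∧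
        Sym n (fun _ => M) (vertSeg b) (fun x => 1 / 2 * (Ea x - Eb x)) ∧
        Sym n (fun _ => M) (vertSeg b) (fun x => -(1 / 2) * (Ea x - Eb x)) := by
    intro n E hE
    obtain ⟨-, Ea, Eb, hd, ha, hb'⟩ := hE
    have hdiv : ∀ x ∈ vertSeg b, M / ‖x‖ ≤ M := fun x hx =>
      div_le_self hM (one_le_norm_of_mem_vertSeg hb hx)
    refine ⟨Ea, Eb, fun z hz => ?_, ?_, ?_⟩
    · refine (HasD.comp (χ := fun z : ℂ => (b : ℂ) + z.im * Complex.I) (hd _ (hmaps hz)) (hχ z) hmaps).cast ?_ ?_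
      · simp [map_ofNat (starRingEnd ℂ) 2]; ring
      · simp [map_ofNat (starRingEnd ℂ) 2]; ring
    · refine (((ha.const_mul (1 / 2)).add (hb'.const_mul (-(1 / 2)))).mono_weight ?_).congr
        fun x _ => by ring
      intro x hx
      have := hdiv x hx
      simp only [norm_neg, norm_div, norm_one, RCLike.norm_ofNat]
      linarith
    · refine (((ha.const_mul (-(1 / 2))).add (hb'.const_mul (1 / 2))).mono_weight ?_).congr
        fun x _ => by ring
      intro x hx
      have := hdiv x hx
      simp only [norm_neg, norm_div, norm_one, RCLike.norm_ofNat]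
      linarith
  induction N generalizing E with
  | zero =>
    obtain ⟨Ea, Eb, hd, ha, hb'⟩ := key hE
    refine ⟨fun z hz => (hE.bound _ (hmaps hz)).trans hMK, fun x hx y hy => ?_⟩
    have h1 := convex_halfSq.norm_image_sub_le_of_norm_hasFDerivWithin_le (C := 2 * M)
      (fun z hz => hd z hz) (fun z hz => (norm_wirt_le _ _).trans (by
        have e1 := ha _ (hmaps hz)
        have e2 := hb' _ (hmaps hz)
        linarith)) hy hx
    refine h1.trans ?_
    rw [← dist_eq_norm]
    rcases (dist_nonneg (x := x) (y := y)).eq_or_lt with h0 | h0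
    · rw [← h0, h.w_zero]; simp
    · have h8 : dist x y ≤ 8 := by
        have e1 := norm_le_two_of_mem_halfSq hx
        have e2 := norm_le_two_of_mem_halfSq hy
        rw [dist_eq_norm]
        linarith [norm_sub_le x y]
      have := mul_le_mul_of_nonneg_left (h.le_w _ h0 h8) (by positivity : 0 ≤ 2 * M)
      linarith
  | succ N ih =>
    obtain ⟨Ea, Eb, hd, ha, hb'⟩ := key hE
    exact ⟨fun z hz => (hE.bound _ (hmaps hz)).trans hMK, _, _, hd, ih ha, ih hb'⟩

lemma logWeight_bound (κ C : ℝ) : ∃ M, 0 ≤ M ∧ ∀ r ∈ Icc (1 : ℝ) 2, logWeight κ C r ≤ M := by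
  have hc : ContinuousOn (fun r => logWeight κ C r) (Icc (1 : ℝ) 2) := by
    have hne : ∀ r ∈ Icc (1 : ℝ) 2, r ≠ 0 := fun r hr => by linarith [hr.1]
    have h1 : ContinuousOn (fun r : ℝ => r ^ κ) (Icc (1 : ℝ) 2) :=
      continuousOn_id.rpow_const fun r hr => Or.inl (hne r hr)
    have h2 : ContinuousOn (fun r : ℝ => |Real.log r|) (Icc (1 : ℝ) 2) :=
      (Real.continuousOn_log.mono fun r hr => hne r hr).abs
    unfold logWeight
    split_ifs
    · exact continuousOn_const.mul (h1.mul (continuousOn_const.add h2))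
    · exact continuousOn_const.mul (h1.mul continuousOn_const)
  obtain ⟨M, hM⟩ := isCompact_Icc.exists_bound_of_continuousOn hc
  exact ⟨|M|, abs_nonneg M, fun r hr => (le_abs_self _).trans ((hM r hr).trans (le_abs_self M))⟩

/-- Functions of the imaginary part obtained from a symbol. -/
lemma GoodMod.exists_reg_vert (h : GoodMod a w ρ Θ K) (hm : 2 ≤ m) (N : ℕ) {E : ℂ → ℂ} {κ : ℝ}
    (hE : ∃ C, 0 ≤ C ∧ Sym (N + 1) (fun z => logWeight κ C ‖z‖) upperHP E) {b : ℝ} (hb : |b| = 1) :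
    ∃ M, 0 ≤ M ∧ Reg N w (clSec m l) M (fun ω => E (b + (chi m l ω).im * Complex.I)) := by
  obtain ⟨C, hC, hs⟩ := hE
  obtain ⟨M, hM, hMb⟩ := logWeight_bound κ C
  have hsub : vertSeg b ⊆ upperHP := fun x hx => ⟨hx.2.1, norm_pos_iff.1
    (one_pos.trans_le (one_le_norm_of_mem_vertSeg hb hx))⟩
  have h1 : Sym (N + 1) (fun _ => M) (vertSeg b) E := by
    refine (hs.mono_set hsub).mono_weight fun x hx => hMb _ ⟨one_le_norm_of_mem_vertSeg hb hx, ?_⟩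
    have := Complex.norm_le_abs_re_add_abs_im x
    rw [hx.1, hb, abs_of_nonneg hx.2.1] at this
    linarith [hx.2.2]
  have hK := h.one_le
  have h2 := h.reg_vert hb hM N h1
  obtain ⟨D, hD, hcomp⟩ := h.reg_comp_pow convex_halfSq halfSq_subset (clSec_subset_ball (l := l) hm)
    (norm_eps l) m (mapsTo_chi hm) N 0 0
  have h3 := hcomp _ _ (by positivity) h2
  simp only [pow_zero, mul_one] at h3
  exact ⟨_, by positivity, h3⟩

lemma sym_pow (N p : ℕ) {B : Set ℂ} (hB : ∀ x ∈ B, x ≠ 0) :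
    ∃ C, 1 ≤ C ∧ Sym N (fun x => C * ‖x‖ ^ p) B (fun x => x ^ p) := by
  induction N generalizing p with
  | zero => exact ⟨1, le_rfl, fun x _ => by simp [norm_pow]⟩
  | succ N ih =>
    obtain ⟨C, hC, hs⟩ := ih (p - 1)
    have hle : ∀ x ∈ B, ‖(p : ℂ)‖ * (C * ‖x‖ ^ (p - 1)) ≤ max 1 (p * C) * ‖x‖ ^ p / ‖x‖ := by
      intro x hx
      have hn : 0 < ‖x‖ := norm_pos_iff.2 (hB x hx)
      rcases Nat.eq_zero_or_pos p with rfl | hp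
      · simp
      · rw [Complex.norm_natCast, le_div_iff₀ hn]
        calc (p : ℝ) * (C * ‖x‖ ^ (p - 1)) * ‖x‖ = p * C * ‖x‖ ^ (p - 1 + 1) := by rw [pow_succ]; ring
          _ = p * C * ‖x‖ ^ p := by rw [Nat.sub_add_cancel hp]
          _ ≤ _ := mul_le_mul_of_nonneg_right (le_max_right _ _) (by positivity)
    refine ⟨max 1 (p * C), le_max_left _ _, fun x _ => ?_, _, _, fun x hx => HasD.pow p,
      (hs.const_mul p).mono_weight hle, ?_⟩
    · rw [norm_pow]
      exact le_mul_of_one_le_left (by positivity) (le_max_left _ _)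
    · refine (Sym.const (C := 0) (by simp)).mono_weight fun x hx => ?_
      positivity

/-- Composition of a symbol on the upper half-plane with the chart. -/
lemma GoodMod.exists_reg_comp_chi (h : GoodMod a w ρ Θ K) (hm : 2 ≤ m) (N : ℕ) {E : ℂ → ℂ} {κ : ℝ}
    (hκ : (N : ℝ) + 1 ≤ m * κ)
    (hE : ∃ C, 0 ≤ C ∧ Sym (N + 1) (fun z => logWeight κ C ‖z‖) upperHP E) :
    ∃ M, 0 ≤ M ∧ ∃ G, Reg N w (clSec m l) M G ∧ ∀ ω ∈ clSec m l, ω ≠ 0 → G ω = E (chi m l ω) := by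
  obtain ⟨C₀, hC₀, hs⟩ := hE
  have hm0 : 0 < m := by omega
  have hmR : (0 : ℝ) < m := by exact_mod_cast hm0
  have hm1 : (1 : ℝ) ≤ m := by exact_mod_cast hm0
  have hK := h.one_le
  have hκ0 : 0 ≤ κ := by
    by_contra h0
    have := mul_neg_of_pos_of_neg hmR (not_le.1 h0)
    have := Nat.cast_nonneg (α := ℝ) N
    linarith
  -- `reg_of_sym` requires convexity, so the estimate is made on this convex set and restricted to
  -- the curvilinear sector afterwards.
  set A : Set ℂ := secCone m l ∩ Metric.closedBall 0 2 with hA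
  have hAconv : Convex ℝ A := (convex_secCone m l).inter (convex_closedBall 0 2)
  have hA4 : A ⊆ Metric.closedBall 0 4 := fun x hx =>
    Metric.closedBall_subset_closedBall (by norm_num) hx.2
  set B := A \ {0} with hB
  have hB0 : ∀ x ∈ B, x ≠ 0 := fun x hx => hx.2
  obtain ⟨C₁, hC₁, hs₁⟩ := sym_pow (N + 1) (m - 1) hB0
  have hmC : 1 ≤ m * C₁ := one_le_mul_of_one_le_of_one_le hm1 hC₁
  have hχ' : Sym (N + 1) (fun x => m * C₁ * (‖chi m l x‖ / ‖x‖)) B (fun x => eps l * (m * x ^ (m - 1))) := by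
    refine ((hs₁.const_mul m).const_mul (eps l)).mono_weight fun x hx => le_of_eq ?_
    have hn : ‖x‖ ≠ 0 := norm_ne_zero_iff.2 (hB0 x hx)
    rw [norm_eps, norm_chi, Complex.norm_natCast, one_mul, ← pow_sub_one_mul hm0.ne', mul_div_assoc, div_self hn]
    ring
  have hcomp := Sym.comp_chart (χ := chi m l) hmC (fun x hx => chi_mem_upperHP hm hx.1.1 hx.2) hB0
    (fun x hx => hx.2) (fun x _ => ((HasD.pow m).const_mul (eps l)).cast rfl (mul_zero _)) hχ' hs
  set D := (2 * (m * C₁)) ^ ((N + 1) * (N + 1)) with hD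
  have hDp : 0 ≤ D := by positivity
  set M := D * (C₀ * (m * (K * 2 ^ (m * κ - (N + 1))))) with hM
  have hMp : 0 ≤ M := by positivity
  have hweight : ∀ x ∈ B, D * logWeight κ C₀ ‖chi m l x‖ ≤ M * (‖x‖ ^ (N + 1) * ρ ‖x‖) := by
    intro x hx
    have hn : 0 < ‖x‖ := norm_pos_iff.2 (hB0 x hx)
    have hn2 : ‖x‖ ≤ 2 := by simpa using hx.1.2
    have hlog := h.log_le_rho _ hn (by linarith)
    have hρ := h.rho_pos hn (by linarith)
    rw [norm_chi, logWeight, if_pos hκ0, Real.log_pow, abs_mul, Nat.abs_cast, ← Real.rpow_natCast ‖x‖ m,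
      ← Real.rpow_mul hn.le]
    have e1 : 1 + (m : ℝ) * |Real.log ‖x‖| ≤ m * (K * ρ ‖x‖) := by
      refine le_trans ?_ (mul_le_mul_of_nonneg_left hlog hmR.le)
      nlinarith [abs_nonneg (Real.log ‖x‖)]
    -- The pullback has degree m κ ≥ N + 1; the surplus power is bounded since ‖x‖ ≤ 2, and the
    -- logarithm is absorbed by ρ in `e1`.
    have e2 : ‖x‖ ^ ((m : ℝ) * κ) ≤ 2 ^ (m * κ - (N + 1)) * ‖x‖ ^ (N + 1) := by
      have : ‖x‖ ^ ((m : ℝ) * κ) = ‖x‖ ^ ((m : ℝ) * κ - (N + 1)) * ‖x‖ ^ (N + 1) := by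
        rw [← Real.rpow_natCast ‖x‖ (N + 1), ← Real.rpow_add hn]
        congr 1; push_cast; ring
      rw [this]
      exact mul_le_mul_of_nonneg_right (Real.rpow_le_rpow hn.le hn2 (by linarith)) (by positivity)
    have e3 := mul_le_mul e2 e1 (by positivity) (by positivity)
    have e4 := mul_le_mul_of_nonneg_left e3 (mul_nonneg hDp hC₀)
    rw [hM]
    calc _ = D * C₀ * (‖x‖ ^ ((m : ℝ) * κ) * (1 + (m : ℝ) * |Real.log ‖x‖|)) := by ring
      _ ≤ _ := e4
      _ = _ := by ring
  classical
  set G : ℂ → ℂ := fun ω => if ω = 0 then 0 else E (chi m l ω) with hG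
  have hGs : Sym (N + 1) (fun x => M * (‖x‖ ^ (N + 1) * ρ ‖x‖)) (A \ {0}) G :=
    (hcomp.mono_weight hweight).congr fun x hx => if_neg (hB0 x hx)
  have hreg := h.reg_of_sym (g := G) hAconv hA4 N hMp (if_pos rfl) hGs
  have h4 : 0 ≤ w 4 := h.w_nonneg (by norm_num)
  refine ⟨_, by positivity, G, hreg.mono_set fun ω hω => ⟨((mem_clSec_iff hm).1 hω).1, clSec_subset_ball hm hω⟩,
    fun ω _ h0 => if_neg h0⟩

/-- Integration along horizontal lines of a function with a known primitive. -/
lemma horInt_eq_sub {E Ea Eb h : ℂ → ℂ} (hd : ∀ z : ℂ, 0 < z.im → HasD E (Ea z) (Eb z) univ z)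
    (hsum : ∀ z : ℂ, 0 < z.im → Ea z + Eb z = h z) (hc : ContinuousOn h {z | 0 < z.im}) (b : ℝ) {z : ℂ}
    (hz : 0 < z.im) : horInt b h z = E z - E (b + z.im * Complex.I) := by
  have hline : ∀ v : ℝ, HasDerivAt (fun v : ℝ => (v : ℂ) + z.im * Complex.I) 1 v := fun v =>
    (Complex.ofRealCLM.hasDerivAt (x := v)).add_const _
  have e0 : ∀ v : ℝ, (⟨v, z.im⟩ : ℂ) = v + z.im * Complex.I := fun v => by
    apply Complex.ext <;> simp
  have hder : ∀ v ∈ uIcc b z.re, HasDerivAt (fun v : ℝ => E ((v : ℂ) + z.im * Complex.I)) (h ⟨v, z.im⟩) v := by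
    intro v _
    have him : 0 < ((v : ℂ) + z.im * Complex.I).im := by simpa using hz
    have h1 := HasD.comp_curve (γ := fun v : ℝ => (v : ℂ) + z.im * Complex.I) (S := univ)
      (hd _ him) (hline v).hasDerivWithinAt (mapsTo_univ _ _)
    rw [hasDerivWithinAt_univ] at h1
    refine h1.congr_deriv ?_
    rw [e0, ← hsum _ him]; simp
  rw [horInt, intervalIntegral.integral_eq_sub_of_hasDerivAt hder]
  · simp
  · refine ContinuousOn.intervalIntegrable ?_
    simp only [e0]
    exact hc.comp (Continuous.continuousOn (by fun_prop)) fun v _ => by simpa using hz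

lemma continuousOn_integrand (hm : 0 < m) {P : ℂ → ℂ} (hP : Continuous P) :
    ContinuousOn (integrand m l P) {z | 0 < z.im} := by
  refine ContinuousOn.mul (hP.comp_continuousOn ((continuousOn_psi hm).mono fun z hz => show 0 ≤ z.im from le_of_lt hz)) ?_
  exact (homSpace.continuousOn (mono_mem rfl)).mono fun z hz => Or.inl hz

lemma pw_pow_nat (n : ℕ) (z : ℂ) : pw (1 / m) z ^ n = pw (n / m) z := by
  rw [pw, pw, ← Complex.cpow_nat_mul]
  congr 1; push_cast; ring

lemma psi_bimon (p q : ℕ) (z : ℂ) : bimon p q (psi m l z) =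
    bimon p q (rot m l) * mono (p / m) (q / m) z := by
  simp only [bimon, psi, mono, map_mul, mul_pow, ← map_pow]
  rw [pw_pow_nat, pw_pow_nat]
  ring

lemma mono_mul_mono (α β α' β' : ℝ) {z : ℂ} (hz : z ≠ 0) :
    mono α β z * mono α' β' z = mono (α + α') (β + β') z := by
  have h0 : -Complex.I * z ≠ 0 := mul_ne_zero (neg_ne_zero.2 Complex.I_ne_zero) hz
  have h1 : ∀ x y : ℝ, pw (x + y) z = pw x z * pw y z := fun x y => by
    rw [pw, pw, pw, Complex.ofReal_add, Complex.cpow_add _ _ h0]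
  rw [mono, mono, mono, h1, h1, map_mul]; ring

/-- The bisector has argument π l / m + π / (2m): the first part gives the power of θ₀ in 𝒞^j_l, the
second the exponential e^(iπ(y-x)/2) of 𝔅. -/
lemma bimon_rot (hm : 0 < m) {j p : ℕ} (hp : p ≤ j) : bimon p (j - p) (rot m l) = phase m l j p := by
  have hmC : (m : ℂ) ≠ 0 := by exact_mod_cast hm.ne'
  rw [bimon, rot, ← Complex.exp_conj, map_mul, Complex.conj_ofReal, Complex.conj_I, ← Complex.exp_nat_mul,
    ← Complex.exp_nat_mul, ← Complex.exp_add, phase, ← Complex.exp_int_mul, ← Complex.exp_add]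
  congr 1
  rw [gexp, gexp, Nat.cast_sub hp, Nat.cast_sub hp]
  push_cast
  field_simp
  ring

lemma integrand_bimon (hm : 0 < m) {j p : ℕ} (hp : p ≤ j) {z : ℂ} (hz : z ≠ 0) :
    integrand m l (bimon p (j - p)) z = phase m l j p * mono (-gexp m p) (-gexp m (j - p)) z := by
  have hmR : (m : ℝ) ≠ 0 := by positivity
  rw [integrand, psi_bimon, bimon_rot hm hp, mul_assoc, mono_mul_mono _ _ _ _ hz]
  congr 2
  · rw [gexp]; ring
  · rw [gexp]; ring

lemma continuous_bimon (p q : ℕ) : Continuous (bimon p q) := by unfold bimon; fun_prop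

lemma integrand_taylorPart (f : ℂ → ℂ) (j : ℕ) (z : ℂ) : integrand m l (taylorPart f j) z =
    ∑ p ∈ Finset.range (j + 1), taylorCoeff f j p * integrand m l (bimon p (j - p)) z := by
  simp only [integrand, taylorPart, Finset.sum_apply, Pi.smul_apply, smul_eq_mul, Finset.sum_mul, mul_assoc]

lemma continuous_taylorPart (f : ℂ → ℂ) (j : ℕ) : Continuous (taylorPart f j) := by
  have : taylorPart f j = fun ω => ∑ p ∈ Finset.range (j + 1), taylorCoeff f j p * bimon p (j - p) ω := by
    ext ω; simp [taylorPart]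
  rw [this]
  exact continuous_finsetSum _ fun p _ => continuous_const.mul (continuous_bimon p (j - p))

/-- The local solution in the chart. -/
noncomputable def chartSol (m l : ℕ) (f : ℂ → ℂ) (ω : ℂ) : ℂ :=
  eps l * horInt (-eps l) (integrand m l f) (chi m l ω)

lemma chi_im_pos (hm : 2 ≤ m) (hl : l < 2 * m) {ω : ℂ} (hω : ω ∈ opSec m l) : 0 < (chi m l ω).im := by
  rw [opSec_eq hm hl] at hω
  obtain ⟨z, hz, rfl⟩ := hω
  rw [chi_psi (by omega)]
  exact hz.2.1

lemma chartSol_taylorPart (hm : 2 ≤ m) (hl : l < 2 * m) (f : ℂ → ℂ) (j : ℕ) {ω : ℂ} (hω : ω ∈ opSec m l) :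
    chartSol m l (taylorPart f j) ω =
      ∑ p ∈ Finset.range (j + 1), taylorCoeff f j p * chartSol m l (bimon p (j - p)) ω := by
  have him := chi_im_pos hm hl hω
  simp only [chartSol, horInt, integrand_taylorPart]
  rw [intervalIntegral.integral_finsetSum]
  · simp only [intervalIntegral.integral_const_mul, Finset.mul_sum]
    exact Finset.sum_congr rfl fun p _ => by ring
  · intro p _
    refine (ContinuousOn.intervalIntegrable ?_).const_mul _
    refine (continuousOn_integrand (by omega) (continuous_bimon p (j - p))).comp
      (continuous_horiz _).continuousOn fun v _ => him

lemma ne_zero_of_mem_opSec {ω : ℂ} (hω : ω ∈ opSec m l) : ω ≠ 0 := hω.2.1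

lemma abs_neg_eps (l : ℕ) : |(-eps l)| = 1 := by
  rcases eps_cases l with h | h <;> simp [h]

/-- A homogeneous part of high degree satisfying the Gamma condition. -/
lemma GoodMod.exists_reg_taylorPart_high (h : GoodMod a w ρ Θ K) (hm : 2 ≤ m) (hl : l < 2 * m) (N : ℕ)
    (f : ℂ → ℂ) {j : ℕ} (hj : N + m ≤ j + 1) (h0 : secDist m j l f = 0) :
    ∃ M, 0 ≤ M ∧ ∃ G, Reg N w (clSec m l) M G ∧ EqOn G (chartSol m l (taylorPart f j)) (opSec m l) := by
  have hm0 : 0 < m := by omega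
  have hmR : (m : ℝ) ≠ 0 := by positivity
  have hγ : ∀ p ∈ Finset.range (j + 1), -gexp m p + -gexp m (j - p) = ((j : ℝ) - 2 * ((m : ℝ) - 1)) / m := by
    intro p hp
    rw [gexp, gexp, Nat.cast_sub (by rw [Finset.mem_range] at hp; omega)]; ring
  obtain ⟨E, hE⟩ := exists_isPrim (Finset.range (j + 1)) (fun p => taylorCoeff f j p * phase m l j p)
    (fun p => -gexp m p) (fun p => -gexp m (j - p)) hγ
    (by simpa only [neg_neg] using sum_taylor_gamma_eq_zero hm l f h0)
  obtain ⟨c, i, Es, -, hd⟩ := hE.exists_deriv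
  -- In the variable ω the primitive has degree j - (m - 2), and this is at least N + 1 exactly when
  -- N + m ≤ j + 1.
  have hκ : (N : ℝ) + 1 ≤ m * (((j : ℝ) - 2 * ((m : ℝ) - 1)) / m + 1) := by
    rw [mul_add, mul_div_cancel₀ _ hmR]
    have : (N : ℝ) + m ≤ j + 1 := by exact_mod_cast hj
    linarith
  obtain ⟨M₁, hM₁, G, hG, hGe⟩ := h.exists_reg_comp_chi (l := l) hm N hκ (hE.sym (N + 1))
  obtain ⟨M₂, hM₂, hV⟩ := h.exists_reg_vert (l := l) hm N (hE.sym (N + 1)) (abs_neg_eps l)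
  refine ⟨_, ?_, _, (hG.add (hV.const_mul (-1))).const_mul (eps l), fun ω hω => ?_⟩
  · positivity
  · have him := chi_im_pos hm hl hω
    have hmem := opSec_subset hm hl hω
    have key := horInt_eq_sub (h := integrand m l (taylorPart f j))
      (fun z hz => (hd z (Or.inl hz)).1) (fun z hz => ?_)
      (continuousOn_integrand hm0 (continuous_taylorPart f j)) (-eps l) him
    · simp only [chartSol, key]
      rw [hGe ω hmem (ne_zero_of_mem_opSec hω)]
      ring
    · have hz0 : z ≠ 0 := by rintro rfl; simp at hz
      rw [integrand_taylorPart]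
      refine Eq.trans (by ring) (Finset.sum_congr rfl fun p hp => ?_ : ∑ p ∈ Finset.range (j + 1), taylorCoeff f j p * phase m l j p * mono (-gexp m p) (-gexp m (j - p)) z = _)
      rw [integrand_bimon hm0 (by rw [Finset.mem_range] at hp; omega) hz0, mul_assoc]

end SaddleSector

/-! ### Homogeneous parts of low degree, and uniform constants -/

namespace SaddleSector

open Set Filter Topology MeasureTheory

variable {m l : ℕ} {a K : ℝ} {w ρ Θ : ℝ → ℝ}

lemma GoodMod.reg_bimon (h : GoodMod a w ρ Θ K) (hm : 2 ≤ m) (N p q : ℕ) :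
    ∃ M, 0 ≤ M ∧ Reg N w (clSec m l) M (bimon p q) := by
  obtain ⟨D, hD, hcomp⟩ := h.reg_comp_pow convex_halfSq halfSq_subset (clSec_subset_ball (l := l) hm)
    (norm_eps l) m (mapsTo_chi hm) N p q
  have h1 := hcomp 1 (fun _ => 1) zero_le_one (Reg.const (fun t ht => h.w_nonneg ht) (by simp))
  simp only [one_mul] at h1
  exact ⟨_, by positivity, h1⟩

lemma GoodMod.reg_span_bimon (h : GoodMod a w ρ Θ K) (hm : 2 ≤ m) (N : ℕ) {J : ℕ} {Q : ℂ → ℂ}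
    (hQ : Q ∈ Submodule.span ℂ {g : ℂ → ℂ | ∃ a b, a + b = J ∧ g = bimon a b}) :
    ∃ M, 0 ≤ M ∧ Reg N w (clSec m l) M Q := by
  induction hQ using Submodule.span_induction with
  | mem g hg =>
    obtain ⟨p, q, -, rfl⟩ := hg
    exact h.reg_bimon hm N p q
  | zero => exact ⟨0, le_rfl, Reg.const (c := 0) (fun t ht => h.w_nonneg ht) (by simp)⟩
  | add f g _ _ ihf ihg =>
    obtain ⟨M, hM, h1⟩ := ihf
    obtain ⟨M', hM', h2⟩ := ihg
    exact ⟨_, add_nonneg hM hM', h1.add h2⟩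
  | smul c f _ ih =>
    obtain ⟨M, hM, h1⟩ := ih
    exact ⟨_, by positivity, h1.const_mul c⟩

lemma exists_homSpace_comp_psi {J : ℕ} {Q : ℂ → ℂ}
    (hQ : Q ∈ Submodule.span ℂ {g : ℂ → ℂ | ∃ a b, a + b = J ∧ g = bimon a b}) :
    (fun z => Q (psi m l z)) ∈ homSpace (J / m) := by
  induction hQ using Submodule.span_induction with
  | mem g hg =>
    obtain ⟨p, q, rfl, rfl⟩ := hg
    have : (fun z => bimon p q (psi m l z)) = bimon p q (rot m l) • mono (p / m) (q / m) := by
      ext z; rw [psi_bimon]; rfl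
    rw [this]
    exact Submodule.smul_mem _ _ (mono_mem (by push_cast; ring))
  | zero => exact Submodule.zero_mem _
  | add f g _ _ ihf ihg => exact Submodule.add_mem _ ihf ihg
  | smul c f _ ih => exact Submodule.smul_mem _ c ih

lemma conj_rot_pow (hm : 0 < m) : (starRingEnd ℂ) (rot m l) ^ (m - 1) = eps l * -Complex.I * rot m l := by
  have h1 : (starRingEnd ℂ) (rot m l) ^ (m - 1) * rot m l ^ (m - 1) = 1 := by
    rw [← mul_pow, conj_rot_mul_rot, one_pow]
  have h2 : rot m l ^ (m - 1) * rot m l = eps l * Complex.I := by rw [pow_sub_one_mul hm.ne', rot_pow hm]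
  have h3 : (starRingEnd ℂ) (rot m l) ^ (m - 1) * (eps l * Complex.I) = rot m l := by
    rw [← h2, ← mul_assoc, h1, one_mul]
  have h4 := eps_mul_eps l
  linear_combination (-(eps l : ℂ) * Complex.I) * h3 +
    (starRingEnd ℂ) (rot m l) ^ (m - 1) * (-h4 + (eps l : ℂ) * eps l * Complex.I_sq)

/-- The logarithmic derivative of the inverse chart. -/
lemma psi_deriv_eq (hm : 0 < m) {z : ℂ} (hz : z ≠ 0) :
    (eps l * m : ℂ) * (rot m l * (-Complex.I * ((1 / m : ℝ) : ℂ) * pw (1 / m - 1) z)) =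
      (starRingEnd ℂ) (psi m l z) ^ (m - 1) * mono (-(((m : ℝ) - 1) / m)) (-(((m : ℝ) - 1) / m)) z := by
  have hmR : (m : ℝ) ≠ 0 := by positivity
  have hmC : (m : ℂ) ≠ 0 := by exact_mod_cast hm.ne'
  have h0 : -Complex.I * z ≠ 0 := mul_ne_zero (neg_ne_zero.2 Complex.I_ne_zero) hz
  have e1 : (1 / m - 1 : ℝ) = -(((m : ℝ) - 1) / m) := by field_simp; ring
  have e2 : pw (1 / m) z ^ (m - 1) * pw (-(((m : ℝ) - 1) / m)) z = 1 := by
    rw [pw_pow_nat, pw, pw, ← Complex.cpow_add _ _ h0, ← Complex.ofReal_add, Nat.cast_sub hm]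
    simp
  have e3 := congrArg (starRingEnd ℂ) e2
  rw [map_mul, map_pow, map_one] at e3
  rw [psi, mono, map_mul, mul_pow, conj_rot_pow hm, e1]
  push_cast at *
  have hm1 : (m : ℂ) * (1 / m) = 1 := mul_one_div_cancel hmC
  linear_combination ((eps l : ℂ) * -Complex.I * rot m l * pw (-((m - 1) / m)) z) * (hm1 - e3)

/-- A homogeneous part in the range of the transport operator. -/
lemma GoodMod.exists_reg_of_polyRange (h : GoodMod a w ρ Θ K) (hm : 2 ≤ m) (hl : l < 2 * m) (N : ℕ)
    {P : ℂ → ℂ} (hPc : Continuous P) {J : ℕ} (hP : P ∈ polyRange m J) :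
    ∃ M, 0 ≤ M ∧ ∃ G, Reg N w (clSec m l) M G ∧ EqOn G (chartSol m l P) (opSec m l) := by
  have hm0 : 0 < m := by omega
  obtain ⟨Q, hQ, Qa, Qb, hd, hPe⟩ := hP
  -- By `psi_deriv_eq` and its conjugate, ∂_u of this function is the transport of conj ω ^ (m - 1)
  -- ∂Q + ω ^ (m - 1) ∂̄Q, that is of P.
  set E : ℂ → ℂ := fun z => (eps l * m : ℂ) * Q (psi m l z) with hE
  have hEm : E ∈ homSpace (J / m) := Submodule.smul_mem _ (eps l * m : ℂ) (exists_homSpace_comp_psi hQ)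
  have hEs : ∃ C, 0 ≤ C ∧ Sym (N + 1) (fun z => logWeight (J / m) C ‖z‖) upperHP E := by
    obtain ⟨C, hC, hs⟩ := homSpace.sym hEm (N + 1)
    exact ⟨C, hC, hs.mono_weight fun z _ => rpow_le_logWeight (norm_nonneg z) hC⟩
  obtain ⟨M₁, hM₁, hG⟩ := h.reg_span_bimon (l := l) hm N hQ
  obtain ⟨M₂, hM₂, hV⟩ := h.exists_reg_vert (l := l) hm N hEs (abs_neg_eps l)
  refine ⟨_, ?_, _, ((hG.const_mul (eps l * m)).add (hV.const_mul (-1))).const_mul (eps l), fun ω hω => ?_⟩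
  · positivity
  · have him := chi_im_pos hm hl hω
    have hmem := opSec_subset hm hl hω
    have hpsi := fun z : ℂ => fun hz : 0 < z.im => (HasD.of_hasDerivAt (A := univ)
      ((hasDerivAt_pw (1 / m) (Or.inl hz : z ∈ slitHP)).const_mul (rot m l)))
    have key := horInt_eq_sub (E := E) (h := integrand m l P)
      (fun z hz => ((hd (psi m l z)).comp_holo (hpsi z hz) (mapsTo_univ _ _)).const_mul (eps l * m : ℂ))
      (fun z hz => ?_) (continuousOn_integrand hm0 hPc) (-eps l) him
    · have e1 : E (chi m l ω) = eps l * m * Q ω := by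
        rw [hE]
        simp only [psi_chi hm ((mem_clSec_iff hm).1 hmem).1]
      simp only [chartSol, key, e1]
      ring
    · have hz0 : z ≠ 0 := by rintro rfl; simp at hz
      have h1 := psi_deriv_eq (l := l) hm0 hz0
      have h2 := congrArg (starRingEnd ℂ) h1
      simp only [map_mul, map_pow, Complex.conj_conj, mono, Complex.conj_ofReal, map_natCast] at h1 h2
      rw [integrand, ← hPe, mono]
      simp only [map_mul, Complex.conj_ofReal]
      linear_combination Qa (psi m l z) * h1 + Qb (psi m l z) * h2

/-- Finite-dimensional uniformity: extension constants depend linearly on the coefficients. -/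
lemma exists_uniform_reg {n N : ℕ} {A S : Set ℂ} (hw : ∀ t, 0 ≤ t → 0 ≤ w t) (F : Fin n → ℂ → ℂ) :
    ∃ C, 0 ≤ C ∧ ∀ c : Fin n → ℂ,
      (∃ M, 0 ≤ M ∧ ∃ G, Reg N w A M G ∧ EqOn G (fun x => ∑ p, c p * F p x) S) →
      ∃ G, Reg N w A (C * ‖c‖) G ∧ EqOn G (fun x => ∑ p, c p * F p x) S := by
  -- Coefficient vectors admitting some regular extension, with an uncontrolled bound, form a linear
  -- subspace. Extensions fixed for a basis give, by linearity, one for every vector with a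
  -- controlled bound.
  let W : Submodule ℂ (Fin n → ℂ) :=
    { carrier := {c | ∃ M, 0 ≤ M ∧ ∃ G, Reg N w A M G ∧ EqOn G (fun x => ∑ p, c p * F p x) S}
      add_mem' := by
        rintro c c' ⟨M, hM, G, hG, he⟩ ⟨M', hM', G', hG', he'⟩
        refine ⟨_, add_nonneg hM hM', _, hG.add hG', fun x hx => ?_⟩
        simp only [Pi.add_apply, add_mul, Finset.sum_add_distrib]
        rw [he hx, he' hx]
      zero_mem' := ⟨0, le_rfl, _, Reg.const (c := 0) hw (by simp), fun x _ => by simp⟩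
      smul_mem' := by
        rintro c c' ⟨M, hM, G, hG, he⟩
        refine ⟨_, by positivity, _, hG.const_mul c, fun x hx => ?_⟩
        simp only [Pi.smul_apply, smul_eq_mul, mul_assoc, ← Finset.mul_sum]
        rw [he hx] }
  let b := Module.finBasis ℂ W
  let L : W →L[ℂ] (Fin (Module.finrank ℂ W) → ℂ) := LinearMap.toContinuousLinearMap b.equivFun.toLinearMap
  have hb : ∀ i, ∃ M, 0 ≤ M ∧ ∃ G, Reg N w A M G ∧ EqOn G (fun x => ∑ p, (b i : Fin n → ℂ) p * F p x) S :=
    fun i => (b i).2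
  choose M hM G hG he using hb
  refine ⟨‖L‖ * ∑ i, M i, by have := Finset.sum_nonneg fun i (_ : i ∈ Finset.univ) => hM i; positivity,
    fun c hc => ?_⟩
  have hsum : ∑ i, L ⟨c, hc⟩ i • b i = ⟨c, hc⟩ := b.sum_equivFun ⟨c, hc⟩
  refine ⟨_, (Reg.sum (s := Finset.univ) fun i _ => (hG i).const_mul (L ⟨c, hc⟩ i)).mono_const hw ?_,
    fun x hx => ?_⟩
  · rw [Finset.mul_sum, Finset.sum_mul]
    refine Finset.sum_le_sum fun i _ => ?_
    have h1 : ‖L ⟨c, hc⟩ i‖ ≤ ‖L‖ * ‖c‖ := (norm_le_pi_norm _ i).trans (L.le_opNorm ⟨c, hc⟩)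
    calc _ ≤ ‖L‖ * ‖c‖ * M i := mul_le_mul_of_nonneg_right h1 (hM i)
      _ = _ := by ring
  · have hcp : ∀ p, c p = ∑ i, L ⟨c, hc⟩ i * (b i : Fin n → ℂ) p := fun p => by
      have := congrArg (fun v : W => (v : Fin n → ℂ) p) hsum
      simpa using this.symm
    simp only [hcp, Finset.sum_mul, mul_assoc]
    rw [Finset.sum_comm]
    refine Finset.sum_congr rfl fun i _ => ?_
    rw [he i hx, Finset.mul_sum]

/-- Homogeneous parts satisfying either of the two families of conditions. -/
lemma GoodMod.exists_reg_taylorPart (h : GoodMod a w ρ Θ K) (hm : 2 ≤ m) (hl : l < 2 * m) (N j : ℕ) :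
    ∃ C, 0 ≤ C ∧ ∀ (f : ℂ → ℂ) (B : ℝ), 0 ≤ B → (∀ p ≤ j, ‖taylorCoeff f j p‖ ≤ B) →
      ((N + m ≤ j + 1 ∧ secDist m j l f = 0) ∨ ∀ i, Relevant m j i → parDist m j i f = 0) →
      ∃ G, Reg N w (clSec m l) (C * B) G ∧ EqOn G (chartSol m l (taylorPart f j)) (opSec m l) := by
  have hw : ∀ t, 0 ≤ t → 0 ≤ w t := fun t ht => h.w_nonneg ht
  obtain ⟨C, hC, hu⟩ := exists_uniform_reg (N := N) (A := clSec m l) (S := opSec m l) hw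
    (fun p : Fin (j + 1) => chartSol m l (bimon p (j - p)))
  refine ⟨C, hC, fun f B hB hf hcond => ?_⟩
  have hrw : EqOn (chartSol m l (taylorPart f j))
      (fun x => ∑ p : Fin (j + 1), taylorCoeff f j p * chartSol m l (bimon p (j - p)) x) (opSec m l) :=
    fun ω hω => by rw [chartSol_taylorPart hm hl f j hω, Finset.sum_range]
  have hex : ∃ M, 0 ≤ M ∧ ∃ G, Reg N w (clSec m l) M G ∧ EqOn G (chartSol m l (taylorPart f j)) (opSec m l) := by
    rcases hcond with ⟨h1, h2⟩ | h1
    · exact h.exists_reg_taylorPart_high hm hl N f h1 h2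
    · exact h.exists_reg_of_polyRange hm hl N (continuous_taylorPart f j) (taylorPart_mem_polyRange hm rfl f h1)
  obtain ⟨M, hM, G, hG, he⟩ := hex
  obtain ⟨G', hG', he'⟩ := hu (fun p => taylorCoeff f j p) ⟨M, hM, G, hG, he.trans hrw⟩
  refine ⟨G', hG'.mono_const hw (mul_le_mul_of_nonneg_left ?_ hC), he'.trans hrw.symm⟩
  exact (pi_norm_le_iff_of_nonneg hB).2 fun p => hf p (Nat.lt_succ_iff.1 p.2)

end SaddleSector

/-! ### Mixed derivatives at the origin and the Taylor remainder -/

namespace SaddleSector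

open Set Filter Topology MeasureTheory

section operators

/-- The coefficient of `dω` in a real-linear form. -/
noncomputable def coeffL : (ℂ →L[ℝ] ℂ) →L[ℝ] ℂ :=
  (1 / 2 : ℂ) • (ContinuousLinearMap.apply ℝ ℂ (1 : ℂ) - Complex.I • ContinuousLinearMap.apply ℝ ℂ Complex.I)

/-- The coefficient of `dω̄` in a real-linear form. -/
noncomputable def coeffR : (ℂ →L[ℝ] ℂ) →L[ℝ] ℂ :=
  (1 / 2 : ℂ) • (ContinuousLinearMap.apply ℝ ℂ (1 : ℂ) + Complex.I • ContinuousLinearMap.apply ℝ ℂ Complex.I)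

lemma coeffL_apply (L : ℂ →L[ℝ] ℂ) : coeffL L = (L 1 - Complex.I * L Complex.I) / 2 := by
  simp [coeffL]; ring

lemma coeffR_apply (L : ℂ →L[ℝ] ℂ) : coeffR L = (L 1 + Complex.I * L Complex.I) / 2 := by
  simp [coeffR]; ring

lemma norm_coeffL_le : ‖coeffL‖ ≤ 1 := by
  refine ContinuousLinearMap.opNorm_le_bound _ zero_le_one fun L => ?_
  rw [coeffL_apply, norm_div, RCLike.norm_ofNat]
  have h1 := L.le_opNorm 1
  have h2 := L.le_opNorm Complex.I
  have h3 := norm_sub_le (L 1) (Complex.I * L Complex.I)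
  rw [norm_mul] at h3
  simp only [norm_one, Complex.norm_I] at h1 h2 h3
  linarith

lemma norm_coeffR_le : ‖coeffR‖ ≤ 1 := by
  refine ContinuousLinearMap.opNorm_le_bound _ zero_le_one fun L => ?_
  rw [coeffR_apply, norm_div, RCLike.norm_ofNat]
  have h1 := L.le_opNorm 1
  have h2 := L.le_opNorm Complex.I
  have h3 := norm_add_le (L 1) (Complex.I * L Complex.I)
  rw [norm_mul] at h3
  simp only [norm_one, Complex.norm_I] at h1 h2 h3
  linarith

lemma dz_eq : dz = fun (g : ℂ → ℂ) ω => coeffL (fderiv ℝ g ω) := by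
  ext g ω; rw [coeffL_apply]; rfl

lemma dzbar_eq : dzbar = fun (g : ℂ → ℂ) ω => coeffR (fderiv ℝ g ω) := by
  ext g ω; rw [coeffR_apply]; rfl

variable {g g₁ g₂ : ℂ → ℂ} {x : ℂ} {A : Set ℂ}

lemma contDiffAt_coeff (T : (ℂ →L[ℝ] ℂ) →L[ℝ] ℂ) {n : ℕ} (h : ContDiffAt ℝ (n + 1 : ℕ) g x) :
    ContDiffAt ℝ n (fun ω => T (fderiv ℝ g ω)) x :=
  T.contDiff.contDiffAt.comp x (h.fderiv_right (by norm_cast))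

lemma contDiffOn_coeff (hA : UniqueDiffOn ℝ A) (T : (ℂ →L[ℝ] ℂ) →L[ℝ] ℂ) {n : ℕ}
    (h : ContDiffOn ℝ (n + 1 : ℕ) g A) : ContDiffOn ℝ n (fun ω => T (fderivWithin ℝ g A ω)) A :=
  T.contDiff.comp_contDiffOn (h.fderivWithin hA (by norm_cast))

lemma norm_iteratedFDerivWithin_coeff_le (hA : UniqueDiffOn ℝ A) {T : (ℂ →L[ℝ] ℂ) →L[ℝ] ℂ} (hT : ‖T‖ ≤ 1)
    {n : ℕ} (h : ContDiffOn ℝ (n + 1 : ℕ) g A) (hx : x ∈ A) :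
    ‖iteratedFDerivWithin ℝ n (fun ω => T (fderivWithin ℝ g A ω)) A x‖ ≤ ‖iteratedFDerivWithin ℝ (n + 1) g A x‖ := by
  have h1 : ContDiffWithinAt ℝ n (fderivWithin ℝ g A) A x := (h.fderivWithin hA (by norm_cast)) x hx
  have h2 := T.iteratedFDerivWithin_comp_left h1 hA hx le_rfl
  rw [← norm_iteratedFDerivWithin_fderivWithin hA hx]
  refine (congrArg norm h2).le.trans ((T.norm_compContinuousMultilinearMap_le _).trans ?_)
  exact mul_le_of_le_one_left (norm_nonneg _) hT

lemma norm_iteratedFDeriv_coeff_le {T : (ℂ →L[ℝ] ℂ) →L[ℝ] ℂ} (hT : ‖T‖ ≤ 1) {n : ℕ}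
    (h : ContDiffAt ℝ (n + 1 : ℕ) g x) :
    ‖iteratedFDeriv ℝ n (fun ω => T (fderiv ℝ g ω)) x‖ ≤ ‖iteratedFDeriv ℝ (n + 1) g x‖ := by
  have h1 : ContDiffAt ℝ n (fderiv ℝ g) x := h.fderiv_right (by norm_cast)
  have h2 := T.iteratedFDeriv_comp_left h1 le_rfl
  rw [← norm_iteratedFDeriv_fderiv]
  refine (congrArg norm h2).le.trans ((T.norm_compContinuousMultilinearMap_le _).trans ?_)
  exact mul_le_of_le_one_left (norm_nonneg _) hT

lemma hasD_coeff {n : ℕ} (h : ContDiffOn ℝ (n + 1 : ℕ) g A) (hx : x ∈ A) :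
    HasD g (coeffL (fderivWithin ℝ g A x)) (coeffR (fderivWithin ℝ g A x)) A x := by
  have h1 := ((h x hx).differentiableWithinAt (by simp)).hasFDerivWithinAt
  rw [eq_wirt (fderivWithin ℝ g A x)] at h1
  rw [coeffL_apply, coeffR_apply]
  exact h1

lemma dz_congr (h : g₁ =ᶠ[𝓝 x] g₂) : dz g₁ =ᶠ[𝓝 x] dz g₂ := by
  simp only [dz_eq]; exact h.fderiv.fun_comp _

lemma dzbar_congr (h : g₁ =ᶠ[𝓝 x] g₂) : dzbar g₁ =ᶠ[𝓝 x] dzbar g₂ := by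
  simp only [dzbar_eq]; exact h.fderiv.fun_comp _

lemma iterate_congr {D : (ℂ → ℂ) → ℂ → ℂ} (hD : ∀ {g₁ g₂ : ℂ → ℂ}, g₁ =ᶠ[𝓝 x] g₂ → D g₁ =ᶠ[𝓝 x] D g₂)
    (n : ℕ) (h : g₁ =ᶠ[𝓝 x] g₂) : D^[n] g₁ =ᶠ[𝓝 x] D^[n] g₂ := by
  induction n generalizing g₁ g₂ with
  | zero => exact h
  | succ n ih => exact ih (hD h)

lemma mixedDeriv_congr (a b : ℕ) (h : g₁ =ᶠ[𝓝 0] g₂) : mixedDeriv a b g₁ = mixedDeriv a b g₂ :=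
  (iterate_congr dz_congr a (iterate_congr dzbar_congr b h)).eq_of_nhds

lemma contDiffAt_dz {n : ℕ} (h : ContDiffAt ℝ (n + 1 : ℕ) g x) : ContDiffAt ℝ n (dz g) x := by
  rw [dz_eq]; exact contDiffAt_coeff coeffL h

lemma contDiffAt_dzbar {n : ℕ} (h : ContDiffAt ℝ (n + 1 : ℕ) g x) : ContDiffAt ℝ n (dzbar g) x := by
  rw [dzbar_eq]; exact contDiffAt_coeff coeffR h

lemma contDiffAt_iterate {D : (ℂ → ℂ) → ℂ → ℂ}
    (hD : ∀ {n : ℕ} {g : ℂ → ℂ}, ContDiffAt ℝ (n + 1 : ℕ) g x → ContDiffAt ℝ n (D g) x) (b : ℕ) {n : ℕ}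
    (h : ContDiffAt ℝ (n + b : ℕ) g x) : ContDiffAt ℝ n (D^[b] g) x := by
  induction b generalizing g with
  | zero => exact h
  | succ b ih => exact ih (hD h)

lemma dzbar_dz (h : ContDiffAt ℝ 2 g x) : dzbar (dz g) x = dz (dzbar g) x := by
  have hsym : IsSymmSndFDerivAt ℝ g x := h.isSymmSndFDerivAt (by simp)
  have hd : DifferentiableAt ℝ (fderiv ℝ g) x :=
    (h.fderiv_right (m := 1) (by norm_num)).differentiableAt (by norm_num)
  have key : ∀ T : (ℂ →L[ℝ] ℂ) →L[ℝ] ℂ, ∀ v, fderiv ℝ (fun ω => T (fderiv ℝ g ω)) x v =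
      T (fderiv ℝ (fderiv ℝ g) x v) := fun T v => by
    have h1 : HasFDerivAt (fun ω => T (fderiv ℝ g ω)) (T ∘L fderiv ℝ (fderiv ℝ g) x) x :=
      T.hasFDerivAt.comp x hd.hasFDerivAt
    rw [h1.fderiv]; rfl
  simp only [dz_eq, dzbar_eq]
  rw [coeffR_apply, coeffL_apply, key, key, key, key]
  simp only [coeffL_apply, coeffR_apply]
  rw [hsym 1 Complex.I]
  ring

lemma dzbar_dz_eventuallyEq (h : ContDiffAt ℝ 2 g x) : dzbar (dz g) =ᶠ[𝓝 x] dz (dzbar g) := by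
  filter_upwards [h.eventually (by simp)] with y hy using dzbar_dz hy

lemma iterate_dzbar_dz (b : ℕ) (h : ContDiffAt ℝ (b + 1 : ℕ) g x) :
    dzbar^[b] (dz g) =ᶠ[𝓝 x] dz (dzbar^[b] g) := by
  induction b with
  | zero => exact Filter.EventuallyEq.rfl
  | succ b ih =>
    rw [Function.iterate_succ_apply', Function.iterate_succ_apply']
    refine (dzbar_congr (ih (h.of_le (by norm_cast; omega)))).trans (dzbar_dz_eventuallyEq ?_)
    exact contDiffAt_iterate (n := 2) contDiffAt_dzbar b (h.of_le (by norm_cast; omega))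

/-- In `mixedDeriv` the ∂̄ are applied first, so a ∂ applied to g beforehand must be commuted past
them by symmetry of second derivatives; for ∂̄ the corresponding identity is definitional. -/
lemma mixedDeriv_dz (a b : ℕ) (h : ContDiffAt ℝ (b + 1 : ℕ) g 0) :
    mixedDeriv a b (dz g) = mixedDeriv (a + 1) b g :=
  (iterate_congr dz_congr a (iterate_dzbar_dz b h)).eq_of_nhds

lemma mixedDeriv_dzbar (a b : ℕ) : mixedDeriv a b (dzbar g) = mixedDeriv a (b + 1) g := rfl

lemma norm_iteratedFDeriv_iterate_le {D : (ℂ → ℂ) → ℂ → ℂ}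
    (hD : ∀ {n : ℕ} {g : ℂ → ℂ}, ContDiffAt ℝ (n + 1 : ℕ) g x → ContDiffAt ℝ n (D g) x ∧
      ‖iteratedFDeriv ℝ n (D g) x‖ ≤ ‖iteratedFDeriv ℝ (n + 1) g x‖) (b : ℕ) {n : ℕ}
    (h : ContDiffAt ℝ (n + b : ℕ) g x) :
    ‖iteratedFDeriv ℝ n (D^[b] g) x‖ ≤ ‖iteratedFDeriv ℝ (n + b) g x‖ := by
  induction b generalizing g with
  | zero => exact le_rfl
  | succ b ih => exact (ih (hD h).1).trans (hD h).2

lemma norm_mixedDeriv_le {a b : ℕ} (h : ContDiffAt ℝ (a + b : ℕ) g 0) :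
    ‖mixedDeriv a b g‖ ≤ ‖iteratedFDeriv ℝ (a + b) g 0‖ := by
  have h1 : ContDiffAt ℝ (a : ℕ) (dzbar^[b] g) 0 := contDiffAt_iterate contDiffAt_dzbar b h
  have h2 := norm_iteratedFDeriv_iterate_le (D := dz) (n := 0) (x := 0) (g := dzbar^[b] g)
    (fun h => ⟨contDiffAt_dz h, by rw [dz_eq]; exact norm_iteratedFDeriv_coeff_le norm_coeffL_le h⟩) a
    (by rwa [zero_add])
  have h3 := norm_iteratedFDeriv_iterate_le (D := dzbar) (n := a) (x := 0) (g := g)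
    (fun h => ⟨contDiffAt_dzbar h, by rw [dzbar_eq]; exact norm_iteratedFDeriv_coeff_le norm_coeffR_le h⟩) b h
  rw [norm_iteratedFDeriv_zero, zero_add] at h2
  exact h2.trans h3

end operators

section taylor

/-- Functions with a vanishing jet of order `< k` at the origin and bounded derivatives of order `k`. -/
def Flat : ℕ → ℝ → Set ℂ → (ℂ → ℂ) → Prop
  | 0, B, A, g => ∀ x ∈ A, ‖g x‖ ≤ B
  | k + 1, B, A, g => g 0 = 0 ∧ ∃ a b : ℂ → ℂ, (∀ x ∈ A, HasD g (a x) (b x) A x) ∧ Flat k B A a ∧ Flat k B A b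

lemma Flat.congr {k : ℕ} {B : ℝ} {A : Set ℂ} {g₁ g₂ : ℂ → ℂ} (hA : (0 : ℂ) ∈ A) (h : Flat k B A g₁)
    (hg : ∀ x ∈ A, g₂ x = g₁ x) : Flat k B A g₂ := by
  cases k with
  | zero => exact fun x hx => by rw [hg x hx]; exact h x hx
  | succ k =>
    obtain ⟨h0, a, b, hd, ha, hb⟩ := h
    exact ⟨by rw [hg 0 hA, h0], a, b, fun x hx => (hd x hx).congr hg (hg x hx), ha, hb⟩

/-- Mean value inequality along the segment from 0, which lies in A; the factor 2 per order accounts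
for the two Wirtinger coefficients. -/
lemma Flat.bound {k : ℕ} {B : ℝ} {A : Set ℂ} {g : ℂ → ℂ} (hA : StarConvex ℝ 0 A) (h : Flat k B A g) :
    ∀ x ∈ A, ‖g x‖ ≤ 2 ^ k * B * ‖x‖ ^ k := by
  induction k generalizing g with
  | zero => exact fun x hx => by simpa using h x hx
  | succ k ih =>
    obtain ⟨h0, a, b, hd, ha, hb⟩ := h
    intro x hx
    have hB : 0 ≤ 2 ^ k * B * ‖x‖ ^ k := (norm_nonneg _).trans (ih ha x hx)
    have hseg : segment ℝ 0 x ⊆ A := hA.segment_subset hx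
    have hle : ∀ y ∈ segment ℝ 0 x, ‖y‖ ^ k ≤ ‖x‖ ^ k := by
      rintro y ⟨s, t, hs, ht, hst, rfl⟩
      refine pow_le_pow_left₀ (norm_nonneg _) ?_ k
      rw [smul_zero, zero_add, norm_smul, Real.norm_of_nonneg ht]
      exact mul_le_of_le_one_left (norm_nonneg _) (by linarith)
    -- B is not assumed nonnegative; the bound at x itself decides its sign unless ‖x‖ ^ k vanishes.
    have hBk : 0 ≤ 2 ^ k * B ∨ ‖x‖ ^ k = 0 := by
      rcases (pow_nonneg (norm_nonneg x) k).eq_or_lt with h | h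
      · exact Or.inr h.symm
      · exact Or.inl (nonneg_of_mul_nonneg_left hB h)
    have hbd : ∀ {u : ℂ → ℂ}, Flat k B A u → ∀ y ∈ segment ℝ 0 x, ‖u y‖ ≤ 2 ^ k * B * ‖x‖ ^ k := by
      intro u hu y hy
      refine (ih hu y (hseg hy)).trans ?_
      rcases hBk with h | h
      · exact mul_le_mul_of_nonneg_left (hle y hy) h
      · have h2 := hle y hy
        rw [h] at h2 ⊢
        rw [le_antisymm h2 (by positivity)]
    have h1 := (convex_segment (0 : ℂ) x).norm_image_sub_le_of_norm_hasFDerivWithin_le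
      (C := 2 * (2 ^ k * B * ‖x‖ ^ k)) (fun y hy => (hd y (hseg hy)).mono hseg) (fun y hy =>
        (norm_wirt_le _ _).trans (by have := hbd ha y hy; have := hbd hb y hy; linarith))
      (left_mem_segment ℝ 0 x) (right_mem_segment ℝ 0 x)
    rw [h0, sub_zero, sub_zero] at h1
    calc _ ≤ _ := h1
      _ = _ := by rw [pow_succ, pow_succ]; ring

lemma Flat.sym {k : ℕ} {B : ℝ} {A : Set ℂ} {g : ℂ → ℂ} (hA : StarConvex ℝ 0 A) (hB : 0 ≤ B)
    (h : Flat k B A g) : Sym k (fun x => 2 ^ k * B * ‖x‖ ^ k) (A \ {0}) g := by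
  induction k generalizing g with
  | zero => exact fun x hx => h.bound hA x hx.1
  | succ k ih =>
    obtain ⟨h0, a, b, hd, ha, hb⟩ := id h
    have hw : ∀ x ∈ A \ {0}, 2 ^ k * B * ‖x‖ ^ k ≤ 2 ^ (k + 1) * B * ‖x‖ ^ (k + 1) / ‖x‖ := by
      intro x hx
      have hn : 0 < ‖x‖ := norm_pos_iff.2 hx.2
      rw [le_div_iff₀ hn, pow_succ 2, pow_succ ‖x‖]
      have : 0 ≤ 2 ^ k * B * (‖x‖ ^ k * ‖x‖) := by positivity
      linarith
    exact ⟨fun x hx => h.bound hA x hx.1, a, b, fun x hx => (hd x hx.1).mono sdiff_subset,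
      (ih ha).mono_weight hw, (ih hb).mono_weight hw⟩

variable {f : ℂ → ℂ}

lemma taylorPart_congr {f₁ f₂ : ℂ → ℂ} (h : f₁ =ᶠ[𝓝 0] f₂) (j : ℕ) : taylorPart f₁ j = taylorPart f₂ j := by
  simp only [taylorPart, taylorCoeff, mixedDeriv_congr _ _ h]

lemma taylorPart_zero (f : ℂ → ℂ) (x : ℂ) : taylorPart f 0 x = f 0 := by
  simp [taylorPart, taylorCoeff, mixedDeriv, bimon]

lemma taylorPart_apply (f : ℂ → ℂ) (j : ℕ) (x : ℂ) :
    taylorPart f j x = ∑ p ∈ Finset.range (j + 1), taylorCoeff f j p * bimon p (j - p) x := by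
  simp [taylorPart]

lemma taylorPart_at_zero (f : ℂ → ℂ) (j : ℕ) : taylorPart f (j + 1) 0 = 0 := by
  rw [taylorPart_apply]
  refine Finset.sum_eq_zero fun p _ => ?_
  rcases Nat.eq_zero_or_pos p with rfl | hp
  · simp [bimon]
  · simp [bimon, hp.ne']

/-- Differentiating a homogeneous Taylor part gives the Taylor part of the derivative. Hence the
remainder of f has as derivatives the remainders of ∂f and ∂̄f, on which the induction for flatness
rests. -/
lemma hasD_taylorPart {j : ℕ} (h : ContDiffAt ℝ (j + 1 : ℕ) f 0) (x : ℂ) (A : Set ℂ) :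
    HasD (taylorPart f (j + 1)) (taylorPart (dz f) j x) (taylorPart (dzbar f) j x) A x := by
  have h1 : HasD (fun x => ∑ p ∈ Finset.range (j + 1 + 1), taylorCoeff f (j + 1) p * bimon p (j + 1 - p) x)
      _ _ A x := HasD.sum fun p _ => (HasD.monomial p (j + 1 - p)).const_mul (taylorCoeff f (j + 1) p)
  refine (h1.congr (fun y _ => taylorPart_apply f _ y) (taylorPart_apply f _ x)).cast ?_ ?_
  · rw [Finset.sum_range_succ', taylorPart_apply]
    simp only [Nat.cast_zero, zero_mul, mul_zero, add_zero]
    refine Finset.sum_congr rfl fun p hp => ?_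
    have hpj : p ≤ j := Nat.lt_succ_iff.1 (Finset.mem_range.1 hp)
    have hp1 : ((p : ℂ) + 1) ≠ 0 := by exact_mod_cast Nat.succ_ne_zero p
    rw [taylorCoeff, taylorCoeff, mixedDeriv_dz _ _ (h.of_le (by norm_cast; omega)),
      show j + 1 - (p + 1) = j - p by omega, Nat.add_sub_cancel, Nat.factorial_succ, bimon]
    have hf1 : ((p.factorial : ℕ) : ℂ) ≠ 0 := by exact_mod_cast p.factorial_ne_zero
    have hf2 : (((j - p).factorial : ℕ) : ℂ) ≠ 0 := by exact_mod_cast (j - p).factorial_ne_zero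
    push_cast
    field_simp
  · rw [Finset.sum_range_succ, taylorPart_apply]
    simp only [Nat.sub_self, Nat.cast_zero, zero_mul, mul_zero, add_zero]
    refine Finset.sum_congr rfl fun p hp => ?_
    have hpj : p ≤ j := Nat.lt_succ_iff.1 (Finset.mem_range.1 hp)
    rw [taylorCoeff, taylorCoeff, mixedDeriv_dzbar, show j + 1 - p = (j - p) + 1 by omega,
      Nat.add_sub_cancel, Nat.factorial_succ, bimon]
    have hp1 : (((j - p : ℕ) : ℂ) + 1) ≠ 0 := by exact_mod_cast Nat.succ_ne_zero (j - p)
    have hf1 : ((p.factorial : ℕ) : ℂ) ≠ 0 := by exact_mod_cast p.factorial_ne_zero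
    have hf2 : (((j - p).factorial : ℕ) : ℂ) ≠ 0 := by exact_mod_cast (j - p).factorial_ne_zero
    push_cast
    field_simp

/-- The remainder of the Taylor expansion at an interior point. -/
lemma flat_taylor_remainder {A : Set ℂ} (hA : UniqueDiffOn ℝ A) (h0 : A ∈ 𝓝 0) {k : ℕ} {B : ℝ}
    (hf : ContDiffOn ℝ k f A) (hB : ∀ x ∈ A, ‖iteratedFDerivWithin ℝ k f A x‖ ≤ B) :
    Flat k B A (fun x => f x - ∑ j ∈ Finset.range k, taylorPart f j x) := by
  have h0A : (0 : ℂ) ∈ A := mem_of_mem_nhds h0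
  induction k generalizing f with
  | zero => exact fun x hx => by simpa using hB x hx
  | succ k ih =>
    have hT : ∀ {T : (ℂ →L[ℝ] ℂ) →L[ℝ] ℂ}, ‖T‖ ≤ 1 → Flat k B A (fun x => T (fderivWithin ℝ f A x) -
        ∑ j ∈ Finset.range k, taylorPart (fun ω => T (fderiv ℝ f ω)) j x) := by
      intro T hT
      -- Taylor parts are defined with derivatives in the whole plane; near the origin, an interior
      -- point of A, these coincide with derivatives within A.
      have hg : (fun ω => T (fderivWithin ℝ f A ω)) =ᶠ[𝓝 0] fun ω => T (fderiv ℝ f ω) := by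
        filter_upwards [eventually_mem_nhds_iff.2 h0] with y hy
        rw [fderivWithin_of_mem_nhds hy]
      refine (ih (contDiffOn_coeff hA T hf) fun x hx =>
        (norm_iteratedFDerivWithin_coeff_le hA hT hf hx).trans (hB x hx)).congr h0A fun x _ => ?_
      simp only [taylorPart_congr hg]
    refine ⟨?_, _, _, fun x hx => ?_, hT norm_coeffL_le, hT norm_coeffR_le⟩
    · simp only [Finset.sum_range_succ', taylorPart_at_zero, taylorPart_zero, Finset.sum_const_zero, zero_add, sub_self]
    · have h1 : HasD (fun x => ∑ j ∈ Finset.range k, taylorPart f (j + 1) x + f 0)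
          (∑ j ∈ Finset.range k, taylorPart (dz f) j x + 0) (∑ j ∈ Finset.range k, taylorPart (dzbar f) j x + 0) A x :=
        (HasD.sum fun j hj => hasD_taylorPart ((hf.contDiffAt h0).of_le
          (by norm_cast; have := Finset.mem_range.1 hj; omega)) x A).add (HasD.const (f 0))
      have h2 := (hasD_coeff hf hx).sub h1
      simp only [add_zero, dz_eq, dzbar_eq] at h2
      refine h2.congr (fun y _ => ?_) ?_ <;>
      simp only [Finset.sum_range_succ', taylorPart_zero]

end taylor

end SaddleSector

/-! ### The domain, the contribution of the remainder, and assembly -/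

namespace SaddleSector

open Set Filter Topology MeasureTheory

variable {m l : ℕ} {a K : ℝ} {w ρ Θ : ℝ → ℝ}

section domain

lemma chi_re_im (ω : ℂ) : |(chi m l ω).re| = |(ω ^ m).re| ∧ |(chi m l ω).im| = |(ω ^ m).im| := by
  rw [chi, Complex.re_ofReal_mul, Complex.im_ofReal_mul, abs_mul, abs_mul]
  rcases eps_cases l with h | h <;> simp [h]

lemma clSec_subset_dom (hm : 2 ≤ m) : clSec m l ⊆ dom m := by
  intro ω hω
  obtain ⟨h1, h2, h3⟩ := mem_halfSq.1 ((mem_clSec_iff hm).1 hω).2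
  have h4 := chi_re_im (m := m) (l := l) ω
  exact ⟨h4.1 ▸ abs_le.2 h1, h4.2 ▸ abs_le.2 ⟨by linarith, h3⟩⟩

lemma argPos_nonneg (z : ℂ) : 0 ≤ argPos z := by
  rw [argPos]
  split_ifs with h
  · exact h
  · linarith [Complex.neg_pi_lt_arg z, Real.pi_pos]

lemma exists_mem_secCone (hm : 2 ≤ m) (ω : ℂ) : ∃ l, ω ∈ secCone m l := by
  have hm0 : (0 : ℝ) < m := by positivity
  have hpi := Real.pi_pos
  have hx : 0 ≤ m * argPos ω / Real.pi := div_nonneg (mul_nonneg hm0.le (argPos_nonneg ω)) hpi.le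
  set l := ⌊m * argPos ω / Real.pi⌋₊ with hl
  have h1 : (l : ℝ) ≤ m * argPos ω / Real.pi := Nat.floor_le hx
  have h2 : m * argPos ω / Real.pi < l + 1 := Nat.lt_floor_add_one _
  rw [le_div_iff₀ hpi] at h1
  rw [div_lt_iff₀ hpi] at h2
  set φ : ℝ := argPos ω - (Real.pi * l / m + Real.pi / (2 * m)) with hφ
  have h3 : m * φ = m * argPos ω - Real.pi * l - Real.pi / 2 := by
    rw [hφ]; field_simp; ring
  have h4 : |φ| ≤ Real.pi / (2 * m) := by
    rw [show Real.pi / (2 * m) = Real.pi / 2 / m by rw [div_div], le_div_iff₀ hm0, ← abs_of_pos hm0, ← abs_mul,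
      mul_comm, h3, abs_le]
    constructor <;> linarith
  refine ⟨l, ?_⟩
  have h5 := mem_secCone_of_polar (l := l) hm (norm_nonneg ω) h4
  rwa [rot, mul_left_comm, ← Complex.exp_add, ← add_mul, ← Complex.ofReal_add, hφ, add_sub_cancel,
    norm_mul_exp_argPos] at h5

lemma exists_mem_clSec (hm : 2 ≤ m) {ω : ℂ} (hω : ω ∈ dom m) : ∃ l, ω ∈ clSec m l := by
  obtain ⟨l, hl⟩ := exists_mem_secCone hm ω
  refine ⟨l, (mem_clSec_iff hm).2 ⟨hl, ?_⟩⟩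
  have h4 := chi_re_im (m := m) (l := l) ω
  refine mem_halfSq.2 ⟨abs_le.1 (h4.1 ▸ hω.1), ?_, (abs_le.1 (h4.2 ▸ hω.2)).2⟩
  rcases eq_or_ne ω 0 with rfl | h0
  · simp [chi, show m ≠ 0 by omega]
  · exact (chi_mem_upperHP hm hl h0).1

/-- The domain is covered by closed sectors contained in it, and unique differentiability passes to
a larger set. -/
lemma uniqueDiffOn_dom (hm : 2 ≤ m) : UniqueDiffOn ℝ (dom m) := fun ω hω => by
  obtain ⟨l, hl⟩ := exists_mem_clSec hm hω
  exact (uniqueDiffOn_clSec hm ω hl).mono (clSec_subset_dom hm)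

lemma continuous_abs_re_pow (m : ℕ) : Continuous fun ω : ℂ => |(ω ^ m).re| :=
  (Complex.continuous_re.comp (continuous_pow m)).abs

lemma continuous_abs_im_pow (m : ℕ) : Continuous fun ω : ℂ => |(ω ^ m).im| :=
  (Complex.continuous_im.comp (continuous_pow m)).abs

lemma isCompact_dom (hm : 2 ≤ m) : IsCompact (dom m) := by
  refine (isCompact_closedBall (0 : ℂ) 2).of_isClosed_subset ?_ fun ω hω => ?_
  · exact (isClosed_le (continuous_abs_re_pow m) continuous_const).inter
      (isClosed_le (continuous_abs_im_pow m) continuous_const)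
  · obtain ⟨l, hl⟩ := exists_mem_clSec hm hω
    exact clSec_subset_ball hm hl

lemma dom_mem_nhds (hm : 2 ≤ m) : dom m ∈ 𝓝 (0 : ℂ) := by
  have h1 : IsOpen {ω : ℂ | |(ω ^ m).re| < 1 ∧ |(ω ^ m).im| < 1} :=
    (isOpen_lt (continuous_abs_re_pow m) continuous_const).inter
      (isOpen_lt (continuous_abs_im_pow m) continuous_const)
  refine mem_of_superset (h1.mem_nhds ?_) fun ω hω => ⟨hω.1.le, hω.2.le⟩
  simp [show m ≠ 0 by omega]

lemma starConvex_dom (m : ℕ) : StarConvex ℝ 0 (dom m) := by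
  rw [starConvex_zero_iff]
  intro ω hω t ht0 ht1
  have h1 : (t • ω) ^ m = ((t ^ m : ℝ) : ℂ) * ω ^ m := by
    rw [Complex.real_smul, mul_pow]; push_cast; rfl
  have h2 : |t ^ m| ≤ 1 := by rw [abs_of_nonneg (by positivity)]; exact pow_le_one₀ ht0 ht1
  rw [dom, mem_ofPred_eq, h1, Complex.re_ofReal_mul, Complex.im_ofReal_mul, abs_mul, abs_mul]
  exact ⟨mul_le_one₀ h2 (abs_nonneg _) hω.1, mul_le_one₀ h2 (abs_nonneg _) hω.2⟩

lemma enorm_le_cNorm {N : ℕ} {A : Set ℂ} {f : ℂ → ℂ} {j : ℕ} (hj : j ≤ N) {x : ℂ} (hx : x ∈ A) :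
    ‖iteratedFDerivWithin ℝ j f A x‖ₑ ≤ cNorm N A f := by
  refine le_trans ?_ (Finset.single_le_sum (f := fun j => ⨆ x ∈ A, ‖iteratedFDerivWithin ℝ j f A x‖ₑ)
    (fun _ _ => zero_le) (Finset.mem_range.2 (Nat.lt_succ_of_le hj)))
  exact le_iSup₂ (f := fun x (_ : x ∈ A) => ‖iteratedFDerivWithin ℝ j f A x‖ₑ) x hx

lemma cNorm_lt_top {N : ℕ} {A : Set ℂ} {f : ℂ → ℂ} (hA : UniqueDiffOn ℝ A) (hc : IsCompact A)
    (hf : ContDiffOn ℝ N f A) : cNorm N A f < ∞ := by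
  refine ENNReal.sum_lt_top.2 fun j hj => ?_
  have hjN : j ≤ N := Nat.lt_succ_iff.1 (Finset.mem_range.1 hj)
  obtain ⟨C, hC⟩ := hc.exists_bound_of_continuousOn
    (hf.continuousOn_iteratedFDerivWithin (m := j) (by exact_mod_cast hjN) hA)
  exact (iSup₂_le fun x hx => enorm_le_ofReal (hC x hx)).trans_lt (ENNReal.ofReal_lt_top (r := C))

lemma norm_le_cNorm {N : ℕ} {A : Set ℂ} {f : ℂ → ℂ} (hfin : cNorm N A f < ∞) {j : ℕ} (hj : j ≤ N) {x : ℂ}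
    (hx : x ∈ A) : ‖iteratedFDerivWithin ℝ j f A x‖ ≤ (cNorm N A f).toReal := by
  rw [← toReal_enorm]
  exact ENNReal.toReal_mono hfin.ne (enorm_le_cNorm hj hx)

lemma norm_taylorCoeff_le {f : ℂ → ℂ} {A : Set ℂ} (hA : UniqueDiffOn ℝ A) (h0 : A ∈ 𝓝 0) {j p : ℕ} (hp : p ≤ j)
    (hf : ContDiffOn ℝ j f A) : ‖taylorCoeff f j p‖ ≤ ‖iteratedFDerivWithin ℝ j f A 0‖ := by
  have hat := hf.contDiffAt h0
  have h1 := norm_mixedDeriv_le (a := p) (b := j - p) (g := f) (by rwa [Nat.add_sub_cancel' hp])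
  rw [Nat.add_sub_cancel' hp] at h1
  rw [iteratedFDerivWithin_eq_iteratedFDeriv hA hat (mem_of_mem_nhds h0), taylorCoeff, norm_div,
    Complex.norm_natCast]
  refine (div_le_self (norm_nonneg _) ?_).trans h1
  exact_mod_cast Nat.mul_pos p.factorial_pos (j - p).factorial_pos

end domain

section remainder

lemma pw_zero_left (z : ℂ) : pw 0 z = 1 := by simp [pw]

/-- The derivative of the inverse chart. -/
noncomputable def psiDeriv (m l : ℕ) (z : ℂ) : ℂ := rot m l * (-Complex.I * ((1 / m : ℝ) : ℂ) * pw (1 / m - 1) z)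

lemma hasD_psi {z : ℂ} (hz : z ∈ slitHP) (A : Set ℂ) : HasD (psi m l) (psiDeriv m l z) 0 A z :=
  HasD.of_hasDerivAt ((hasDerivAt_pw (1 / m) hz).const_mul (rot m l))

lemma sym_psiDeriv (hm : 2 ≤ m) (N : ℕ) :
    ∃ C, 1 ≤ C ∧ Sym N (fun z => C * (‖psi m l z‖ / ‖z‖)) upperHP (psiDeriv m l) := by
  have h1 : psiDeriv m l = (rot m l * (-Complex.I * ((1 / m : ℝ) : ℂ))) • mono (1 / m - 1) 0 := by
    ext z
    simp only [psiDeriv, Pi.smul_apply, smul_eq_mul, mono, pw_zero_left, map_one, mul_one, mul_assoc]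
  have h2 : psiDeriv m l ∈ homSpace (1 / m - 1) := h1 ▸ Submodule.smul_mem _ _ (mono_mem (add_zero _))
  obtain ⟨C, hC, hs⟩ := homSpace.sym h2 N
  refine ⟨max 1 C, le_max_left _ _, hs.mono_weight fun z hz => ?_⟩
  have hn : 0 < ‖z‖ := norm_pos_iff.2 hz.2
  rw [norm_psi (by omega), Real.rpow_sub_one hn.ne']
  exact mul_le_mul_of_nonneg_right (le_max_right _ _) (by positivity)

lemma psi_ne_zero (hm : 0 < m) {z : ℂ} (hz : z ≠ 0) : psi m l z ≠ 0 := fun h => hz (by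
  have := norm_psi_pow (l := l) hm z
  rw [h, norm_zero, zero_pow hm.ne'] at this
  exact norm_eq_zero.1 this.symm)

lemma psi_mem_clSec {z : ℂ} (hz : z ∈ halfSq) : psi m l z ∈ clSec m l := mem_image_of_mem _ hz

lemma halfSq_diff_subset : halfSq \ {0} ⊆ upperHP := fun _ hz => ⟨(mem_halfSq.1 hz.1).2.1, hz.2⟩

/-- Symbol estimates for the transported integrand. -/
lemma exists_sym_integrand (hm : 2 ≤ m) (n k : ℕ) (hnk : n ≤ k) : ∃ C, 0 ≤ C ∧ ∀ (R : ℂ → ℂ) (B : ℝ), 0 ≤ B →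
    Flat k B (dom m) R → Sym n (fun z => C * B * ‖z‖ ^ (((k : ℝ) - 2 * (m - 1)) / m)) (halfSq \ {0})
      (integrand m l R) := by
  have hm0 : 0 < m := by omega
  have hmR : (m : ℝ) ≠ 0 := by positivity
  obtain ⟨C₁, hC₁, hs₁⟩ := sym_psiDeriv (l := l) hm n
  obtain ⟨C₂, hC₂, hs₂⟩ := homSpace.sym (mono_mem (α := -(((m : ℝ) - 1) / m)) (β := -(((m : ℝ) - 1) / m)) rfl) n
  refine ⟨2 ^ n * ((2 * C₁) ^ (n * n) * (2 ^ k * C₂)), by positivity, fun R B hB hR => ?_⟩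
  have h1 := (hR.sym (starConvex_dom m) hB).of_le hnk
  have h2 := Sym.comp_chart (χ := psi m l) (A := dom m \ {0}) (B := halfSq \ {0}) hC₁
    (fun z hz => ⟨clSec_subset_dom hm (psi_mem_clSec hz.1), psi_ne_zero hm0 hz.2⟩) (fun z hz => hz.2)
    (fun x hx => hx.2) (fun z hz => hasD_psi (upperHP_subset (halfSq_diff_subset hz)) _)
    (hs₁.mono_set halfSq_diff_subset) h1
  refine (h2.mul (hs₂.mono_set halfSq_diff_subset)).mono_weight fun z hz => le_of_eq ?_
  have hn : 0 < ‖z‖ := norm_pos_iff.2 hz.2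
  -- Flatness contributes k / m through |psi z| = |z| ^ (1/m), the Jacobian factor -2(m - 1)/m.
  have e1 : ‖z‖ ^ (((k : ℝ) - 2 * (m - 1)) / m) =
      ‖psi m l z‖ ^ k * ‖z‖ ^ (-(((m : ℝ) - 1) / m) + -(((m : ℝ) - 1) / m)) := by
    rw [norm_psi hm0, ← Real.rpow_natCast (‖z‖ ^ (1 / m : ℝ)), ← Real.rpow_mul hn.le, ← Real.rpow_add hn]
    congr 1; field_simp; ring
  rw [e1]; ring

/-- The contribution of the Taylor remainder. -/
lemma GoodMod.exists_reg_remainder (h : GoodMod a w ρ Θ K) (hm : 2 ≤ m) {N k : ℕ}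
    (hκ : (N : ℝ) + a = ((k : ℝ) - (m - 2)) / m) (hNk : N + 1 ≤ k) :
    ∃ C, 0 ≤ C ∧ ∀ (R : ℂ → ℂ) (B : ℝ), 0 ≤ B → Flat k B (dom m) R →
      Reg N w (clSec m l) (C * B) (chartSol m l R) := by
  have hm0 : 0 < m := by omega
  have hmR : (m : ℝ) ≠ 0 := by positivity
  have hm2 : (2 : ℝ) ≤ m := by exact_mod_cast hm
  obtain ⟨C₁, hC₁, hs⟩ := exists_sym_integrand (l := l) hm (N + 1) k hNk
  have hb : -eps l ∈ Icc (-1 : ℝ) 1 := by rw [mem_Icc, ← abs_le, abs_neg_eps]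
  obtain ⟨C₂, hC₂, hI⟩ := h.reg_horInt hb N
  obtain ⟨C₃, hC₃, hcomp⟩ := h.reg_comp_pow convex_halfSq halfSq_subset (clSec_subset_ball (l := l) hm)
    (norm_eps l) m (mapsTo_chi hm) N 0 0
  refine ⟨C₃ * (C₂ * C₁), by positivity, fun R B hB hR => ?_⟩
  -- The default value 0 of a nonzero power of 0 provides the normalisation at the origin required
  -- by `reg_horInt`.
  have h0 : integrand m l R 0 = 0 := by
    have : -(((m : ℝ) - 1) / m) ≠ 0 := neg_ne_zero.2 (div_ne_zero (by linarith) hmR)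
    have h1 : pw (-(((m : ℝ) - 1) / m)) 0 = 0 := by
      rw [pw, mul_zero, Complex.zero_cpow (by exact_mod_cast this)]
    rw [integrand, mono, h1]; simp
  have h1 : Sym (N + 1) (fun z => C₁ * B * (‖z‖ ^ N * ‖z‖ ^ (a - 1))) (halfSq \ {0}) (integrand m l R) := by
    refine (hs R B hB hR).mono_weight fun z hz => le_of_eq ?_
    have hn : 0 < ‖z‖ := norm_pos_iff.2 hz.2
    rw [← Real.rpow_natCast, ← Real.rpow_add hn]
    congr 2
    have : (N : ℝ) + (a - 1) = ((k : ℝ) - (m - 2)) / m - 1 := by linarith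
    rw [this]; field_simp; ring
  have h2 := hcomp _ _ (by positivity) (hI _ _ (by positivity) h0 h1)
  simp only [pow_zero, mul_one] at h2
  have h3 := h2.const_mul (eps l)
  rw [norm_eps, one_mul] at h3
  exact h3.mono_const (fun t ht => h.w_nonneg ht) (by ring_nf; rfl)

/-- Over the open sector the horizontal line misses the origin, so every piece is integrable
separately. On the real axis this could fail, since low Taylor parts may give a nonintegrable
singularity. -/
lemma chartSol_eq_add (hm : 2 ≤ m) (hl : l < 2 * m) {f : ℂ → ℂ} (hf : ContinuousOn f (dom m)) (k : ℕ) {ω : ℂ}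
    (hω : ω ∈ opSec m l) : chartSol m l f ω =
      chartSol m l (fun x => f x - ∑ j ∈ Finset.range k, taylorPart f j x) ω +
        ∑ j ∈ Finset.range k, chartSol m l (taylorPart f j) ω := by
  have hm0 : 0 < m := by omega
  have him := chi_im_pos hm hl hω
  have hsq := mapsTo_chi hm (opSec_subset hm hl hω)
  set z := chi m l ω with hz
  have hT : ∀ j ∈ Finset.range k, IntervalIntegrable (fun v : ℝ => integrand m l (taylorPart f j) ⟨v, z.im⟩)
      volume (-eps l) z.re := fun j _ => ContinuousOn.intervalIntegrable <|
    (continuousOn_integrand hm0 (continuous_taylorPart f j)).comp (continuous_horiz _).continuousOn fun v _ => him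
  have hF : IntervalIntegrable (fun v : ℝ => integrand m l f ⟨v, z.im⟩) volume (-eps l) z.re := by
    refine ContinuousOn.intervalIntegrable ?_
    have hmaps : MapsTo (fun v : ℝ => (⟨v, z.im⟩ : ℂ)) (uIcc (-eps l) z.re) (halfSq ∩ {z | 0 < z.im}) := by
      intro v hv
      have hb : -eps l ∈ Icc (-1 : ℝ) 1 := by rw [mem_Icc, ← abs_le, abs_neg_eps]
      exact ⟨mem_halfSq.2 ⟨uIcc_subset_Icc hb (mem_halfSq.1 hsq).1 hv, (mem_halfSq.1 hsq).2⟩, him⟩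
    have hg : ContinuousOn (integrand m l f) (halfSq ∩ {z | 0 < z.im}) := ?_
    · exact hg.comp (continuous_horiz _).continuousOn hmaps
    refine ContinuousOn.mul (hf.comp ((continuousOn_psi hm0).mono fun z hz => ?_) fun z hz => ?_) ?_
    · exact (mem_halfSq.1 hz.1).2.1
    · exact clSec_subset_dom hm (psi_mem_clSec hz.1)
    · exact (homSpace.continuousOn (mono_mem rfl)).mono fun z hz => Or.inl hz.2
  have e1 : horInt (-eps l) (integrand m l f) z =
      horInt (-eps l) (integrand m l (fun x => f x - ∑ j ∈ Finset.range k, taylorPart f j x)) z +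
        ∑ j ∈ Finset.range k, horInt (-eps l) (integrand m l (taylorPart f j)) z := by
    simp only [horInt]
    rw [← intervalIntegral.integral_finsetSum hT]
    have h1 := IntervalIntegrable.sum _ hT
    have h2 : (fun v : ℝ => integrand m l (fun x => f x - ∑ j ∈ Finset.range k, taylorPart f j x) ⟨v, z.im⟩) =
        fun v : ℝ => integrand m l f ⟨v, z.im⟩ - ∑ j ∈ Finset.range k, integrand m l (taylorPart f j) ⟨v, z.im⟩ := by
      ext v; simp only [integrand, sub_mul, Finset.sum_mul]
    have h3 : IntervalIntegrable
        (fun v : ℝ => ∑ j ∈ Finset.range k, integrand m l (taylorPart f j) ⟨v, z.im⟩) volume (-eps l) z.re := by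
      have h4 : (fun v : ℝ => ∑ j ∈ Finset.range k, integrand m l (taylorPart f j) ⟨v, z.im⟩) =
          ∑ j ∈ Finset.range k, fun v : ℝ => integrand m l (taylorPart f j) ⟨v, z.im⟩ := by
        funext v; rw [Finset.sum_apply]
      rw [h4]; exact h1
    rw [h2, intervalIntegral.integral_sub hF h3, sub_add_cancel]
  simp only [chartSol, ← hz, e1, mul_add, Finset.mul_sum]

/-- Regularity of the local solution on a sector. -/
lemma GoodMod.exists_reg_localSol (h : GoodMod a w ρ Θ K) (hm : 2 ≤ m) (hl : l < 2 * m) {N k N' : ℕ}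
    (hκ : (N : ℝ) + a = ((k : ℝ) - (m - 2)) / m) (hNk : N + 1 ≤ k) (hk : k ≤ N') :
    ∃ C, 0 ≤ C ∧ ∀ f : ℂ → ℂ, ContDiffOn ℝ N' f (dom m) →
      (∀ j, j + 1 < N + m → ∀ i, Relevant m j i → parDist m j i f = 0) → (∀ j < k, secDist m j l f = 0) →
      ∃ g, EqOn g (localSol m f) (opSec m l) ∧ Reg N w (clSec m l) (C * (cNorm N' (dom m) f).toReal) g := by
  have hU := uniqueDiffOn_dom hm
  obtain ⟨C₀, hC₀, hR⟩ := h.exists_reg_remainder (l := l) hm hκ hNk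
  choose C hC hT using h.exists_reg_taylorPart hm hl N
  refine ⟨C₀ + ∑ j ∈ Finset.range k, C j, add_nonneg hC₀ (Finset.sum_nonneg fun j _ => hC j),
    fun f hf hpar hsec => ?_⟩
  have hfin := cNorm_lt_top hU (isCompact_dom hm) hf
  set B := (cNorm N' (dom m) f).toReal with hB
  have hB0 : 0 ≤ B := ENNReal.toReal_nonneg
  have hfk : ContDiffOn ℝ k f (dom m) := hf.of_le (by exact_mod_cast hk)
  have hrem := hR _ B hB0 (flat_taylor_remainder hU (dom_mem_nhds hm) hfk fun x hx => norm_le_cNorm hfin hk hx)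
  have hparts : ∀ j ∈ Finset.range k, ∃ G, Reg N w (clSec m l) (C j * B) G ∧
      EqOn G (chartSol m l (taylorPart f j)) (opSec m l) := by
    intro j hj
    have hjk := Finset.mem_range.1 hj
    refine hT j f B hB0 (fun p hp => ?_) ?_
    · exact (norm_taylorCoeff_le hU (dom_mem_nhds hm) hp (hfk.of_le (by exact_mod_cast hjk.le))).trans
        (norm_le_cNorm hfin (hjk.le.trans hk) (mem_of_mem_nhds (dom_mem_nhds hm)))
    -- Below this threshold all `parDist` vanish and the part is handled through the polynomial
    -- range; from it on, the sector condition suffices.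
    · rcases lt_or_ge (j + 1) (N + m) with h1 | h1
      · exact Or.inr (hpar j h1)
      · exact Or.inl ⟨h1, hsec j hjk⟩
  choose! G hG hGe using hparts
  refine ⟨_, fun ω hω => ?_, (add_mul C₀ _ B ▸ Finset.sum_mul (Finset.range k) C B ▸
    hrem.add (Reg.sum (s := Finset.range k) hG) :)⟩
  rw [localSol_eq hm f hω (chi_im_pos hm hl hω)]
  refine Eq.trans ?_ (chartSol_eq_add hm hl hf.continuousOn k hω).symm
  exact congrArg _ (Finset.sum_congr rfl fun j hj => hGe j hj hω)

end remainder

end SaddleSector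

/-! ### Choice of the modulus and conclusion -/

namespace SaddleSector

open Set Filter Topology MeasureTheory

/-- The exponent `𝔢(σ,k)` is governed by one of the two families of moduli. -/
lemma exists_goodMod_expo {m k n : ℕ} (hm : 2 ≤ m) (hk : m - 1 ≤ k) (hn : (n : ℤ) = ⌈ord m k⌉) :
    ∃ a ρ Θ K, GoodMod a (expo m k).modulus ρ Θ K ∧ (expo m k).degree + 1 = n ∧
      ((expo m k).degree : ℝ) + a = ((k : ℝ) - (m - 2)) / m := by
  have hm0 : (0 : ℝ) < m := by positivity
  have hk' : (m : ℝ) - 1 ≤ k := by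
    have : m ≤ k + 1 := by omega
    have : (m : ℝ) ≤ k + 1 := by exact_mod_cast this
    linarith
  have hpos : 0 < ord m k := div_pos (by linarith) hm0
  rw [expo]
  split_ifs with hdvd
  · obtain ⟨q, hq⟩ := hdvd
    have hqR : (k : ℝ) - ((m : ℝ) - 2) = m * q := by exact_mod_cast hq
    have hord : ord m k = q := by rw [ord, hqR, mul_div_cancel_left₀ _ hm0.ne']
    have hdiv : ((k : ℤ) - 2 * ((m : ℤ) - 1)) / m = q - 1 := by
      rw [show (k : ℤ) - 2 * ((m : ℤ) - 1) = m * (q - 1) by linarith]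
      exact Int.mul_ediv_cancel_left _ (by omega)
    rw [hord, Int.ceil_intCast] at hn
    have hq1 : 1 ≤ q := by rw [hord] at hpos; exact_mod_cast hpos
    obtain ⟨K, hK⟩ := goodMod_eta
    have hdeg : ((q - 1).toNat : ℤ) = q - 1 := Int.toNat_of_nonneg (by omega)
    rw [hdiv]
    refine ⟨1, _, _, K, hK, ?_, ?_⟩
    · simp only [RegExp.degree]; omega
    · have : (((q - 1).toNat : ℕ) : ℝ) = q - 1 := by exact_mod_cast hdeg
      simp only [RegExp.degree]
      rw [this, sub_add_cancel, ← hord, ord]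
  · have hfr : Int.fract (ord m k) ≠ 0 := fun h0 => by
      obtain ⟨q, hq⟩ := Int.fract_eq_zero_iff.1 h0
      refine hdvd ⟨q, ?_⟩
      rw [ord, eq_div_iff hm0.ne'] at hq
      have : (k : ℝ) - ((m : ℝ) - 2) = m * q := by linarith
      exact_mod_cast this
    have hfp : 0 < Int.fract (ord m k) := lt_of_le_of_ne (Int.fract_nonneg _) (Ne.symm hfr)
    obtain ⟨K, hK⟩ := goodMod_hol hfp (Int.fract_lt_one _)
    have hfl : ((⌊ord m k⌋₊ : ℕ) : ℤ) = ⌊ord m k⌋ := Int.natCast_floor_eq_floor hpos.le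
    have hflR : ((⌊ord m k⌋₊ : ℕ) : ℝ) = ⌊ord m k⌋ := by exact_mod_cast hfl
    refine ⟨_, _, _, K, hK, ?_, ?_⟩
    -- For a nonintegral order n is the floor plus one, so the degree is n - 1 here as well as in
    -- the integral case.
    · have : ⌈ord m k⌉ = ⌊ord m k⌋ + 1 := by
        rw [Int.ceil_eq_iff]
        have := Int.floor_add_fract (ord m k)
        have h1 := Int.fract_lt_one (ord m k)
        push_cast
        constructor <;> linarith
      simp only [RegExp.degree]; omega
    · simp only [RegExp.degree]
      rw [hflR, Int.floor_add_fract, ord]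

end SaddleSector

open SaddleSector in
theorem mainTheorem7 (m k l n kLow : ℕ) (hm : 2 ≤ m) (hk : m - 1 ≤ k) (hl : l < 2 * m)
    (hn : (n : ℤ) = ⌈SaddleSector.ord m k⌉)
    (hkLow : SaddleSector.ordHat m kLow = (n : ℤ)) :
    ∃ C : ℝ≥0, 0 < C ∧ ∀ f : ℂ → ℂ,
      ContDiffOn ℝ (max k (n + 1) : ℕ) f (SaddleSector.dom m) →
      (∀ j < kLow, ∀ i, SaddleSector.Relevant m j i → SaddleSector.parDist m j i f = 0) →
      (∀ j < k, SaddleSector.secDist m j l f = 0) →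
      ∃ g : ℂ → ℂ,
        Set.EqOn g (SaddleSector.localSol m f)
          (SaddleSector.sector m ((l : ℝ) / (2 * m)) (((l : ℝ) + 1) / (2 * m))) ∧
        SaddleSector.IsClassC (SaddleSector.expo m k)
          (closure (SaddleSector.sector m ((l : ℝ) / (2 * m)) (((l : ℝ) + 1) / (2 * m)))) g ∧
        SaddleSector.regNorm (SaddleSector.expo m k)
          (closure (SaddleSector.sector m ((l : ℝ) / (2 * m)) (((l : ℝ) + 1) / (2 * m)))) g
            ≤ C * SaddleSector.cNorm (max k (n + 1)) (SaddleSector.dom m) f := by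
  obtain ⟨a, ρ, Θ, K, hmod, hdeg, hκ⟩ := exists_goodMod_expo hm hk hn
  have hNk : (expo m k).degree + 1 ≤ k := by
    have hm0 : (0 : ℝ) < m := by positivity
    have h2 : (2 : ℝ) ≤ m := by exact_mod_cast hm
    have h1 : (((expo m k).degree : ℝ) + a) * m = k - (m - 2) := by rw [hκ, div_mul_cancel₀ _ hm0.ne']
    have ha := mul_pos hmod.a_pos hm0
    have h3 : ((expo m k).degree : ℝ) * 2 ≤ (expo m k).degree * m :=
      mul_le_mul_of_nonneg_left h2 (Nat.cast_nonneg _)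
    have h4 : ((expo m k).degree : ℝ) * 2 < k := by linarith
    have h5 : (expo m k).degree * 2 < k := by exact_mod_cast h4
    omega
  obtain ⟨C, hC, hmain⟩ := hmod.exists_reg_localSol hm hl hκ hNk (le_max_left k (n + 1))
  set c : ℝ := (∑ j ∈ Finset.range ((expo m k).degree + 1), (2 : ℝ) ^ j) + 2 ^ (expo m k).degree with hc
  have hc0 : 0 ≤ c := by positivity
  -- The added 1 only makes the constant strictly positive.
  refine ⟨(c * C).toNNReal + 1, by positivity, fun f hf hpar hsec => ?_⟩
  -- Since n = N + 1, the threshold j + 1 < N + m is exactly j < n + (m - 2), the range in which all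
  -- `parDist` are assumed to vanish.
  have hlow : ∀ j, j + 1 < (expo m k).degree + m → j < kLow := by
    intro j hj
    rw [ordHat] at hkLow
    omega
  obtain ⟨g, hg, hreg⟩ := hmain f hf (fun j hj => hpar j (hlow j hj)) hsec
  have hfin := cNorm_lt_top (uniqueDiffOn_dom hm) (isCompact_dom hm) hf
  have hfinal := Reg.isClassC (uniqueDiffOn_clSec hm)
    (fun x _ y _ hxy => hmod.w_pos _ (dist_pos.2 hxy)) (fun g hg => hmod.continuousOn_of_le hg)
    (mul_nonneg hC ENNReal.toReal_nonneg) hreg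
  have hcl : closure (sector m ((l : ℝ) / (2 * m)) (((l : ℝ) + 1) / (2 * m))) = clSec m l := closure_opSec hm hl
  rw [hcl]
  refine ⟨g, hg, hfinal.1, hfinal.2.trans ?_⟩
  rw [← mul_assoc, ENNReal.ofReal_mul (mul_nonneg hc0 hC), ENNReal.ofReal_toReal hfin.ne]
  refine mul_le_mul_left ?_ _
  rw [ENNReal.ofReal, ENNReal.coe_le_coe]
  exact le_self_add
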